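/- Let $\mathbb{RP}^1$ carry the affine coordinate $x$, let $\mathrm{Vect}(\mathbb{RP}^1)$ be the Lie algebra of smooth vector fields on $\mathbb{RP}^1$, and let $\mathrm{sl}(2,\mathbb R)\subset \mathrm{Vect}(\mathbb{RP}^1)$ be the subalgebra spanned by $\frac{d}{dx}, x\frac{d}{dx}, x^2\frac{d}{dx}$. For $\lambda\in\mathbb R$ let $\mathcal F_\lambda$ be the space of smooth sections of $(T^*\mathbb{RP}^1)^{\otimes\lambda}$, with the action $L^\lambda_X\phi = X\phi'+\lambda X'\phi$ of $\mathrm{Vect}(\mathbb{RP}^1)$. For $\lambda,\nu,\mu\in\mathbb R$ let $\mathcal D_{\lambda,\nu;\mu}$ be the space of bilinear differential operators $A:\mathcal F_\lambda\otimes\mathcal F_\nu\to\mathcal F_\mu$ (of finite order, with smooth coefficients), with the action $$(X\cdot A)(\phi,\psi)=L^\mu_X A(\phi,\psi)-A(L^\lambda_X\phi,\psi)-A(\phi,L^\nu_X\psi).$$ Let $H^1=\mathrm H^1(\mathrm{Vect}(\mathbb{RP}^1),\mathrm{sl}(2,\mathbb R);\mathcal D_{\lambda,\nu;\mu})$ be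 the space of linear maps $c:\mathrm{Vect}(\mathbb{RP}^1)\to\mathcal D_{\lambda,\nu;\mu}$ that vanish on $\mathrm{sl}(2,\mathbb R)$ and satisfy $c([X,Y])=X\cdot c(Y)-Y\cdot c(X)$ for all $X,Y$, modulo the maps $X\mapsto X\cdot B$ with $B\in\mathcal D_{\lambda,\nu;\mu}$ an $\mathrm{sl}(2,\mathbb R)$-invariant operator (no continuity or differentiability of $c$ in $X$ is assumed). Put $k=\mu-\lambda-\nu$. **Theorem 5.1.** (i) If $k=2$, then $H^1\cong\mathbb R$ if $\lambda+\nu+1=0$ and $(\lambda,\nu)\ne(-\frac12,-\frac12)$, or if $\lambda=0$ and $\nu\neq-\frac12$, or if $\nu=0$ and $\lambda\ne-\frac12$; otherwise $H^1=0$. (ii) If $k=3$, then $H^1\cong\mathbb R^2$ for $(\lambda,\nu)\in\{(0,0),(-2,0),(0,-2),(-\frac23,-\frac23)\}$; $H^1=0$ for $(\lambda,\nu)\in\{(-\frac12,-1),(-1,-\frac12),(-1,-1),(0,-1),(-1,0),(-\frac12,-\frac12)\}$; and $H^1\cong\mathbb R$ for all other $(\lambda,\nu)$. (iii) If $k=4$,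 then $H^1\cong\mathbb R$ for $(\lambda,\nu)\in\{(0,-\frac32),(-\frac32,0),(-1,-1),(-\frac12,-\frac32),(-\frac32,-\frac12),(-\frac32,-1),(-1,-\frac32),(-\frac32,-\frac32),(-\frac12,-1),(-1,-\frac12)\}$, and $H^1\cong\mathbb R^2$ for all other $(\lambda,\nu)$. (iv) If $k=5$, then $H^1\cong\mathbb R^3$ for $(\lambda,\nu)\in\{(0,0),(-4,0),(0,-4)\}$; $H^1\cong\mathbb R$ for $(\lambda,\nu)\in\{(-\frac12,-\frac32),(-\frac32,-\frac12),(-\frac12,-2),(-2,-\frac12),(-1,-2),(-2,-1),(-1,-\frac32),(-\frac32,-1),(-1,-1),(-\frac32,-2),(-2,-\frac32),(-\frac32,-\frac32)\}$; and $H^1\cong\mathbb R^2$ for all other $(\lambda,\nu)$. (v) If $k=6$, put $a_\pm=\frac{-5\pm\sqrt{19}}2$. Then $H^1\cong\mathbb R^3$ for $(\lambda,\nu)\in\{(a_+,0),(a_-,0),(0,a_+),(0,a_-),(a_+,a_-),(a_-,a_+)\}$; $H^1\cong\mathbb R$ for $(\lambda,\nu)\in\{(-2,-\frac12),(-\frac12,-2),(-\frac52,-\frac12),(-\frac12,-\frac52),(-1,-\frac32),(-\frac32,-1),(-1,-2),(-2,-1),(-1,-\frac52),(-\frac52,-1),(-\frac32,-\frac32),(-\frac32,-2),(-2,-\frac32),(-\frac32,-\frac52),(-\frac52,-\frac32),(-2,-2),(-2,-\frac52),(-\frac52,-2)\}$;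 and $H^1\cong\mathbb R^2$ for all other $(\lambda,\nu)$. (vi) If $k=7$, with $a_\pm$ as in (v), then $H^1\cong\mathbb R^2$ if $\lambda=0$, or $\nu=0$, or $\nu=-6-\lambda$, or $(\lambda,\nu)\in\{(a_-,a_-),(a_+,a_+),(\sqrt{19}-1,a_-),(a_-,\sqrt{19}-1),(-\sqrt{19}-1,a_+),(a_+,-\sqrt{19}-1)\}$; $H^1=0$ for $(\lambda,\nu)\in\{(-\frac52,-\frac12),(-\frac12,-\frac52),(-\frac12,-3),(-3,-\frac12),(-1,-2),(-2,-1),(-1,-3),(-3,-1),(-\frac32,-2),(-2,-\frac32),(-\frac32,-\frac52),(-\frac52,-\frac32),(-2,-3),(-3,-2),(-2,-\frac52),(-\frac52,-2),(-3,-\frac52),(-\frac52,-3)\}$; and $H^1\cong\mathbb R$ for all other $(\lambda,\nu)$. (vii) If $k\in\mathbb R\setminus\{2,3,4,5,6,7\}$, then $H^1=0$ for generic $(\lambda,\nu)$: there is a nonzero polynomial $P\in\mathbb R[s,t]$, depending only on $k$, such that $H^1=0$ whenever $\mu=\lambda+\nu+k$ and $P(\lambda,\nu)\neq0$. -/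

import Mathlib

open scoped ContDiff

noncomputable section

/-! ### The projective line, vector fields and tensor densities

`ℝP¹` is covered by two affine charts, with coordinates `x` and `y = -1/x`, both with image `ℝ`.
The coordinate change satisfies `dy = x⁻² dx`.  A section of a natural line bundle is recorded as
the pair of its components in the coordinates `x` and `y`. -/

/-- The Lie derivative `X φ' + τ X' φ` of a density of weight `τ`, in one coordinate. -/
def lieDer (τ : ℝ) (X f : ℝ → ℝ) : ℝ → ℝ := fun x => X x * deriv f x + τ * deriv X x * f x

/-- Smooth sections of `(T^* ℝP¹)^{⊗ τ}`.  A pair `(f, g)` stands for the section equal to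
`f (dx)^τ` and to `g (dy)^τ` in the two charts; on the overlap `(dy)^τ = (x⁻²)^τ (dx)^τ`. -/
def densitySubmodule (τ : ℝ) : Submodule ℝ ((ℝ → ℝ) × (ℝ → ℝ)) where
  carrier := {φ | ContDiff ℝ ∞ φ.1 ∧ ContDiff ℝ ∞ φ.2 ∧
    ∀ x : ℝ, x ≠ 0 → φ.1 x = ((x ^ 2)⁻¹) ^ τ * φ.2 (-x⁻¹)}
  add_mem' := by
    rintro φ ψ ⟨h1, h2, h3⟩ ⟨k1, k2, k3⟩
    refine ⟨h1.add k1, h2.add k2, fun x hx => ?_⟩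
    simp only [Prod.fst_add, Prod.snd_add, Pi.add_apply, h3 x hx, k3 x hx]
    ring
  zero_mem' := ⟨contDiff_const, contDiff_const, by simp⟩
  smul_mem' := by
    rintro c φ ⟨h1, h2, h3⟩
    refine ⟨h1.const_smul c, h2.const_smul c, fun x hx => ?_⟩
    simp only [Prod.smul_fst, Prod.smul_snd, Pi.smul_apply, smul_eq_mul, h3 x hx]
    ring

/-- `F_τ`, the space of tensor densities of weight `τ` on `ℝP¹`. -/
def Density (τ : ℝ) : Type := densitySubmodule τ

instance (τ : ℝ) : AddCommGroup (Density τ) := inferInstanceAs (AddCommGroup (densitySubmodule τ))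

instance (τ : ℝ) : Module ℝ (Density τ) := inferInstanceAs (Module ℝ (densitySubmodule τ))

/-- Smooth vector fields on `ℝP¹`.  A pair `(X, Y)` stands for the vector field equal to
`X d/dx` and to `Y d/dy` in the two charts; on the overlap `d/dy = x² d/dx`. -/
def vectSubmodule : Submodule ℝ ((ℝ → ℝ) × (ℝ → ℝ)) where
  carrier := {X | ContDiff ℝ ∞ X.1 ∧ ContDiff ℝ ∞ X.2 ∧
    ∀ x : ℝ, x ≠ 0 → X.1 x = x ^ 2 * X.2 (-x⁻¹)}
  add_mem' := by
    rintro φ ψ ⟨h1, h2, h3⟩ ⟨k1, k2, k3⟩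
    refine ⟨h1.add k1, h2.add k2, fun x hx => ?_⟩
    simp only [Prod.fst_add, Prod.snd_add, Pi.add_apply, h3 x hx, k3 x hx]
    ring
  zero_mem' := ⟨contDiff_const, contDiff_const, by simp⟩
  smul_mem' := by
    rintro c φ ⟨h1, h2, h3⟩
    refine ⟨h1.const_smul c, h2.const_smul c, fun x hx => ?_⟩
    simp only [Prod.smul_fst, Prod.smul_snd, Pi.smul_apply, smul_eq_mul, h3 x hx]
    ring

/-- `Vect(ℝP¹)`, the space of smooth vector fields on `ℝP¹`. -/
def VectRP1 : Type := vectSubmodule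

instance : AddCommGroup VectRP1 := inferInstanceAs (AddCommGroup vectSubmodule)

instance : Module ℝ VectRP1 := inferInstanceAs (Module ℝ vectSubmodule)

/-- The components of a vector field in the charts `x` and `y`. -/
def VectRP1.comp (X : VectRP1) : (ℝ → ℝ) × (ℝ → ℝ) := Subtype.val X

/-- The components of a density in the charts `x` and `y`. -/
def Density.comp {τ : ℝ} (φ : Density τ) : (ℝ → ℝ) × (ℝ → ℝ) := Subtype.val φ

theorem VectRP1.ext {X Y : VectRP1} (h1 : X.comp.1 = Y.comp.1) (h2 : X.comp.2 = Y.comp.2) :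
    X = Y := Subtype.ext (Prod.ext h1 h2)

theorem Density.ext {τ : ℝ} {φ ψ : Density τ} (h1 : φ.comp.1 = ψ.comp.1)
    (h2 : φ.comp.2 = ψ.comp.2) : φ = ψ := Subtype.ext (Prod.ext h1 h2)

theorem vect_smooth (X : VectRP1) : ContDiff ℝ ∞ X.comp.1 ∧ ContDiff ℝ ∞ X.comp.2 :=
  ⟨X.2.1, X.2.2.1⟩

theorem density_smooth {τ : ℝ} (φ : Density τ) :
    ContDiff ℝ ∞ φ.comp.1 ∧ ContDiff ℝ ∞ φ.comp.2 :=
  ⟨φ.2.1, φ.2.2.1⟩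

theorem contDiff_lieDer {τ : ℝ} {X f : ℝ → ℝ} (hX : ContDiff ℝ ∞ X) (hf : ContDiff ℝ ∞ f) :
    ContDiff ℝ ∞ (lieDer τ X f) :=
  (hX.mul (contDiff_infty_iff_deriv.1 hf).2).add
    ((contDiff_const.mul (contDiff_infty_iff_deriv.1 hX).2).mul hf)

/-- The expression `X φ' + τ X' φ` does not depend on the chart. -/
theorem lieDer_transition {τ : ℝ} {X Y f g : ℝ → ℝ} (hY : ContDiff ℝ ∞ Y) (hg : ContDiff ℝ ∞ g)
    (hXY : ∀ x : ℝ, x ≠ 0 → X x = x ^ 2 * Y (-x⁻¹))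
    (hfg : ∀ x : ℝ, x ≠ 0 → f x = ((x ^ 2)⁻¹) ^ τ * g (-x⁻¹)) (x : ℝ) (hx : x ≠ 0) :
    lieDer τ X f x = ((x ^ 2)⁻¹) ^ τ * lieDer τ Y g (-x⁻¹) := by
  have hy : HasDerivAt (fun x : ℝ => -x⁻¹) ((x ^ 2)⁻¹) x := by
    simpa using (hasDerivAt_inv hx).fun_neg
  have hYd : HasDerivAt (fun x : ℝ => Y (-x⁻¹)) (deriv Y (-x⁻¹) * (x ^ 2)⁻¹) x :=
    ((hY.differentiable (by simp)) _).hasDerivAt.comp x hy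
  have hgd : HasDerivAt (fun x : ℝ => g (-x⁻¹)) (deriv g (-x⁻¹) * (x ^ 2)⁻¹) x :=
    ((hg.differentiable (by simp)) _).hasDerivAt.comp x hy
  have hpos : 0 < (x ^ 2)⁻¹ := by positivity
  have hu : HasDerivAt (fun x : ℝ => ((x ^ 2)⁻¹ : ℝ)) (-(2 * x) / (x ^ 2) ^ 2) x := by
    simpa using (hasDerivAt_pow 2 x).fun_inv (pow_ne_zero 2 hx)
  have hJ := hu.rpow_const (p := τ) (Or.inl hpos.ne')
  have hne : ∀ᶠ z in nhds x, z ≠ 0 := isOpen_ne.mem_nhds hx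
  have hX' : deriv X x = 2 * x * Y (-x⁻¹) + x ^ 2 * (deriv Y (-x⁻¹) * (x ^ 2)⁻¹) := by
    have h1 : X =ᶠ[nhds x] fun x => x ^ 2 * Y (-x⁻¹) := hne.mono fun z hz => hXY z hz
    rw [h1.deriv_eq]
    simpa using ((hasDerivAt_pow 2 x).fun_mul hYd).deriv
  have hf' : deriv f x = (-(2 * x) / (x ^ 2) ^ 2) * τ * ((x ^ 2)⁻¹) ^ (τ - 1) * g (-x⁻¹)
      + ((x ^ 2)⁻¹) ^ τ * (deriv g (-x⁻¹) * (x ^ 2)⁻¹) := by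
    have h1 : f =ᶠ[nhds x] fun x => ((x ^ 2)⁻¹) ^ τ * g (-x⁻¹) := hne.mono fun z hz => hfg z hz
    rw [h1.deriv_eq]
    exact (hJ.fun_mul hgd).deriv
  have hpow : ((x ^ 2)⁻¹) ^ (τ - 1) = ((x ^ 2)⁻¹) ^ τ * x ^ 2 := by
    rw [Real.rpow_sub_one hpos.ne', div_inv_eq_mul]
  unfold lieDer
  rw [hX', hf', hXY x hx, hfg x hx, hpow]
  field_simp
  ring

/-! ### The Lie algebra `Vect(ℝP¹)` -/

theorem bracket_mem (X Y : VectRP1) :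
    ((lieDer (-1) X.comp.1 Y.comp.1, lieDer (-1) X.comp.2 Y.comp.2) : (ℝ → ℝ) × (ℝ → ℝ)) ∈ vectSubmodule := by
  refine ⟨contDiff_lieDer (vect_smooth X).1 (vect_smooth Y).1,
    contDiff_lieDer (vect_smooth X).2 (vect_smooth Y).2, fun x hx => ?_⟩
  have key : ∀ x : ℝ, ((x ^ 2)⁻¹) ^ (-1 : ℝ) = x ^ 2 := fun x => by
    rw [Real.rpow_neg_one, inv_inv]
  have := lieDer_transition (τ := -1) (f := Y.comp.1) (vect_smooth X).2 (vect_smooth Y).2 X.2.2.2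
    (fun x hx => by rw [key]; exact Y.2.2.2 x hx) x hx
  rw [key] at this
  exact this

/-- The bracket of vector fields, `[X, Y] = X Y' - X' Y` in both charts. -/
instance : Bracket VectRP1 VectRP1 where
  bracket X Y := Subtype.mk (lieDer (-1) X.comp.1 Y.comp.1, lieDer (-1) X.comp.2 Y.comp.2) (bracket_mem X Y)

theorem smooth_diffAt {f : ℝ → ℝ} (hf : ContDiff ℝ ∞ f) (x : ℝ) : DifferentiableAt ℝ f x :=
  hf.differentiable (by simp) x

theorem smooth_deriv {f : ℝ → ℝ} (hf : ContDiff ℝ ∞ f) : ContDiff ℝ ∞ (deriv f) :=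
  (contDiff_infty_iff_deriv.1 hf).2

theorem lieDer_add_right {τ : ℝ} {X f g : ℝ → ℝ} (hf : ContDiff ℝ ∞ f) (hg : ContDiff ℝ ∞ g) :
    lieDer τ X (f + g) = lieDer τ X f + lieDer τ X g := by
  funext x
  simp only [lieDer, Pi.add_apply, deriv_add (smooth_diffAt hf x) (smooth_diffAt hg x)]
  ring

theorem lieDer_add_left {τ : ℝ} {X Y f : ℝ → ℝ} (hX : ContDiff ℝ ∞ X) (hY : ContDiff ℝ ∞ Y) :
    lieDer τ (X + Y) f = lieDer τ X f + lieDer τ Y f := by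
  funext x
  simp only [lieDer, Pi.add_apply, deriv_add (smooth_diffAt hX x) (smooth_diffAt hY x)]
  ring

theorem lieDer_smul_right {τ c : ℝ} {X f : ℝ → ℝ} :
    lieDer τ X (c • f) = c • lieDer τ X f := by
  funext x
  simp only [lieDer, Pi.smul_apply, smul_eq_mul, deriv_const_smul_field]
  ring

theorem lieDer_smul_left {τ c : ℝ} {X f : ℝ → ℝ} :
    lieDer τ (c • X) f = c • lieDer τ X f := by
  funext x
  simp only [lieDer, Pi.smul_apply, smul_eq_mul, deriv_const_smul_field]
  ring

theorem deriv_lieDer {τ : ℝ} {X f : ℝ → ℝ} (hX : ContDiff ℝ ∞ X) (hf : ContDiff ℝ ∞ f) (x : ℝ) :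
    deriv (lieDer τ X f) x = deriv X x * deriv f x + X x * deriv (deriv f) x
      + τ * (deriv (deriv X) x * f x + deriv X x * deriv f x) := by
  have h1 := (smooth_diffAt hX x).hasDerivAt
  have h2 := (smooth_diffAt hf x).hasDerivAt
  have h3 := (smooth_diffAt (smooth_deriv hX) x).hasDerivAt
  have h4 := (smooth_diffAt (smooth_deriv hf) x).hasDerivAt
  have h := (h1.mul h4).add ((h3.const_mul τ).mul h2)
  have e : deriv (lieDer τ X f) x = _ := h.deriv
  rw [e]
  ring

/-- `L_X L_Y - L_Y L_X = L_[X,Y]`. -/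
theorem lieDer_lie {τ : ℝ} {X Y f : ℝ → ℝ} (hX : ContDiff ℝ ∞ X) (hY : ContDiff ℝ ∞ Y)
    (hf : ContDiff ℝ ∞ f) :
    lieDer τ X (lieDer τ Y f) = lieDer τ (lieDer (-1) X Y) f + lieDer τ Y (lieDer τ X f) := by
  funext x
  have e1 := deriv_lieDer (τ := τ) hY hf x
  have e2 := deriv_lieDer (τ := τ) hX hf x
  have e3 := deriv_lieDer (τ := -1) hX hY x
  show X x * deriv (lieDer τ Y f) x + τ * deriv X x * lieDer τ Y f x =
    (lieDer (-1) X Y x * deriv f x + τ * deriv (lieDer (-1) X Y) x * f x) +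
      (Y x * deriv (lieDer τ X f) x + τ * deriv Y x * lieDer τ X f x)
  rw [e1, e2, e3]
  simp only [lieDer]
  ring

theorem vect_add_comp (X Y : VectRP1) : (X + Y).comp = X.comp + Y.comp := rfl

theorem vect_zero_comp : (0 : VectRP1).comp = 0 := rfl

theorem vect_smul_comp (c : ℝ) (X : VectRP1) : (c • X).comp = c • X.comp := rfl

theorem vect_lie_val (X Y : VectRP1) :
    (⁅X, Y⁆ : VectRP1).comp = (lieDer (-1) X.comp.1 Y.comp.1, lieDer (-1) X.comp.2 Y.comp.2) := rfl

instance : LieRing VectRP1 where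
  add_lie X Y Z := VectRP1.ext
    (lieDer_add_left (vect_smooth X).1 (vect_smooth Y).1)
    (lieDer_add_left (vect_smooth X).2 (vect_smooth Y).2)
  lie_add X Y Z := VectRP1.ext
    (lieDer_add_right (vect_smooth Y).1 (vect_smooth Z).1)
    (lieDer_add_right (vect_smooth Y).2 (vect_smooth Z).2)
  lie_self X := by
    refine VectRP1.ext ?_ ?_ <;> funext x <;>
      simp only [vect_lie_val, lieDer, vect_zero_comp, Prod.fst_zero, Prod.snd_zero,
        Pi.zero_apply] <;> ring
  leibniz_lie X Y Z := VectRP1.ext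
    (lieDer_lie (vect_smooth X).1 (vect_smooth Y).1 (vect_smooth Z).1)
    (lieDer_lie (vect_smooth X).2 (vect_smooth Y).2 (vect_smooth Z).2)

instance : LieAlgebra ℝ VectRP1 where
  lie_smul _ _ _ := VectRP1.ext lieDer_smul_right lieDer_smul_right

/-! ### The modules `F_τ` -/

theorem density_lie_mem {τ : ℝ} (X : VectRP1) (φ : Density τ) :
    ((lieDer τ X.comp.1 φ.comp.1, lieDer τ X.comp.2 φ.comp.2) : (ℝ → ℝ) × (ℝ → ℝ)) ∈ densitySubmodule τ :=
  ⟨contDiff_lieDer (vect_smooth X).1 (density_smooth φ).1,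
    contDiff_lieDer (vect_smooth X).2 (density_smooth φ).2,
    lieDer_transition (vect_smooth X).2 (density_smooth φ).2 X.2.2.2 φ.2.2.2⟩

/-- The action of `Vect(ℝP¹)` on `F_τ` by the Lie derivative. -/
instance (τ : ℝ) : LieRingModule VectRP1 (Density τ) where
  bracket X φ := Subtype.mk (lieDer τ X.comp.1 φ.comp.1, lieDer τ X.comp.2 φ.comp.2) (density_lie_mem X φ)
  add_lie X Y _ := Density.ext
    (lieDer_add_left (vect_smooth X).1 (vect_smooth Y).1)
    (lieDer_add_left (vect_smooth X).2 (vect_smooth Y).2)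
  lie_add _ φ ψ := Density.ext
    (lieDer_add_right (density_smooth φ).1 (density_smooth ψ).1)
    (lieDer_add_right (density_smooth φ).2 (density_smooth ψ).2)
  leibniz_lie X Y φ := Density.ext
    (lieDer_lie (vect_smooth X).1 (vect_smooth Y).1 (density_smooth φ).1)
    (lieDer_lie (vect_smooth X).2 (vect_smooth Y).2 (density_smooth φ).2)

instance (τ : ℝ) : LieModule ℝ VectRP1 (Density τ) where
  smul_lie _ _ _ := Density.ext lieDer_smul_left lieDer_smul_left
  lie_smul _ _ _ := Density.ext lieDer_smul_right lieDer_smul_right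

theorem density_lie_val {τ : ℝ} (X : VectRP1) (φ : Density τ) :
    (⁅X, φ⁆ : Density τ).comp = (lieDer τ X.comp.1 φ.comp.1, lieDer τ X.comp.2 φ.comp.2) := rfl

/-! ### The subalgebra `sl(2,ℝ)` of `Vect(ℝP¹)` -/

/-- The vector field `(a + b x + c x²) d/dx`; in the other chart it is `(c - b y + a y²) d/dy`. -/
def projField (a b c : ℝ) : VectRP1 :=
  Subtype.mk (fun x => a + b * x + c * x ^ 2, fun y => c - b * y + a * y ^ 2) (by
    refine ⟨by fun_prop, by fun_prop, fun x hx => ?_⟩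
    simp only
    field_simp
    ring)

theorem projField_comp (a b c : ℝ) : (projField a b c).comp =
    (fun x => a + b * x + c * x ^ 2, fun y => c - b * y + a * y ^ 2) := rfl

theorem projField_lie (a b c a' b' c' : ℝ) : ⁅projField a b c, projField a' b' c'⁆ =
    projField (a * b' - b * a') (2 * (a * c' - c * a')) (b * c' - c * b') := by
  have h1 : ∀ a b c x : ℝ, deriv (fun x : ℝ => a + b * x + c * x ^ 2) x = b + 2 * c * x := by
    intro a b c x
    have := (((hasDerivAt_id x).const_mul b).const_add a).add ((hasDerivAt_pow 2 x).const_mul c)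
    refine (HasDerivAt.deriv (this.congr_deriv ?_))
    simp; ring
  have h2 : ∀ a b c x : ℝ, deriv (fun x : ℝ => a - b * x + c * x ^ 2) x = - b + 2 * c * x := by
    intro a b c x
    have := (((hasDerivAt_id x).const_mul b).const_sub a).add ((hasDerivAt_pow 2 x).const_mul c)
    refine (HasDerivAt.deriv (this.congr_deriv ?_))
    simp; ring
  refine VectRP1.ext ?_ ?_ <;> funext x <;>
    simp only [vect_lie_val, lieDer, projField_comp, h1, h2] <;> ring

/-- `sl(2,ℝ)`, the Lie subalgebra spanned by `d/dx`, `x d/dx` and `x² d/dx`. -/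
def sl2RP1 : LieSubalgebra ℝ VectRP1 where
  carrier := {X | ∃ a b c : ℝ, X = projField a b c}
  add_mem' := by
    rintro _ _ ⟨a, b, c, rfl⟩ ⟨a', b', c', rfl⟩
    refine ⟨a + a', b + b', c + c', ?_⟩
    refine VectRP1.ext ?_ ?_ <;> funext x <;>
      simp only [projField_comp, vect_add_comp, Prod.fst_add, Prod.snd_add, Pi.add_apply] <;> ring
  zero_mem' := by
    refine ⟨0, 0, 0, ?_⟩
    refine VectRP1.ext ?_ ?_ <;> funext x <;> simp [projField_comp, vect_zero_comp]
  smul_mem' := by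
    rintro t _ ⟨a, b, c, rfl⟩
    refine ⟨t * a, t * b, t * c, ?_⟩
    refine VectRP1.ext ?_ ?_ <;> funext x <;>
      simp only [projField_comp, vect_smul_comp, Prod.smul_fst, Prod.smul_snd, Pi.smul_apply,
        smul_eq_mul] <;> ring
  lie_mem' := by
    rintro _ _ ⟨a, b, c, rfl⟩ ⟨a', b', c', rfl⟩
    exact ⟨_, _, _, projField_lie a b c a' b' c'⟩

/-! ### Bilinear differential operators -/

/-- The bilinear differential expression `∑_{i, j ≤ N} a_{ij} f⁽ⁱ⁾ g⁽ʲ⁾` in one coordinate. -/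
def bidiffExpr (N : ℕ) (a : ℕ → ℕ → ℝ → ℝ) (f g : ℝ → ℝ) (x : ℝ) : ℝ :=
  ∑ i ∈ Finset.range (N + 1), ∑ j ∈ Finset.range (N + 1),
    a i j x * iteratedDeriv i f x * iteratedDeriv j g x

/-- `A : F_l ⊗ F_n → F_m` is a bilinear differential operator: in each of the two charts it is
given by a bilinear differential expression of finite order with smooth coefficients. -/
def IsBidiffOp {l n m : ℝ} (A : Density l →ₗ[ℝ] Density n →ₗ[ℝ] Density m) : Prop :=
  ∃ (N : ℕ) (a b : ℕ → ℕ → ℝ → ℝ),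
    (∀ i j, ContDiff ℝ ∞ (a i j)) ∧ (∀ i j, ContDiff ℝ ∞ (b i j)) ∧
    ∀ (φ : Density l) (ψ : Density n) (x : ℝ),
      (A φ ψ).comp.1 x = bidiffExpr N a φ.comp.1 ψ.comp.1 x ∧
      (A φ ψ).comp.2 x = bidiffExpr N b φ.comp.2 ψ.comp.2 x

/-- An operation on pairs of smooth functions that is a bilinear differential expression. -/
def IsExpr (P : (ℝ → ℝ) → (ℝ → ℝ) → ℝ → ℝ) : Prop :=
  ∃ (N : ℕ) (a : ℕ → ℕ → ℝ → ℝ), (∀ i j, ContDiff ℝ ∞ (a i j)) ∧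
    ∀ f g, ContDiff ℝ ∞ f → ContDiff ℝ ∞ g → ∀ x, P f g x = bidiffExpr N a f g x

theorem bidiffExpr_extend {N M : ℕ} (h : N ≤ M) (a : ℕ → ℕ → ℝ → ℝ) (f g : ℝ → ℝ) (x : ℝ) :
    bidiffExpr N a f g x =
      bidiffExpr M (fun i j => if i ≤ N ∧ j ≤ N then a i j else 0) f g x := by
  unfold bidiffExpr
  have hs : Finset.range (N + 1) ⊆ Finset.range (M + 1) :=
    Finset.range_subset_range.2 (by omega)
  have h1 : ∀ i ∈ Finset.range (M + 1), i ∉ Finset.range (N + 1) →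
      ∑ j ∈ Finset.range (M + 1), (if i ≤ N ∧ j ≤ N then a i j else 0) x * iteratedDeriv i f x *
        iteratedDeriv j g x = 0 := by
    intro i _ hi
    have : ¬ i ≤ N := by simpa [Nat.lt_succ_iff] using hi
    simp [this]
  rw [← Finset.sum_subset hs h1]
  refine Finset.sum_congr rfl fun i hi => ?_
  have hi' : i ≤ N := Nat.lt_succ_iff.1 (Finset.mem_range.1 hi)
  have h2 : ∀ j ∈ Finset.range (M + 1), j ∉ Finset.range (N + 1) →
      (if i ≤ N ∧ j ≤ N then a i j else 0) x * iteratedDeriv i f x * iteratedDeriv j g x = 0 := by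
    intro j _ hj
    have : ¬ j ≤ N := by simpa [Nat.lt_succ_iff] using hj
    simp [this]
  rw [← Finset.sum_subset hs h2]
  refine Finset.sum_congr rfl fun j hj => ?_
  have hj' : j ≤ N := Nat.lt_succ_iff.1 (Finset.mem_range.1 hj)
  simp [hi', hj']

theorem bidiffExpr_add (N : ℕ) (a b : ℕ → ℕ → ℝ → ℝ) (f g : ℝ → ℝ) (x : ℝ) :
    bidiffExpr N (fun i j => a i j + b i j) f g x =
      bidiffExpr N a f g x + bidiffExpr N b f g x := by
  simp only [bidiffExpr, Pi.add_apply, add_mul, Finset.sum_add_distrib]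

theorem bidiffExpr_mul (N : ℕ) (c : ℝ → ℝ) (a : ℕ → ℕ → ℝ → ℝ) (f g : ℝ → ℝ) (x : ℝ) :
    bidiffExpr N (fun i j => c * a i j) f g x = c x * bidiffExpr N a f g x := by
  simp only [bidiffExpr, Pi.mul_apply, Finset.mul_sum, mul_assoc]

theorem IsExpr.congr {P Q : (ℝ → ℝ) → (ℝ → ℝ) → ℝ → ℝ} (hP : IsExpr P)
    (h : ∀ f g, ContDiff ℝ ∞ f → ContDiff ℝ ∞ g → ∀ x, Q f g x = P f g x) : IsExpr Q := by
  obtain ⟨N, a, ha, hP⟩ := hP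
  exact ⟨N, a, ha, fun f g hf hg x => (h f g hf hg x).trans (hP f g hf hg x)⟩

theorem smooth_ite {p : Prop} [Decidable p] {a : ℝ → ℝ} (ha : ContDiff ℝ ∞ a) :
    ContDiff ℝ ∞ (if p then a else 0) := by
  split_ifs
  · exact ha
  · exact contDiff_const

theorem IsExpr.add {P Q : (ℝ → ℝ) → (ℝ → ℝ) → ℝ → ℝ} (hP : IsExpr P) (hQ : IsExpr Q) :
    IsExpr fun f g x => P f g x + Q f g x := by
  obtain ⟨N, a, ha, hP⟩ := hP
  obtain ⟨M, b, hb, hQ⟩ := hQ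
  refine ⟨max N M, fun i j => (if i ≤ N ∧ j ≤ N then a i j else 0) +
    (if i ≤ M ∧ j ≤ M then b i j else 0),
    fun i j => (smooth_ite (ha i j)).add (smooth_ite (hb i j)), fun f g hf hg x => ?_⟩
  rw [bidiffExpr_add, ← bidiffExpr_extend (le_max_left N M),
    ← bidiffExpr_extend (le_max_right N M), ← hP f g hf hg x, ← hQ f g hf hg x]

theorem IsExpr.mul {P : (ℝ → ℝ) → (ℝ → ℝ) → ℝ → ℝ} (hP : IsExpr P) {c : ℝ → ℝ}
    (hc : ContDiff ℝ ∞ c) : IsExpr fun f g x => c x * P f g x := by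
  obtain ⟨N, a, ha, hP⟩ := hP
  refine ⟨N, fun i j => c * a i j, fun i j => hc.mul (ha i j), fun f g hf hg x => ?_⟩
  rw [bidiffExpr_mul, ← hP f g hf hg x]

theorem IsExpr.zero : IsExpr fun _ _ _ => 0 :=
  ⟨0, fun _ _ => 0, fun _ _ => contDiff_const, fun f g _ _ x => by simp [bidiffExpr]⟩

theorem IsExpr.sum {ι : Type*} (s : Finset ι) {P : ι → (ℝ → ℝ) → (ℝ → ℝ) → ℝ → ℝ}
    (hP : ∀ t ∈ s, IsExpr (P t)) : IsExpr fun f g x => ∑ t ∈ s, P t f g x := by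
  classical
  induction s using Finset.induction_on with
  | empty => simpa using IsExpr.zero
  | insert t s ht ih =>
    have h1 := (hP t (Finset.mem_insert_self t s)).add
      (ih fun u hu => hP u (Finset.mem_insert_of_mem hu))
    exact h1.congr fun f g _ _ x => Finset.sum_insert ht

theorem IsExpr.mono {c : ℝ → ℝ} (hc : ContDiff ℝ ∞ c) (i j : ℕ) :
    IsExpr fun f g x => c x * iteratedDeriv i f x * iteratedDeriv j g x := by
  refine ⟨max i j, fun i' j' => if i' = i ∧ j' = j then c else 0, fun _ _ => smooth_ite hc,
    fun f g _ _ x => ?_⟩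
  unfold bidiffExpr
  rw [Finset.sum_eq_single i, Finset.sum_eq_single j]
  · simp
  · intro b _ hb
    simp [hb]
  · intro h
    exact absurd (Finset.mem_range.2 (by omega)) h
  · intro b _ hb
    simp [hb]
  · intro h
    exact absurd (Finset.mem_range.2 (by omega)) h

theorem smooth_iteratedDeriv {f : ℝ → ℝ} (hf : ContDiff ℝ ∞ f) (i : ℕ) :
    ContDiff ℝ ∞ (iteratedDeriv i f) := by
  rw [iteratedDeriv_eq_iterate]
  exact hf.iterate_deriv i

theorem iteratedDeriv_lieDer {τ : ℝ} {X f : ℝ → ℝ} (hX : ContDiff ℝ ∞ X) (hf : ContDiff ℝ ∞ f)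
    (i : ℕ) (x : ℝ) : iteratedDeriv i (lieDer τ X f) x =
      ∑ t ∈ Finset.range (i + 1),
        (i.choose t * iteratedDeriv t X x * iteratedDeriv (i - t + 1) f x
          + τ * (i.choose t * iteratedDeriv (t + 1) X x * iteratedDeriv (i - t) f x)) := by
  have e : lieDer τ X f = X * deriv f + τ • (deriv X * f) := by
    funext x
    simp only [lieDer, Pi.add_apply, Pi.mul_apply, Pi.smul_apply, smul_eq_mul]
    ring
  have s : ∀ {h : ℝ → ℝ}, ContDiff ℝ ∞ h → ContDiffAt ℝ i h x := fun hh =>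
    (hh.of_le (by exact_mod_cast le_top)).contDiffAt
  have hX' := smooth_deriv hX
  have hf' := smooth_deriv hf
  have a1 : ContDiff ℝ ∞ (X * deriv f) := hX.mul hf'
  have a2 : ContDiff ℝ ∞ (τ • (deriv X * f)) := (hX'.mul hf).const_smul τ
  rw [e, iteratedDeriv_add (s a1) (s a2),
    iteratedDeriv_const_smul_field, iteratedDeriv_mul (s hX) (s hf'),
    iteratedDeriv_mul (s hX') (s hf), smul_eq_mul, Finset.mul_sum, ← Finset.sum_add_distrib]
  simp only [iteratedDeriv_succ']

theorem IsExpr.deriv {P : (ℝ → ℝ) → (ℝ → ℝ) → ℝ → ℝ} (hP : IsExpr P) :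
    IsExpr fun f g x => deriv (P f g) x := by
  obtain ⟨N, a, ha, hP⟩ := hP
  have key : IsExpr fun f g x => ∑ i ∈ Finset.range (N + 1), ∑ j ∈ Finset.range (N + 1),
      (_root_.deriv (a i j) x * iteratedDeriv i f x * iteratedDeriv j g x
        + a i j x * iteratedDeriv (i + 1) f x * iteratedDeriv j g x
        + a i j x * iteratedDeriv i f x * iteratedDeriv (j + 1) g x) :=
    IsExpr.sum _ fun i _ => IsExpr.sum _ fun j _ =>
      ((IsExpr.mono (smooth_deriv (ha i j)) i j).add (IsExpr.mono (ha i j) (i + 1) j)).add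
        (IsExpr.mono (ha i j) i (j + 1))
  refine key.congr fun f g hf hg x => ?_
  have e : P f g = fun x => ∑ i ∈ Finset.range (N + 1), ∑ j ∈ Finset.range (N + 1),
      a i j x * iteratedDeriv i f x * iteratedDeriv j g x := by
    funext x
    exact hP f g hf hg x
  rw [e]
  refine HasDerivAt.deriv (HasDerivAt.fun_sum fun i _ => HasDerivAt.fun_sum fun j _ => ?_)
  have h1 := (smooth_diffAt (ha i j) x).hasDerivAt
  have h2 := (smooth_diffAt (smooth_iteratedDeriv hf i) x).hasDerivAt
  have h3 := (smooth_diffAt (smooth_iteratedDeriv hg j) x).hasDerivAt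
  refine ((h1.mul h2).mul h3).congr_deriv ?_
  rw [iteratedDeriv_succ, iteratedDeriv_succ]
  simp only [Pi.mul_apply]
  ring

theorem IsExpr.comp_left {P : (ℝ → ℝ) → (ℝ → ℝ) → ℝ → ℝ} (hP : IsExpr P) (τ : ℝ) {X : ℝ → ℝ}
    (hX : ContDiff ℝ ∞ X) : IsExpr fun f g => P (lieDer τ X f) g := by
  obtain ⟨N, a, ha, hP⟩ := hP
  have key : IsExpr fun f g x => ∑ i ∈ Finset.range (N + 1), ∑ j ∈ Finset.range (N + 1),
      ∑ t ∈ Finset.range (i + 1),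
        (a i j x * ((i.choose t : ℝ) * iteratedDeriv t X x) * iteratedDeriv (i - t + 1) f x *
            iteratedDeriv j g x
          + a i j x * ((τ * i.choose t : ℝ) * iteratedDeriv (t + 1) X x) *
            iteratedDeriv (i - t) f x * iteratedDeriv j g x) :=
    IsExpr.sum _ fun i _ => IsExpr.sum _ fun j _ => IsExpr.sum _ fun t _ =>
      (IsExpr.mono ((ha i j).mul (contDiff_const.mul (smooth_iteratedDeriv hX t))) _ _).add
        (IsExpr.mono ((ha i j).mul (contDiff_const.mul (smooth_iteratedDeriv hX (t + 1)))) _ _)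
  refine key.congr fun f g hf hg x => ?_
  rw [hP _ g (contDiff_lieDer hX hf) hg x, bidiffExpr]
  refine Finset.sum_congr rfl fun i _ => Finset.sum_congr rfl fun j _ => ?_
  rw [iteratedDeriv_lieDer hX hf, Finset.mul_sum, Finset.sum_mul]
  refine Finset.sum_congr rfl fun t _ => ?_
  ring

theorem IsExpr.swap {P : (ℝ → ℝ) → (ℝ → ℝ) → ℝ → ℝ} (hP : IsExpr P) :
    IsExpr fun f g => P g f := by
  obtain ⟨N, a, ha, hP⟩ := hP
  refine ⟨N, fun i j => a j i, fun i j => ha j i, fun f g hf hg x => ?_⟩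
  refine (hP g f hg hf x).trans ?_
  rw [bidiffExpr, bidiffExpr, Finset.sum_comm]
  refine Finset.sum_congr rfl fun i _ => Finset.sum_congr rfl fun j _ => ?_
  ring

theorem IsExpr.comp_right {P : (ℝ → ℝ) → (ℝ → ℝ) → ℝ → ℝ} (hP : IsExpr P) (τ : ℝ) {X : ℝ → ℝ}
    (hX : ContDiff ℝ ∞ X) : IsExpr fun f g => P f (lieDer τ X g) :=
  (hP.swap.comp_left τ hX).swap

theorem IsExpr.lie {P : (ℝ → ℝ) → (ℝ → ℝ) → ℝ → ℝ} (hP : IsExpr P) (l n m : ℝ) {X : ℝ → ℝ}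
    (hX : ContDiff ℝ ∞ X) : IsExpr fun f g x =>
      lieDer m X (P f g) x - P (lieDer l X f) g x - P f (lieDer n X g) x := by
  have h1 := hP.deriv.mul hX
  have h2 := hP.mul (c := fun x => m * _root_.deriv X x) (contDiff_const.mul (smooth_deriv hX))
  have h3 := (hP.comp_left l hX).mul (c := fun _ => -1) contDiff_const
  have h4 := (hP.comp_right n hX).mul (c := fun _ => -1) contDiff_const
  refine (((h1.add h2).add h3).add h4).congr fun f g _ _ x => ?_
  simp only [lieDer]
  ring

theorem isBidiffOp_iff {l n m : ℝ} (A : Density l →ₗ[ℝ] Density n →ₗ[ℝ] Density m) :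
    IsBidiffOp A ↔ ∃ P Q, IsExpr P ∧ IsExpr Q ∧ ∀ (φ : Density l) (ψ : Density n),
      (A φ ψ).comp.1 = P φ.comp.1 ψ.comp.1 ∧ (A φ ψ).comp.2 = Q φ.comp.2 ψ.comp.2 := by
  constructor
  · rintro ⟨N, a, b, ha, hb, h⟩
    exact ⟨bidiffExpr N a, bidiffExpr N b, ⟨N, a, ha, fun _ _ _ _ _ => rfl⟩,
      ⟨N, b, hb, fun _ _ _ _ _ => rfl⟩,
      fun φ ψ => ⟨funext fun x => (h φ ψ x).1, funext fun x => (h φ ψ x).2⟩⟩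
  · rintro ⟨P, Q, ⟨N, a, ha, hP⟩, ⟨M, b, hb, hQ⟩, h⟩
    refine ⟨max N M, _, _, fun i j => smooth_ite (p := i ≤ N ∧ j ≤ N) (ha i j),
      fun i j => smooth_ite (p := i ≤ M ∧ j ≤ M) (hb i j), fun φ ψ x => ⟨?_, ?_⟩⟩
    · rw [(h φ ψ).1, hP _ _ (density_smooth φ).1 (density_smooth ψ).1]
      exact bidiffExpr_extend (le_max_left N M) _ _ _ _
    · rw [(h φ ψ).2, hQ _ _ (density_smooth φ).2 (density_smooth ψ).2]
      exact bidiffExpr_extend (le_max_right N M) _ _ _ _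

/-- `D_{l,n;m}`: the `Vect(ℝP¹)`-module of bilinear differential operators `F_l ⊗ F_n → F_m`.
The action is Mathlib's action on linear maps, used twice:
`(X · A)(φ, ψ) = L_X (A (φ, ψ)) - A (L_X φ, ψ) - A (φ, L_X ψ)`. -/
def BidiffOp (l n m : ℝ) :
    LieSubmodule ℝ VectRP1 (Density l →ₗ[ℝ] Density n →ₗ[ℝ] Density m) where
  carrier := {A | IsBidiffOp A}
  add_mem' := by
    intro A B hA hB
    obtain ⟨P, Q, hP, hQ, h⟩ := (isBidiffOp_iff A).1 hA
    obtain ⟨P', Q', hP', hQ', h'⟩ := (isBidiffOp_iff B).1 hB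
    refine (isBidiffOp_iff _).2 ⟨_, _, hP.add hP', hQ.add hQ', fun φ ψ => ⟨?_, ?_⟩⟩
    · rw [← (h φ ψ).1, ← (h' φ ψ).1]; rfl
    · rw [← (h φ ψ).2, ← (h' φ ψ).2]; rfl
  zero_mem' := (isBidiffOp_iff _).2 ⟨_, _, IsExpr.zero, IsExpr.zero, fun _ _ => ⟨rfl, rfl⟩⟩
  smul_mem' := by
    intro c A hA
    obtain ⟨P, Q, hP, hQ, h⟩ := (isBidiffOp_iff A).1 hA
    refine (isBidiffOp_iff _).2 ⟨_, _, hP.mul (c := fun _ => c) contDiff_const,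
      hQ.mul (c := fun _ => c) contDiff_const, fun φ ψ => ⟨?_, ?_⟩⟩
    · rw [← (h φ ψ).1]; rfl
    · rw [← (h φ ψ).2]; rfl
  lie_mem := by
    intro X A hA
    obtain ⟨P, Q, hP, hQ, h⟩ := (isBidiffOp_iff A).1 hA
    refine (isBidiffOp_iff _).2 ⟨_, _, hP.lie l n m (vect_smooth X).1,
      hQ.lie l n m (vect_smooth X).2, fun φ ψ => ⟨?_, ?_⟩⟩
    · have h1 := (h φ ψ).1
      have h2 := (h ⁅X, φ⁆ ψ).1
      have h3 := (h φ ⁅X, ψ⁆).1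
      rw [density_lie_val] at h2 h3
      funext x
      rw [← h1, ← h2, ← h3]
      show lieDer m X.comp.1 (A φ ψ).comp.1 x - (A φ ⁅X, ψ⁆).comp.1 x - (A ⁅X, φ⁆ ψ).comp.1 x = _
      ring
    · have h1 := (h φ ψ).2
      have h2 := (h ⁅X, φ⁆ ψ).2
      have h3 := (h φ ⁅X, ψ⁆).2
      rw [density_lie_val] at h2 h3
      funext x
      rw [← h1, ← h2, ← h3]
      show lieDer m X.comp.2 (A φ ψ).comp.2 x - (A φ ⁅X, ψ⁆).comp.2 x - (A ⁅X, φ⁆ ψ).comp.2 x = _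
      ring

/-! ### First relative cohomology -/

section RelativeCohomology

variable (R : Type*) [CommRing R] (L : Type*) [LieRing L] [LieAlgebra R L]
  (h : LieSubalgebra R L)
  (M : Type*) [AddCommGroup M] [Module R M] [LieRingModule L M] [LieModule R L M]

/-- Relative 1-cocycles of `(L, h)` in `M`: linear maps `c : L → M` that vanish on `h` and satisfy
`c [x, y] = x · c y - y · c x`.  (They are then automatically `h`-equivariant.) -/
def relCocycle : Submodule R (L →ₗ[R] M) where
  carrier := {c | (∀ x ∈ h, c x = 0) ∧ LieModule.Cohomology.d₁₂ R L M c = 0}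
  add_mem' := by
    rintro c d ⟨h1, h2⟩ ⟨k1, k2⟩
    exact ⟨fun x hx => by simp [h1 x hx, k1 x hx], by rw [map_add, h2, k2, add_zero]⟩
  zero_mem' := ⟨fun _ _ => rfl, map_zero _⟩
  smul_mem' := by
    rintro t c ⟨h1, h2⟩
    exact ⟨fun x hx => by simp [h1 x hx], by rw [map_smul, h2, smul_zero]⟩

/-- Relative 1-coboundaries of `(L, h)` in `M`: the maps `x ↦ x · m` with `m` invariant under `h`. -/
def relCoboundary : Submodule R (L →ₗ[R] M) where
  carrier := {c | ∃ m : M, (∀ x ∈ h, ⁅x, m⁆ = 0) ∧ ∀ x, c x = ⁅x, m⁆}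
  add_mem' := by
    rintro c d ⟨m, h1, h2⟩ ⟨m', k1, k2⟩
    exact ⟨m + m', fun x hx => by rw [lie_add, h1 x hx, k1 x hx, add_zero],
      fun x => by rw [LinearMap.add_apply, h2, k2, lie_add]⟩
  zero_mem' := ⟨0, by simp, by simp⟩
  smul_mem' := by
    rintro t c ⟨m, h1, h2⟩
    exact ⟨t • m, fun x hx => by rw [lie_smul, h1 x hx, smul_zero],
      fun x => by rw [LinearMap.smul_apply, h2, lie_smul]⟩

theorem relCoboundary_le_relCocycle : relCoboundary R L h M ≤ relCocycle R L h M := by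
  rintro c ⟨m, h1, h2⟩
  refine ⟨fun x hx => by rw [h2, h1 x hx], ?_⟩
  ext x y
  have : ⁅x, c y⁆ - ⁅y, c x⁆ - c ⁅x, y⁆ = 0 := by
    rw [h2, h2, h2, lie_lie, sub_self]
  exact this

/-- The first relative cohomology `H¹(L, h; M)`: relative cocycles modulo coboundaries. -/
abbrev RelH1 : Type _ :=
  relCocycle R L h M ⧸ (relCoboundary R L h M).submoduleOf (relCocycle R L h M)

end RelativeCohomology

/-- `H¹(Vect(ℝP¹), sl(2,ℝ); D_{l,n;m}) ≅ ℝ^d`. -/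
def H1Iso (l n m : ℝ) (d : ℕ) : Prop :=
  Nonempty (RelH1 ℝ VectRP1 sl2RP1 (BidiffOp l n m) ≃ₗ[ℝ] (Fin d → ℝ))

/-! ### The exceptional weights `(λ, ν)`, for each value of `k = μ - λ - ν` -/

/-- `k = 2`, dimension one. -/
def k2DimOne : Set (ℝ × ℝ) :=
  {p | (p.1 + p.2 + 1 = 0 ∧ p ≠ (-1/2, -1/2)) ∨ (p.1 = 0 ∧ p.2 ≠ -1/2) ∨ (p.2 = 0 ∧ p.1 ≠ -1/2)}

/-- `k = 3`, dimension two. -/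
def k3DimTwo : Set (ℝ × ℝ) :=
  {(0, 0), (-2, 0), (0, -2), (-2/3, -2/3)}

/-- `k = 3`, dimension zero. -/
def k3DimZero : Set (ℝ × ℝ) :=
  {(-1/2, -1), (-1, -1/2), (-1, -1), (0, -1), (-1, 0), (-1/2, -1/2)}

/-- `k = 4`, dimension one. -/
def k4DimOne : Set (ℝ × ℝ) :=
  {(0, -3/2), (-3/2, 0), (-1, -1), (-1/2, -3/2), (-3/2, -1/2), (-3/2, -1), (-1, -3/2),
    (-3/2, -3/2), (-1/2, -1), (-1, -1/2)}

/-- `k = 5`, dimension three. -/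
def k5DimThree : Set (ℝ × ℝ) :=
  {(0, 0), (-4, 0), (0, -4)}

/-- `k = 5`, dimension one. -/
def k5DimOne : Set (ℝ × ℝ) :=
  {(-1/2, -3/2), (-3/2, -1/2), (-1/2, -2), (-2, -1/2), (-1, -2), (-2, -1), (-1, -3/2),
    (-3/2, -1), (-1, -1), (-3/2, -2), (-2, -3/2), (-3/2, -3/2)}

/-- `k = 6`, dimension three. -/
def k6DimThree : Set (ℝ × ℝ) :=
  {((-5 + √19) / 2, 0), ((-5 - √19) / 2, 0), (0, (-5 + √19) / 2), (0, (-5 - √19) / 2),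
    ((-5 + √19) / 2, (-5 - √19) / 2), ((-5 - √19) / 2, (-5 + √19) / 2)}

/-- `k = 6`, dimension one. -/
def k6DimOne : Set (ℝ × ℝ) :=
  {(-2, -1/2), (-1/2, -2), (-5/2, -1/2), (-1/2, -5/2), (-1, -3/2), (-3/2, -1), (-1, -2),
    (-2, -1), (-1, -5/2), (-5/2, -1), (-3/2, -3/2), (-3/2, -2), (-2, -3/2), (-3/2, -5/2),
    (-5/2, -3/2), (-2, -2), (-2, -5/2), (-5/2, -2)}

/-- `k = 7`, dimension two. -/
def k7DimTwo : Set (ℝ × ℝ) :=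
  {p | p.1 = 0 ∨ p.2 = 0 ∨ p.2 = -6 - p.1} ∪
  {((-5 - √19) / 2, (-5 - √19) / 2), ((-5 + √19) / 2, (-5 + √19) / 2),
    (√19 - 1, (-5 - √19) / 2), ((-5 - √19) / 2, √19 - 1),
    (-√19 - 1, (-5 + √19) / 2), ((-5 + √19) / 2, -√19 - 1)}

/-- `k = 7`, dimension zero. -/
def k7DimZero : Set (ℝ × ℝ) :=
  {(-5/2, -1/2), (-1/2, -5/2), (-1/2, -3), (-3, -1/2), (-1, -2), (-2, -1), (-1, -3), (-3, -1),
    (-3/2, -2), (-2, -3/2), (-3/2, -5/2), (-5/2, -3/2), (-2, -3), (-3, -2), (-2, -5/2),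
    (-5/2, -2), (-3, -5/2), (-5/2, -3)}

end

/-! The computation of H¹ becomes a rank computation for small matrices with entries polynomial in
the weights l, n.

Locality and symbols. A relative cocycle c vanishes on sl(2), so the cocycle identity says that c is
sl(2)-equivariant. It is also local, with no continuity assumed: a field supported in an interval is
a sum of two brackets of fields supported in a slightly larger interval, and the identity kills such
brackets away from their supports (`relCocycle_local`). A local equivariant operator is
differential. Indeed, the field (x - p) d/dx makes it homogeneous at p, and a function vanishing to
high order at p lies in the image of the shifted Euler operator, which is annihilated; so only
finitely many Taylor coefficients matter (`IsLocalOp.apply_mono`, `IsLocalOp.apply_eq`).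
Translations make the coefficients constant and x² d/dx imposes a three-term relation; these
conditions define `invSymbol`. Conversely, an invariant symbol defines an operator on the whole
projective line, because the change of chart is the flow of x² d/dx up to scalings
(`triForm_transition`).

Coordinates. A cocycle has total order k + 1 = κ + 3 in its three arguments. Vanishing on sl(2)
removes X, X', X'', and the x² relation recovers everything from the coefficients of X'''. Thus
cocycles Z and coboundaries B become subspaces of a space of dimension κ + 1, and dim H¹ = dim Z -
dim B (`h1Iso_of_finrank`).

Coboundaries. The invariant operators of order k solve a two-term recurrence, with solution space of
dimension 1, or 2 at the half-integral weights of `IsDoubleWeight`. For κ ≥ 1 the coboundary map is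
injective on them except at four weights with k = 3: an operator in its kernel is invariant under x²
and x³, hence under all x^r with r ≥ 2 (`coboundaryMap_injective`).

Cocycles. The differential of a cochain is again invariant, so for k ≤ 7 its vanishing on (x³, x⁴)
and (x³, x⁶) suffices (`mem_cocycleSymbol_of_forms`). This gives no equation for k ≤ 4, one equation
in 4 unknowns for k = 5, two in 5 for k = 6 and four in 6 for k = 7. The dimension of Z is then
governed by linear relations between these equations, that is, by left kernels. At several
half-integral weights a rank drop coincides with a second invariant operator and the two effects
cancel.

Generic weights. For k ≥ 8 the same forms are necessary conditions. At the weights (1/2, -κ/2),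
together with the vanishing of the first coordinate, they have only the zero solution; a determinant
then shows dim Z ≤ 1 generically, while dim B ≥ 1 always. If k is not an integer ≥ 2 there are no
nonzero cocycles at all. -/

/-! ### Taylor coefficients and trilinear symbols -/

/-- The `r`-th Taylor coefficient of `f` at `x`. -/
noncomputable def taylorCoef (f : ℝ → ℝ) (x : ℝ) (r : ℕ) : ℝ := iteratedDeriv r f x / r.factorial

/-- The Lie derivative of a density of weight `τ`, on sequences of Taylor coefficients. -/
noncomputable def lieSeq (τ : ℝ) (X f : ℕ → ℝ) (n : ℕ) : ℝ :=
  ∑ t ∈ Finset.range (n + 1),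
    (X t * (((n - t + 1 : ℕ) : ℝ) * f (n - t + 1)) + τ * (((t + 1 : ℕ) : ℝ) * X (t + 1) * f (n - t)))

/-- The derivative, on sequences of Taylor coefficients. -/
def derivSeq (f : ℕ → ℝ) (n : ℕ) : ℝ := ((n + 1 : ℕ) : ℝ) * f (n + 1)

/-- The trilinear form on sequences with symbol `Γ`. -/
def triForm (N : ℕ) (Γ : ℕ → ℕ → ℕ → ℝ) (F G H : ℕ → ℝ) : ℝ :=
  ∑ r ∈ Finset.range N, ∑ i ∈ Finset.range N, ∑ j ∈ Finset.range N, Γ r i j * F r * G i * H j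

/-- Dividing the Leibniz rule by n! absorbs the binomial coefficients, so fields act on Taylor
coefficients as they do on formal power series. -/
theorem taylorCoef_lieDer {τ : ℝ} {X f : ℝ → ℝ} (hX : ContDiff ℝ ∞ X) (hf : ContDiff ℝ ∞ f)
    (x : ℝ) : taylorCoef (lieDer τ X f) x = lieSeq τ (taylorCoef X x) (taylorCoef f x) := by
  funext n
  simp only [taylorCoef, lieSeq, iteratedDeriv_lieDer hX hf, Finset.sum_div]
  refine Finset.sum_congr rfl fun t ht => ?_
  have ht : t ≤ n := Nat.lt_succ_iff.1 (Finset.mem_range.1 ht)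
  rw [Nat.cast_choose ℝ ht]
  have h1 : (n.factorial : ℝ) ≠ 0 := by positivity
  have h2 : (t.factorial : ℝ) ≠ 0 := by positivity
  have h3 : ((n - t).factorial : ℝ) ≠ 0 := by positivity
  rw [Nat.factorial_succ (n - t), Nat.factorial_succ t]
  have h4 : ((t + 1 : ℕ) : ℝ) ≠ 0 := by positivity
  have h5 : ((n - t + 1 : ℕ) : ℝ) ≠ 0 := by positivity
  rw [Nat.cast_mul, Nat.cast_mul]
  field_simp

theorem hasDerivAt_taylorCoef {f : ℝ → ℝ} (hf : ContDiff ℝ ∞ f) (x : ℝ) (r : ℕ) :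
    HasDerivAt (fun x => taylorCoef f x r) (derivSeq (taylorCoef f x) r) x := by
  have h := (smooth_diffAt (smooth_iteratedDeriv hf r) x).hasDerivAt.div_const (r.factorial : ℝ)
  refine h.congr_deriv ?_
  rw [← iteratedDeriv_succ, derivSeq, taylorCoef, Nat.factorial_succ, Nat.cast_mul]
  have h1 : (r.factorial : ℝ) ≠ 0 := by positivity
  have h4 : ((r + 1 : ℕ) : ℝ) ≠ 0 := by positivity
  field_simp

theorem taylorCoef_add {f g : ℝ → ℝ} (hf : ContDiff ℝ ∞ f) (hg : ContDiff ℝ ∞ g) (x : ℝ) :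
    taylorCoef (f + g) x = taylorCoef f x + taylorCoef g x := by
  funext n
  have s : ∀ {h : ℝ → ℝ}, ContDiff ℝ ∞ h → ContDiffAt ℝ n h x := fun hh =>
    (hh.of_le (by exact_mod_cast le_top)).contDiffAt
  simp only [taylorCoef, Pi.add_apply, iteratedDeriv_add (s hf) (s hg), add_div]

theorem taylorCoef_smul (c : ℝ) (f : ℝ → ℝ) (x : ℝ) :
    taylorCoef (c • f) x = c • taylorCoef f x := by
  funext n
  simp only [taylorCoef, Pi.smul_apply, iteratedDeriv_const_smul_field, smul_eq_mul, mul_div_assoc]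

theorem taylorCoef_congr {f g : ℝ → ℝ} {x : ℝ} (h : f =ᶠ[nhds x] g) :
    taylorCoef f x = taylorCoef g x := by
  funext n
  simp only [taylorCoef, h.iteratedDeriv_eq n]

theorem taylorCoef_zero (f : ℝ → ℝ) (x : ℝ) : taylorCoef f x 0 = f x := by
  simp [taylorCoef]

theorem taylorCoef_one (f : ℝ → ℝ) (x : ℝ) : taylorCoef f x 1 = deriv f x := by
  simp [taylorCoef]

theorem contDiff_taylorCoef {f : ℝ → ℝ} (hf : ContDiff ℝ ∞ f) (r : ℕ) :
    ContDiff ℝ ∞ fun x => taylorCoef f x r :=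
  (smooth_iteratedDeriv hf r).div_const _

theorem taylorCoef_pow (p : ℝ) (a : ℕ) :
    taylorCoef (fun x => (x - p) ^ a) p = Pi.single a 1 := by
  funext n
  have h : iteratedDeriv n (fun x : ℝ => (x - p) ^ a) p
      = iteratedDeriv n (fun x : ℝ => x ^ a) (p - p) :=
    congrFun (iteratedDeriv_comp_sub_const n (fun x : ℝ => x ^ a) p) p
  rw [taylorCoef, h, sub_self, iteratedDeriv_pow]
  rcases lt_trichotomy n a with h | rfl | h
  · simp [show a - n ≠ 0 by omega, show n ≠ a by omega]
  · have h1 : (n.factorial : ℝ) ≠ 0 := by positivity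
    simp [Nat.descFactorial_self, h1]
  · simp [Nat.descFactorial_of_lt h, show n ≠ a by omega]

/-! ### Multilinearity, truncation and values on the standard basis -/

section Linear

variable (N : ℕ) (Γ : ℕ → ℕ → ℕ → ℝ) (F F' G G' H H' : ℕ → ℝ) (c τ : ℝ)

theorem triForm_add₁ : triForm N Γ (F + F') G H = triForm N Γ F G H + triForm N Γ F' G H := by
  simp only [triForm, Pi.add_apply, mul_add, add_mul, Finset.sum_add_distrib]

theorem triForm_add₂ : triForm N Γ F (G + G') H = triForm N Γ F G H + triForm N Γ F G' H := by
  simp only [triForm, Pi.add_apply, mul_add, add_mul, Finset.sum_add_distrib]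

theorem triForm_add₃ : triForm N Γ F G (H + H') = triForm N Γ F G H + triForm N Γ F G H' := by
  simp only [triForm, Pi.add_apply, mul_add, Finset.sum_add_distrib]

theorem triForm_smul₁ : triForm N Γ (c • F) G H = c * triForm N Γ F G H := by
  simp only [triForm, Pi.smul_apply, smul_eq_mul, Finset.mul_sum]
  exact Finset.sum_congr rfl fun _ _ => Finset.sum_congr rfl fun _ _ =>
    Finset.sum_congr rfl fun _ _ => by ring

theorem triForm_smul₂ : triForm N Γ F (c • G) H = c * triForm N Γ F G H := by
  simp only [triForm, Pi.smul_apply, smul_eq_mul, Finset.mul_sum]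
  exact Finset.sum_congr rfl fun _ _ => Finset.sum_congr rfl fun _ _ =>
    Finset.sum_congr rfl fun _ _ => by ring

theorem triForm_smul₃ : triForm N Γ F G (c • H) = c * triForm N Γ F G H := by
  simp only [triForm, Pi.smul_apply, smul_eq_mul, Finset.mul_sum]
  exact Finset.sum_congr rfl fun _ _ => Finset.sum_congr rfl fun _ _ =>
    Finset.sum_congr rfl fun _ _ => by ring

theorem lieSeq_add_left : lieSeq τ (F + F') G = lieSeq τ F G + lieSeq τ F' G := by
  funext n
  simp only [lieSeq, Pi.add_apply, ← Finset.sum_add_distrib]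
  exact Finset.sum_congr rfl fun _ _ => by ring

theorem lieSeq_add_right : lieSeq τ F (G + G') = lieSeq τ F G + lieSeq τ F G' := by
  funext n
  simp only [lieSeq, Pi.add_apply, ← Finset.sum_add_distrib]
  exact Finset.sum_congr rfl fun _ _ => by ring

theorem lieSeq_smul_left : lieSeq τ (c • F) G = c • lieSeq τ F G := by
  funext n
  simp only [lieSeq, Pi.smul_apply, smul_eq_mul, Finset.mul_sum]
  exact Finset.sum_congr rfl fun _ _ => by ring

theorem lieSeq_smul_right : lieSeq τ F (c • G) = c • lieSeq τ F G := by
  funext n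
  simp only [lieSeq, Pi.smul_apply, smul_eq_mul, Finset.mul_sum]
  exact Finset.sum_congr rfl fun _ _ => by ring

theorem derivSeq_add : derivSeq (F + G) = derivSeq F + derivSeq G := by
  funext n; simp only [derivSeq, Pi.add_apply]; ring

theorem derivSeq_smul : derivSeq (c • F) = c • derivSeq F := by
  funext n; simp only [derivSeq, Pi.smul_apply, smul_eq_mul]; ring

variable {N Γ F F' G G' H H' c τ}

theorem triForm_single (hΓ : ∀ r i j, ¬ (r < N ∧ i < N ∧ j < N) → Γ r i j = 0) (r i j : ℕ) :
    triForm N Γ (Pi.single r 1) (Pi.single i 1) (Pi.single j 1) = Γ r i j := by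
  by_cases h : r < N ∧ i < N ∧ j < N
  · simp only [triForm, Pi.single_apply, mul_ite, mul_one, mul_zero, Finset.sum_ite_eq',
      Finset.mem_range]
    simp [h]
  · rw [hΓ r i j h]
    refine Finset.sum_eq_zero fun a ha => Finset.sum_eq_zero fun b hb =>
      Finset.sum_eq_zero fun c hc => ?_
    rw [Finset.mem_range] at ha hb hc
    by_cases h1 : a = r
    · by_cases h2 : b = i
      · rw [Pi.single_eq_of_ne (i := j) (i' := c) (by omega), mul_zero]
      · rw [Pi.single_eq_of_ne h2]; ring
    · rw [Pi.single_eq_of_ne h1]; ring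

/-- This is the Lie derivative of x^b along x^a d/dx. The exponent a + b - 1 is truncated only for a
= b = 0, where the scalar vanishes. -/
theorem lieSeq_single (a b : ℕ) : lieSeq τ (Pi.single a 1) (Pi.single b 1)
    = ((b : ℝ) + τ * a) • Pi.single (a + b - 1) 1 := by
  funext n
  have e1 : ∑ t ∈ Finset.range (n + 1), ((Pi.single a 1 : ℕ → ℝ) t *
      (((n - t + 1 : ℕ) : ℝ) * (Pi.single b 1 : ℕ → ℝ) (n - t + 1)))
      = if n + 1 = a + b then (b : ℝ) else 0 := by
    by_cases ha : a < n + 1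
    · rw [Finset.sum_eq_single a]
      · rw [Pi.single_eq_same, one_mul]
        by_cases h : n + 1 = a + b
        · have : n - a + 1 = b := by omega
          rw [if_pos h, this, Pi.single_eq_same, mul_one]
        · rw [if_neg h, Pi.single_eq_of_ne (by omega), mul_zero]
      · intro t _ ht
        rw [Pi.single_eq_of_ne ht, zero_mul]
      · intro h
        exact absurd (Finset.mem_range.2 ha) h
    · rw [Finset.sum_eq_zero]
      · split_ifs with h
        · have : b = 0 := by omega
          simp [this]
        · rfl
      · intro t ht
        have := Finset.mem_range.1 ht
        rw [Pi.single_eq_of_ne (by omega), zero_mul]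
  have e2 : ∑ t ∈ Finset.range (n + 1), (((t + 1 : ℕ) : ℝ) * (Pi.single a 1 : ℕ → ℝ) (t + 1) *
      (Pi.single b 1 : ℕ → ℝ) (n - t)) = if n + 1 = a + b then (a : ℝ) else 0 := by
    rcases a with _ | a
    · rw [Finset.sum_eq_zero]
      · simp
      · intro t _
        rw [Pi.single_eq_of_ne (by omega), mul_zero, zero_mul]
    · by_cases ha : a < n + 1
      · rw [Finset.sum_eq_single a]
        · rw [Pi.single_eq_same, mul_one]
          by_cases h : n + 1 = a + 1 + b
          · have : n - a = b := by omega
            rw [if_pos h, this, Pi.single_eq_same, mul_one]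
          · rw [if_neg h, Pi.single_eq_of_ne (by omega), mul_zero]
        · intro t _ ht
          rw [Pi.single_eq_of_ne (by omega), mul_zero, zero_mul]
        · intro h
          exact absurd (Finset.mem_range.2 ha) h
      · rw [Finset.sum_eq_zero]
        · rw [if_neg (by omega)]
        · intro t ht
          have := Finset.mem_range.1 ht
          rw [Pi.single_eq_of_ne (by omega), mul_zero, zero_mul]
  rw [lieSeq, Finset.sum_add_distrib, e1, ← Finset.mul_sum, e2, Pi.smul_apply, smul_eq_mul]
  by_cases h : n + 1 = a + b
  · have : n = a + b - 1 := by omega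
    rw [if_pos h, if_pos h, this, Pi.single_eq_same, mul_one]
  · rw [if_neg h, if_neg h]
    by_cases h0 : a + b = 0
    · have ha : a = 0 := by omega
      have hb : b = 0 := by omega
      simp [ha, hb]
    · rw [Pi.single_eq_of_ne (by omega)]; ring

theorem derivSeq_single (a : ℕ) :
    derivSeq (Pi.single a 1) = (a : ℝ) • Pi.single (a - 1) 1 := by
  funext n
  rw [derivSeq, Pi.smul_apply, smul_eq_mul]
  by_cases h : n + 1 = a
  · subst h; simp
  · rw [Pi.single_eq_of_ne h]
    rcases a with _ | a
    · simp
    · rw [Pi.single_eq_of_ne (by omega)]; ring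

/-- A linear form on sequences that sees finitely many entries is determined by its values on the
standard basis. -/
theorem eq_zero_of_single {Q : (ℕ → ℝ) → ℝ} (M : ℕ) (hadd : ∀ F G, Q (F + G) = Q F + Q G)
    (hsmul : ∀ (c : ℝ) F, Q (c • F) = c * Q F) (htail : ∀ F : ℕ → ℝ, (∀ r < M, F r = 0) → Q F = 0)
    (hs : ∀ r, Q (Pi.single r 1) = 0) (F : ℕ → ℝ) : Q F = 0 := by
  have h0 : Q 0 = 0 := htail 0 fun _ _ => rfl
  have h1 : ∀ m, Q (∑ r ∈ Finset.range m, F r • (Pi.single r 1 : ℕ → ℝ)) = 0 := by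
    intro m
    induction m with
    | zero => simpa using h0
    | succ m ih => rw [Finset.sum_range_succ, hadd, ih, hsmul, hs]; ring
  have h2 : F = (∑ r ∈ Finset.range M, F r • (Pi.single r 1 : ℕ → ℝ)) +
      (F - ∑ r ∈ Finset.range M, F r • (Pi.single r 1 : ℕ → ℝ)) := by abel
  rw [h2, hadd, h1, htail, add_zero]
  intro r hr
  simp [Finset.sum_apply, Pi.single_apply, hr]

/-- A Lie derivative costs one order of vanishing; this is why the multilinear reductions below use
a bound one larger than that of the form. -/
theorem lieSeq_eq_zero_left {M : ℕ} (hF : ∀ r < M + 1, F r = 0) : ∀ r < M, lieSeq τ F G r = 0 := by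
  intro r hr
  refine Finset.sum_eq_zero fun t ht => ?_
  have := Finset.mem_range.1 ht
  rw [hF t (by omega), hF (t + 1) (by omega)]; ring

theorem lieSeq_eq_zero_right {M : ℕ} (hG : ∀ r < M + 1, G r = 0) :
    ∀ r < M, lieSeq τ F G r = 0 := by
  intro r hr
  refine Finset.sum_eq_zero fun t ht => ?_
  have := Finset.mem_range.1 ht
  rw [hG (r - t) (by omega), hG (r - t + 1) (by omega)]; ring

theorem triForm_zero₁ (h : ∀ r < N, F r = 0) : triForm N Γ F G H = 0 :=
  Finset.sum_eq_zero fun r hr => Finset.sum_eq_zero fun i _ => Finset.sum_eq_zero fun j _ => by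
    rw [h r (Finset.mem_range.1 hr)]; ring

theorem triForm_zero₂ (h : ∀ r < N, G r = 0) : triForm N Γ F G H = 0 :=
  Finset.sum_eq_zero fun r _ => Finset.sum_eq_zero fun i hi => Finset.sum_eq_zero fun j _ => by
    rw [h i (Finset.mem_range.1 hi)]; ring

theorem triForm_zero₃ (h : ∀ r < N, H r = 0) : triForm N Γ F G H = 0 :=
  Finset.sum_eq_zero fun r _ => Finset.sum_eq_zero fun i _ => Finset.sum_eq_zero fun j hj => by
    rw [h j (Finset.mem_range.1 hj)]; ring

end Linear

/-! ### Invariant symbols -/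

/-- Symbols of degree `K` invariant under `sl(2)`, for arguments of weights `σ`, `l`, `n`. -/
def invSymbol (σ l n : ℝ) (K : ℕ) : Submodule ℝ (ℕ → ℕ → ℕ → ℝ) where
  carrier := {Γ | (∀ r i j, r + i + j ≠ K → Γ r i j = 0) ∧ ∀ r i j : ℕ,
    (r + 2 * σ) * Γ (r + 1) i j + (i + 2 * l) * Γ r (i + 1) j + (j + 2 * n) * Γ r i (j + 1) = 0}
  add_mem' := by
    rintro Γ Δ ⟨h1, h2⟩ ⟨k1, k2⟩
    refine ⟨fun r i j h => ?_, fun r i j => ?_⟩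
    · simp only [Pi.add_apply, h1 r i j h, k1 r i j h, add_zero]
    · simp only [Pi.add_apply]; linear_combination h2 r i j + k2 r i j
  zero_mem' := ⟨fun _ _ _ _ => rfl, fun _ _ _ => by simp⟩
  smul_mem' := by
    rintro c Γ ⟨h1, h2⟩
    refine ⟨fun r i j h => ?_, fun r i j => ?_⟩
    · simp only [Pi.smul_apply, h1 r i j h, smul_zero]
    · simp only [Pi.smul_apply, smul_eq_mul]; linear_combination c * h2 r i j

theorem invSymbol.box {σ l n : ℝ} {K : ℕ} {Γ : ℕ → ℕ → ℕ → ℝ} (h : Γ ∈ invSymbol σ l n K)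
    (r i j : ℕ) (h' : ¬ (r < K + 1 ∧ i < K + 1 ∧ j < K + 1)) : Γ r i j = 0 :=
  h.1 r i j (by omega)

/-- The coefficient of the Chevalley-Eilenberg differential of the 1-cochain with symbol `Γ` on
`x^a`, `x^s`, `x^i`, `x^j`. -/
def cocycleCoef (l n : ℝ) (Γ : ℕ → ℕ → ℕ → ℝ) (a s i j : ℕ) : ℝ :=
  -((i + l * a) * Γ s (i + a - 1) j) - (j + n * a) * Γ s i (j + a - 1)
    + (i + l * s) * Γ a (i + s - 1) j + (j + n * s) * Γ a i (j + s - 1)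
    - (s - a) * Γ (a + s - 1) i j

/-- The action of `X` on the operator with symbol `Γ` and first argument `Y`. -/
noncomputable def actForm (N : ℕ) (Γ : ℕ → ℕ → ℕ → ℝ) (l n m : ℝ) (X Y f g : ℕ → ℝ) : ℝ :=
  X 0 * (triForm N Γ (derivSeq Y) f g + triForm N Γ Y (derivSeq f) g +
    triForm N Γ Y f (derivSeq g)) + m * X 1 * triForm N Γ Y f g
    - triForm N Γ Y (lieSeq l X f) g - triForm N Γ Y f (lieSeq n X g)

/-- On the output only the value and the first derivative of X at the base point count. The first
gives the total derivative, by Leibniz since the coefficients are constant, and the second gives the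
weight m. The other terms are the action on the two arguments. -/
theorem actForm_single {N : ℕ} {Γ : ℕ → ℕ → ℕ → ℝ}
    (hΓ : ∀ r i j, ¬ (r < N ∧ i < N ∧ j < N) → Γ r i j = 0) (l n m : ℝ) (a s i j : ℕ) :
    actForm N Γ l n m (Pi.single a 1) (Pi.single s 1) (Pi.single i 1) (Pi.single j 1) =
      (if a = 0 then s * Γ (s - 1) i j + i * Γ s (i - 1) j + j * Γ s i (j - 1) else 0)
      + (if a = 1 then m * Γ s i j else 0)
      - (i + l * a) * Γ s (a + i - 1) j - (j + n * a) * Γ s i (a + j - 1) := by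
  simp only [actForm, lieSeq_single, derivSeq_single, triForm_smul₁, triForm_smul₂, triForm_smul₃,
    triForm_single hΓ]
  rcases a with _ | _ | a <;> simp

/-- The Chevalley-Eilenberg differential on sequences. -/
noncomputable def cocycleForm (N : ℕ) (Γ : ℕ → ℕ → ℕ → ℝ) (l n m : ℝ) (X Y f g : ℕ → ℝ) : ℝ :=
  actForm N Γ l n m X Y f g - actForm N Γ l n m Y X f g - triForm N Γ (lieSeq (-1) X Y) f g

/-- By multilinearity it is enough to test monomials. If one of the two fields is 1, x or x², the
cocycle identity is the sl(2)-equivariance of the symbol; if both have degree at least 3 it is `hW`.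
The weight relation has m + 1 because the field itself has weight -1. -/
theorem cocycleForm_eq_zero {l n m : ℝ} {K : ℕ} {Γ : ℕ → ℕ → ℕ → ℝ}
    (hm : m + 1 = l + n + K) (hΓ : Γ ∈ invSymbol (-1) l n K) (h3 : ∀ r < 3, ∀ i j, Γ r i j = 0)
    (hW : ∀ a s i j, 3 ≤ a → 3 ≤ s → cocycleCoef l n Γ a s i j = 0) (X Y f g : ℕ → ℝ) :
    cocycleForm (K + 1) Γ l n m X Y f g = 0 := by
  have hb := invSymbol.box hΓ
  have single : ∀ a s i j, cocycleForm (K + 1) Γ l n m (Pi.single a 1) (Pi.single s 1)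
      (Pi.single i 1) (Pi.single j 1) = 0 := by
    have e : ∀ a s i j, cocycleForm (K + 1) Γ l n m (Pi.single a 1) (Pi.single s 1)
        (Pi.single i 1) (Pi.single j 1) =
        (if a = 0 then s * Γ (s - 1) i j + i * Γ s (i - 1) j + j * Γ s i (j - 1) else 0)
      + (if a = 1 then m * Γ s i j else 0) -
        (if s = 0 then a * Γ (a - 1) i j + i * Γ a (i - 1) j + j * Γ a i (j - 1) else 0)
      - (if s = 1 then m * Γ a i j else 0) + cocycleCoef l n Γ a s i j := by
      intro a s i j
      rw [cocycleForm, actForm_single hb, actForm_single hb, lieSeq_single, triForm_smul₁,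
        triForm_single hb, cocycleCoef, add_comm i a, add_comm j a, add_comm i s, add_comm j s]
      ring
    -- For a = 0 the terms cancel because coefficients are constant, for a = 1 because degree and
    -- weights match (`hm`), and for a = 2 by the defining relation of `invSymbol`.
    have low : ∀ a s i j, a < 3 → cocycleForm (K + 1) Γ l n m (Pi.single a 1) (Pi.single s 1)
      (Pi.single i 1) (Pi.single j 1) = 0 := by
      intro a s i j ha
      rw [e, cocycleCoef]
      have z := h3 a ha
      have z0 := h3 0 (by norm_num)
      have z1 := h3 1 (by norm_num)
      simp only [z]
      interval_cases a
      · simp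
        ring
      · by_cases hK : s + i + j = K
        · have hK' : ((s : ℝ) + i + j) = K := by exact_mod_cast hK
          have e1 : i + 1 - 1 = i := rfl
          have e2 : j + 1 - 1 = j := rfl
          have e3 : 1 + s - 1 = s := by omega
          simp only [e1, e2, e3, Nat.cast_one, if_pos]
          simp
          rw [← hK'] at hm
          simp only [z0, ite_self]
          linear_combination (Γ s i j) * hm
        · have e1 : i + 1 - 1 = i := rfl
          have e2 : j + 1 - 1 = j := rfl
          have e3 : 1 + s - 1 = s := by omega
          simp [e1, e2, e3, hΓ.1 s i j hK]
          try (intros; simp [z0])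
      · have h2 := hΓ.2 s i j
        have e1 : i + 2 - 1 = i + 1 := rfl
        have e2 : j + 2 - 1 = j + 1 := rfl
        have e3 : 2 + s - 1 = s + 1 := by omega
        simp [e1, e2, e3]
        simp only [z1, mul_zero, ite_self]
        linear_combination (-1 : ℝ) * h2
    have anti : ∀ a s i j, cocycleCoef l n Γ a s i j = - cocycleCoef l n Γ s a i j := by
      intro a s i j
      rw [cocycleCoef, cocycleCoef, add_comm a s]; ring
    intro a s i j
    by_cases ha : a < 3
    · exact low a s i j ha
    by_cases hs : s < 3
    · have := low s a i j hs
      rw [e] at this ⊢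
      rw [anti]
      linarith
    · rw [e, hW a s i j (by omega) (by omega)]
      simp [show a ≠ 0 by omega, show a ≠ 1 by omega, show s ≠ 0 by omega, show s ≠ 1 by omega]
  -- The margin K + 2 instead of K + 1 absorbs the index shift in `derivSeq` and `lieSeq`.
  have z : ∀ {F : ℕ → ℝ}, (∀ r < K + 2, F r = 0) → ∀ r < K + 1, F r = 0 :=
    fun h r hr => h r (by omega)
  have zd : ∀ {F : ℕ → ℝ}, (∀ r < K + 2, F r = 0) → ∀ r < K + 1, derivSeq F r = 0 :=
    fun h r hr => by rw [derivSeq, h (r + 1) (by omega), mul_zero]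
  refine eq_zero_of_single (Q := fun X => cocycleForm (K + 1) Γ l n m X Y f g) (K + 2)
    ?_ ?_ ?_ ?_ X
  · intro F G
    simp only [cocycleForm, actForm, lieSeq_add_left, triForm_add₁, triForm_add₂,
      triForm_add₃, derivSeq_add, Pi.add_apply]
    ring
  · intro F G
    simp only [cocycleForm, actForm, lieSeq_smul_left, triForm_smul₁,
      triForm_smul₂, triForm_smul₃, derivSeq_smul, Pi.smul_apply, smul_eq_mul]
    ring
  · intro F hF
    simp only [cocycleForm, actForm, triForm_zero₁ (z hF), triForm_zero₁ (zd hF),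
      triForm_zero₁ (lieSeq_eq_zero_left hF), triForm_zero₂ (lieSeq_eq_zero_left hF),
      triForm_zero₃ (lieSeq_eq_zero_left hF), hF 0 (by omega), hF 1 (by omega)]
    ring
  intro a
  refine eq_zero_of_single (Q := fun Y => cocycleForm (K + 1) Γ l n m (Pi.single a 1) Y f g) (K + 2)
    ?_ ?_ ?_ ?_ Y
  · intro F G
    simp only [cocycleForm, actForm, lieSeq_add_left, lieSeq_add_right, triForm_add₁, triForm_add₂,
      triForm_add₃, derivSeq_add, Pi.add_apply]
    ring
  · intro F G
    simp only [cocycleForm, actForm, lieSeq_smul_left, lieSeq_smul_right, triForm_smul₁,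
      triForm_smul₂, triForm_smul₃, derivSeq_smul, Pi.smul_apply, smul_eq_mul]
    ring
  · intro F hF
    simp only [cocycleForm, actForm, triForm_zero₁ (z hF), triForm_zero₁ (zd hF),
      triForm_zero₁ (lieSeq_eq_zero_right hF), triForm_zero₂ (lieSeq_eq_zero_left hF),
      triForm_zero₃ (lieSeq_eq_zero_left hF), hF 0 (by omega), hF 1 (by omega)]
    ring
  intro s
  refine eq_zero_of_single (Q := fun f => cocycleForm (K + 1) Γ l n m (Pi.single a 1)
    (Pi.single s 1) f g) (K + 2) ?_ ?_ ?_ ?_ f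
  · intro F G
    simp only [cocycleForm, actForm, lieSeq_add_right, triForm_add₂, derivSeq_add]
    ring
  · intro F G
    simp only [cocycleForm, actForm, lieSeq_smul_right, triForm_smul₂, derivSeq_smul]
    ring
  · intro F hF
    simp only [cocycleForm, actForm, triForm_zero₂ (z hF), triForm_zero₂ (zd hF),
      triForm_zero₂ (lieSeq_eq_zero_right hF)]
    ring
  intro i
  refine eq_zero_of_single (Q := fun g => cocycleForm (K + 1) Γ l n m (Pi.single a 1)
    (Pi.single s 1) (Pi.single i 1) g) (K + 2) ?_ ?_ ?_ (single a s i) g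
  · intro F G
    simp only [cocycleForm, actForm, lieSeq_add_right, triForm_add₃, derivSeq_add]
    ring
  · intro F G
    simp only [cocycleForm, actForm, lieSeq_smul_right, triForm_smul₃, derivSeq_smul]
    ring
  · intro F hF
    simp only [cocycleForm, actForm, triForm_zero₃ (z hF), triForm_zero₃ (zd hF),
      triForm_zero₃ (lieSeq_eq_zero_right hF)]
    ring

/-! ### Invariance under the change of chart -/

/-- `(2τ + m) (2τ + m + 1) ⋯ (2τ + m + n - 1) / n!` -/
noncomputable def chartCoef (τ : ℝ) (n m : ℕ) : ℝ :=
  (∏ t ∈ Finset.range n, (2 * τ + m + t)) / n.factorial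

/-- The Taylor coefficients of `(1 + c u)^(-2τ) g (u / (1 + c u))` at `u = 0`. -/
noncomputable def chartSeq (τ : ℝ) (g : ℕ → ℝ) (c : ℝ) (i : ℕ) : ℝ :=
  ∑ t ∈ Finset.range (i + 1), (-c) ^ (i - t) * chartCoef τ (i - t) t * g t

/-- The dual action of `x² d/dx` on Taylor coefficients. -/
def lowerSeq (τ : ℝ) (F : ℕ → ℝ) : ℕ → ℝ
  | 0 => 0
  | i + 1 => (i + 2 * τ) * F i

theorem chartCoef_succ (τ : ℝ) (n m : ℕ) :
    ((n : ℝ) + 1) * chartCoef τ (n + 1) m = chartCoef τ n m * (2 * τ + m + n) := by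
  have h1 : (n.factorial : ℝ) ≠ 0 := by positivity
  have h2 : (n : ℝ) + 1 ≠ 0 := by positivity
  rw [chartCoef, chartCoef, Finset.prod_range_succ, Nat.factorial_succ]
  push_cast
  field_simp

/-- Here the first factor of the rising product is split off, whereas `chartCoef_succ` splits off
the last one; the recursion for `chartSeq` needs both. -/
theorem chartCoef_succ' (τ : ℝ) (n m : ℕ) :
    ((n : ℝ) + 1) * chartCoef τ (n + 1) m = chartCoef τ n (m + 1) * (2 * τ + m) := by
  have h1 : (n.factorial : ℝ) ≠ 0 := by positivity
  have h2 : (n : ℝ) + 1 ≠ 0 := by positivity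
  rw [chartCoef, chartCoef, Finset.prod_range_succ', Nat.factorial_succ]
  have : ∏ t ∈ Finset.range n, (2 * τ + m + ((t + 1 : ℕ) : ℝ)) =
      ∏ t ∈ Finset.range n, (2 * τ + ((m + 1 : ℕ) : ℝ) + t) :=
    Finset.prod_congr rfl fun t _ => by push_cast; ring
  rw [this]
  push_cast
  field_simp
  ring

/-- The maps u / (1 + c u) form a one-parameter group generated by a multiple of u² d/du, so the
transformed coefficients satisfy the corresponding linear flow equation in c. -/
theorem hasDerivAt_chartSeq (τ : ℝ) (g : ℕ → ℝ) (c : ℝ) (i : ℕ) :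
    HasDerivAt (fun c => chartSeq τ g c i) (-lowerSeq τ (chartSeq τ g c) i) c := by
  rcases i with _ | i
  · simpa [chartSeq, lowerSeq] using hasDerivAt_const c (chartCoef τ 0 0 * g 0)
  · have h : HasDerivAt (fun c => chartSeq τ g c (i + 1))
        ((∑ t ∈ Finset.range (i + 1), -(((i + 2 * τ) * ((-c) ^ (i - t) * chartCoef τ (i - t) t * g t))))
          + 0) c := by
      have e : (fun c => chartSeq τ g c (i + 1)) = fun c => (∑ t ∈ Finset.range (i + 1),
          (-c) ^ (i + 1 - t) * chartCoef τ (i + 1 - t) t * g t) + chartCoef τ 0 (i + 1) * g (i + 1) := by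
        funext c
        rw [chartSeq, Finset.sum_range_succ]
        simp
      rw [e]
      refine (HasDerivAt.fun_sum fun t ht => ?_).add (hasDerivAt_const _ _)
      obtain ⟨n, rfl⟩ := Nat.exists_eq_add_of_le (Nat.lt_succ_iff.1 (Finset.mem_range.1 ht))
      have e1 : t + n + 1 - t = n + 1 := by omega
      have e2 : t + n - t = n := by omega
      rw [e1, e2]
      have hd := ((((hasDerivAt_id c).fun_neg.fun_pow (n + 1)).mul_const
        (chartCoef τ (n + 1) t)).mul_const (g t))
      refine hd.congr_deriv ?_
      have := chartCoef_succ τ n t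
      simp only [id, Nat.add_sub_cancel]
      push_cast
      linear_combination (-(-c) ^ n * g t) * this
    refine h.congr_deriv ?_
    rw [add_zero, Finset.sum_neg_distrib, ← Finset.mul_sum, lowerSeq, chartSeq]

/-- A summation by parts; the boundary term at K + 1 is removed by `ha`. -/
theorem sum_shift {K : ℕ} {a b : ℕ → ℝ} (F : ℕ → ℝ) (τ : ℝ) (ha : a (K + 1) = 0)
    (hb : ∀ i, b i = (i + 2 * τ) * a (i + 1)) :
    ∑ i ∈ Finset.range (K + 1), a i * lowerSeq τ F i = ∑ i ∈ Finset.range (K + 1), b i * F i := by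
  rw [Finset.sum_range_succ', Finset.sum_range_succ (fun i => b i * F i), hb K, ha]
  simp only [lowerSeq, hb, mul_zero, zero_mul, add_zero]
  exact Finset.sum_congr rfl fun _ _ => by ring

/-- Transposing `lowerSeq` from the arguments to the coefficients turns the sum into the defining
relation of `invSymbol`, entry by entry. -/
theorem triForm_lower {σ l n : ℝ} {K : ℕ} {Γ : ℕ → ℕ → ℕ → ℝ} (hΓ : Γ ∈ invSymbol σ l n K)
    (F G H : ℕ → ℝ) : triForm (K + 1) Γ (lowerSeq σ F) G H + triForm (K + 1) Γ F (lowerSeq l G) H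
      + triForm (K + 1) Γ F G (lowerSeq n H) = 0 := by
  have e1 : triForm (K + 1) Γ (lowerSeq σ F) G H =
      triForm (K + 1) (fun r i j => (r + 2 * σ) * Γ (r + 1) i j) F G H := by
    have := sum_shift (K := K) (a := fun r => ∑ i ∈ Finset.range (K + 1),
      ∑ j ∈ Finset.range (K + 1), Γ r i j * G i * H j) (b := fun r => (r + 2 * σ) *
        ∑ i ∈ Finset.range (K + 1), ∑ j ∈ Finset.range (K + 1), Γ (r + 1) i j * G i * H j) F σ
      (Finset.sum_eq_zero fun i _ => Finset.sum_eq_zero fun j _ => by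
        rw [hΓ.1 _ _ _ (by omega)]; ring) (fun _ => rfl)
    simp only [triForm]
    simp only [Finset.mul_sum, Finset.sum_mul] at this
    refine Eq.trans ?_ (this.trans ?_) <;>
    exact Finset.sum_congr rfl fun _ _ => Finset.sum_congr rfl fun _ _ =>
      Finset.sum_congr rfl fun _ _ => by ring
  have e2 : triForm (K + 1) Γ F (lowerSeq l G) H =
      triForm (K + 1) (fun r i j => (i + 2 * l) * Γ r (i + 1) j) F G H := by
    simp only [triForm]
    refine Finset.sum_congr rfl fun r _ => ?_
    have := sum_shift (K := K) (a := fun i => ∑ j ∈ Finset.range (K + 1), Γ r i j * F r * H j)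
      (b := fun i => (i + 2 * l) * ∑ j ∈ Finset.range (K + 1), Γ r (i + 1) j * F r * H j) G l
      (Finset.sum_eq_zero fun j _ => by rw [hΓ.1 _ _ _ (by omega)]; ring) (fun _ => rfl)
    simp only [Finset.mul_sum, Finset.sum_mul] at this
    refine Eq.trans ?_ (this.trans ?_) <;>
    exact Finset.sum_congr rfl fun _ _ => Finset.sum_congr rfl fun _ _ => by ring
  have e3 : triForm (K + 1) Γ F G (lowerSeq n H) =
      triForm (K + 1) (fun r i j => (j + 2 * n) * Γ r i (j + 1)) F G H := by
    simp only [triForm]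
    refine Finset.sum_congr rfl fun r _ => Finset.sum_congr rfl fun i _ => ?_
    have := sum_shift (K := K) (a := fun j => Γ r i j * F r * G i)
      (b := fun j => (j + 2 * n) * (Γ r i (j + 1) * F r * G i)) H n
      (by rw [hΓ.1 _ _ _ (by omega)]; ring) (fun _ => rfl)
    refine Eq.trans ?_ (this.trans ?_) <;>
    exact Finset.sum_congr rfl fun _ _ => by ring
  rw [e1, e2, e3]
  simp only [triForm, ← Finset.sum_add_distrib]
  refine Finset.sum_eq_zero fun r _ => Finset.sum_eq_zero fun i _ => Finset.sum_eq_zero fun j _ => ?_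
  linear_combination (F r * G i * H j) * hΓ.2 r i j

theorem hasDerivAt_triForm {N : ℕ} (Γ : ℕ → ℕ → ℕ → ℝ) {F G H : ℝ → ℕ → ℝ} {F' G' H' : ℕ → ℝ}
    {c : ℝ} (hF : ∀ r, HasDerivAt (fun c => F c r) (F' r) c)
    (hG : ∀ r, HasDerivAt (fun c => G c r) (G' r) c)
    (hH : ∀ r, HasDerivAt (fun c => H c r) (H' r) c) :
    HasDerivAt (fun c => triForm N Γ (F c) (G c) (H c))
      (triForm N Γ F' (G c) (H c) + triForm N Γ (F c) G' (H c) + triForm N Γ (F c) (G c) H') c := by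
  have h : HasDerivAt (fun c => triForm N Γ (F c) (G c) (H c)) (∑ r ∈ Finset.range N,
      ∑ i ∈ Finset.range N, ∑ j ∈ Finset.range N, ((Γ r i j * F' r * G c i + Γ r i j * F c r * G' i)
        * H c j + Γ r i j * F c r * G c i * H' j)) c :=
    HasDerivAt.fun_sum fun r _ => HasDerivAt.fun_sum fun i _ => HasDerivAt.fun_sum fun j _ =>
      (((hF r).const_mul (Γ r i j)).fun_mul (hG i)).fun_mul (hH j)
  refine h.congr_deriv ?_
  simp only [triForm, ← Finset.sum_add_distrib]
  exact Finset.sum_congr rfl fun _ _ => Finset.sum_congr rfl fun _ _ =>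
    Finset.sum_congr rfl fun _ _ => by ring

theorem chartSeq_zero (τ : ℝ) (g : ℕ → ℝ) : chartSeq τ g 0 = g := by
  funext i
  rw [chartSeq, Finset.sum_eq_single i]
  · simp [chartCoef]
  · intro t ht hti
    have := Finset.mem_range.1 ht
    rw [neg_zero, zero_pow (by omega)]; ring
  · intro h
    exact absurd (Finset.mem_range.2 (Nat.lt_succ_self i)) h

/-- The derivative in c is the infinitesimal invariance `triForm_lower`, hence zero; and at c = 0
the transformation is the identity. -/
theorem triForm_chartSeq {σ l n : ℝ} {K : ℕ} {Γ : ℕ → ℕ → ℕ → ℝ} (hΓ : Γ ∈ invSymbol σ l n K)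
    (F G H : ℕ → ℝ) (c : ℝ) : triForm (K + 1) Γ (chartSeq σ F c) (chartSeq l G c) (chartSeq n H c)
      = triForm (K + 1) Γ F G H := by
  have hd : ∀ c, HasDerivAt (fun c => triForm (K + 1) Γ (chartSeq σ F c) (chartSeq l G c)
      (chartSeq n H c)) 0 c := by
    intro c
    refine (hasDerivAt_triForm Γ (hasDerivAt_chartSeq σ F c) (hasDerivAt_chartSeq l G c)
      (hasDerivAt_chartSeq n H c)).congr_deriv ?_
    have e : ∀ τ (F : ℕ → ℝ), (fun r => -lowerSeq τ F r) = (-1 : ℝ) • lowerSeq τ F := by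
      intro τ F; funext r; simp
    rw [e, e, e, triForm_smul₁, triForm_smul₂, triForm_smul₃]
    linear_combination (-1 : ℝ) * triForm_lower hΓ (chartSeq σ F c) (chartSeq l G c) (chartSeq n H c)
  have := is_const_of_deriv_eq_zero (fun c => (hd c).differentiableAt) (fun c => (hd c).deriv) c 0
  simpa only [chartSeq_zero] using this

/-- This is the algebra behind the step from order i to i + 1 when the transition formula is
differentiated: one sum comes from differentiating the factors, the other from differentiating g. -/
theorem chartSeq_recursion (τ : ℝ) (g : ℕ → ℝ) (x : ℝ) (i : ℕ) :
    ((i : ℝ) + 1) * chartSeq τ g x (i + 1) =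
      (∑ t ∈ Finset.range (i + 1),
        (-x) ^ (i + 1 - t) * (chartCoef τ (i - t) t * (2 * τ + i + t)) * g t)
      + ∑ t ∈ Finset.range (i + 1),
        (-x) ^ (i - t) * chartCoef τ (i - t) t * (((t + 1 : ℕ) : ℝ) * g (t + 1)) := by
  -- The second sum is reindexed so that both involve g t; the truncated t - 1 at t = 0 is harmless
  -- because of the factor t.
  set w : ℕ → ℝ := fun t => (-x) ^ (i + 1 - t) * chartCoef τ (i + 1 - t) (t - 1) * (t * g t) with hw
  have h1 : ∑ t ∈ Finset.range (i + 1),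
        (-x) ^ (i - t) * chartCoef τ (i - t) t * (((t + 1 : ℕ) : ℝ) * g (t + 1)) =
      ∑ t ∈ Finset.range (i + 2), w t := by
    rw [Finset.sum_range_succ' w (i + 1)]
    simp only [hw, Nat.cast_zero, zero_mul, mul_zero, add_zero, Nat.add_sub_add_right,
      Nat.add_sub_cancel]
  rw [h1, Finset.sum_range_succ w, chartSeq, Finset.mul_sum, Finset.sum_range_succ, ← add_assoc,
    ← Finset.sum_add_distrib]
  congr 1
  · refine Finset.sum_congr rfl fun t ht => ?_
    obtain ⟨n, rfl⟩ := Nat.exists_eq_add_of_le (Nat.lt_succ_iff.1 (Finset.mem_range.1 ht))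
    have e1 : t + n + 1 - t = n + 1 := by omega
    have e2 : t + n - t = n := by omega
    simp only [hw, e1, e2]
    have h2 : (n : ℝ) + 1 ≠ 0 := by positivity
    have c1 := chartCoef_succ τ n t
    rcases t with _ | t
    · push_cast at c1 ⊢
      linear_combination ((-x) ^ (n + 1) * g 0) * c1
    · have c2 := chartCoef_succ' τ n t
      simp only [Nat.add_sub_cancel]
      refine mul_left_cancel₀ h2 ?_
      push_cast at c1 c2 ⊢
      linear_combination ((-x) ^ (n + 1) * g (t + 1)) * ((n + t + 2) * c1 - (t + 1) * c2)
  · simp [hw, chartCoef]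

/-- Taylor coefficients of a density in the two charts. -/
theorem taylorCoef_transition {τ : ℝ} {f g : ℝ → ℝ} (hf : ContDiff ℝ ∞ f) (hg : ContDiff ℝ ∞ g)
    (hfg : ∀ x : ℝ, x ≠ 0 → f x = ((x ^ 2)⁻¹) ^ τ * g (-x⁻¹)) (i : ℕ) (x : ℝ) (hx : x ≠ 0) :
    taylorCoef f x i =
      ((x ^ 2)⁻¹) ^ τ * (((x ^ 2)⁻¹) ^ i * chartSeq τ (taylorCoef g (-x⁻¹)) x i) := by
  induction i generalizing x with
  | zero => simp [chartSeq, chartCoef, taylorCoef_zero, hfg x hx]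
  | succ i ih =>
    have hy : HasDerivAt (fun x : ℝ => -x⁻¹) ((x ^ 2)⁻¹) x := by
      simpa using (hasDerivAt_inv hx).fun_neg
    have hpos : 0 < (x ^ 2)⁻¹ := by positivity
    have hu : HasDerivAt (fun x : ℝ => ((x ^ 2)⁻¹ : ℝ)) (-(2 * x) / (x ^ 2) ^ 2) x := by
      simpa using (hasDerivAt_pow 2 x).fun_inv (pow_ne_zero 2 hx)
    have hJ := hu.rpow_const (p := τ) (Or.inl hpos.ne')
    have hpow : ((x ^ 2)⁻¹) ^ (τ - 1) = ((x ^ 2)⁻¹) ^ τ * x ^ 2 := by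
      rw [Real.rpow_sub_one hpos.ne', div_inv_eq_mul]
    have hB := hu.fun_pow i
    have hg' : ∀ t, HasDerivAt (fun x => taylorCoef g (-x⁻¹) t)
        (derivSeq (taylorCoef g (-x⁻¹)) t * (x ^ 2)⁻¹) x := fun t =>
      HasDerivAt.comp (h₂ := fun y => taylorCoef g y t) x (hasDerivAt_taylorCoef hg (-x⁻¹) t) hy
    have hS : HasDerivAt (fun x => chartSeq τ (taylorCoef g (-x⁻¹)) x i)
        (∑ t ∈ Finset.range (i + 1), ((((i - t : ℕ) : ℝ) * (-x) ^ (i - t - 1) * (-1) *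
          chartCoef τ (i - t) t) * taylorCoef g (-x⁻¹) t + (-x) ^ (i - t) * chartCoef τ (i - t) t *
            (derivSeq (taylorCoef g (-x⁻¹)) t * (x ^ 2)⁻¹))) x := by
      refine HasDerivAt.fun_sum fun t _ => ?_
      exact (((hasDerivAt_id x).fun_neg.fun_pow (i - t)).mul_const (chartCoef τ (i - t) t)).fun_mul
        (hg' t)
    have hR := hJ.fun_mul (hB.fun_mul hS)
    have hne : ∀ᶠ z in nhds x, z ≠ 0 := isOpen_ne.mem_nhds hx
    have hL := (hasDerivAt_taylorCoef hf x i).congr_of_eventuallyEq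
      (hne.mono fun z hz => (ih z hz).symm)
    -- The derivative of the i-th coefficient is i + 1 times the next one; comparison with the
    -- derivative of the transition formula gives the inductive step.
    have e := hL.unique hR
    rw [hpow, derivSeq] at e
    have hsum : x ^ 2 * (∑ t ∈ Finset.range (i + 1), ((((i - t : ℕ) : ℝ) * (-x) ^ (i - t - 1) * (-1) *
          chartCoef τ (i - t) t) * taylorCoef g (-x⁻¹) t + (-x) ^ (i - t) * chartCoef τ (i - t) t *
            (derivSeq (taylorCoef g (-x⁻¹)) t * (x ^ 2)⁻¹))) =
        2 * (τ + i) * x * chartSeq τ (taylorCoef g (-x⁻¹)) x i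
          + ((i : ℝ) + 1) * chartSeq τ (taylorCoef g (-x⁻¹)) x (i + 1) := by
      rw [chartSeq_recursion, chartSeq, Finset.mul_sum, Finset.mul_sum, ← add_assoc,
        ← Finset.sum_add_distrib, ← Finset.sum_add_distrib]
      refine Finset.sum_congr rfl fun t ht => ?_
      obtain ⟨n, rfl⟩ := Nat.exists_eq_add_of_le (Nat.lt_succ_iff.1 (Finset.mem_range.1 ht))
      have e1 : t + n + 1 - t = n + 1 := by omega
      have e2 : t + n - t = n := by omega
      rw [e1, e2, derivSeq]
      have e3 : x ^ 2 * ((n : ℝ) * (-x) ^ (n - 1) * (-1)) = n * x * (-x) ^ n := by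
        rcases n with _ | n
        · simp
        · rw [Nat.add_sub_cancel]; ring
      have e4 : x ^ 2 * (x ^ 2)⁻¹ = 1 := mul_inv_cancel₀ (pow_ne_zero 2 hx)
      push_cast
      linear_combination (chartCoef τ n t * taylorCoef g (-x⁻¹) t) * e3 +
        ((-x) ^ n * chartCoef τ n t * ((t + 1) * taylorCoef g (-x⁻¹) (t + 1))) * e4
    set S' := (∑ t ∈ Finset.range (i + 1), ((((i - t : ℕ) : ℝ) * (-x) ^ (i - t - 1) * (-1) *
          chartCoef τ (i - t) t) * taylorCoef g (-x⁻¹) t + (-x) ^ (i - t) * chartCoef τ (i - t) t *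
            (derivSeq (taylorCoef g (-x⁻¹)) t * (x ^ 2)⁻¹))) with hS'
    have hS2 : S' = (x ^ 2)⁻¹ * (2 * (τ + i) * x * chartSeq τ (taylorCoef g (-x⁻¹)) x i
          + ((i : ℝ) + 1) * chartSeq τ (taylorCoef g (-x⁻¹)) x (i + 1)) := by
      rw [← hsum]; field_simp
    rw [hS2] at e
    have h2 : (i : ℝ) + 1 ≠ 0 := by positivity
    refine mul_left_cancel₀ h2 ?_
    push_cast at e
    rw [e]
    have hBi : (i : ℝ) * ((x ^ 2)⁻¹) ^ (i - 1) * (-(2 * x) / (x ^ 2) ^ 2) =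
        -2 * i * x * (x ^ 2)⁻¹ * ((x ^ 2)⁻¹) ^ i := by
      rcases i with _ | i
      · simp
      · rw [Nat.add_sub_cancel, pow_succ _ i, show -(2 * x) / (x ^ 2) ^ 2 =
          -2 * x * ((x ^ 2)⁻¹ * (x ^ 2)⁻¹) by field_simp]
        ring
    rw [hBi, pow_succ _ i]
    have e5 : -(2 * x) / (x ^ 2) ^ 2 * x ^ 2 = -2 * x * (x ^ 2)⁻¹ := by field_simp
    linear_combination (τ * ((x ^ 2)⁻¹) ^ τ * (((x ^ 2)⁻¹) ^ i *
      chartSeq τ (taylorCoef g (-x⁻¹)) x i)) * e5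

/-- Homogeneity: the scaling acts by u^(r + i + j), and only r + i + j = K contributes. -/
theorem triForm_pow {Γ : ℕ → ℕ → ℕ → ℝ} {N K : ℕ} (hΓ : ∀ r i j, r + i + j ≠ K → Γ r i j = 0)
    (u : ℝ) (F G H : ℕ → ℝ) :
    triForm N Γ (fun r => u ^ r * F r) (fun r => u ^ r * G r) (fun r => u ^ r * H r) =
      u ^ K * triForm N Γ F G H := by
  simp only [triForm, Finset.mul_sum]
  refine Finset.sum_congr rfl fun r _ => Finset.sum_congr rfl fun i _ =>
    Finset.sum_congr rfl fun j _ => ?_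
  by_cases h : r + i + j = K
  · rw [← h, pow_add, pow_add]; ring
  · rw [hΓ r i j h]; ring

/-- A trilinear expression with invariant symbol is compatible with the change of chart. -/
theorem triForm_transition {σ l n m : ℝ} {K : ℕ} (hm : m = σ + l + n + K)
    {Γ : ℕ → ℕ → ℕ → ℝ} (hΓ : Γ ∈ invSymbol σ l n K) (f : Density σ) (φ : Density l)
    (ψ : Density n) (x : ℝ) (hx : x ≠ 0) :
    triForm (K + 1) Γ (taylorCoef f.comp.1 x) (taylorCoef φ.comp.1 x) (taylorCoef ψ.comp.1 x) =
      ((x ^ 2)⁻¹) ^ m * triForm (K + 1) Γ (taylorCoef f.comp.2 (-x⁻¹))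
        (taylorCoef φ.comp.2 (-x⁻¹)) (taylorCoef ψ.comp.2 (-x⁻¹)) := by
  have hpos : 0 < (x ^ 2)⁻¹ := by positivity
  -- The chart change is a scalar, a scaling by x⁻² and the flow `chartSeq`. The scalars contribute
  -- σ + l + n, the scaling contributes K, and invariance removes the flow.
  have e : ∀ {τ : ℝ} (f : Density τ), taylorCoef f.comp.1 x = (((x ^ 2)⁻¹) ^ τ) •
      fun i => ((x ^ 2)⁻¹) ^ i * chartSeq τ (taylorCoef f.comp.2 (-x⁻¹)) x i := fun f => by
    funext i
    exact taylorCoef_transition (density_smooth f).1 (density_smooth f).2 f.2.2.2 i x hx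
  rw [e f, e φ, e ψ, triForm_smul₁, triForm_smul₂, triForm_smul₃, triForm_pow hΓ.1,
    triForm_chartSeq hΓ, hm, Real.rpow_add hpos, Real.rpow_add hpos, Real.rpow_add hpos,
    Real.rpow_natCast]
  ring

theorem contDiff_triForm {N : ℕ} (Γ : ℕ → ℕ → ℕ → ℝ) {f g h : ℝ → ℝ} (hf : ContDiff ℝ ∞ f)
    (hg : ContDiff ℝ ∞ g) (hh : ContDiff ℝ ∞ h) :
    ContDiff ℝ ∞ fun x => triForm N Γ (taylorCoef f x) (taylorCoef g x) (taylorCoef h x) :=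
  ContDiff.sum fun r _ => ContDiff.sum fun i _ => ContDiff.sum fun j _ =>
    ((contDiff_const.mul (contDiff_taylorCoef hf r)).mul (contDiff_taylorCoef hg i)).mul
      (contDiff_taylorCoef hh j)

/-- The density obtained from an invariant symbol. -/
noncomputable def triDensity {σ l n m : ℝ} {K : ℕ} (hm : m = σ + l + n + K)
    {Γ : ℕ → ℕ → ℕ → ℝ} (hΓ : Γ ∈ invSymbol σ l n K) (f : Density σ) (φ : Density l)
    (ψ : Density n) : Density m :=
  Subtype.mk (fun x => triForm (K + 1) Γ (taylorCoef f.comp.1 x) (taylorCoef φ.comp.1 x)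
      (taylorCoef ψ.comp.1 x), fun x => triForm (K + 1) Γ (taylorCoef f.comp.2 x)
      (taylorCoef φ.comp.2 x) (taylorCoef ψ.comp.2 x))
    ⟨contDiff_triForm Γ (density_smooth f).1 (density_smooth φ).1 (density_smooth ψ).1,
      contDiff_triForm Γ (density_smooth f).2 (density_smooth φ).2 (density_smooth ψ).2,
      triForm_transition hm hΓ f φ ψ⟩

theorem isExpr_triForm (N : ℕ) (Γ : ℕ → ℕ → ℕ → ℝ) {f : ℝ → ℝ} (hf : ContDiff ℝ ∞ f) :
    IsExpr fun g h x => triForm N Γ (taylorCoef f x) (taylorCoef g x) (taylorCoef h x) := by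
  refine IsExpr.sum _ fun r _ => IsExpr.sum _ fun i _ => IsExpr.sum _ fun j _ => ?_
  refine (IsExpr.mono (c := fun x => Γ r i j * taylorCoef f x r / i.factorial / j.factorial)
    (((contDiff_const.mul (contDiff_taylorCoef hf r)).div_const _).div_const _) i j).congr
    fun g h _ _ x => ?_
  simp only [taylorCoef]
  ring

/-- The bilinear differential operator obtained from an invariant symbol and a density. -/
noncomputable def triOp {σ l n m : ℝ} {K : ℕ} (hm : m = σ + l + n + K)
    {Γ : ℕ → ℕ → ℕ → ℝ} (hΓ : Γ ∈ invSymbol σ l n K) (f : Density σ) : BidiffOp l n m where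
  val := LinearMap.mk₂ ℝ (triDensity hm hΓ f)
    (fun φ φ' _ => Density.ext
      (funext fun x => (congrArg (fun u => triForm _ Γ _ u _)
        (taylorCoef_add (density_smooth φ).1 (density_smooth φ').1 x)).trans (triForm_add₂ ..))
      (funext fun x => (congrArg (fun u => triForm _ Γ _ u _)
        (taylorCoef_add (density_smooth φ).2 (density_smooth φ').2 x)).trans (triForm_add₂ ..)))
    (fun c φ _ => Density.ext
      (funext fun x => (congrArg (fun u => triForm _ Γ _ u _)
        (taylorCoef_smul c φ.comp.1 x)).trans (triForm_smul₂ ..))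
      (funext fun x => (congrArg (fun u => triForm _ Γ _ u _)
        (taylorCoef_smul c φ.comp.2 x)).trans (triForm_smul₂ ..)))
    (fun _ ψ ψ' => Density.ext
      (funext fun x => (congrArg (fun u => triForm _ Γ _ _ u)
        (taylorCoef_add (density_smooth ψ).1 (density_smooth ψ').1 x)).trans (triForm_add₃ ..))
      (funext fun x => (congrArg (fun u => triForm _ Γ _ _ u)
        (taylorCoef_add (density_smooth ψ).2 (density_smooth ψ').2 x)).trans (triForm_add₃ ..)))
    (fun c _ ψ => Density.ext
      (funext fun x => (congrArg (fun u => triForm _ Γ _ _ u)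
        (taylorCoef_smul c ψ.comp.1 x)).trans (triForm_smul₃ ..))
      (funext fun x => (congrArg (fun u => triForm _ Γ _ _ u)
        (taylorCoef_smul c ψ.comp.2 x)).trans (triForm_smul₃ ..)))
  property := (isBidiffOp_iff _).2 ⟨_, _, isExpr_triForm (K + 1) Γ (density_smooth f).1,
    isExpr_triForm (K + 1) Γ (density_smooth f).2, fun _ _ => ⟨rfl, rfl⟩⟩

/-! ### Sections with prescribed germs -/

/-- Every smooth function with compact support in the chart `x` is a density. -/
theorem Density.exists_of_hasCompactSupport (τ : ℝ) {f : ℝ → ℝ} (hf : ContDiff ℝ ∞ f)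
    (hc : HasCompactSupport f) : ∃ φ : Density τ, φ.comp.1 = f := by
  refine ⟨Subtype.mk (f, fun y => if y = 0 then 0 else ((y ^ 2)⁻¹) ^ τ * f (-y⁻¹))
    ⟨hf, ?_, fun x hx => ?_⟩, rfl⟩
  · rw [contDiff_iff_contDiffAt]
    intro y
    by_cases hy : y = 0
    · subst hy
      -- The punctured neighbourhood |y| < 1 / (|R| + 1) corresponds to |x| > |R| + 1, which lies
      -- off the support, so the second component vanishes near y = 0.
      obtain ⟨R, hR⟩ := hc.isCompact.isBounded.subset_closedBall 0
      have h0 : ∀ᶠ y : ℝ in nhds 0, |y| < (|R| + 1)⁻¹ := by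
        have := Metric.ball_mem_nhds (0 : ℝ) (ε := (|R| + 1)⁻¹) (by positivity)
        filter_upwards [this] with y hy
        simpa [Metric.mem_ball, dist_zero_right] using hy
      refine (contDiffAt_const (c := (0 : ℝ))).congr_of_eventuallyEq ?_
      filter_upwards [h0] with y hy
      split_ifs with h
      · rfl
      · have : f (-y⁻¹) = 0 := by
          by_contra hne
          have h1 := hR (subset_tsupport f hne)
          rw [Metric.mem_closedBall, dist_zero_right, norm_neg, norm_inv, Real.norm_eq_abs] at h1
          have h2 : |R| + 1 < |y|⁻¹ := by
            rwa [lt_inv_comm₀ (by positivity) (abs_pos.2 h)]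
          linarith [le_abs_self R]
        rw [this, mul_zero]
    · have h1 : ContDiffAt ℝ ∞ (fun y : ℝ => ((y ^ 2)⁻¹) ^ τ * f (-y⁻¹)) y := by
        have h2 : ContDiffAt ℝ ∞ (fun y : ℝ => (y ^ 2)⁻¹) y :=
          (contDiffAt_id.pow 2).inv (pow_ne_zero 2 hy)
        have h3 : ((y ^ 2)⁻¹ : ℝ) ≠ 0 := inv_ne_zero (pow_ne_zero 2 hy)
        exact (h2.rpow_const_of_ne h3).mul (hf.contDiffAt.comp y (contDiffAt_id.inv hy).neg)
      refine h1.congr_of_eventuallyEq ?_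
      filter_upwards [isOpen_ne.mem_nhds hy] with z hz
      rw [if_neg hz]
  · have hx' : -x⁻¹ ≠ 0 := neg_ne_zero.2 (inv_ne_zero hx)
    simp only [if_neg hx']
    have e1 : -(-x⁻¹)⁻¹ = x := by rw [inv_neg, neg_neg, inv_inv]
    have e2 : ((-x⁻¹) ^ 2)⁻¹ = x ^ 2 := by rw [neg_sq, inv_pow, inv_inv]
    rw [e1, e2, ← mul_assoc, ← Real.mul_rpow (by positivity) (by positivity),
      inv_mul_cancel₀ (pow_ne_zero 2 hx), Real.one_rpow, one_mul]

/-- Every germ of a smooth function is the germ of a density. -/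
theorem Density.exists_germ (τ p : ℝ) {g : ℝ → ℝ} (hg : ContDiff ℝ ∞ g) :
    ∃ φ : Density τ, φ.comp.1 =ᶠ[nhds p] g := by
  let χ : ContDiffBump p := ⟨1, 2, one_pos, one_lt_two⟩
  obtain ⟨φ, hφ⟩ := Density.exists_of_hasCompactSupport τ (f := fun x => χ x * g x)
    (χ.contDiff.mul hg) χ.hasCompactSupport.mul_right
  refine ⟨φ, ?_⟩
  rw [hφ]
  filter_upwards [χ.eventuallyEq_one] with x hx
  rw [hx, Pi.one_apply, one_mul]

/-- A density equal to `(x - p)^i` near `p`. -/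
noncomputable def Density.mono (τ p : ℝ) (i : ℕ) : Density τ :=
  (Density.exists_germ τ p (g := fun x => (x - p) ^ i) (by fun_prop)).choose

theorem Density.mono_germ (τ p : ℝ) (i : ℕ) :
    (Density.mono τ p i).comp.1 =ᶠ[nhds p] fun x => (x - p) ^ i :=
  (Density.exists_germ τ p (g := fun x => (x - p) ^ i) (by fun_prop)).choose_spec

theorem taylorCoef_mono (τ p : ℝ) (i : ℕ) :
    taylorCoef (Density.mono τ p i).comp.1 p = Pi.single i 1 := by
  rw [taylorCoef_congr (Density.mono_germ τ p i), taylorCoef_pow]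

/-- Vector fields are densities of weight `-1`. -/
def vectEquiv : VectRP1 ≃ₗ[ℝ] Density (-1) where
  toFun X := Subtype.mk X.comp ⟨X.2.1, X.2.2.1, fun x hx => by
    rw [Real.rpow_neg_one, inv_inv]; exact X.2.2.2 x hx⟩
  invFun f := Subtype.mk f.comp ⟨f.2.1, f.2.2.1, fun x hx => by
    have := f.2.2.2 x hx
    rw [Real.rpow_neg_one, inv_inv] at this
    exact this⟩
  map_add' _ _ := rfl
  map_smul' _ _ := rfl
  left_inv _ := rfl
  right_inv _ := rfl

theorem vectEquiv_comp (X : VectRP1) : (vectEquiv X).comp = X.comp := rfl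

theorem vectEquiv_symm_comp (f : Density (-1)) : (vectEquiv.symm f).comp = f.comp := rfl

theorem vectEquiv_lie (X Y : VectRP1) : vectEquiv ⁅X, Y⁆ = ⁅X, vectEquiv Y⁆ := rfl

/-- Exchange of the two charts. -/
def VectRP1.swap (X : VectRP1) : VectRP1 :=
  Subtype.mk (X.comp.2, X.comp.1) ⟨X.2.2.1, X.2.1, fun x hx => by
    have := X.2.2.2 (-x⁻¹) (neg_ne_zero.2 (inv_ne_zero hx))
    have e1 : -(-x⁻¹)⁻¹ = x := by rw [inv_neg, neg_neg, inv_inv]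
    rw [e1] at this
    show X.comp.2 x = x ^ 2 * X.comp.1 (-x⁻¹)
    rw [show X.comp.1 (-x⁻¹) = _ from this, neg_sq, inv_pow, mul_inv_cancel_left₀ (pow_ne_zero 2 hx)]
    rfl⟩

theorem VectRP1.exists_fst {f : ℝ → ℝ} (hf : ContDiff ℝ ∞ f) (hc : HasCompactSupport f) :
    ∃ X : VectRP1, X.comp.1 = f :=
  let ⟨φ, hφ⟩ := Density.exists_of_hasCompactSupport (-1) hf hc
  ⟨vectEquiv.symm φ, hφ⟩

theorem VectRP1.exists_snd {f : ℝ → ℝ} (hf : ContDiff ℝ ∞ f) (hc : HasCompactSupport f) :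
    ∃ X : VectRP1, X.comp.2 = f :=
  let ⟨X, hX⟩ := VectRP1.exists_fst hf hc
  ⟨X.swap, hX⟩

/-- The chart x misses a single point, so its component determines the other one on a dense set,
hence everywhere by continuity. -/
theorem VectRP1.ext_fst {X Y : VectRP1} (h : X.comp.1 = Y.comp.1) : X = Y := by
  refine VectRP1.ext h ?_
  have hne : ∀ y : ℝ, y ≠ 0 → X.comp.2 y = Y.comp.2 y := fun y hy => by
    have hX := X.swap.2.2.2 y hy
    have hY := Y.swap.2.2.2 y hy
    exact hX.trans ((congrArg (fun u : ℝ → ℝ => y ^ 2 * u (-y⁻¹)) h).trans hY.symm)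
  exact Continuous.ext_on (dense_compl_singleton (0 : ℝ)) (vect_smooth X).2.continuous
    (vect_smooth Y).2.continuous fun y hy => hne y hy

theorem VectRP1.ext_snd {X Y : VectRP1} (h : X.comp.2 = Y.comp.2) : X = Y := by
  have : X.swap = Y.swap := VectRP1.ext_fst h
  exact VectRP1.ext (congrArg (fun Z : VectRP1 => Z.comp.2) this) h

theorem Density.ext_fst {τ : ℝ} {φ ψ : Density τ} (h : φ.comp.1 = ψ.comp.1) : φ = ψ := by
  refine Density.ext h ?_
  have hne : ∀ y : ℝ, y ≠ 0 → φ.comp.2 y = ψ.comp.2 y := fun y hy => by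
    have hy' : -y⁻¹ ≠ 0 := neg_ne_zero.2 (inv_ne_zero hy)
    have e1 : -(-y⁻¹)⁻¹ = y := by rw [inv_neg, neg_neg, inv_inv]
    have h1 : φ.comp.1 (-y⁻¹) = (((-y⁻¹) ^ 2)⁻¹) ^ τ * φ.comp.2 (-(-y⁻¹)⁻¹) := φ.2.2.2 _ hy'
    have h2 : ψ.comp.1 (-y⁻¹) = (((-y⁻¹) ^ 2)⁻¹) ^ τ * ψ.comp.2 (-(-y⁻¹)⁻¹) := ψ.2.2.2 _ hy'
    rw [h, h2, e1] at h1
    exact (mul_left_cancel₀ (Real.rpow_pos_of_pos (by positivity) τ).ne' h1).symm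
  exact Continuous.ext_on (dense_compl_singleton (0 : ℝ)) (density_smooth φ).2.continuous
    (density_smooth ψ).2.continuous fun y hy => hne y hy

/-! ### Inverting the Euler operator -/

/-- The derivative is an integral of the same shape, with a + 1 and f' in place of a and f; this
makes smoothness provable by induction. -/
theorem hasDerivAt_integral_rpow_mul {a : ℝ} (ha : 0 ≤ a) {f : ℝ → ℝ} (hf : ContDiff ℝ ∞ f)
    (x : ℝ) : HasDerivAt (fun x => ∫ s in (0 : ℝ)..1, s ^ a * f (s * x))
      (∫ s in (0 : ℝ)..1, s ^ (a + 1) * deriv f (s * x)) x := by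
  have ca : Continuous fun s : ℝ => s ^ a := Real.continuous_rpow_const ha
  have ca' : Continuous fun s : ℝ => s ^ (a + 1) := Real.continuous_rpow_const (by linarith)
  have cf := hf.continuous
  have cf' := (smooth_deriv hf).continuous
  have hcont : Continuous fun q : ℝ × ℝ => q.2 ^ (a + 1) * deriv f (q.2 * q.1) :=
    (ca'.comp continuous_snd).mul (cf'.comp (continuous_snd.mul continuous_fst))
  obtain ⟨C, hC⟩ := ((isCompact_closedBall x 1).prod (isCompact_Icc (a := (0 : ℝ)) (b := 1))
    ).exists_bound_of_continuousOn hcont.continuousOn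
  refine (intervalIntegral.hasDerivAt_integral_of_dominated_loc_of_deriv_le
    (F := fun x s => s ^ a * f (s * x)) (F' := fun x s => s ^ (a + 1) * deriv f (s * x))
    (bound := fun _ => C) (Metric.closedBall_mem_nhds x one_pos) ?_ ?_ ?_ ?_ ?_ ?_).2
  · exact Filter.Eventually.of_forall fun y =>
      (ca.mul (cf.comp (continuous_id.mul continuous_const))).aestronglyMeasurable
  · exact (ca.mul (cf.comp (continuous_id.mul continuous_const))).intervalIntegrable _ _
  · exact (ca'.mul (cf'.comp (continuous_id.mul continuous_const))).aestronglyMeasurable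
  · refine Filter.Eventually.of_forall fun t ht y hy => ?_
    rw [Set.uIoc_of_le zero_le_one] at ht
    exact hC (y, t) ⟨hy, ht.1.le, ht.2⟩
  · exact intervalIntegrable_const
  · refine Filter.Eventually.of_forall fun t ht y _ => ?_
    rw [Set.uIoc_of_le zero_le_one] at ht
    have h1 : HasDerivAt (fun y => f (t * y)) (deriv f (t * y) * t) y := by
      have := ((hasDerivAt_id y).const_mul t)
      rw [mul_one] at this
      exact (smooth_diffAt hf (t * y)).hasDerivAt.comp y this
    refine (h1.const_mul (t ^ a)).congr_deriv ?_
    rw [Real.rpow_add_one ht.1.ne']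
    ring

theorem contDiff_integral_rpow_mul {a : ℝ} (ha : 0 ≤ a) {f : ℝ → ℝ} (hf : ContDiff ℝ ∞ f) :
    ContDiff ℝ ∞ fun x => ∫ s in (0 : ℝ)..1, s ^ a * f (s * x) := by
  rw [contDiff_infty]
  intro n
  induction n generalizing a f with
  | zero =>
    exact contDiff_zero.2 (continuous_iff_continuousAt.2 fun x =>
      (hasDerivAt_integral_rpow_mul ha hf x).continuousAt)
  | succ n ih =>
    rw [Nat.cast_add, Nat.cast_one, contDiff_succ_iff_deriv]
    refine ⟨fun x => (hasDerivAt_integral_rpow_mul ha hf x).differentiableAt, by simp, ?_⟩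
    have : deriv (fun x => ∫ s in (0 : ℝ)..1, s ^ a * f (s * x)) =
        fun x => ∫ s in (0 : ℝ)..1, s ^ (a + 1) * deriv f (s * x) :=
      funext fun x => (hasDerivAt_integral_rpow_mul ha hf x).deriv
    rw [this]
    exact ih (by linarith) (smooth_deriv hf)

/-- The integral of s^a f(s x) over [0, 1] works: applying x d/dx + a + 1 turns the integrand into
the s-derivative of s^(a + 1) f(s x). -/
theorem exists_euler_zero {a : ℝ} (ha : 0 ≤ a) {f : ℝ → ℝ} (hf : ContDiff ℝ ∞ f) :
    ∃ g, ContDiff ℝ ∞ g ∧ ∀ x, x * deriv g x + (a + 1) * g x = f x := by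
  refine ⟨_, contDiff_integral_rpow_mul ha hf, fun x => ?_⟩
  rw [(hasDerivAt_integral_rpow_mul ha hf x).deriv, ← intervalIntegral.integral_const_mul,
    ← intervalIntegral.integral_const_mul]
  have ca : Continuous fun s : ℝ => s ^ a := Real.continuous_rpow_const ha
  have ca' : Continuous fun s : ℝ => s ^ (a + 1) := Real.continuous_rpow_const (by linarith)
  have cf := hf.continuous
  have cf' := (smooth_deriv hf).continuous
  have i1 : Continuous fun s : ℝ => x * (s ^ (a + 1) * deriv f (s * x)) :=
    continuous_const.mul (ca'.mul (cf'.comp (continuous_id.mul continuous_const)))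
  have i2 : Continuous fun s : ℝ => (a + 1) * (s ^ a * f (s * x)) :=
    continuous_const.mul (ca.mul (cf.comp (continuous_id.mul continuous_const)))
  rw [← intervalIntegral.integral_add (i1.intervalIntegrable _ _) (i2.intervalIntegrable _ _)]
  have h := intervalIntegral.integral_eq_sub_of_hasDerivAt (a := 0) (b := 1)
    (f := fun s : ℝ => s ^ (a + 1) * f (s * x))
    (f' := fun s => x * (s ^ (a + 1) * deriv f (s * x)) + (a + 1) * (s ^ a * f (s * x)))
    (fun s _ => by
      have h1 : HasDerivAt (fun s => f (s * x)) (deriv f (s * x) * x) s := by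
        have := ((hasDerivAt_id s).mul_const x)
        rw [one_mul] at this
        exact (smooth_diffAt hf (s * x)).hasDerivAt.comp s this
      have h2 := Real.hasDerivAt_rpow_const (x := s) (p := a + 1) (Or.inr (by linarith))
      refine (h2.fun_mul h1).congr_deriv ?_
      rw [add_sub_cancel_right]
      ring) ((i1.add i2).intervalIntegrable _ _)
  rw [h, Real.one_rpow, Real.zero_rpow (by linarith)]
  simp

/-- `x g' - r g = f` is solvable when `f` vanishes at `0` to an order larger than `r`. -/
theorem exists_euler (M : ℕ) {r : ℝ} (hr : r + 1 ≤ M) {f : ℝ → ℝ} (hf : ContDiff ℝ ∞ f)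
    (h0 : ∀ j < M, iteratedDeriv j f 0 = 0) :
    ∃ g, ContDiff ℝ ∞ g ∧ ∀ x, x * deriv g x - r * g x = f x := by
  induction M generalizing r f with
  | zero =>
    obtain ⟨g, hg, h⟩ := exists_euler_zero (a := -r - 1) (by push_cast at hr; linarith) hf
    exact ⟨g, hg, fun x => by rw [← h x]; ring⟩
  | succ M ih =>
    -- Differentiating x g' - r g = f gives the same equation for g' with r - 1 and f', so g is
    -- taken to be the primitive of h that vanishes at 0.
    obtain ⟨h, hh, e⟩ := ih (r := r - 1) (by push_cast at hr; linarith) (smooth_deriv hf)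
      (fun j hj => by rw [← iteratedDeriv_succ']; exact h0 (j + 1) (by omega))
    have hd : ∀ x, HasDerivAt (fun x => ∫ t in (0 : ℝ)..x, h t) (h x) x := fun x =>
      intervalIntegral.integral_hasDerivAt_right (hh.continuous.intervalIntegrable _ _)
        (hh.continuous.stronglyMeasurableAtFilter _ _) hh.continuous.continuousAt
    have hg : ContDiff ℝ ∞ fun x => ∫ t in (0 : ℝ)..x, h t := by
      rw [contDiff_infty_iff_deriv]
      exact ⟨fun x => (hd x).differentiableAt, by rw [funext fun x => (hd x).deriv]; exact hh⟩
    refine ⟨_, hg, fun x => ?_⟩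
    -- The defect of the equation has zero derivative, and it vanishes at 0 because f 0 = 0.
    have hc : ∀ x, HasDerivAt (fun x => x * h x - r * (∫ t in (0 : ℝ)..x, h t) - f x) 0 x := by
      intro x
      refine ((((hasDerivAt_id x).fun_mul (smooth_diffAt hh x).hasDerivAt).fun_sub
        ((hd x).const_mul r)).fun_sub (smooth_diffAt hf x).hasDerivAt).congr_deriv ?_
      simp only [id]
      linear_combination e x
    have := is_const_of_deriv_eq_zero (fun c => (hc c).differentiableAt) (fun c => (hc c).deriv) x 0
    have hf0 := h0 0 (by omega)
    rw [iteratedDeriv_zero] at hf0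
    rw [(hd x).deriv]
    simp only [hf0, zero_mul, intervalIntegral.integral_same, mul_zero, sub_self] at this
    linarith

theorem exists_euler_at (p : ℝ) (M : ℕ) {r : ℝ} (hr : r + 1 ≤ M) {f : ℝ → ℝ}
    (hf : ContDiff ℝ ∞ f) (h0 : ∀ j < M, taylorCoef f p j = 0) :
    ∃ g, ContDiff ℝ ∞ g ∧ ∀ x, (x - p) * deriv g x - r * g x = f x := by
  obtain ⟨g, hg, h⟩ := exists_euler M hr (f := fun x => f (x + p))
    (hf.comp (contDiff_id.add contDiff_const)) (fun j hj => by
      have h1 := h0 j hj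
      rw [taylorCoef, div_eq_zero_iff] at h1
      rw [iteratedDeriv_comp_add_const]
      simp only [zero_add]
      exact h1.resolve_right (by positivity))
  refine ⟨fun x => g (x - p), hg.comp (contDiff_id.sub contDiff_const), fun x => ?_⟩
  rw [deriv_comp_sub_const, h (x - p), sub_add_cancel]

/-! ### Local `sl(2)`-equivariant operators -/

theorem bidiffOp_congr {l n m : ℝ} (A : BidiffOp l n m) {φ φ' : Density l} {ψ ψ' : Density n}
    {p : ℝ} (hφ : φ.comp.1 =ᶠ[nhds p] φ'.comp.1) (hψ : ψ.comp.1 =ᶠ[nhds p] ψ'.comp.1) :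
    (A.1 φ ψ).comp.1 p = (A.1 φ' ψ').comp.1 p := by
  obtain ⟨N, a, b, -, -, h⟩ := A.2
  rw [(h φ ψ p).1, (h φ' ψ' p).1, bidiffExpr, bidiffExpr]
  simp only [hφ.iteratedDeriv_eq, hψ.iteratedDeriv_eq]

/-- The coefficients of a bidifferential expression are recovered by evaluating it on monomials
centred at the point. The order bound may depend on A; this is removed later by homogeneity. -/
theorem bidiffOp_expand {l n m : ℝ} (A : BidiffOp l n m) : ∃ N : ℕ, ∀ M, N ≤ M →
    ∀ (p : ℝ) (φ : Density l) (ψ : Density n), (A.1 φ ψ).comp.1 p =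
      ∑ i ∈ Finset.range (M + 1), ∑ j ∈ Finset.range (M + 1),
        (A.1 (Density.mono l p i) (Density.mono n p j)).comp.1 p *
          taylorCoef φ.comp.1 p i * taylorCoef ψ.comp.1 p j := by
  obtain ⟨N, a, b, -, -, h⟩ := A.2
  refine ⟨N, fun M hM p φ ψ => ?_⟩
  have key : ∀ (φ : Density l) (ψ : Density n), (A.1 φ ψ).comp.1 p =
      ∑ i ∈ Finset.range (M + 1), ∑ j ∈ Finset.range (M + 1),
        (if i ≤ N ∧ j ≤ N then a i j else 0) p * (i.factorial * taylorCoef φ.comp.1 p i) *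
          (j.factorial * taylorCoef ψ.comp.1 p j) := by
    intro φ ψ
    rw [(h φ ψ p).1, bidiffExpr_extend hM, bidiffExpr]
    refine Finset.sum_congr rfl fun i _ => Finset.sum_congr rfl fun j _ => ?_
    have h1 : (i.factorial : ℝ) ≠ 0 := by positivity
    have h2 : (j.factorial : ℝ) ≠ 0 := by positivity
    rw [taylorCoef, taylorCoef, mul_div_cancel₀ _ h1, mul_div_cancel₀ _ h2]
  rw [key φ ψ]
  refine Finset.sum_congr rfl fun i hi => Finset.sum_congr rfl fun j hj => ?_
  rw [key, taylorCoef_mono, taylorCoef_mono, Finset.sum_eq_single i, Finset.sum_eq_single j]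
  · rw [Pi.single_eq_same, Pi.single_eq_same]; ring
  · intro b _ hb
    rw [Pi.single_eq_of_ne hb]; ring
  · exact fun h => absurd hj h
  · intro b _ hb
    refine Finset.sum_eq_zero fun c _ => ?_
    rw [Pi.single_eq_of_ne hb]; ring
  · exact fun h => absurd hi h

/-- The field `(x - p) d/dx` in the chart `x`. -/
theorem projField_euler (p : ℝ) {τ : ℝ} (f : ℝ → ℝ) :
    lieDer τ (projField (-p) 1 0).comp.1 f = fun x => (x - p) * deriv f x + τ * f x := by
  funext x
  have : deriv (fun x : ℝ => -p + 1 * x + 0 * x ^ 2) x = 1 := by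
    have := (((hasDerivAt_id x).const_mul 1).const_add (-p)).add ((hasDerivAt_pow 2 x).const_mul 0)
    exact HasDerivAt.deriv (this.congr_deriv (by simp))
  rw [lieDer, projField_comp]
  simp only [this]
  ring

theorem projField_const {τ : ℝ} (f : ℝ → ℝ) :
    lieDer τ (projField 1 0 0).comp.1 f = deriv f := by
  funext x
  have : deriv (fun x : ℝ => 1 + 0 * x + 0 * x ^ 2) x = 0 := by simp
  rw [lieDer, projField_comp]
  simp only [this]
  ring

theorem euler_pow_germ {f : ℝ → ℝ} {p : ℝ} {i : ℕ} (h : f =ᶠ[nhds p] fun x => (x - p) ^ i) :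
    (fun x => (x - p) * deriv f x) =ᶠ[nhds p] fun x => (i : ℝ) * f x := by
  filter_upwards [h.deriv, h] with x h1 h2
  have : deriv (fun x : ℝ => (x - p) ^ i) x = i * (x - p) ^ (i - 1) := by
    simp
  rw [h1, h2, this]
  rcases i with _ | i
  · simp
  · rw [Nat.add_sub_cancel, pow_succ]; ring

section Structure

variable {σ l n m : ℝ} {T : Density σ →ₗ[ℝ] BidiffOp l n m}

/-- `T` is local in its first argument. -/
def IsLocalOp (T : Density σ →ₗ[ℝ] BidiffOp l n m) : Prop :=
  ∀ (f : Density σ) (p : ℝ), f.comp.1 =ᶠ[nhds p] 0 → ∀ φ ψ, ((T f).1 φ ψ).comp.1 p = 0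

/-- `T` commutes with `sl(2)`. -/
def IsEquivariantOp (T : Density σ →ₗ[ℝ] BidiffOp l n m) : Prop :=
  ∀ (a b c : ℝ) (f : Density σ), T ⁅projField a b c, f⁆ = ⁅projField a b c, T f⁆

theorem IsLocalOp.congr (hT : IsLocalOp T) {f f' : Density σ} {p : ℝ}
    (h : f.comp.1 =ᶠ[nhds p] f'.comp.1) (φ : Density l) (ψ : Density n) :
    ((T f).1 φ ψ).comp.1 p = ((T f').1 φ ψ).comp.1 p := by
  have h1 : (f - f').comp.1 =ᶠ[nhds p] 0 := by
    filter_upwards [h] with x hx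
    exact sub_eq_zero.2 hx
  have h2 := hT (f - f') p h1 φ ψ
  rw [map_sub] at h2
  exact sub_eq_zero.1 h2

theorem IsEquivariantOp.apply (hT : IsEquivariantOp T) (a b c : ℝ) (f : Density σ) (φ : Density l)
    (ψ : Density n) (x : ℝ) : ((T ⁅projField a b c, f⁆).1 φ ψ).comp.1 x =
      lieDer m (projField a b c).comp.1 ((T f).1 φ ψ).comp.1 x -
        ((T f).1 φ ⁅projField a b c, ψ⁆).comp.1 x - ((T f).1 ⁅projField a b c, φ⁆ ψ).comp.1 x := by
  rw [hT]; rfl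

theorem density_smul_comp {τ c : ℝ} (φ : Density τ) : (c • φ).comp.1 = c • φ.comp.1 := rfl

theorem density_sub_comp {τ : ℝ} (φ ψ : Density τ) : (φ - ψ).comp.1 = φ.comp.1 - ψ.comp.1 := rfl

theorem density_add_comp {τ : ℝ} (φ ψ : Density τ) : (φ + ψ).comp.1 = φ.comp.1 + ψ.comp.1 := rfl

/-- The homogeneity of a local equivariant operator at `p`. -/
theorem IsLocalOp.euler (hT : IsLocalOp T) (hE : IsEquivariantOp T) {p r : ℝ} {i j : ℕ}
    (hr : r = m - l - n - σ - i - j) {f f' : Density σ}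
    (hf : f'.comp.1 =ᶠ[nhds p] fun x => (x - p) * deriv f.comp.1 x - r * f.comp.1 x) :
    ((T f').1 (Density.mono l p i) (Density.mono n p j)).comp.1 p = 0 := by
  have hE' := hE.apply (-p) 1 0 f (Density.mono l p i) (Density.mono n p j) p
  rw [projField_euler] at hE'
  have h1 : (⁅projField (-p) 1 0, Density.mono l p i⁆ : Density l).comp.1 =ᶠ[nhds p]
      ((i + l) • Density.mono l p i).comp.1 := by
    rw [density_lie_val, density_smul_comp]
    simp only [projField_euler]
    filter_upwards [euler_pow_germ (Density.mono_germ l p i)] with x hx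
    rw [hx, Pi.smul_apply, smul_eq_mul]; ring
  have h2 : (⁅projField (-p) 1 0, Density.mono n p j⁆ : Density n).comp.1 =ᶠ[nhds p]
      ((j + n) • Density.mono n p j).comp.1 := by
    rw [density_lie_val, density_smul_comp]
    simp only [projField_euler]
    filter_upwards [euler_pow_germ (Density.mono_germ n p j)] with x hx
    rw [hx, Pi.smul_apply, smul_eq_mul]; ring
  -- Near p, f' is the Lie derivative of f along E = (x - p) d/dx minus (σ + r) f. At p, E acts on
  -- the output by m and on the monomials by i + l and j + n, so r is exactly the value for which
  -- the two terms cancel.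
  have h3 : f'.comp.1 =ᶠ[nhds p] (⁅projField (-p) 1 0, f⁆ - (σ + r) • f).comp.1 := by
    filter_upwards [hf] with x hx
    rw [density_sub_comp, density_smul_comp, density_lie_val]
    simp only [projField_euler, Pi.sub_apply, Pi.smul_apply, smul_eq_mul, hx]
    ring
  rw [bidiffOp_congr (T f) h1 Filter.EventuallyEq.rfl,
    bidiffOp_congr (T f) Filter.EventuallyEq.rfl h2] at hE'
  rw [hT.congr h3, map_sub, map_smul]
  rw [map_smul, map_smul, LinearMap.smul_apply, density_smul_comp, density_smul_comp] at hE'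
  show ((T ⁅projField (-p) 1 0, f⁆).1 _ _).comp.1 p - (σ + r) * ((T f).1 _ _).comp.1 p = 0
  rw [hE', hr]
  simp only [Pi.smul_apply, smul_eq_mul]
  ring

/-- The values of a local equivariant operator on monomials at `p`. -/
noncomputable def monoValue (T : Density σ →ₗ[ℝ] BidiffOp l n m) (p : ℝ) (r i j : ℕ) : ℝ :=
  ((T (Density.mono σ p r)).1 (Density.mono l p i) (Density.mono n p j)).comp.1 p

/-- The monomial of degree r is an eigenvector of the Euler operator, so homogeneity multiplies its
value by a nonzero number and gives zero. -/
theorem IsLocalOp.monoValue_eq_zero (hT : IsLocalOp T) (hE : IsEquivariantOp T) (p : ℝ)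
    {r i j : ℕ} (h : (r : ℝ) ≠ m - l - n - σ - i - j) : monoValue T p r i j = 0 := by
  have h1 := hT.euler hE (i := i) (j := j) rfl (f := Density.mono σ p r)
    (f' := ((r : ℝ) - (m - l - n - σ - i - j)) • Density.mono σ p r) (p := p) (by
      filter_upwards [euler_pow_germ (Density.mono_germ σ p r)] with x hx
      rw [hx, density_smul_comp, Pi.smul_apply, smul_eq_mul]; ring)
  rw [map_smul] at h1
  exact (mul_eq_zero.1 h1).resolve_left (sub_ne_zero.2 h)

theorem taylorCoef_sum_mono (τ p : ℝ) (F : ℕ → ℝ) (M r : ℕ) (hr : r < M) :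
    taylorCoef (∑ a ∈ Finset.range M, F a • Density.mono τ p a).comp.1 p r = F r := by
  have : ∀ M, taylorCoef (∑ a ∈ Finset.range M, F a • Density.mono τ p a).comp.1 p =
      ∑ a ∈ Finset.range M, F a • (Pi.single a 1 : ℕ → ℝ) := by
    intro M
    induction M with
    | zero =>
      have := taylorCoef_smul 0 0 p
      rw [zero_smul, zero_smul] at this
      exact this
    | succ M ih =>
      rw [Finset.sum_range_succ, Finset.sum_range_succ, density_add_comp,
        taylorCoef_add (density_smooth _).1 (density_smooth _).1, ih, density_smul_comp,
        taylorCoef_smul, taylorCoef_mono]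
  rw [this]
  simp [Finset.sum_apply, Pi.single_apply, hr]

/-- This replaces any continuity assumption. After subtraction of a Taylor polynomial of f, the
remainder vanishes at p to an order beyond the critical exponent, so `exists_euler_at` puts it in
the image of the Euler operator, on which the value at p is zero. -/
theorem IsLocalOp.apply_mono (hT : IsLocalOp T) (hE : IsEquivariantOp T) (p : ℝ) (i j M : ℕ)
    (hM : m - l - n - σ - i - j + 1 ≤ M) (f : Density σ) :
    ((T f).1 (Density.mono l p i) (Density.mono n p j)).comp.1 p =
      ∑ r ∈ Finset.range M, taylorCoef f.comp.1 p r * monoValue T p r i j := by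
  set g := ∑ r ∈ Finset.range M, taylorCoef f.comp.1 p r • Density.mono σ p r with hg
  have h0 : ∀ r < M, taylorCoef (f - g).comp.1 p r = 0 := by
    intro r hr
    have h1 := taylorCoef_sum_mono σ p (taylorCoef f.comp.1 p) M r hr
    have h2 : (f - g).comp.1 = f.comp.1 + (-1 : ℝ) • g.comp.1 := by
      rw [density_sub_comp]; funext x; simp [sub_eq_add_neg]
    rw [h2, taylorCoef_add (g := (-1 : ℝ) • g.comp.1) (density_smooth f).1
      (density_smooth ((-1 : ℝ) • g)).1,
      taylorCoef_smul, Pi.add_apply, Pi.smul_apply, h1]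
    simp
  obtain ⟨G, hG, e⟩ := exists_euler_at p M hM (density_smooth (f - g)).1 h0
  obtain ⟨γ, hγ⟩ := Density.exists_germ σ p hG
  have h3 := hT.euler hE (p := p) (i := i) (j := j) rfl (f := γ) (f' := f - g) (by
    filter_upwards [hγ, hγ.deriv] with x h1 h2
    rw [h1, h2, e])
  rw [map_sub] at h3
  have h4 : ((T f).1 (Density.mono l p i) (Density.mono n p j)).comp.1 p =
      ((T g).1 (Density.mono l p i) (Density.mono n p j)).comp.1 p := sub_eq_zero.1 h3
  have h5 : ∀ (F : ℕ → ℝ) (M : ℕ), ((T (∑ r ∈ Finset.range M, F r • Density.mono σ p r)).1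
      (Density.mono l p i) (Density.mono n p j)).comp.1 p =
      ∑ r ∈ Finset.range M, F r * monoValue T p r i j := by
    intro F M
    induction M with
    | zero => simp only [Finset.sum_range_zero, map_zero]; rfl
    | succ M ih =>
      rw [Finset.sum_range_succ, Finset.sum_range_succ, map_add, map_smul, ← ih]
      rfl
  rw [h4, hg, h5]

theorem IsLocalOp.eq_zero (hT : IsLocalOp T) (hE : IsEquivariantOp T)
    (hK : ∀ K : ℕ, (K : ℝ) ≠ m - l - n - σ) : T = 0 := by
  have h0 : ∀ p r i j, monoValue T p r i j = 0 := fun p r i j =>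
    hT.monoValue_eq_zero hE p fun h => hK (r + i + j) (by push_cast; linarith)
  refine LinearMap.ext fun f => Subtype.ext (LinearMap.ext₂ fun φ ψ => Density.ext_fst ?_)
  funext p
  obtain ⟨N, hN⟩ := bidiffOp_expand (T f)
  rw [hN N le_rfl]
  refine Finset.sum_eq_zero fun i _ => Finset.sum_eq_zero fun j _ => ?_
  obtain ⟨M, hM⟩ := exists_nat_ge (m - l - n - σ - i - j + 1)
  rw [hT.apply_mono hE p i j M hM f, Finset.sum_eq_zero fun r _ => by rw [h0, mul_zero]]
  ring

/-- Finite dependence on f, combined with the expansion in the other two arguments, gives a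
trilinear form in Taylor coefficients; homogeneity confines it to total degree K, which removes the
dependence of the order on f. -/
theorem IsLocalOp.apply_eq (hT : IsLocalOp T) (hE : IsEquivariantOp T) {K : ℕ}
    (hm : m = σ + l + n + K) (f : Density σ) (φ : Density l) (ψ : Density n) (p : ℝ) :
    ((T f).1 φ ψ).comp.1 p = triForm (K + 1) (monoValue T p) (taylorCoef f.comp.1 p)
      (taylorCoef φ.comp.1 p) (taylorCoef ψ.comp.1 p) := by
  have h0 : ∀ r i j, r + i + j ≠ K → monoValue T p r i j = 0 := fun r i j h =>
    hT.monoValue_eq_zero hE p fun h' => h (by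
      have : ((r + i + j : ℕ) : ℝ) = K := by push_cast; linarith
      exact_mod_cast this)
  obtain ⟨N, hN⟩ := bidiffOp_expand (T f)
  rw [hN (N + K) (by omega)]
  have e1 : ∀ i j, ((T f).1 (Density.mono l p i) (Density.mono n p j)).comp.1 p =
      ∑ r ∈ Finset.range (K + 1), taylorCoef f.comp.1 p r * monoValue T p r i j := fun i j =>
    hT.apply_mono hE p i j (K + 1) (by
      push_cast
      have := Nat.cast_nonneg (α := ℝ) i
      have := Nat.cast_nonneg (α := ℝ) j
      linarith) f
  have hs : Finset.range (K + 1) ⊆ Finset.range (N + K + 1) :=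
    Finset.range_subset_range.2 (by omega)
  have e2 : ∀ i j, (K + 1 ≤ i ∨ K + 1 ≤ j) →
      ((T f).1 (Density.mono l p i) (Density.mono n p j)).comp.1 p = 0 := fun i j h => by
    rw [e1]
    exact Finset.sum_eq_zero fun r _ => by rw [h0 r i j (by omega), mul_zero]
  rw [← Finset.sum_subset hs fun i _ hi => Finset.sum_eq_zero fun j _ => by
    rw [e2 i j (Or.inl (by simpa using hi))]; ring]
  have e3 : ∀ i, ∑ j ∈ Finset.range (N + K + 1),
      ((T f).1 (Density.mono l p i) (Density.mono n p j)).comp.1 p * taylorCoef φ.comp.1 p i *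
        taylorCoef ψ.comp.1 p j = ∑ j ∈ Finset.range (K + 1), ∑ r ∈ Finset.range (K + 1),
        monoValue T p r i j * taylorCoef f.comp.1 p r * taylorCoef φ.comp.1 p i *
        taylorCoef ψ.comp.1 p j := by
    intro i
    rw [← Finset.sum_subset hs fun j _ hj => by rw [e2 i j (Or.inr (by simpa using hj))]; ring]
    refine Finset.sum_congr rfl fun j _ => ?_
    rw [e1, Finset.sum_mul, Finset.sum_mul]
    exact Finset.sum_congr rfl fun r _ => by ring
  rw [Finset.sum_congr rfl fun i _ => e3 i, triForm]
  have : ∀ F : ℕ → ℕ → ℕ → ℝ, ∑ i ∈ Finset.range (K + 1), ∑ j ∈ Finset.range (K + 1),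
      ∑ r ∈ Finset.range (K + 1), F r i j = ∑ r ∈ Finset.range (K + 1),
      ∑ i ∈ Finset.range (K + 1), ∑ j ∈ Finset.range (K + 1), F r i j := by
    intro F
    rw [Finset.sum_comm]
    simp_rw [Finset.sum_comm (s := Finset.range (K + 1)) (f := fun i r => F r i _)]
    rw [Finset.sum_comm]
    exact Finset.sum_congr rfl fun r _ => Finset.sum_comm
  exact this fun r i j => monoValue T p r i j * taylorCoef f.comp.1 p r * taylorCoef φ.comp.1 p i *
        taylorCoef ψ.comp.1 p j

theorem taylorCoef_sub_pow (p q : ℝ) (a r : ℕ) (h : a ≤ r) :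
    taylorCoef (fun x => (x - p) ^ a) q r = if r = a then 1 else 0 := by
  have h' : iteratedDeriv r (fun x : ℝ => (x - p) ^ a) q
      = iteratedDeriv r (fun x : ℝ => x ^ a) (q - p) :=
    congrFun (iteratedDeriv_comp_sub_const r (fun x : ℝ => x ^ a) p) q
  rw [taylorCoef, h', iteratedDeriv_pow]
  rcases h.eq_or_lt with rfl | h
  · have h1 : (a.factorial : ℝ) ≠ 0 := by positivity
    simp [Nat.descFactorial_self, h1]
  · simp [Nat.descFactorial_of_lt h, show r ≠ a by omega]

/-- Any other triple of total degree K exceeds r, i or j in some slot, where the corresponding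
sequence vanishes. Entries below r, i, j may be arbitrary. -/
theorem triForm_eq_single {N r i j K : ℕ} {Γ : ℕ → ℕ → ℕ → ℝ} {F G H : ℕ → ℝ}
    (hΓ : ∀ r i j, r + i + j ≠ K → Γ r i j = 0) (hK : r + i + j = K) (hN : K < N)
    (hF : ∀ a, r ≤ a → F a = if a = r then 1 else 0)
    (hG : ∀ a, i ≤ a → G a = if a = i then 1 else 0)
    (hH : ∀ a, j ≤ a → H a = if a = j then 1 else 0) : triForm N Γ F G H = Γ r i j := by
  have h0 : ∀ a b c, ¬ (a = r ∧ b = i ∧ c = j) → Γ a b c * F a * G b * H c = 0 := by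
    intro a b c h
    by_cases hs : a + b + c = K
    · have : r < a ∨ i < b ∨ j < c := by omega
      rcases this with h1 | h1 | h1
      · rw [hF a h1.le, if_neg (by omega)]; ring
      · rw [hG b h1.le, if_neg (by omega)]; ring
      · rw [hH c h1.le, if_neg (by omega)]; ring
    · rw [hΓ a b c hs]; ring
  rw [triForm, Finset.sum_eq_single r, Finset.sum_eq_single i, Finset.sum_eq_single j]
  · rw [hF r le_rfl, hG i le_rfl, hH j le_rfl]; simp
  · exact fun c _ hc => h0 _ _ _ (by tauto)
  · exact fun h => absurd (Finset.mem_range.2 (by omega)) h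
  · exact fun b _ hb => Finset.sum_eq_zero fun c _ => h0 _ _ _ (by tauto)
  · exact fun h => absurd (Finset.mem_range.2 (by omega)) h
  · exact fun a _ ha => Finset.sum_eq_zero fun b _ => Finset.sum_eq_zero fun c _ =>
      h0 _ _ _ (by tauto)
  · exact fun h => absurd (Finset.mem_range.2 (by omega)) h

theorem taylorCoef_deriv_mono (τ p : ℝ) (a : ℕ) :
    taylorCoef (⁅projField 1 0 0, Density.mono τ p a⁆ : Density τ).comp.1 p =
      (a : ℝ) • Pi.single (a - 1) 1 := by
  rw [← derivSeq_single, ← taylorCoef_mono τ p a, density_lie_val]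
  simp only [projField_const]
  funext r
  have h := hasDerivAt_taylorCoef (density_smooth (Density.mono τ p a)).1 p r
  rw [derivSeq, taylorCoef, ← iteratedDeriv_succ', taylorCoef, Nat.factorial_succ, Nat.cast_mul]
  have h1 : (r.factorial : ℝ) ≠ 0 := by positivity
  have h4 : ((r + 1 : ℕ) : ℝ) ≠ 0 := by positivity
  field_simp

/-- The symbol of a local equivariant operator does not depend on the point. -/
theorem IsLocalOp.monoValue_const (hT : IsLocalOp T) (hE : IsEquivariantOp T) {K : ℕ}
    (hm : m = σ + l + n + K) (p : ℝ) : monoValue T p = monoValue T 0 := by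
  have h0 : ∀ p r i j, r + i + j ≠ K → monoValue T p r i j = 0 := fun p r i j h =>
    hT.monoValue_eq_zero hE p fun h' => h (by
      have : ((r + i + j : ℕ) : ℝ) = K := by push_cast; linarith
      exact_mod_cast this)
  have hbox : ∀ p r i j, ¬ (r < K + 1 ∧ i < K + 1 ∧ j < K + 1) → monoValue T p r i j = 0 :=
    fun p r i j h => h0 p r i j (by omega)
  funext r i j
  by_cases hK : r + i + j = K
  swap
  · rw [h0 _ _ _ _ hK, h0 _ _ _ _ hK]
  have hd : ∀ p, HasDerivAt (fun q => monoValue T q r i j) 0 p := by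
    intro p
    set v := ((T (Density.mono σ p r)).1 (Density.mono l p i) (Density.mono n p j)).comp.1 with hv
    -- Recentring a monomial from p to q changes only its lower Taylor coefficients, which a
    -- homogeneous form cannot see; so the varying monomials may be replaced by those at p.
    have h1 : (fun q => monoValue T q r i j) =ᶠ[nhds p] v := by
      have g : ∀ τ a, ∀ᶠ q in nhds p, ∀ b, a ≤ b →
          taylorCoef (Density.mono τ p a).comp.1 q b = if b = a then 1 else 0 := by
        intro τ a
        filter_upwards [eventually_eventually_nhds.2 (Density.mono_germ τ p a)] with q hq b hb
        rw [taylorCoef_congr hq, taylorCoef_sub_pow p q a b hb]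
      filter_upwards [g σ r, g l i, g n j] with q q1 q2 q3
      rw [hv, hT.apply_eq hE hm, triForm_eq_single (h0 q) hK (Nat.lt_succ_self K) q1 q2 q3]
    -- By translation equivariance this derivative is a combination of values on monomials of total
    -- degree K - 1, which vanish.
    have h2 : deriv v p = 0 := by
      have e := hE.apply 1 0 0 (Density.mono σ p r) (Density.mono l p i) (Density.mono n p j) p
      rw [projField_const, hT.apply_eq hE hm, hT.apply_eq hE hm, hT.apply_eq hE hm,
        taylorCoef_deriv_mono, taylorCoef_deriv_mono, taylorCoef_deriv_mono, taylorCoef_mono,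
        taylorCoef_mono, taylorCoef_mono, triForm_smul₁, triForm_smul₂, triForm_smul₃,
        triForm_single (hbox p), triForm_single (hbox p), triForm_single (hbox p)] at e
      have z1 : (r : ℝ) * monoValue T p (r - 1) i j = 0 := by
        rcases r with _ | r
        · simp
        · rw [h0 _ _ _ _ (by omega), mul_zero]
      have z2 : (i : ℝ) * monoValue T p r (i - 1) j = 0 := by
        rcases i with _ | i
        · simp
        · rw [h0 _ _ _ _ (by omega), mul_zero]
      have z3 : (j : ℝ) * monoValue T p r i (j - 1) = 0 := by
        rcases j with _ | j
        · simp
        · rw [h0 _ _ _ _ (by omega), mul_zero]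
      rw [z1, z2, z3] at e
      linarith
    have h3 : HasDerivAt v 0 p := by
      rw [← h2]
      exact (smooth_diffAt (density_smooth _).1 p).hasDerivAt
    exact h3.congr_of_eventuallyEq h1
  exact is_const_of_deriv_eq_zero (fun c => (hd c).differentiableAt) (fun c => (hd c).deriv) p 0

theorem taylorCoef_projField_two : taylorCoef (projField 0 0 1).comp.1 0 = Pi.single 2 1 := by
  rw [← taylorCoef_pow 0 2]
  refine taylorCoef_congr (Filter.Eventually.of_forall fun x => ?_)
  simp [projField_comp]

theorem taylorCoef_lie {τ : ℝ} (X : VectRP1) (φ : Density τ) (x : ℝ) :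
    taylorCoef (⁅X, φ⁆ : Density τ).comp.1 x =
      lieSeq τ (taylorCoef X.comp.1 x) (taylorCoef φ.comp.1 x) :=
  taylorCoef_lieDer (vect_smooth X).1 (density_smooth φ).1 x

/-- A local equivariant operator has an invariant symbol. -/
theorem IsLocalOp.symbol_mem (hT : IsLocalOp T) (hE : IsEquivariantOp T) {K : ℕ}
    (hm : m = σ + l + n + K) : monoValue T 0 ∈ invSymbol σ l n K := by
  have h0 : ∀ r i j, r + i + j ≠ K → monoValue T 0 r i j = 0 := fun r i j h =>
    hT.monoValue_eq_zero hE 0 fun h' => h (by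
      have : ((r + i + j : ℕ) : ℝ) = K := by push_cast; linarith
      exact_mod_cast this)
  have hbox : ∀ r i j, ¬ (r < K + 1 ∧ i < K + 1 ∧ j < K + 1) → monoValue T 0 r i j = 0 :=
    fun r i j h => h0 r i j (by omega)
  refine ⟨h0, fun r i j => ?_⟩
  have e := hE.apply 0 0 1 (Density.mono σ 0 r) (Density.mono l 0 i) (Density.mono n 0 j) 0
  -- The field x² d/dx and its first derivative vanish at 0, so only the action on the arguments
  -- remains.
  have hz : ∀ v : ℝ → ℝ, lieDer m (projField 0 0 1).comp.1 v 0 = 0 := by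
    intro v
    have h1 := congrFun taylorCoef_projField_two 0
    have h2 := congrFun taylorCoef_projField_two 1
    rw [taylorCoef_zero] at h1
    rw [taylorCoef_one] at h2
    rw [lieDer, h1, h2]
    simp
  rw [hz, hT.apply_eq hE hm, hT.apply_eq hE hm, hT.apply_eq hE hm, taylorCoef_lie, taylorCoef_lie,
    taylorCoef_lie, taylorCoef_projField_two, taylorCoef_mono, taylorCoef_mono, taylorCoef_mono,
    lieSeq_single, lieSeq_single, lieSeq_single, triForm_smul₁, triForm_smul₂, triForm_smul₃,
    triForm_single hbox, triForm_single hbox, triForm_single hbox] at e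
  have a1 : 2 + r - 1 = r + 1 := by omega
  have a2 : 2 + i - 1 = i + 1 := by omega
  have a3 : 2 + j - 1 = j + 1 := by omega
  rw [a1, a2, a3] at e
  push_cast at e
  linear_combination e

/-- A local equivariant operator is given by its symbol. -/
theorem IsLocalOp.eq_triOp (hT : IsLocalOp T) (hE : IsEquivariantOp T) {K : ℕ}
    (hm : m = σ + l + n + K) (f : Density σ) : T f = triOp hm (hT.symbol_mem hE hm) f := by
  refine Subtype.ext (LinearMap.ext₂ fun φ ψ => Density.ext_fst (funext fun p => ?_))
  rw [hT.apply_eq hE hm, hT.monoValue_const hE hm]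
  rfl

end Structure

/-! ### Locality of relative cocycles -/

/-- Compactly supported fields on an interval are sums of brackets. -/
theorem exists_brackets {c d ε : ℝ} (hcd : c < d) (hε : 0 < ε) {f : ℝ → ℝ} (hf : ContDiff ℝ ∞ f)
    (h0 : ∀ x, x ∉ Set.Icc c d → f x = 0) : ∃ A B A' B' : ℝ → ℝ,
    (∀ g ∈ ({A, B, A', B'} : Set (ℝ → ℝ)), ContDiff ℝ ∞ g ∧
      ∀ x, x ∉ Set.Ioo (c - ε) (d + ε) → g x = 0) ∧
    f = lieDer (-1) A B + lieDer (-1) A' B' := by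
  let χ : ContDiffBump ((c + d) / 2) :=
    ⟨(d - c) / 2 + ε / 2, (d - c) / 2 + ε, by linarith, by linarith⟩
  let b : ContDiffBump ((c + d) / 2) := ⟨(d - c) / 4, (d - c) / 2, by linarith, by linarith⟩
  have hχ1 : ∀ x ∈ Set.Icc c d, (χ : ℝ → ℝ) =ᶠ[nhds x] 1 := fun x hx =>
    χ.eventuallyEq_one_of_mem_ball (by
      show dist x ((c + d) / 2) < (d - c) / 2 + ε / 2
      rw [Real.dist_eq, abs_lt]
      constructor <;> linarith [hx.1, hx.2])
  have hχ0 : ∀ x, x ∉ Set.Ioo (c - ε) (d + ε) → χ x = 0 := fun x hx =>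
    χ.zero_of_le_dist (by
      show (d - c) / 2 + ε ≤ dist x ((c + d) / 2)
      rw [Real.dist_eq, le_abs]
      by_contra h
      push Not at h
      exact hx ⟨by linarith, by linarith⟩)
  have hb0 : ∀ x, x ∉ Set.Ioo c d → b x = 0 := fun x hx =>
    b.zero_of_le_dist (by
      show (d - c) / 2 ≤ dist x ((c + d) / 2)
      rw [Real.dist_eq, le_abs]
      by_contra h
      push Not at h
      exact hx ⟨by linarith, by linarith⟩)
  have hbs : ContDiff ℝ ∞ b := b.contDiff
  have hI : 0 < ∫ x in c..d, b x := by
    refine intervalIntegral.intervalIntegral_pos_of_pos_on (hbs.continuous.intervalIntegrable _ _)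
      (fun x hx => b.pos_of_mem_ball ?_) hcd
    show dist x ((c + d) / 2) < (d - c) / 2
    rw [Real.dist_eq, abs_lt]
    constructor <;> linarith [hx.1, hx.2]
  -- The bracket of x d/dx with κ b d/dx is x (κ b)' - κ b, with integral -2 κ ∫ b; this κ makes
  -- that integral equal to the one of f.
  set κ : ℝ := -(∫ x in c..d, f x) / (2 * ∫ x in c..d, b x) with hκ
  have hκb : ContDiff ℝ ∞ (fun x => κ * b x) := contDiff_const.mul hbs
  have hcl : ∀ {g : ℝ → ℝ}, (∀ x, x ∉ Set.Icc c d → g x = 0) →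
      ∀ x, x ∉ Set.Icc c d → g =ᶠ[nhds x] 0 := fun hg x hx =>
    Filter.mem_of_superset (isClosed_Icc.isOpen_compl.mem_nhds hx) fun y hy => hg y hy
  have hκ0 : ∀ x, x ∉ Set.Icc c d → κ * b x = 0 := fun x hx => by
    rw [hb0 x fun h => hx ⟨h.1.le, h.2.le⟩, mul_zero]
  set e : ℝ → ℝ := fun x => x * deriv (fun x => κ * b x) x - κ * b x with he
  have hes : ContDiff ℝ ∞ e := (contDiff_id.mul (smooth_deriv hκb)).sub hκb
  have he0 : ∀ x, x ∉ Set.Icc c d → e x = 0 := fun x hx => by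
    simp only [he, hκ0 x hx, (hcl hκ0 x hx).deriv_eq, Pi.zero_def, deriv_const]
    ring
  have hfe : ContDiff ℝ ∞ (fun x => f x - e x) := hf.sub hes
  have hie : ∫ x in c..d, e x = ∫ x in c..d, f x := by
    have h1 : ∀ x ∈ Set.uIcc c d, HasDerivAt (fun x => x * (κ * b x))
        (e x + 2 * (κ * b x)) x := fun x _ => by
      refine ((hasDerivAt_id x).fun_mul (smooth_diffAt hκb x).hasDerivAt).congr_deriv ?_
      simp only [he, id]
      ring
    have h2 := intervalIntegral.integral_eq_sub_of_hasDerivAt h1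
      ((hes.continuous.add (continuous_const.mul hκb.continuous)).intervalIntegrable _ _)
    have i2 : Continuous fun x => 2 * (κ * b x) := continuous_const.mul hκb.continuous
    rw [intervalIntegral.integral_add (hes.continuous.intervalIntegrable _ _)
      (i2.intervalIntegrable _ _),
      intervalIntegral.integral_const_mul, intervalIntegral.integral_const_mul,
      hb0 c (by simp), hb0 d (by simp)] at h2
    have h3 : 2 * (κ * ∫ x in c..d, b x) = -∫ x in c..d, f x := by
      rw [hκ]; field_simp
    linarith
  -- As f - e has total integral zero, its primitive g is again supported in [c, d].
  set g : ℝ → ℝ := fun x => ∫ t in c..x, (f t - e t) with hg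
  have hgd : ∀ x, HasDerivAt g (f x - e x) x := fun x =>
    intervalIntegral.integral_hasDerivAt_right (hfe.continuous.intervalIntegrable _ _)
      (hfe.continuous.stronglyMeasurableAtFilter _ _) hfe.continuous.continuousAt
  have hgs : ContDiff ℝ ∞ g := by
    rw [contDiff_infty_iff_deriv]
    exact ⟨fun x => (hgd x).differentiableAt, by rw [funext fun x => (hgd x).deriv]; exact hfe⟩
  have hg0 : ∀ x, x ∉ Set.Icc c d → g x = 0 := by
    have hz : ∀ a b, (∀ x ∈ Set.uIoc a b, x ≠ c → x ≠ d → x ∉ Set.Icc c d) →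
        ∫ t in a..b, (f t - e t) = 0 := by
      intro a b hab
      refine intervalIntegral.integral_zero_ae ?_
      have h1 : ∀ᵐ x : ℝ, x ≠ c := by simp [MeasureTheory.ae_iff]
      have h2 : ∀ᵐ x : ℝ, x ≠ d := by simp [MeasureTheory.ae_iff]
      filter_upwards [h1, h2] with x hc hd hx
      rw [h0 x (hab x hx hc hd), he0 x (hab x hx hc hd), sub_zero]
    intro x hx
    rw [Set.mem_Icc, not_and_or, not_le, not_le] at hx
    rcases hx with hx | hx
    · refine hz c x fun y hy hc _ hI => ?_
      rw [Set.uIoc_of_ge hx.le] at hy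
      exact hc (le_antisymm hy.2 hI.1)
    · have h1 := intervalIntegral.integral_add_adjacent_intervals (μ := MeasureTheory.volume)
        (hfe.continuous.intervalIntegrable c d) (hfe.continuous.intervalIntegrable d x)
      have h2 : ∫ t in c..d, (f t - e t) = 0 := by
        rw [intervalIntegral.integral_sub (hf.continuous.intervalIntegrable _ _)
          (hes.continuous.intervalIntegrable _ _), hie, sub_self]
      rw [hg]
      simp only
      rw [← h1, h2, zero_add]
      refine hz d x fun y hy _ hd hI => ?_
      rw [Set.uIoc_of_le hx.le] at hy
      exact absurd hI.2 (not_le.2 hy.1)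
  have hsub : ∀ x, x ∉ Set.Ioo (c - ε) (d + ε) → x ∉ Set.Icc c d := fun x hx h =>
    hx ⟨by linarith [h.1], by linarith [h.2]⟩
  -- On [c, d] the cutoff χ is 1, so the brackets are those of d/dx with g and of x d/dx with κ b,
  -- namely g' = f - e and e.
  refine ⟨χ, g, fun x => x * χ x, fun x => κ * b x, ?_, ?_⟩
  · rintro _ (rfl | rfl | rfl | rfl)
    · exact ⟨χ.contDiff, hχ0⟩
    · exact ⟨hgs, fun x hx => hg0 x (hsub x hx)⟩
    · exact ⟨contDiff_id.mul χ.contDiff, fun x hx => by simp only [hχ0 x hx, mul_zero]⟩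
    · exact ⟨hκb, fun x hx => hκ0 x (hsub x hx)⟩
  · funext x
    rw [Pi.add_apply, lieDer, lieDer]
    by_cases hx : x ∈ Set.Icc c d
    · have h1 := hχ1 x hx
      have h2 : (fun x => x * χ x) =ᶠ[nhds x] fun x => x := by
        filter_upwards [h1] with y hy
        rw [hy, Pi.one_apply, mul_one]
      rw [h1.deriv_eq, h2.deriv_eq, h1.eq_of_nhds, (hgd x).deriv, Pi.one_def]
      simp only [deriv_const, deriv_id'', he]
      ring
    · rw [(hcl hg0 x hx).deriv_eq, (hcl hκ0 x hx).deriv_eq, hg0 x hx, hκ0 x hx, h0 x hx, Pi.zero_def]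
      simp only [deriv_const]
      ring

theorem relCocycle_lie {R L M : Type*} [CommRing R] [LieRing L] [LieAlgebra R L] [AddCommGroup M]
    [Module R M] [LieRingModule L M] [LieModule R L M] {h : LieSubalgebra R L} {c : L →ₗ[R] M}
    (hc : c ∈ relCocycle R L h M) (x y : L) : c ⁅x, y⁆ = ⁅x, c y⁆ - ⁅y, c x⁆ := by
  have h0 : LieModule.Cohomology.d₁₂ R L M c x y = 0 := by rw [hc.2]; rfl
  have h1 : ⁅x, c y⁆ - ⁅y, c x⁆ - c ⁅x, y⁆ = 0 := h0
  exact (sub_eq_zero.1 h1).symm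

section Locality

variable {l n m : ℝ} {c : VectRP1 →ₗ[ℝ] BidiffOp l n m}

theorem lie_apply_eq_zero {A : VectRP1} {p : ℝ} (hA : A.comp.1 =ᶠ[nhds p] 0) (D : BidiffOp l n m)
    (φ : Density l) (ψ : Density n) : ((⁅A, D⁆ : BidiffOp l n m).1 φ ψ).comp.1 p = 0 := by
  have h1 : ∀ {τ : ℝ} (f : Density τ), (⁅A, f⁆ : Density τ).comp.1 =ᶠ[nhds p]
      ((0 : ℝ) • f).comp.1 := by
    intro τ f
    rw [density_lie_val, density_smul_comp]
    filter_upwards [hA, hA.deriv] with x h1 h2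
    rw [Pi.zero_def, deriv_const] at h2
    simp only [lieDer, h1, h2]
    simp
  have e : ((⁅A, D⁆ : BidiffOp l n m).1 φ ψ).comp.1 p = (⁅A, D.1 φ ψ⁆ : Density m).comp.1 p -
      (D.1 φ ⁅A, ψ⁆).comp.1 p - (D.1 ⁅A, φ⁆ ψ).comp.1 p := rfl
  rw [e, (h1 _).eq_of_nhds, bidiffOp_congr D (h1 φ) Filter.EventuallyEq.rfl,
    bidiffOp_congr D Filter.EventuallyEq.rfl (h1 ψ), map_smul, map_smul, LinearMap.smul_apply]
  have hz : ∀ {τ : ℝ} (f : Density τ), ((0 : ℝ) • f).comp.1 p = 0 := fun f => by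
    rw [density_smul_comp, zero_smul, Pi.zero_apply]
  rw [hz, sub_self, sub_zero]

/-- In the cocycle identity each term is the action of a field vanishing near p, and such an action
gives zero at p. -/
theorem cocycle_bracket_eq_zero (hc : c ∈ relCocycle ℝ VectRP1 sl2RP1 (BidiffOp l n m))
    {A B : VectRP1} {p : ℝ} (hA : A.comp.1 =ᶠ[nhds p] 0) (hB : B.comp.1 =ᶠ[nhds p] 0)
    (φ : Density l) (ψ : Density n) : ((c ⁅A, B⁆).1 φ ψ).comp.1 p = 0 := by
  rw [relCocycle_lie hc]
  have e : ((⁅A, c B⁆ - ⁅B, c A⁆ : BidiffOp l n m).1 φ ψ).comp.1 p =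
    ((⁅A, c B⁆ : BidiffOp l n m).1 φ ψ).comp.1 p - ((⁅B, c A⁆ : BidiffOp l n m).1 φ ψ).comp.1 p := rfl
  rw [e, lie_apply_eq_zero hA, lie_apply_eq_zero hB, sub_zero]

theorem hasCompactSupport_of_Icc {f : ℝ → ℝ} {a b : ℝ} (h : ∀ x, x ∉ Set.Icc a b → f x = 0) :
    HasCompactSupport f :=
  HasCompactSupport.intro isCompact_Icc h

/-- The brackets of `exists_brackets` enlarge the support by ε only, so their factors still vanish
near p. -/
theorem cocycle_eq_zero_fst (hc : c ∈ relCocycle ℝ VectRP1 sl2RP1 (BidiffOp l n m))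
    {X : VectRP1} {p a b ε : ℝ} (hab : a < b) (hε : 0 < ε)
    (hX : ∀ x, x ∉ Set.Icc a b → X.comp.1 x = 0)
    (hp : p ∉ Set.Icc (a - ε) (b + ε)) (φ : Density l) (ψ : Density n) :
    ((c X).1 φ ψ).comp.1 p = 0 := by
  obtain ⟨A, B, A', B', h, e⟩ := exists_brackets hab hε (vect_smooth X).1 hX
  have key : ∀ g ∈ ({A, B, A', B'} : Set (ℝ → ℝ)), ∃ Y : VectRP1, Y.comp.1 = g ∧
      Y.comp.1 =ᶠ[nhds p] 0 := by
    intro g hg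
    have h0 : ∀ x, x ∉ Set.Icc (a - ε) (b + ε) → g x = 0 := fun x hx =>
      (h g hg).2 x fun hx' => hx ⟨hx'.1.le, hx'.2.le⟩
    obtain ⟨Y, hY⟩ := VectRP1.exists_fst (h g hg).1 (hasCompactSupport_of_Icc h0)
    refine ⟨Y, hY, ?_⟩
    rw [hY]
    exact Filter.mem_of_superset (isClosed_Icc.isOpen_compl.mem_nhds hp) fun y hy => h0 y hy
  obtain ⟨YA, eA, zA⟩ := key A (by simp)
  obtain ⟨YB, eB, zB⟩ := key B (by simp)
  obtain ⟨YA', eA', zA'⟩ := key A' (by simp)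
  obtain ⟨YB', eB', zB'⟩ := key B' (by simp)
  have hXe : X = ⁅YA, YB⁆ + ⁅YA', YB'⁆ := VectRP1.ext_fst (by
    rw [vect_add_comp, vect_lie_val, vect_lie_val, Prod.fst_add, e, eA, eB, eA', eB'])
  rw [hXe, map_add]
  have h1 := cocycle_bracket_eq_zero hc zA zB φ ψ
  have h2 := cocycle_bracket_eq_zero hc zA' zB' φ ψ
  exact (congrArg₂ (· + ·) h1 h2).trans (add_zero 0)

theorem fst_eq_zero_of_snd {A : VectRP1} {δ : ℝ} (hδ : 0 < δ)
    (h : ∀ y, y ∉ Set.Ioo (-δ) δ → A.comp.2 y = 0) (x : ℝ) (hx : |x| < δ⁻¹) : A.comp.1 x = 0 := by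
  have hne : ∀ x : ℝ, x ≠ 0 → |x| < δ⁻¹ → A.comp.1 x = 0 := by
    intro x hx0 hx
    have h1 : A.comp.1 x = x ^ 2 * A.comp.2 (-x⁻¹) := A.2.2.2 x hx0
    rw [h1, h, mul_zero]
    intro hI
    have h2 : |(-x⁻¹)| < δ := abs_lt.2 hI
    rw [abs_neg, abs_inv] at h2
    rw [lt_inv_comm₀ (abs_pos.2 hx0) hδ] at hx
    linarith
  by_cases hx0 : x = 0
  · subst hx0
    have hl : Filter.Tendsto A.comp.1 (nhdsWithin 0 {0}ᶜ) (nhds (A.comp.1 0)) :=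
      ((vect_smooth A).1.continuous.tendsto 0).mono_left nhdsWithin_le_nhds
    refine tendsto_nhds_unique hl ((tendsto_const_nhds (x := (0 : ℝ))).congr' ?_)
    have hb : Metric.ball (0 : ℝ) δ⁻¹ ∈ nhds (0 : ℝ) := Metric.ball_mem_nhds _ (by positivity)
    filter_upwards [self_mem_nhdsWithin, mem_nhdsWithin_of_mem_nhds hb] with z hz hz'
    refine (hne z hz ?_).symm
    simpa [Metric.mem_ball, dist_zero_right] using hz'
  · exact hne x hx0 hx

/-- The same argument for fields concentrated near infinity: the brackets live in |y| < 2 δ, that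
is, |x| > 1 / (2 δ), away from p. -/
theorem cocycle_eq_zero_snd (hc : c ∈ relCocycle ℝ VectRP1 sl2RP1 (BidiffOp l n m))
    {X : VectRP1} {p δ : ℝ} (hδ : 0 < δ) (hX : ∀ y, y ∉ Set.Icc (-δ) δ → X.comp.2 y = 0)
    (hp : |p| < (2 * δ)⁻¹) (φ : Density l) (ψ : Density n) :
    ((c X).1 φ ψ).comp.1 p = 0 := by
  obtain ⟨A, B, A', B', h, e⟩ := exists_brackets (c := -δ) (d := δ) (by linarith) hδ
    (vect_smooth X).2 hX
  have key : ∀ g ∈ ({A, B, A', B'} : Set (ℝ → ℝ)), ∃ Y : VectRP1, Y.comp.2 = g ∧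
      Y.comp.1 =ᶠ[nhds p] 0 := by
    intro g hg
    have h0 : ∀ x, x ∉ Set.Ioo (-(2 * δ)) (2 * δ) → g x = 0 := fun x hx =>
      (h g hg).2 x fun hx' => hx ⟨by linarith [hx'.1], by linarith [hx'.2]⟩
    obtain ⟨Y, hY⟩ := VectRP1.exists_snd (h g hg).1
      (hasCompactSupport_of_Icc (a := -(2 * δ)) (b := 2 * δ) fun x hx =>
        h0 x fun hx' => hx ⟨hx'.1.le, hx'.2.le⟩)
    refine ⟨Y, hY, ?_⟩
    have hop : IsOpen {x : ℝ | |x| < (2 * δ)⁻¹} := isOpen_lt continuous_abs continuous_const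
    filter_upwards [hop.mem_nhds hp] with x hx
    exact fst_eq_zero_of_snd (by linarith) (by rwa [hY]) x hx
  obtain ⟨YA, eA, zA⟩ := key A (by simp)
  obtain ⟨YB, eB, zB⟩ := key B (by simp)
  obtain ⟨YA', eA', zA'⟩ := key A' (by simp)
  obtain ⟨YB', eB', zB'⟩ := key B' (by simp)
  have hXe : X = ⁅YA, YB⁆ + ⁅YA', YB'⁆ := VectRP1.ext_snd (by
    rw [vect_add_comp, vect_lie_val, vect_lie_val, Prod.snd_add, e, eA, eB, eA', eB'])
  rw [hXe, map_add]
  have h1 := cocycle_bracket_eq_zero hc zA zB φ ψ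
  have h2 := cocycle_bracket_eq_zero hc zA' zB' φ ψ
  exact (congrArg₂ (· + ·) h1 h2).trans (add_zero 0)

theorem contDiff_cut {h : ℝ → ℝ} (hh : ContDiff ℝ ∞ h) {p : ℝ} (hp : h =ᶠ[nhds p] 0) :
    ContDiff ℝ ∞ fun x => if p < x then h x else 0 := by
  rw [contDiff_iff_contDiffAt]
  intro x
  rcases lt_trichotomy x p with hx | rfl | hx
  · refine (contDiffAt_const (c := (0 : ℝ))).congr_of_eventuallyEq ?_
    filter_upwards [isOpen_Iio.mem_nhds hx] with y hy
    rw [if_neg (not_lt.2 (le_of_lt hy))]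
  · refine (contDiffAt_const (c := (0 : ℝ))).congr_of_eventuallyEq ?_
    filter_upwards [hp] with y hy
    rw [hy]; simp
  · refine hh.contDiffAt.congr_of_eventuallyEq ?_
    filter_upwards [isOpen_Ioi.mem_nhds hx] with y hy
    exact if_pos hy

/-- Relative cocycles are local. -/
theorem relCocycle_local (hc : c ∈ relCocycle ℝ VectRP1 sl2RP1 (BidiffOp l n m)) {X : VectRP1}
    {p : ℝ} (hX : X.comp.1 =ᶠ[nhds p] 0) (φ : Density l) (ψ : Density n) :
    ((c X).1 φ ψ).comp.1 p = 0 := by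
  have hp1 : 0 < |p| + 1 := by positivity
  -- With this δ even the doubled neighbourhood |y| < 2 δ of infinity stays in |x| > |p| + 1.
  set δ : ℝ := (2 * (|p| + 1))⁻¹ with hδd
  have hδ : 0 < δ := by positivity
  have hδp : |p| < (2 * δ)⁻¹ := by
    have : (2 * δ)⁻¹ = |p| + 1 := by rw [hδd]; field_simp
    linarith
  let ρ : ContDiffBump (0 : ℝ) := ⟨δ / 2, δ, by linarith, by linarith⟩
  have hρ0 : ∀ y, y ∉ Set.Ioo (-δ) δ → ρ y = 0 := fun y hy => ρ.zero_of_le_dist (by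
    show δ ≤ dist y 0
    rw [dist_zero_right, Real.norm_eq_abs]
    by_contra h
    exact hy (abs_lt.1 (not_le.1 h)))
  obtain ⟨Z, hZ⟩ := VectRP1.exists_snd (f := fun y => ρ y * X.comp.2 y)
    (ρ.contDiff.mul (vect_smooth X).2) ρ.hasCompactSupport.mul_right
  have hZ2 : ∀ y, y ∉ Set.Ioo (-δ) δ → Z.comp.2 y = 0 := fun y hy => by
    rw [hZ]; simp only [hρ0 y hy, zero_mul]
  have hZp : Z.comp.1 =ᶠ[nhds p] 0 := by
    have hop : IsOpen {x : ℝ | |x| < δ⁻¹} := isOpen_lt continuous_abs continuous_const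
    have : |p| < δ⁻¹ := by rw [hδd, inv_inv]; linarith
    filter_upwards [hop.mem_nhds this] with x hx
    exact fst_eq_zero_of_snd hδ hZ2 x hx
  -- Here Z is X cut off to a neighbourhood of infinity, so h has compact support in the chart x and
  -- still vanishes near p.
  set h : ℝ → ℝ := (X - Z).comp.1 with hh
  have hhs : ContDiff ℝ ∞ h := (vect_smooth _).1
  have hhp : h =ᶠ[nhds p] 0 := by
    filter_upwards [hX, hZp] with x h1 h2
    have : h x = X.comp.1 x - Z.comp.1 x := rfl
    rw [this, h1, h2]; simp
  have hfar : ∀ x, 2 * δ⁻¹ < |x| → h x = 0 := by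
    intro x hx
    have hx0 : x ≠ 0 := by
      rintro rfl
      rw [abs_zero] at hx
      have : 0 < δ⁻¹ := by positivity
      linarith
    have h1 : h x = x ^ 2 * (X - Z).comp.2 (-x⁻¹) := (X - Z).2.2.2 x hx0
    have h2 : (X - Z).comp.2 (-x⁻¹) = X.comp.2 (-x⁻¹) - Z.comp.2 (-x⁻¹) := rfl
    have h3 : ρ (-x⁻¹) = 1 := ρ.one_of_mem_closedBall (by
      rw [Metric.mem_closedBall, dist_zero_right, norm_neg, norm_inv, Real.norm_eq_abs]
      show |x|⁻¹ ≤ δ / 2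
      rw [inv_le_comm₀ (abs_pos.2 hx0) (by positivity)]
      have : (δ / 2)⁻¹ = 2 * δ⁻¹ := by field_simp
      linarith)
    rw [h1, h2, hZ]
    simp only [h3]
    ring
  obtain ⟨η, hη, hηp⟩ := Metric.eventually_nhds_iff.1 hhp
  set R : ℝ := 2 * δ⁻¹ + |p| + η with hR
  have hδi : 0 < δ⁻¹ := by positivity
  have hpa := abs_le.1 (le_refl |p|)
  have hRx : ∀ x, (R < x ∨ x < -R) → h x = 0 := fun x hx => hfar x (by
    have := abs_nonneg p
    rcases hx with hx | hx
    · exact lt_of_lt_of_le (by linarith) (le_abs_self x)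
    · exact lt_of_lt_of_le (by linarith) (neg_le_abs x))
  have hcutR : ∀ x, x ∉ Set.Icc (p + η / 2) (R + 1) → (if p < x then h x else 0) = 0 := by
    intro x hx
    split_ifs with hpx
    · by_cases h1 : R < x
      · exact hRx x (Or.inl h1)
      · refine hηp ?_
        rw [Real.dist_eq, abs_lt]
        by_contra h2
        exact hx ⟨by by_contra h3; exact h2 ⟨by linarith, by linarith⟩, by linarith⟩
    · rfl
  have hcutL : ∀ x, x ∉ Set.Icc (-R - 1) (p - η / 2) → h x - (if p < x then h x else 0) = 0 := by
    intro x hx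
    split_ifs with hpx
    · ring
    · rw [sub_zero]
      by_cases h1 : x < -R
      · exact hRx x (Or.inr h1)
      · refine hηp ?_
        rw [Real.dist_eq, abs_lt]
        by_contra h2
        exact hx ⟨by linarith, by by_contra h3; exact h2 ⟨by linarith, by linarith⟩⟩
  -- Because h vanishes near p it splits smoothly into a right and a left part, each supported in an
  -- interval at positive distance from p.
  obtain ⟨XR, hXR⟩ := VectRP1.exists_fst (contDiff_cut hhs hhp) (hasCompactSupport_of_Icc hcutR)
  obtain ⟨XL, hXL⟩ := VectRP1.exists_fst (hhs.sub (contDiff_cut hhs hhp))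
    (hasCompactSupport_of_Icc hcutL)
  have hsum : X = Z + (XR + XL) := VectRP1.ext_fst (by
    funext x
    have h1 : (Z + (XR + XL)).comp.1 x = Z.comp.1 x + (XR.comp.1 x + XL.comp.1 x) := rfl
    have h2 : h x = X.comp.1 x - Z.comp.1 x := rfl
    rw [h1, hXR, hXL]
    simp only
    linarith)
  have e1 := cocycle_eq_zero_snd hc hδ (fun y hy => hZ2 y fun hy' => hy ⟨hy'.1.le, hy'.2.le⟩) hδp φ ψ
  have e2 := cocycle_eq_zero_fst hc (X := XR) (p := p) (a := p + η / 2) (b := R + 1) (ε := η / 4)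
    (by linarith) (by linarith) (by rw [hXR]; exact hcutR)
    (fun hI => by linarith [hI.1]) φ ψ
  have e3 := cocycle_eq_zero_fst hc (X := XL) (p := p) (a := -R - 1) (b := p - η / 2) (ε := η / 4)
    (by linarith) (by linarith) (by rw [hXL]; exact hcutL)
    (fun hI => by linarith [hI.2]) φ ψ
  rw [hsum, map_add, map_add]
  have e4 : ((c Z + (c XR + c XL) : BidiffOp l n m).1 φ ψ).comp.1 p = ((c Z).1 φ ψ).comp.1 p +
    (((c XR).1 φ ψ).comp.1 p + ((c XL).1 φ ψ).comp.1 p) := rfl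
  rw [e4, e1, e2, e3]
  ring

end Locality

/-! ### Symbols of relative cocycles -/

/-- Symbols of relative 1-cocycles. -/
def cocycleSymbol (l n : ℝ) (K : ℕ) : Submodule ℝ (ℕ → ℕ → ℕ → ℝ) where
  carrier := {Γ | Γ ∈ invSymbol (-1) l n K ∧ (∀ r < 3, ∀ i j, Γ r i j = 0) ∧
    ∀ a s i j, 3 ≤ a → 3 ≤ s → cocycleCoef l n Γ a s i j = 0}
  add_mem' := by
    rintro Γ Δ ⟨h1, h2, h3⟩ ⟨k1, k2, k3⟩
    refine ⟨add_mem h1 k1, fun r hr i j => ?_, fun a s i j ha hs => ?_⟩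
    · simp only [Pi.add_apply, h2 r hr, k2 r hr, add_zero]
    · have e1 := h3 a s i j ha hs
      have e2 := k3 a s i j ha hs
      simp only [cocycleCoef, Pi.add_apply] at e1 e2 ⊢
      linear_combination e1 + e2
  zero_mem' := ⟨zero_mem _, fun _ _ _ _ => rfl, fun _ _ _ _ _ _ => by simp [cocycleCoef]⟩
  smul_mem' := by
    rintro c Γ ⟨h1, h2, h3⟩
    refine ⟨Submodule.smul_mem _ c h1, fun r hr i j => ?_, fun a s i j ha hs => ?_⟩
    · simp only [Pi.smul_apply, h2 r hr, smul_zero]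
    · have e1 := h3 a s i j ha hs
      simp only [cocycleCoef, Pi.smul_apply, smul_eq_mul] at e1 ⊢
      linear_combination c * e1

section FromCocycle

variable {l n m : ℝ} {c : VectRP1 →ₗ[ℝ] BidiffOp l n m}

/-- A 1-cochain as an operator on densities of weight `-1`. -/
noncomputable def cochainOp (c : VectRP1 →ₗ[ℝ] BidiffOp l n m) :
    Density (-1) →ₗ[ℝ] BidiffOp l n m :=
  c ∘ₗ vectEquiv.symm.toLinearMap

theorem cochainOp_isLocal (hc : c ∈ relCocycle ℝ VectRP1 sl2RP1 (BidiffOp l n m)) :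
    IsLocalOp (cochainOp c) :=
  fun _ _ hf φ ψ => relCocycle_local hc hf φ ψ

theorem projField_mem (a b c : ℝ) : projField a b c ∈ sl2RP1 := ⟨a, b, c, rfl⟩

/-- For a field in sl(2) the term containing its cocycle value vanishes, and the cocycle identity
becomes equivariance. -/
theorem cochainOp_isEquivariant (hc : c ∈ relCocycle ℝ VectRP1 sl2RP1 (BidiffOp l n m)) :
    IsEquivariantOp (cochainOp c) := by
  intro a b d f
  have h1 : cochainOp c ⁅projField a b d, f⁆ = c ⁅projField a b d, vectEquiv.symm f⁆ := rfl
  rw [h1, relCocycle_lie hc, hc.1 _ (projField_mem a b d), lie_zero, sub_zero]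
  rfl

theorem lie_apply_flat {X : VectRP1} (h0 : X.comp.1 0 = 0) (h1 : deriv X.comp.1 0 = 0)
    (D : BidiffOp l n m) (φ : Density l) (ψ : Density n) :
    ((⁅X, D⁆ : BidiffOp l n m).1 φ ψ).comp.1 0 =
      -(D.1 φ ⁅X, ψ⁆).comp.1 0 - (D.1 ⁅X, φ⁆ ψ).comp.1 0 := by
  have e : ((⁅X, D⁆ : BidiffOp l n m).1 φ ψ).comp.1 0 = lieDer m X.comp.1 (D.1 φ ψ).comp.1 0 -
      (D.1 φ ⁅X, ψ⁆).comp.1 0 - (D.1 ⁅X, φ⁆ ψ).comp.1 0 := rfl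
  rw [e, lieDer, h0, h1]
  ring

theorem mono_flat {a : ℕ} (ha : 2 ≤ a) : (vectEquiv.symm (Density.mono (-1) 0 a)).comp.1 0 = 0 ∧
    deriv (vectEquiv.symm (Density.mono (-1) 0 a)).comp.1 0 = 0 := by
  rw [vectEquiv_symm_comp]
  have h := taylorCoef_mono (-1) 0 a
  refine ⟨(taylorCoef_zero _ _).symm.trans ?_, (taylorCoef_one _ _).symm.trans ?_⟩ <;> rw [h] <;>
    exact Pi.single_eq_of_ne (by omega) _

theorem taylorCoef_lie_mono {τ : ℝ} (a b : ℕ) :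
    taylorCoef (⁅vectEquiv.symm (Density.mono (-1) 0 a), Density.mono τ 0 b⁆ : Density τ).comp.1 0 =
      ((b : ℝ) + τ * a) • Pi.single (a + b - 1) 1 := by
  rw [taylorCoef_lie, vectEquiv_symm_comp, taylorCoef_mono, taylorCoef_mono, lieSeq_single]

/-- Monomials of degree below 3 are germs of elements of sl(2), on which the cocycle vanishes. In
degrees at least 3 both fields are flat to first order at 0, so the cocycle identity there involves
only values on monomials. -/
theorem monoValue_mem_cocycleSymbol (hc : c ∈ relCocycle ℝ VectRP1 sl2RP1 (BidiffOp l n m)) {K : ℕ}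
    (hm : m = -1 + l + n + K) : monoValue (cochainOp c) 0 ∈ cocycleSymbol l n K := by
  have hT := cochainOp_isLocal hc
  have hE := cochainOp_isEquivariant hc
  have hS := hT.symbol_mem hE hm
  refine ⟨hS, fun r hr i j => ?_, fun a s i j ha hs => ?_⟩
  · obtain ⟨α, β, γ, h⟩ : ∃ α β γ : ℝ, ∀ x : ℝ, (x - 0) ^ r = (projField α β γ).comp.1 x := by
      interval_cases r
      · exact ⟨1, 0, 0, fun x => by simp [projField_comp]⟩
      · exact ⟨0, 1, 0, fun x => by simp [projField_comp]⟩
      · exact ⟨0, 0, 1, fun x => by simp [projField_comp]⟩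
    have h1 : (Density.mono (-1) 0 r).comp.1 =ᶠ[nhds 0] (vectEquiv (projField α β γ)).comp.1 := by
      filter_upwards [Density.mono_germ (-1) 0 r] with x hx
      rw [hx, h x]; rfl
    rw [monoValue, hT.congr h1]
    have h2 : cochainOp c (vectEquiv (projField α β γ)) = c (projField α β γ) := rfl
    rw [h2, hc.1 _ (projField_mem α β γ)]
    rfl
  · set X := vectEquiv.symm (Density.mono (-1) 0 a) with hX
    set Y := vectEquiv.symm (Density.mono (-1) 0 s) with hY
    have e := relCocycle_lie hc X Y
    have e1 : ((c ⁅X, Y⁆).1 (Density.mono l 0 i) (Density.mono n 0 j)).comp.1 0 =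
        ((⁅X, c Y⁆ : BidiffOp l n m).1 (Density.mono l 0 i) (Density.mono n 0 j)).comp.1 0 -
        ((⁅Y, c X⁆ : BidiffOp l n m).1 (Density.mono l 0 i) (Density.mono n 0 j)).comp.1 0 := by
      rw [e]; rfl
    have hXf := mono_flat (a := a) (by omega)
    have hYf := mono_flat (a := s) (by omega)
    rw [lie_apply_flat hXf.1 hXf.2, lie_apply_flat hYf.1 hYf.2] at e1
    have f1 : c ⁅X, Y⁆ = cochainOp c ⁅X, Density.mono (-1) 0 s⁆ := rfl
    have f2 : c Y = cochainOp c (Density.mono (-1) 0 s) := rfl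
    have f3 : c X = cochainOp c (Density.mono (-1) 0 a) := rfl
    rw [f1, f2, f3] at e1
    simp only [hT.apply_eq hE hm, hX, taylorCoef_lie_mono, taylorCoef_mono, triForm_smul₁,
      triForm_smul₂, triForm_smul₃, triForm_single (invSymbol.box hS)] at e1
    rw [cocycleCoef, add_comm i a, add_comm j a, add_comm i s, add_comm j s]
    linear_combination -e1

end FromCocycle

/-! ### Cocycles from symbols -/

theorem triOp_apply {σ l n m : ℝ} {K : ℕ} (hm : m = σ + l + n + K) {Γ : ℕ → ℕ → ℕ → ℝ}
    (hΓ : Γ ∈ invSymbol σ l n K) (f : Density σ) (φ : Density l) (ψ : Density n) (x : ℝ) :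
    ((triOp hm hΓ f).1 φ ψ).comp.1 x = triForm (K + 1) Γ (taylorCoef f.comp.1 x)
      (taylorCoef φ.comp.1 x) (taylorCoef ψ.comp.1 x) := rfl

theorem lie_triOp_apply {σ l n m : ℝ} {K : ℕ} (hm : m = σ + l + n + K) {Γ : ℕ → ℕ → ℕ → ℝ}
    (hΓ : Γ ∈ invSymbol σ l n K) (X : VectRP1) (f : Density σ) (φ : Density l) (ψ : Density n)
    (x : ℝ) : ((⁅X, triOp hm hΓ f⁆ : BidiffOp l n m).1 φ ψ).comp.1 x =
      actForm (K + 1) Γ l n m (taylorCoef X.comp.1 x) (taylorCoef f.comp.1 x)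
        (taylorCoef φ.comp.1 x) (taylorCoef ψ.comp.1 x) := by
  have e : ((⁅X, triOp hm hΓ f⁆ : BidiffOp l n m).1 φ ψ).comp.1 x =
      lieDer m X.comp.1 ((triOp hm hΓ f).1 φ ψ).comp.1 x -
      ((triOp hm hΓ f).1 φ ⁅X, ψ⁆).comp.1 x - ((triOp hm hΓ f).1 ⁅X, φ⁆ ψ).comp.1 x := rfl
  have hd : deriv ((triOp hm hΓ f).1 φ ψ).comp.1 x = _ :=
    (hasDerivAt_triForm (N := K + 1) Γ (hasDerivAt_taylorCoef (density_smooth f).1 x)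
      (hasDerivAt_taylorCoef (density_smooth φ).1 x)
      (hasDerivAt_taylorCoef (density_smooth ψ).1 x)).deriv
  rw [e, lieDer, hd, triOp_apply, triOp_apply, triOp_apply, taylorCoef_lie, taylorCoef_lie, actForm,
    taylorCoef_zero, taylorCoef_one]
  ring

/-- The 1-cochain with a given symbol. -/
noncomputable def symbolCochain {l n m : ℝ} {K : ℕ} (hm : m = -1 + l + n + K)
    {Γ : ℕ → ℕ → ℕ → ℝ} (hΓ : Γ ∈ invSymbol (-1) l n K) : VectRP1 →ₗ[ℝ] BidiffOp l n m where
  toFun X := triOp hm hΓ (vectEquiv X)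
  map_add' X Y := Subtype.ext (LinearMap.ext₂ fun _ _ => Density.ext_fst (funext fun x =>
    (congrArg (fun u => triForm _ Γ u _ _) (taylorCoef_add (vect_smooth X).1 (vect_smooth Y).1 x)).trans
      (triForm_add₁ ..)))
  map_smul' c X := Subtype.ext (LinearMap.ext₂ fun _ _ => Density.ext_fst (funext fun x =>
    (congrArg (fun u => triForm _ Γ u _ _) (taylorCoef_smul c X.comp.1 x)).trans
      (triForm_smul₁ ..)))

theorem taylorCoef_projField (a b c x : ℝ) : taylorCoef (projField a b c).comp.1 x =
    (a + b * x + c * x ^ 2) • Pi.single 0 1 + (b + 2 * c * x) • Pi.single 1 1 +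
      c • Pi.single 2 1 := by
  have s : ∀ (i : ℕ) (t : ℝ), ContDiff ℝ ∞ (t • fun y : ℝ => (y - x) ^ i) := fun i t =>
    ContDiff.const_smul t (by fun_prop)
  have e : (projField a b c).comp.1 = (a + b * x + c * x ^ 2) • (fun y : ℝ => (y - x) ^ 0) +
      (b + 2 * c * x) • (fun y : ℝ => (y - x) ^ 1) + c • (fun y : ℝ => (y - x) ^ 2) := by
    funext y
    simp only [projField_comp, Pi.add_apply, Pi.smul_apply, smul_eq_mul]
    ring
  have h1 := taylorCoef_add (s 0 (a + b * x + c * x ^ 2)) (s 1 (b + 2 * c * x)) x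
  have h2 := taylorCoef_add ((s 0 (a + b * x + c * x ^ 2)).add (s 1 (b + 2 * c * x))) (s 2 c) x
  rw [e]
  refine h2.trans ?_
  rw [taylorCoef_smul c]
  refine (congrArg (· + _) h1).trans ?_
  rw [taylorCoef_smul, taylorCoef_smul, taylorCoef_pow, taylorCoef_pow, taylorCoef_pow]

/-- At each point only the Taylor coefficients 0, 1, 2 of an sl(2) field are nonzero, and the symbol
ignores them. The cocycle identity is checked pointwise on Taylor sequences. -/
theorem symbolCochain_mem {l n m : ℝ} {K : ℕ} (hm : m = -1 + l + n + K)
    {Γ : ℕ → ℕ → ℕ → ℝ} (hΓ : Γ ∈ cocycleSymbol l n K) :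
    symbolCochain hm hΓ.1 ∈ relCocycle ℝ VectRP1 sl2RP1 (BidiffOp l n m) := by
  refine ⟨?_, ?_⟩
  · rintro _ ⟨a, b, c, rfl⟩
    refine Subtype.ext (LinearMap.ext₂ fun φ ψ => Density.ext_fst (funext fun x => ?_))
    refine (triOp_apply hm hΓ.1 _ φ ψ x).trans ?_
    rw [vectEquiv_comp, taylorCoef_projField]
    refine Finset.sum_eq_zero fun r _ => Finset.sum_eq_zero fun i _ =>
      Finset.sum_eq_zero fun j _ => ?_
    by_cases hr : r < 3
    · rw [hΓ.2.1 r hr]; ring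
    · simp [show r ≠ 0 by omega, show r ≠ 1 by omega, show r ≠ 2 by omega]
  · ext X Y φ ψ
    have : ⁅X, symbolCochain hm hΓ.1 Y⁆ - ⁅Y, symbolCochain hm hΓ.1 X⁆ -
        symbolCochain hm hΓ.1 ⁅X, Y⁆ = 0 := by
      refine Subtype.ext (LinearMap.ext₂ fun φ ψ => Density.ext_fst (funext fun x => ?_))
      have h := cocycleForm_eq_zero (m := m) (by linarith) hΓ.1 hΓ.2.1 hΓ.2.2
        (taylorCoef X.comp.1 x) (taylorCoef Y.comp.1 x) (taylorCoef φ.comp.1 x)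
        (taylorCoef ψ.comp.1 x)
      refine Eq.trans ?_ h
      rw [cocycleForm]
      have e1 := lie_triOp_apply hm hΓ.1 X (vectEquiv Y) φ ψ x
      have e2 := lie_triOp_apply hm hΓ.1 Y (vectEquiv X) φ ψ x
      have e3 := triOp_apply hm hΓ.1 (vectEquiv ⁅X, Y⁆) φ ψ x
      rw [vectEquiv_lie, taylorCoef_lie] at e3
      exact congrArg₂ (· - ·) (congrArg₂ (· - ·) e1 e2) e3
    exact congrArg (fun D : BidiffOp l n m => D.1 φ ψ) this

/-! ### Invariant bilinear operators -/

/-- The coefficients `β i` of `φ⁽ⁱ⁾ ψ⁽ᵏ⁻ⁱ⁾ / (i! (k-i)!)` in an `sl(2)`-invariant operator of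
order `k`. -/
def invCoef (k : ℕ) (l n : ℝ) : Submodule ℝ (ℕ → ℝ) where
  carrier := {β | (∀ i, k < i → β i = 0) ∧
    ∀ i j : ℕ, i + j + 1 = k → (i + 2 * l) * β (i + 1) + (j + 2 * n) * β i = 0}
  add_mem' := by
    rintro β γ ⟨h1, h2⟩ ⟨k1, k2⟩
    refine ⟨fun i h => ?_, fun i j h => ?_⟩
    · simp only [Pi.add_apply, h1 i h, k1 i h, add_zero]
    · simp only [Pi.add_apply]; linear_combination h2 i j h + k2 i j h
  zero_mem' := ⟨fun _ _ => rfl, fun _ _ _ => by simp⟩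
  smul_mem' := by
    rintro c β ⟨h1, h2⟩
    refine ⟨fun i h => ?_, fun i j h => ?_⟩
    · simp only [Pi.smul_apply, h1 i h, smul_zero]
    · simp only [Pi.smul_apply, smul_eq_mul]; linear_combination c * h2 i j h

/-- The trilinear symbol, with first argument of weight `0`, of a bilinear operator. -/
def invCoefSymbol (k : ℕ) (β : ℕ → ℝ) (r i j : ℕ) : ℝ := if r = 0 ∧ i + j = k then β i else 0

theorem invCoefSymbol_mem {k : ℕ} {l n : ℝ} {β : ℕ → ℝ} (hβ : β ∈ invCoef k l n) :
    invCoefSymbol k β ∈ invSymbol 0 l n k := by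
  refine ⟨fun r i j h => if_neg (by omega), fun r i j => ?_⟩
  by_cases h : r = 0 ∧ i + j + 1 = k
  · have e := hβ.2 i j h.2
    rw [invCoefSymbol, invCoefSymbol, invCoefSymbol, if_neg (by omega), if_pos (by omega),
      if_pos (by omega)]
    linear_combination e
  · rw [invCoefSymbol, invCoefSymbol, invCoefSymbol, if_neg (by omega), if_neg (by omega),
      if_neg (by omega)]
    ring

/-- The constant density of weight `0`. -/
def Density.one : Density 0 :=
  Subtype.mk (fun _ => 1, fun _ => 1) ⟨contDiff_const, contDiff_const, by simp⟩

theorem taylorCoef_one_density (x : ℝ) : taylorCoef Density.one.comp.1 x = Pi.single 0 1 := by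
  rw [← taylorCoef_pow x 0]
  exact taylorCoef_congr (Filter.Eventually.of_forall fun y => by simp [Density.one, Density.comp])

section ActLinear

variable (N : ℕ) (Γ : ℕ → ℕ → ℕ → ℝ) (l n m : ℝ)

theorem actForm_add_left (X X' Y f g : ℕ → ℝ) : actForm N Γ l n m (X + X') Y f g =
    actForm N Γ l n m X Y f g + actForm N Γ l n m X' Y f g := by
  simp only [actForm, lieSeq_add_left, triForm_add₂, triForm_add₃, Pi.add_apply]
  ring

theorem actForm_smul_left (c : ℝ) (X Y f g : ℕ → ℝ) : actForm N Γ l n m (c • X) Y f g =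
    c * actForm N Γ l n m X Y f g := by
  simp only [actForm, lieSeq_smul_left, triForm_smul₂, triForm_smul₃, Pi.smul_apply, smul_eq_mul]
  ring

/-- `actForm` vanishes as soon as it vanishes on the standard basis in the last two arguments. -/
theorem actForm_eq_zero {X Y : ℕ → ℝ} (h : ∀ i j,
    actForm N Γ l n m X Y (Pi.single i 1) (Pi.single j 1) = 0) (f g : ℕ → ℝ) :
    actForm N Γ l n m X Y f g = 0 := by
  have z : ∀ {F : ℕ → ℝ}, (∀ r < N + 1, F r = 0) → ∀ r < N, F r = 0 :=
    fun h r hr => h r (by omega)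
  have zd : ∀ {F : ℕ → ℝ}, (∀ r < N + 1, F r = 0) → ∀ r < N, derivSeq F r = 0 :=
    fun h r hr => by rw [derivSeq, h (r + 1) (by omega), mul_zero]
  refine eq_zero_of_single (Q := fun f => actForm N Γ l n m X Y f g) (N + 1) ?_ ?_ ?_ ?_ f
  · intro F G
    simp only [actForm, lieSeq_add_right, triForm_add₂, derivSeq_add]
    ring
  · intro F G
    simp only [actForm, lieSeq_smul_right, triForm_smul₂, derivSeq_smul]
    ring
  · intro F hF
    simp only [actForm, triForm_zero₂ (z hF), triForm_zero₂ (zd hF),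
      triForm_zero₂ (lieSeq_eq_zero_right hF)]
    ring
  intro i
  refine eq_zero_of_single (Q := fun g => actForm N Γ l n m X Y (Pi.single i 1) g) (N + 1)
    ?_ ?_ ?_ (h i) g
  · intro F G
    simp only [actForm, lieSeq_add_right, triForm_add₃, derivSeq_add]
    ring
  · intro F G
    simp only [actForm, lieSeq_smul_right, triForm_smul₃, derivSeq_smul]
    ring
  · intro F hF
    simp only [actForm, triForm_zero₃ (z hF), triForm_zero₃ (zd hF),
      triForm_zero₃ (lieSeq_eq_zero_right hF)]
    ring

end ActLinear

section Invariants

variable {l n m : ℝ} {k : ℕ}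

/-- The invariant operator with given coefficients. -/
noncomputable def invOp (hm : m = l + n + k) {β : ℕ → ℝ} (hβ : β ∈ invCoef k l n) :
    BidiffOp l n m :=
  triOp (by rw [hm]; ring) (invCoefSymbol_mem hβ) Density.one

/-- An element of sl(2) has a Taylor sequence of length three at every point, so invariance reduces
to the fields 1, x, x² acting on the symbol. -/
theorem invOp_invariant (hm : m = l + n + k) {β : ℕ → ℝ} (hβ : β ∈ invCoef k l n) :
    ∀ X ∈ sl2RP1, ⁅X, invOp hm hβ⁆ = 0 := by
  rintro _ ⟨a, b, c, rfl⟩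
  refine Subtype.ext (LinearMap.ext₂ fun φ ψ => Density.ext_fst (funext fun x => ?_))
  have hS := invCoefSymbol_mem hβ
  refine (lie_triOp_apply _ hS _ _ φ ψ x).trans ?_
  rw [taylorCoef_projField, taylorCoef_one_density, actForm_add_left, actForm_add_left,
    actForm_smul_left, actForm_smul_left, actForm_smul_left]
  have z : ∀ t < 3, ∀ f g, actForm (k + 1) (invCoefSymbol k β) l n m (Pi.single t 1)
      (Pi.single 0 1) f g = 0 := by
    intro t ht
    refine actForm_eq_zero _ _ _ _ _ fun i j => ?_
    rw [actForm_single (invSymbol.box hS)]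
    interval_cases t
    · simp
    · have e1 : 1 + i - 1 = i := by omega
      have e2 : 1 + j - 1 = j := by omega
      rw [e1, e2]
      by_cases h : i + j = k
      · have : (i : ℝ) + j = k := by exact_mod_cast h
        simp only [one_ne_zero, if_false, if_true, Nat.cast_one, hm, ← this]
        ring
      · simp [invCoefSymbol, h]
    · have e1 : 2 + i - 1 = i + 1 := by omega
      have e2 : 2 + j - 1 = j + 1 := by omega
      have h := hS.2 0 i j
      rw [e1, e2]
      simp only [OfNat.ofNat_ne_zero, OfNat.ofNat_ne_one, if_false, Nat.cast_ofNat]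
      push_cast at h
      linear_combination -h
  rw [z 0 (by norm_num), z 1 (by norm_num), z 2 (by norm_num)]
  simp
  rfl

/-- The product of a function and a density. -/
def Density.mulFun {τ : ℝ} (f : Density 0) (φ : Density τ) : Density τ :=
  Subtype.mk (f.comp.1 * φ.comp.1, f.comp.2 * φ.comp.2)
    ⟨(density_smooth f).1.mul (density_smooth φ).1, (density_smooth f).2.mul (density_smooth φ).2,
      fun x hx => by
        have h1 := f.2.2.2 x hx
        have h2 := φ.2.2.2 x hx
        rw [Real.rpow_zero, one_mul] at h1
        show f.comp.1 x * φ.comp.1 x = _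
        rw [show f.comp.1 x = _ from h1, show φ.comp.1 x = _ from h2]
        show f.comp.2 (-x⁻¹) * (_ * φ.comp.2 (-x⁻¹)) = _ * (f.comp.2 (-x⁻¹) * φ.comp.2 (-x⁻¹))
        ring⟩

/-- The product of a function and an operator. -/
noncomputable def mulOp (B : BidiffOp l n m) : Density 0 →ₗ[ℝ] BidiffOp l n m where
  toFun f :=
    { val := LinearMap.mk₂ ℝ (fun φ ψ => Density.mulFun f (B.1 φ ψ))
        (fun φ φ' ψ => Density.ext_fst (by
          funext x
          show f.comp.1 x * (B.1 (φ + φ') ψ).comp.1 x = f.comp.1 x * (B.1 φ ψ).comp.1 x +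
            f.comp.1 x * (B.1 φ' ψ).comp.1 x
          rw [map_add, LinearMap.add_apply, density_add_comp, Pi.add_apply, mul_add]))
        (fun t φ ψ => Density.ext_fst (by
          funext x
          show f.comp.1 x * (B.1 (t • φ) ψ).comp.1 x = t * (f.comp.1 x * (B.1 φ ψ).comp.1 x)
          rw [map_smul, LinearMap.smul_apply, density_smul_comp, Pi.smul_apply, smul_eq_mul]
          ring))
        (fun φ ψ ψ' => Density.ext_fst (by
          funext x
          show f.comp.1 x * (B.1 φ (ψ + ψ')).comp.1 x = f.comp.1 x * (B.1 φ ψ).comp.1 x +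
            f.comp.1 x * (B.1 φ ψ').comp.1 x
          rw [map_add, density_add_comp, Pi.add_apply, mul_add]))
        (fun t φ ψ => Density.ext_fst (by
          funext x
          show f.comp.1 x * (B.1 φ (t • ψ)).comp.1 x = t * (f.comp.1 x * (B.1 φ ψ).comp.1 x)
          rw [map_smul, density_smul_comp, Pi.smul_apply, smul_eq_mul]
          ring))
      property := by
        obtain ⟨P, Q, hP, hQ, h⟩ := (isBidiffOp_iff B.1).1 B.2
        refine (isBidiffOp_iff _).2 ⟨_, _, hP.mul (density_smooth f).1,
          hQ.mul (density_smooth f).2, fun φ ψ => ⟨?_, ?_⟩⟩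
        · rw [← (h φ ψ).1]; rfl
        · rw [← (h φ ψ).2]; rfl }
  map_add' f g := Subtype.ext (LinearMap.ext₂ fun _ _ => Density.ext_fst (funext fun x =>
    add_mul (f.comp.1 x) (g.comp.1 x) _))
  map_smul' t f := Subtype.ext (LinearMap.ext₂ fun _ _ => Density.ext_fst (funext fun x =>
    mul_assoc t (f.comp.1 x) _))

theorem mulOp_isLocal (B : BidiffOp l n m) : IsLocalOp (mulOp B) := fun f p hf φ ψ => by
  show f.comp.1 p * (B.1 φ ψ).comp.1 p = 0
  rw [hf.eq_of_nhds, Pi.zero_apply, zero_mul]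

/-- Multiplication by a function is an equivariant operation. This makes an invariant bilinear
operator a local trilinear one with first argument of weight 0, to which the classification of
symbols applies. -/
theorem mulOp_isEquivariant {B : BidiffOp l n m} (hB : ∀ X ∈ sl2RP1, ⁅X, B⁆ = 0) :
    IsEquivariantOp (mulOp B) := fun a b c f => by
  refine Subtype.ext (LinearMap.ext₂ fun φ ψ => Density.ext_fst (funext fun x => ?_))
  have h := hB _ (projField_mem a b c)
  set Z := projField a b c
  have h1 : ((⁅Z, B⁆ : BidiffOp l n m).1 φ ψ).comp.1 x = 0 := by rw [h]; rfl
  have e : ((⁅Z, B⁆ : BidiffOp l n m).1 φ ψ).comp.1 x = lieDer m Z.comp.1 (B.1 φ ψ).comp.1 x -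
      (B.1 φ ⁅Z, ψ⁆).comp.1 x - (B.1 ⁅Z, φ⁆ ψ).comp.1 x := rfl
  rw [e] at h1
  show lieDer 0 Z.comp.1 f.comp.1 x * (B.1 φ ψ).comp.1 x =
    lieDer m Z.comp.1 (f.comp.1 * (B.1 φ ψ).comp.1) x - f.comp.1 x * (B.1 φ ⁅Z, ψ⁆).comp.1 x -
      f.comp.1 x * (B.1 ⁅Z, φ⁆ ψ).comp.1 x
  rw [lieDer, lieDer, deriv_mul (smooth_diffAt (density_smooth f).1 x)
    (smooth_diffAt (density_smooth (B.1 φ ψ)).1 x), Pi.mul_apply]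
  rw [lieDer] at h1
  linear_combination (-(f.comp.1 x)) * h1

/-- Every `sl(2)`-invariant operator comes from its coefficients. -/
theorem exists_invOp (hm : m = l + n + k) {B : BidiffOp l n m}
    (hB : ∀ X ∈ sl2RP1, ⁅X, B⁆ = 0) : ∃ β, ∃ hβ : β ∈ invCoef k l n, B = invOp hm hβ := by
  have hT := mulOp_isLocal B
  have hE := mulOp_isEquivariant hB
  have hm' : m = 0 + l + n + k := by rw [hm]; ring
  have hS := hT.symbol_mem hE hm'
  set Γ := monoValue (mulOp B) 0 with hΓ
  -- The function enters undifferentiated, so only its value at 0 matters.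
  have hr : ∀ r i j, r ≠ 0 → Γ r i j = 0 := by
    intro r i j hr
    have h1 : Γ r i j = (Density.mono 0 0 r).comp.1 0 *
      (B.1 (Density.mono l 0 i) (Density.mono n 0 j)).comp.1 0 := rfl
    have h2 := (Density.mono_germ 0 0 r).eq_of_nhds
    rw [h1, h2, sub_self, zero_pow hr, zero_mul]
  have hβ : (fun i => Γ 0 i (k - i)) ∈ invCoef k l n := by
    refine ⟨fun i hi => hS.1 _ _ _ (by omega), fun i j h => ?_⟩
    have e := hS.2 0 i j
    rw [hr 1 i j one_ne_zero] at e
    have e1 : k - (i + 1) = j := by omega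
    have e2 : k - i = j + 1 := by omega
    beta_reduce
    rw [e1, e2]
    linear_combination e
  refine ⟨_, hβ, ?_⟩
  have h1 : mulOp B Density.one = B :=
    Subtype.ext (LinearMap.ext₂ fun φ ψ => Density.ext_fst (funext fun x =>
      one_mul ((B.1 φ ψ).comp.1 x)))
  rw [← h1, hT.eq_triOp hE hm', invOp]
  congr 1
  funext r i j
  rw [invCoefSymbol, ← hΓ]
  by_cases h : r = 0 ∧ i + j = k
  · rw [if_pos h, h.1, show k - i = j by omega]
  · rw [if_neg h]
    by_cases h0 : r = 0
    · exact hS.1 _ _ _ (by omega)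
    · exact hr _ _ _ h0

end Invariants

/-! ### Reduction of `H¹` to linear algebra -/

section RelativeCohomologyDimension

variable {R L : Type*} [Field R] [LieRing L] [LieAlgebra R L] {h : LieSubalgebra R L}
  {M : Type*} [AddCommGroup M] [Module R M] [LieRingModule L M] [LieModule R L M]
  {V : Type*} [AddCommGroup V] [Module R V]

theorem injective_of_map_eq_zero (F : relCocycle R L h M →ₗ[R] V) (hF : ∀ c, F c = 0 → c = 0) :
    Function.Injective F :=
  (injective_iff_map_eq_zero _).2 hF

/-- An injection into a finite-dimensional space transports cocycles and coboundaries to Z and B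
without loss of dimension, so the quotient has dimension dim Z - dim B. -/
theorem relH1_equiv_of_finrank [FiniteDimensional R V] {F : relCocycle R L h M →ₗ[R] V}
    (hi : Function.Injective F) {Z B : Submodule R V} (hZ : LinearMap.range F = Z)
    (hB : ((relCoboundary R L h M).submoduleOf (relCocycle R L h M)).map F = B) {d : ℕ}
    (hd : Module.finrank R Z = d + Module.finrank R B) :
    Nonempty (RelH1 R L h M ≃ₗ[R] (Fin d → R)) := by
  have : FiniteDimensional R (relCocycle R L h M) := FiniteDimensional.of_injective _ hi
  have h1 := (LinearEquiv.ofInjective _ hi).finrank_eq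
  have h2 := (Submodule.equivMapOfInjective _ hi
    ((relCoboundary R L h M).submoduleOf (relCocycle R L h M))).finrank_eq
  have h3 := ((relCoboundary R L h M).submoduleOf
    (relCocycle R L h M)).finrank_quotient_add_finrank
  rw [hZ] at h1
  rw [hB] at h2
  have h4 : Module.finrank R (relCocycle R L h M ⧸
      (relCoboundary R L h M).submoduleOf (relCocycle R L h M)) = d := by omega
  exact ⟨LinearEquiv.ofFinrankEq _ _ (h4.trans (Module.finrank_fin_fun R).symm)⟩

theorem relH1_equiv_zero (hz : ∀ c ∈ relCocycle R L h M, c = 0) :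
    Nonempty (RelH1 R L h M ≃ₗ[R] (Fin 0 → R)) := by
  have hs : Subsingleton (relCocycle R L h M) :=
    ⟨fun c d => Subtype.ext ((hz c.1 c.2).trans (hz d.1 d.2).symm)⟩
  have : Subsingleton (RelH1 R L h M) := (Submodule.Quotient.mk_surjective _).subsingleton
  exact ⟨LinearEquiv.ofFinrankEq _ _ (by simp [Module.finrank_zero_of_subsingleton])⟩

end RelativeCohomologyDimension

/-- The coefficients of `X'''` in a trilinear symbol of order `κ + 3`. -/
def leadCoef (κ : ℕ) : (ℕ → ℕ → ℕ → ℝ) →ₗ[ℝ] (Fin (κ + 1) → ℝ) where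
  toFun Γ i := Γ 3 i (κ - i)
  map_add' _ _ := rfl
  map_smul' _ _ := rfl

/-- The coboundary of an invariant operator, in terms of coefficients. -/
def coboundaryMap (κ : ℕ) (l n : ℝ) : (ℕ → ℝ) →ₗ[ℝ] (Fin (κ + 1) → ℝ) where
  toFun β i := -((i + 3 * l) * β (i + 2) + ((κ - i : ℕ) + 3 * n) * β i)
  map_add' β γ := funext fun i => by simp only [Pi.add_apply]; ring
  map_smul' c β := funext fun i => by
    simp only [Pi.smul_apply, smul_eq_mul, RingHom.id_apply]; ring

/-- The space of relative cocycles, in coordinates. -/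
def cocycleSpace (κ : ℕ) (l n : ℝ) : Submodule ℝ (Fin (κ + 1) → ℝ) :=
  (cocycleSymbol l n (κ + 3)).map (leadCoef κ)

/-- The space of relative coboundaries, in coordinates. -/
def coboundarySpace (κ : ℕ) (l n : ℝ) : Submodule ℝ (Fin (κ + 1) → ℝ) :=
  (invCoef (κ + 2) l n).map (coboundaryMap κ l n)

/-- In the invariance relation the coefficient of Γ (r + 1) is r - 2, nonzero for r ≥ 3; hence every
Γ r with r > 3 is determined by Γ 3. -/
theorem cocycleSymbol_eq_zero {κ : ℕ} {l n : ℝ} {Γ : ℕ → ℕ → ℕ → ℝ}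
    (hΓ : Γ ∈ cocycleSymbol l n (κ + 3)) (h : leadCoef κ Γ = 0) : Γ = 0 := by
  have h3 : ∀ r i j, Γ (r + 3) i j = 0 := by
    intro r
    induction r with
    | zero =>
      intro i j
      by_cases hij : i + j = κ
      · have e := congrFun h ⟨i, by omega⟩
        have e' : Γ 3 i (κ - i) = 0 := e
        rwa [show κ - i = j by omega] at e'
      · exact hΓ.1.1 _ _ _ (by omega)
    | succ r ih =>
      intro i j
      have e := hΓ.1.2 (r + 3) i j
      rw [ih, ih] at e
      have hr : ((r + 3 : ℕ) : ℝ) + 2 * (-1) ≠ 0 := by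
        have : (0 : ℝ) ≤ r := r.cast_nonneg
        push_cast
        intro h
        linarith
      have := (mul_eq_zero.1 (by linarith : (((r + 3 : ℕ) : ℝ) + 2 * (-1)) * Γ (r + 3 + 1) i j = 0))
      rw [show r + 1 + 3 = r + 3 + 1 by ring]
      exact this.resolve_left hr
  funext r i j
  by_cases hr : r < 3
  · exact hΓ.2.1 r hr i j
  · obtain ⟨t, rfl⟩ : ∃ t, r = t + 3 := ⟨r - 3, by omega⟩
    exact h3 t i j

section Reduction

variable {l n m : ℝ}

theorem cochain_eq_zero {c : VectRP1 →ₗ[ℝ] BidiffOp l n m} {K : ℕ} (hm : m = -1 + l + n + K)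
    (hc : c ∈ relCocycle ℝ VectRP1 sl2RP1 (BidiffOp l n m))
    (h : monoValue (cochainOp c) 0 = 0) : c = 0 := by
  refine LinearMap.ext fun X => Subtype.ext (LinearMap.ext₂ fun φ ψ => Density.ext_fst
    (funext fun x => ?_))
  have hT := cochainOp_isLocal hc
  have hE := cochainOp_isEquivariant hc
  have e := hT.apply_eq hE hm (vectEquiv X) φ ψ x
  rw [hT.monoValue_const hE hm, h] at e
  refine e.trans ?_
  simp only [triForm, Pi.zero_apply, zero_mul, Finset.sum_const_zero]
  rfl

/-- The leading coefficients of a relative cocycle. -/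
noncomputable def cocycleLead (l n m : ℝ) (κ : ℕ) :
    relCocycle ℝ VectRP1 sl2RP1 (BidiffOp l n m) →ₗ[ℝ] (Fin (κ + 1) → ℝ) where
  toFun c := leadCoef κ (monoValue (cochainOp c.1) 0)
  map_add' _ _ := rfl
  map_smul' _ _ := rfl

variable {κ : ℕ}

theorem cocycleLead_injective (hm : m = l + n + (κ + 2)) :
    Function.Injective (cocycleLead l n m κ) := by
  refine injective_of_map_eq_zero _ fun c hc => Subtype.ext ?_
  have hm' : m = -1 + l + n + (κ + 3 : ℕ) := by push_cast; linarith
  exact cochain_eq_zero hm' c.2 (cocycleSymbol_eq_zero (monoValue_mem_cocycleSymbol c.2 hm') hc)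

theorem range_cocycleLead (hm : m = l + n + (κ + 2)) :
    LinearMap.range (cocycleLead l n m κ) = cocycleSpace κ l n := by
  have hm' : m = -1 + l + n + (κ + 3 : ℕ) := by push_cast; linarith
  apply le_antisymm
  · rintro _ ⟨c, rfl⟩
    exact ⟨_, monoValue_mem_cocycleSymbol c.2 hm', rfl⟩
  · rintro _ ⟨Γ, hΓ, rfl⟩
    refine ⟨⟨_, symbolCochain_mem hm' hΓ⟩, ?_⟩
    show leadCoef κ (monoValue (cochainOp (symbolCochain hm' hΓ.1)) 0) = _
    refine congrArg (leadCoef κ) (funext fun r => funext fun i => funext fun j => ?_)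
    refine (triOp_apply hm' hΓ.1 (Density.mono (-1) 0 r) (Density.mono l 0 i)
      (Density.mono n 0 j) 0).trans ?_
    rw [taylorCoef_mono, taylorCoef_mono, taylorCoef_mono, triForm_single (invSymbol.box hΓ.1)]

/-- The coefficients of X''' are read off at X = x³, which is flat to second order at 0, so only the
action on the two arguments survives. -/
theorem lead_invOp (hm : m = l + n + (κ + 2 : ℕ)) {β : ℕ → ℝ} (hβ : β ∈ invCoef (κ + 2) l n)
    {c : VectRP1 →ₗ[ℝ] BidiffOp l n m} (hc : ∀ X, c X = ⁅X, invOp hm hβ⁆) :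
    leadCoef κ (monoValue (cochainOp c) 0) = coboundaryMap κ l n β := by
  funext i
  have e : leadCoef κ (monoValue (cochainOp c) 0) i =
      ((c (vectEquiv.symm (Density.mono (-1) 0 3))).1 (Density.mono l 0 i)
        (Density.mono n 0 (κ - i))).comp.1 0 := rfl
  have hS := invCoefSymbol_mem hβ
  rw [e, hc]
  refine (lie_triOp_apply _ hS _ _ _ _ _).trans ?_
  have hi := i.2
  rw [vectEquiv_symm_comp, taylorCoef_mono, taylorCoef_mono, taylorCoef_mono,
    taylorCoef_one_density, actForm_single (invSymbol.box hS)]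
  simp only [invCoefSymbol, OfNat.ofNat_ne_zero, OfNat.ofNat_ne_one, if_false, true_and]
  rw [if_pos (by omega), if_pos (by omega), show 3 + (i : ℕ) - 1 = i + 2 by omega]
  simp only [coboundaryMap, LinearMap.coe_mk, AddHom.coe_mk]
  push_cast
  ring

theorem map_coboundary (hm : m = l + n + (κ + 2)) :
    ((relCoboundary ℝ VectRP1 sl2RP1 (BidiffOp l n m)).submoduleOf
      (relCocycle ℝ VectRP1 sl2RP1 (BidiffOp l n m))).map (cocycleLead l n m κ) =
      coboundarySpace κ l n := by
  have hm' : m = l + n + (κ + 2 : ℕ) := by push_cast; linarith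
  apply le_antisymm
  · rintro _ ⟨c, ⟨B, hB, hc⟩, rfl⟩
    obtain ⟨β, hβ, rfl⟩ := exists_invOp hm' hB
    exact ⟨β, hβ, (lead_invOp hm' hβ hc).symm⟩
  · rintro _ ⟨β, hβ, rfl⟩
    let c : VectRP1 →ₗ[ℝ] BidiffOp l n m :=
      { toFun := fun X => ⁅X, invOp hm' hβ⁆
        map_add' := fun X Y => add_lie X Y _
        map_smul' := fun t X => smul_lie t X _ }
    have hc : c ∈ relCoboundary ℝ VectRP1 sl2RP1 (BidiffOp l n m) :=
      ⟨_, invOp_invariant hm' hβ, fun _ => rfl⟩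
    exact ⟨⟨c, relCoboundary_le_relCocycle _ _ _ _ hc⟩, hc, lead_invOp (c := c) hm' hβ fun _ => rfl⟩

/-- The dimension of `H¹` is `dim Z - dim B`. -/
theorem h1Iso_of_finrank (hm : m = l + n + (κ + 2)) {d : ℕ}
    (h : Module.finrank ℝ (cocycleSpace κ l n) =
      d + Module.finrank ℝ (coboundarySpace κ l n)) : H1Iso l n m d :=
  relH1_equiv_of_finrank (cocycleLead_injective hm) (range_cocycleLead hm) (map_coboundary hm) h

/-- If `k` is not an integer `≥ 2`, there are no relative cocycles. -/
theorem h1Iso_zero_of_forall_ne (hm : ∀ κ : ℕ, m ≠ l + n + (κ + 2)) : H1Iso l n m 0 := by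
  refine relH1_equiv_zero fun c hc => ?_
  by_cases hK : ∃ K : ℕ, m = -1 + l + n + K
  · obtain ⟨K, hK⟩ := hK
    refine cochain_eq_zero hK hc ?_
    have h1 := monoValue_mem_cocycleSymbol hc hK
    -- A nonzero entry needs r ≥ 3 by vanishing on sl(2), yet r + i + j = K < 3.
    have h2 : K < 3 := by
      by_contra h
      refine hm (K - 3) ?_
      rw [Nat.cast_sub (by omega), hK]
      push_cast
      ring
    funext r i j
    by_cases hr : r < 3
    · exact h1.2.1 r hr i j
    · exact h1.1.1 _ _ _ (by omega)
  · have h0 := (cochainOp_isLocal hc).eq_zero (cochainOp_isEquivariant hc) fun K h =>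
      hK ⟨K, by linarith⟩
    exact LinearMap.ext fun X => LinearMap.congr_fun h0 (vectEquiv X)

end Reduction

/-! ### The dimension of the space of invariant operators -/

/-- The sequence which vanishes before `t`, is `1` at `t`, and then solves
`p i * β (i + 1) + q i * β i = 0`. -/
noncomputable def chainCoef (p q : ℕ → ℝ) (t : ℕ) : ℕ → ℝ
  | 0 => if t = 0 then 1 else 0
  | i + 1 => if i + 1 = t then 1 else -(q i / p i) * chainCoef p q t i

theorem chainCoef_of_lt (p q : ℕ → ℝ) {t i : ℕ} (h : i < t) : chainCoef p q t i = 0 := by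
  induction i with
  | zero => exact if_neg (by omega)
  | succ i ih => rw [chainCoef, if_neg (by omega), ih (by omega), mul_zero]

theorem chainCoef_self (p q : ℕ → ℝ) (t : ℕ) : chainCoef p q t t = 1 := by
  cases t with
  | zero => exact if_pos rfl
  | succ t => exact if_pos rfl

section InvCoef

variable {k : ℕ} {l n : ℝ}

theorem invCoef_rel {β : ℕ → ℝ} (hβ : β ∈ invCoef k l n) {i : ℕ} (hi : i < k) :
    (i + 2 * l) * β (i + 1) + ((k : ℝ) - 1 - i + 2 * n) * β i = 0 := by
  have h := hβ.2 i (k - 1 - i) (by omega)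
  rw [Nat.cast_sub (by omega), Nat.cast_sub (by omega)] at h
  exact_mod_cast h

theorem mem_invCoef {β : ℕ → ℝ} (h0 : ∀ i, k < i → β i = 0)
    (h : ∀ i < k, (i + 2 * l) * β (i + 1) + ((k : ℝ) - 1 - i + 2 * n) * β i = 0) :
    β ∈ invCoef k l n := by
  refine ⟨h0, fun i j hij => ?_⟩
  have e := h i (by omega)
  have : (k : ℝ) = i + j + 1 := by exact_mod_cast hij.symm
  rw [this] at e
  linear_combination e

/-- A solution may start at t when the factor i + 2 l vanishes at i = t - 1 (or t = 0), and may stop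
at e when the factor of β e in its last relation vanishes (or e = k). -/
theorem chainCoef_mem {t e : ℕ} (hte : t ≤ e) (he : e ≤ k)
    (hp : ∀ u : ℕ, t ≤ u → u < e → (u : ℝ) + 2 * l ≠ 0)
    (ht : ∀ u : ℕ, u + 1 = t → (u : ℝ) + 2 * l = 0)
    (hq : e < k → (k : ℝ) - 1 - e + 2 * n = 0) :
    (fun i => if i ≤ e then chainCoef (fun u => u + 2 * l) (fun u => k - 1 - u + 2 * n) t i else 0) ∈
      invCoef k l n := by
  refine mem_invCoef (fun i hi => if_neg (by omega)) fun i hi => ?_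
  rcases lt_trichotomy i e with h | rfl | h
  · rw [if_pos (by omega), if_pos (by omega), chainCoef]
    by_cases h1 : i + 1 = t
    · rw [if_pos h1, chainCoef_of_lt _ _ (by omega : i < t), ht i h1]
      ring
    · rw [if_neg h1]
      by_cases h2 : i < t
      · rw [chainCoef_of_lt _ _ h2]; ring
      · have := hp i (by omega) h
        field_simp
        ring
  · rw [if_neg (by omega), hq hi]; ring
  · rw [if_neg (by omega), if_neg (by omega)]; ring

theorem invCoef_eq_zero_of_left {β : ℕ → ℝ} (hβ : β ∈ invCoef k l n) {t e : ℕ} (he : e ≤ k)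
    (hp : ∀ u : ℕ, t ≤ u → u < e → (u : ℝ) + 2 * l ≠ 0) (h : β t = 0) (d : ℕ) (hd : t + d ≤ e) :
    β (t + d) = 0 := by
  induction d with
  | zero => exact h
  | succ d ih =>
    have e1 := invCoef_rel hβ (i := t + d) (by omega)
    rw [ih (by omega), mul_zero, add_zero] at e1
    exact (mul_eq_zero.1 e1).resolve_left (hp _ (by omega) (by omega))

theorem invCoef_eq_zero_of_right {β : ℕ → ℝ} (hβ : β ∈ invCoef k l n) {e : ℕ} (he : e ≤ k) (d : ℕ)
    (hd : d ≤ e) (hq : ∀ u : ℕ, e - d ≤ u → u < e → (k : ℝ) - 1 - u + 2 * n ≠ 0) (h : β e = 0) :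
    β (e - d) = 0 := by
  induction d with
  | zero => exact h
  | succ d ih =>
    have e1 := invCoef_rel hβ (i := e - (d + 1)) (by omega)
    rw [show e - (d + 1) + 1 = e - d by omega,
      ih (by omega) (fun u h1 h2 => hq u (by omega) h2), mul_zero, zero_add] at e1
    exact (mul_eq_zero.1 e1).resolve_left (hq _ le_rfl (by omega))

/-- The weights for which there are two independent invariant operators of order `k`. -/
def IsDoubleWeight (k : ℕ) (l n : ℝ) : Prop :=
  ∃ i₀ i₁ : ℕ, i₁ ≤ i₀ ∧ i₀ < k ∧ (i₀ : ℝ) + 2 * l = 0 ∧ (k : ℝ) - 1 - i₁ + 2 * n = 0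

theorem invCoef_ext {β : ℕ → ℝ} (hβ : β ∈ invCoef k l n) (h : ∀ i ≤ k, β i = 0) : β = 0 := by
  funext i
  by_cases hi : i ≤ k
  · exact h i hi
  · exact hβ.1 i (by omega)

/-- The factor i + 2 l vanishes for at most one i₀. If there is none below k, the first entry
determines the solution. Otherwise the other factors are nonzero up to i₀, which forces zeros up to
i₀, and the entry i₀ + 1 is the free parameter. -/
theorem finrank_invCoef_one (h : ¬ IsDoubleWeight k l n) : Module.finrank ℝ (invCoef k l n) = 1 := by
  obtain ⟨t, htk, hp, ht, h0⟩ : ∃ t ≤ k, (∀ u : ℕ, t ≤ u → u < k → (u : ℝ) + 2 * l ≠ 0) ∧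
      (∀ u : ℕ, u + 1 = t → (u : ℝ) + 2 * l = 0) ∧
      ∀ β ∈ invCoef k l n, ∀ i < t, β i = 0 := by
    by_cases hz : ∃ i < k, (i : ℝ) + 2 * l = 0
    · obtain ⟨i₀, hi, hl⟩ := hz
      have hq : ∀ u : ℕ, u ≤ i₀ → (k : ℝ) - 1 - u + 2 * n ≠ 0 := fun u hu hq =>
        h ⟨i₀, u, hu, hi, hl, hq⟩
      refine ⟨i₀ + 1, hi, fun u h1 _ h2 => ?_, fun u hu => ?_, fun β hβ i hi' => ?_⟩
      · have : (u : ℝ) = i₀ := by linarith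
        have : u = i₀ := by exact_mod_cast this
        omega
      · rw [show u = i₀ by omega, hl]
      · have e1 := invCoef_rel hβ hi
        rw [hl, zero_mul, zero_add] at e1
        have := invCoef_eq_zero_of_right hβ hi.le (i₀ - i) (by omega)
          (fun u _ h2 => hq u h2.le) ((mul_eq_zero.1 e1).resolve_left (hq _ le_rfl))
        rwa [show i₀ - (i₀ - i) = i by omega] at this
    · push Not at hz
      exact ⟨0, by omega, fun u _ hu => hz u hu, fun u hu => by omega, fun _ _ i hi => by omega⟩
  refine (LinearEquiv.ofBijective
    ((LinearMap.proj t : (ℕ → ℝ) →ₗ[ℝ] ℝ).comp (invCoef k l n).subtype) ⟨?_, ?_⟩).finrank_eq.trans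
      (Module.finrank_self ℝ)
  · refine (injective_iff_map_eq_zero _).2 fun β hβ => Subtype.ext ?_
    refine invCoef_ext β.2 fun i hi => ?_
    by_cases hit : i < t
    · exact h0 _ β.2 i hit
    · have := invCoef_eq_zero_of_left β.2 le_rfl hp hβ (i - t) (by omega)
      rwa [show t + (i - t) = i by omega] at this
  · intro x
    refine ⟨x • ⟨_, chainCoef_mem htk le_rfl hp ht fun h => absurd h (lt_irrefl _)⟩, ?_⟩
    simp [chainCoef_self, htk]

/-- The recurrence breaks into two independent chains, one on [0, i₁] and one on [i₀ + 1, k], with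
zeros forced in between; their starting values are the two parameters. -/
theorem finrank_invCoef_two (h : IsDoubleWeight k l n) : Module.finrank ℝ (invCoef k l n) = 2 := by
  obtain ⟨i₀, i₁, h10, h0k, hl, hn⟩ := h
  have hp : ∀ u : ℕ, u ≠ i₀ → (u : ℝ) + 2 * l ≠ 0 := fun u hu h => hu (by
    have : (u : ℝ) = i₀ := by linarith
    exact_mod_cast this)
  have hq : ∀ u : ℕ, u ≠ i₁ → (k : ℝ) - 1 - u + 2 * n ≠ 0 := fun u hu h => hu (by
    have : (u : ℝ) = i₁ := by linarith
    exact_mod_cast this)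
  have hmid : ∀ β ∈ invCoef k l n, ∀ i, i₁ < i → i ≤ i₀ → β i = 0 := by
    intro β hβ i h1 h2
    have e1 := invCoef_rel hβ h0k
    rw [hl, zero_mul, zero_add] at e1
    have := invCoef_eq_zero_of_right hβ h0k.le (i₀ - i) (by omega)
      (fun u h3 h4 => hq u (by omega)) ((mul_eq_zero.1 e1).resolve_left (hq _ (by omega)))
    rwa [show i₀ - (i₀ - i) = i by omega] at this
  refine (LinearEquiv.ofBijective
    (((LinearMap.proj 0 : (ℕ → ℝ) →ₗ[ℝ] ℝ).prod (LinearMap.proj (i₀ + 1))).comp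
      (invCoef k l n).subtype) ⟨?_, ?_⟩).finrank_eq.trans (by simp)
  · refine (injective_iff_map_eq_zero _).2 fun β hβ => Subtype.ext ?_
    have hβ0 : β.1 0 = 0 := congrArg Prod.fst hβ
    have hβ1 : β.1 (i₀ + 1) = 0 := congrArg Prod.snd hβ
    refine invCoef_ext β.2 fun i hi => ?_
    by_cases h1 : i ≤ i₁
    · have := invCoef_eq_zero_of_left β.2 (e := i₁) (by omega) (fun u _ hu => hp u (by omega)) hβ0 i
        (by omega)
      rwa [zero_add] at this
    · by_cases h2 : i ≤ i₀
      · exact hmid _ β.2 i (by omega) h2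
      · have := invCoef_eq_zero_of_left β.2 le_rfl (fun u _ hu => hp u (by omega)) hβ1
          (i - (i₀ + 1)) (by omega)
        rwa [show i₀ + 1 + (i - (i₀ + 1)) = i by omega] at this
  · rintro ⟨x, y⟩
    refine ⟨x • ⟨_, chainCoef_mem (t := 0) (e := i₁) (by omega) (by omega)
      (fun u _ hu => hp u (by omega)) (fun u hu => by omega) fun _ => hn⟩ +
      y • ⟨_, chainCoef_mem (t := i₀ + 1) (e := k) (by omega) le_rfl
        (fun u hu _ => hp u (by omega)) (fun u hu => by rw [show u = i₀ by omega, hl])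
        fun h => absurd h (lt_irrefl _)⟩, ?_⟩
    have hk : i₀ + 1 ≤ k := h0k
    have hi : ¬ i₀ + 1 ≤ i₁ := by omega
    simp [chainCoef_self, hk, hi, chainCoef_of_lt]

end InvCoef

/-! ### Injectivity of the coboundary map -/

/-- The coefficients of an operator which is invariant under all vector fields. -/
def IsFlatCoef (k : ℕ) (l n : ℝ) (β : ℕ → ℝ) : Prop :=
  ∀ i i' : ℕ, i < i' → i' ≤ k →
    (i + ((i' : ℝ) - i + 1) * l) * β i' + (k - i' + ((i' : ℝ) - i + 1) * n) * β i = 0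

theorem IsFlatCoef.swap {k : ℕ} {l n : ℝ} {β : ℕ → ℝ} (h : IsFlatCoef k l n β) :
    IsFlatCoef k n l fun i => β (k - i) := by
  intro i i' h1 h2
  have e := h (k - i') (k - i) (by omega) (by omega)
  rw [Nat.cast_sub h2, Nat.cast_sub (by omega)] at e
  linear_combination e

/-- The relation `key r` is invariance under x^(r + 2). Cases 0 and 1 are the hypotheses; the rest
follows because the bracket of x² with x^(r + 3) is (r + 1) x^(r + 4). -/
theorem isFlatCoef_of_coboundaryMap {κ : ℕ} {l n : ℝ} {β : ℕ → ℝ} (hβ : β ∈ invCoef (κ + 2) l n)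
    (h : coboundaryMap κ l n β = 0) : IsFlatCoef (κ + 2) l n β := by
  have key : ∀ r i j : ℕ, i + j + (r + 1) = κ + 2 →
      (i + (r + 2) * l) * β (i + r + 1) + (j + (r + 2) * n) * β i = 0 := by
    intro r
    induction r with
    | zero =>
      intro i j hij
      have := hβ.2 i j hij
      push_cast
      linear_combination this
    | succ r ih =>
      intro i j hij
      rcases r with _ | r
      · have e := congrFun h ⟨i, by omega⟩
        have e' : -((i + 3 * l) * β (i + 2) + ((κ - i : ℕ) + 3 * n) * β i) = 0 := e
        rw [show κ - i = j by omega] at e'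
        push_cast
        linear_combination -e'
      · have e1 := ih (i + 1) j (by omega)
        have e2 := ih i (j + 1) (by omega)
        have e3 := hβ.2 (i + r + 2) j (by omega)
        have e4 := hβ.2 i (j + r + 2) (by omega)
        rw [show i + 1 + (r + 1) + 1 = i + r + 2 + 1 by ring] at e1
        rw [show i + (r + 1) + 1 = i + r + 2 by ring] at e2
        rw [show i + (r + 1 + 1) + 1 = i + r + 2 + 1 by ring]
        push_cast at *
        have hr : (0 : ℝ) < r + 1 := by positivity
        refine (mul_eq_zero.1 (?_ : ((r : ℝ) + 1) * _ = 0)).resolve_left hr.ne'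
        linear_combination (i + (r + 3) * l) * e3 + (j + (r + 3) * n) * e4 - (i + 2 * l) * e1 -
          (j + 2 * n) * e2
  intro i i' h1 h2
  have e := key (i' - i - 1) i (κ + 2 - i') (by omega)
  rw [show i + (i' - i - 1) + 1 = i' by omega, Nat.cast_sub h2, Nat.cast_sub (by omega),
    Nat.cast_sub h1.le] at e
  push_cast at e ⊢
  linear_combination e

section Flat

variable {k : ℕ} {l n : ℝ} {β : ℕ → ℝ}

theorem IsFlatCoef.apply_zero (h : IsFlatCoef k l n β) (i : ℕ) (hi : i < k) :
    ((i + 2 : ℝ) * l) * β (i + 1) + (k - (i + 1) + (i + 2) * n) * β 0 = 0 := by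
  have e := h 0 (i + 1) (by omega) hi
  push_cast at e
  linear_combination e

/-- As l ≠ 0, invariance expresses every β (i + 1) through β 0. If β 0 were nonzero, the remaining
relations would become polynomial conditions on l, n, k, solvable only at the excluded weights with
k = 3. -/
theorem IsFlatCoef.eq_zero_of_left_ne (h : IsFlatCoef k l n β) (hk : 3 ≤ k) (hl : l ≠ 0)
    (h3 : k = 3 → ¬ (l = -2 ∧ n = 0) ∧ ¬ (l = -2 / 3 ∧ n = -2 / 3)) : ∀ i ≤ k, β i = 0 := by
  have h0 : β 0 = 0 := by
    obtain ⟨d, rfl⟩ : ∃ d, k = d + 3 := ⟨k - 3, by omega⟩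
    by_contra hb
    have d0 : (0 : ℝ) ≤ d := d.cast_nonneg
    have a1 := h.apply_zero 0 (by omega)
    have a2 := h.apply_zero 1 (by omega)
    have a3 := h.apply_zero 2 (by omega)
    have e12 := h 1 2 (by omega) (by omega)
    have e13 := h 1 3 (by omega) (by omega)
    push_cast at a1 a2 a3 e12 e13
    by_cases hn : n = 0
    · subst hn
      have f1 : (1 + 2 * l) * 2 + 3 * (d + 2) = 0 := by
        refine (mul_eq_zero.1 (?_ : ((d + 1) * β 0) * _ = 0)).resolve_left
          (mul_ne_zero (by positivity) hb)
        linear_combination -6 * l * e12 + 2 * (1 + 2 * l) * a2 + 3 * (d + 1) * a1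
      have f2 : (d : ℝ) * ((1 + 3 * l) + 2 * (d + 2)) = 0 := by
        refine (mul_eq_zero.1 (?_ : β 0 * _ = 0)).resolve_left hb
        linear_combination -4 * l * e13 + (1 + 3 * l) * a3 + 2 * d * a1
      rcases mul_eq_zero.1 f2 with f2 | f2
      · exact (h3 (by simp at f2; omega)).1 ⟨by rw [f2] at f1; linarith, rfl⟩
      · linarith
    · have b0 := h.apply_zero (d + 2) (by omega)
      have b1 := h.apply_zero (d + 1) (by omega)
      have b2 := h.apply_zero d (by omega)
      have c1 := h (d + 2) (d + 3) (by omega) le_rfl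
      have c2 := h (d + 1) (d + 3) (by omega) le_rfl
      push_cast at b0 b1 b2 c1 c2
      have f1 : (d + 2 + 2 * l) * (d + 3) + 2 * (1 + (d + 3) * n) = 0 := by
        refine (mul_eq_zero.1 (?_ : ((d + 4) * n * β 0) * _ = 0)).resolve_left
          (mul_ne_zero (mul_ne_zero (by positivity) hn) hb)
        linear_combination -(l * (d + 3) * (d + 4)) * c1 + (d + 2 + 2 * l) * (d + 3) * b0 +
          2 * n * (d + 4) * b1
      have f2 : (d + 1 + 3 * l) * (d + 2) + 3 * (2 + (d + 2) * n) = 0 := by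
        refine (mul_eq_zero.1 (?_ : ((d + 4) * n * β 0) * _ = 0)).resolve_left
          (mul_ne_zero (mul_ne_zero (by positivity) hn) hb)
        linear_combination -(l * (d + 2) * (d + 4)) * c2 + (d + 1 + 3 * l) * (d + 2) * b0 +
          3 * n * (d + 4) * b2
      -- Eliminating l and n from `f1` and `f2` leaves a condition on d = k - 3 alone.
      have f3 : (d : ℝ) * ((d + 4) * (d + 5)) = 0 := by
        linear_combination 3 * (d + 2) * f1 - 2 * (d + 3) * f2
      have fd : (d : ℝ) = 0 := (mul_eq_zero.1 f3).resolve_right (by positivity)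
      have d' : d = 0 := by exact_mod_cast fd
      subst d'
      have f4 : (1 + 2 * l) * (1 / 3 + n) + (1 + 2 * n) * (1 + n) = 0 := by
        refine (mul_eq_zero.1 (?_ : β 0 * _ = 0)).resolve_left hb
        push_cast at a1 a2 e12
        linear_combination -l * e12 + (1 + 2 * l) / 3 * a2 + (1 + 2 * n) / 2 * a1
      push_cast at f1 f2
      have hn' : n = -2 / 3 := by
        have hl' : l = -4 / 3 - n := by linarith
        rw [hl'] at f4
        linarith
      exact (h3 rfl).2 ⟨by linarith, hn'⟩
  intro i hi
  rcases i with _ | i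
  · exact h0
  · have e := h.apply_zero i (by omega)
    rw [h0, mul_zero, add_zero] at e
    exact (mul_eq_zero.1 e).resolve_left (mul_ne_zero (by positivity) hl)

theorem IsFlatCoef.eq_zero_of_zero (h : IsFlatCoef k 0 0 β) (hk : 4 ≤ k) : ∀ i ≤ k, β i = 0 := by
  have k4 : (4 : ℝ) ≤ k := by exact_mod_cast hk
  have h0 : β 0 = 0 := by
    have e := h 0 1 (by omega) (by omega)
    push_cast at e
    exact (mul_eq_zero.1 (by linarith : ((k : ℝ) - 1) * β 0 = 0)).resolve_left (by linarith)
  have h1 : β 1 = 0 := by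
    have e1 := h 1 2 (by omega) (by omega)
    have e2 := h 1 3 (by omega) (by omega)
    have e3 := h 2 3 (by omega) (by omega)
    push_cast at e1 e2 e3
    have e4 : ((k : ℝ) - 3) * (k * β 1) = 0 := by
      linear_combination 2 * e2 - e3 + (k - 3) * e1
    have := (mul_eq_zero.1 e4).resolve_left (by linarith)
    exact (mul_eq_zero.1 this).resolve_left (by linarith)
  intro i hi
  rcases i with _ | _ | i
  · exact h0
  · exact h1
  · have e := h 1 (i + 2) (by omega) hi
    rw [h1] at e
    push_cast at e
    linarith

/-- The coboundary map is injective except in four cases. -/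
theorem coboundaryMap_injective {κ : ℕ} (hκ : 1 ≤ κ) (h3 : κ = 1 → (l, n) ∉ k3DimTwo)
    {β : ℕ → ℝ} (hβ : β ∈ invCoef (κ + 2) l n) (h : coboundaryMap κ l n β = 0) : β = 0 := by
  have hf := isFlatCoef_of_coboundaryMap hβ h
  refine invCoef_ext hβ ?_
  simp only [k3DimTwo, Set.mem_insert_iff, Set.mem_singleton_iff, Prod.mk.injEq, not_or] at h3
  by_cases hl : l = 0
  · by_cases hn : n = 0
    · subst hl hn
      refine hf.eq_zero_of_zero ?_
      by_contra hk
      exact (h3 (by omega)).1 ⟨rfl, rfl⟩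
    · have := hf.swap.eq_zero_of_left_ne (by omega) hn fun hk => by
        obtain ⟨_, _, h4, h5⟩ := h3 (by omega)
        exact ⟨fun h => h4 ⟨h.2, h.1⟩, fun h => h5 ⟨h.2, h.1⟩⟩
      intro i hi
      have e := this (κ + 2 - i) (by omega)
      rwa [show κ + 2 - (κ + 2 - i) = i by omega] at e
  · refine hf.eq_zero_of_left_ne (by omega) hl fun hk => ?_
    obtain ⟨_, h4, _, h5⟩ := h3 (by omega)
    exact ⟨h4, h5⟩

end Flat

theorem finrank_coboundarySpace {κ : ℕ} {l n : ℝ} (hκ : 1 ≤ κ) (h3 : κ = 1 → (l, n) ∉ k3DimTwo) :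
    Module.finrank ℝ (coboundarySpace κ l n) = Module.finrank ℝ (invCoef (κ + 2) l n) := by
  have hi : Function.Injective ((coboundaryMap κ l n).comp (invCoef (κ + 2) l n).subtype) :=
    (injective_iff_map_eq_zero _).2 fun β hβ =>
      Subtype.ext (coboundaryMap_injective hκ h3 β.2 hβ)
  have := (LinearEquiv.ofInjective _ hi).finrank_eq
  rw [this, LinearMap.range_comp, Submodule.range_subtype]
  rfl

/-! ### The equations of the space of cocycles -/

/-- The cocycle condition on `x³`, `x⁴`, in terms of the coefficients of `X'''`. -/
noncomputable def quarticForm (l n : ℝ) (i j : ℕ) (σ : ℕ → ℕ → ℝ) : ℝ :=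
  ((i + 3 * l) * (i + 2 + 2 * l) + (i + 4 * l) +
      (i + 2 * l) * (i + 2 * l + 1) * (i + 2 * l + 2) / 6) * σ (i + 3) j
    + (j + 2 * n) * ((i + 3 * l) + (i + 2 * l) * (i + 2 * l + 1) / 2) * σ (i + 2) (j + 1)
    + (i + 2 * l) * ((j + 3 * n) + (j + 2 * n) * (j + 2 * n + 1) / 2) * σ (i + 1) (j + 2)
    + ((j + 3 * n) * (j + 2 + 2 * n) + (j + 4 * n) +
      (j + 2 * n) * (j + 2 * n + 1) * (j + 2 * n + 2) / 6) * σ i (j + 3)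

/-- The cocycle condition on `x³`, `x⁶`, in terms of the coefficients of `X'''`; here `a = i + 2 l`
and `b = j + 2 n`. -/
noncomputable def sexticForm (l n : ℝ) (i j : ℕ) (σ : ℕ → ℕ → ℝ) (a b : ℝ) : ℝ :=
  ((i + 3 * l) / 6 * ((a + 2) * (a + 3) * (a + 4)) + (i + 6 * l) +
      a * (a + 1) * (a + 2) * (a + 3) * (a + 4) / 40) * σ (i + 5) j
    + ((i + 3 * l) / 2 * ((a + 2) * (a + 3)) * b +
      a * (a + 1) * (a + 2) * (a + 3) * b / 8) * σ (i + 4) (j + 1)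
    + ((i + 3 * l) / 2 * (a + 2) * (b * (b + 1)) + (j + 3 * n) / 6 * (a * (a + 1) * (a + 2)) +
      a * (a + 1) * (a + 2) * (b * (b + 1)) / 4) * σ (i + 3) (j + 2)
    + ((i + 3 * l) / 6 * (b * (b + 1) * (b + 2)) + (j + 3 * n) / 2 * (b + 2) * (a * (a + 1)) +
      a * (a + 1) * (b * (b + 1) * (b + 2)) / 4) * σ (i + 2) (j + 3)
    + ((j + 3 * n) / 2 * ((b + 2) * (b + 3)) * a +
      a * (b * (b + 1) * (b + 2) * (b + 3)) / 8) * σ (i + 1) (j + 4)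
    + ((j + 3 * n) / 6 * ((b + 2) * (b + 3) * (b + 4)) + (j + 6 * n) +
      b * (b + 1) * (b + 2) * (b + 3) * (b + 4) / 40) * σ i (j + 5)

section Equations

variable {l n : ℝ} {K : ℕ} {Γ : ℕ → ℕ → ℕ → ℝ}

/-- This and the next four lemmas iterate the invariance relation to express Γ r through Γ 3. The
result is a binomial expansion in rising products of i + 2 l and j + 2 n, with denominator (r - 3)!.
-/
theorem invSymbol_four (hΓ : Γ ∈ invSymbol (-1) l n K) (i j : ℕ) :
    Γ 4 i j = -((i + 2 * l) * Γ 3 (i + 1) j + (j + 2 * n) * Γ 3 i (j + 1)) := by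
  have e := hΓ.2 3 i j
  push_cast at e
  linear_combination e

theorem invSymbol_five (hΓ : Γ ∈ invSymbol (-1) l n K) (i j : ℕ) :
    2 * Γ 5 i j = (i + 2 * l) * (i + 2 * l + 1) * Γ 3 (i + 2) j +
      2 * (i + 2 * l) * (j + 2 * n) * Γ 3 (i + 1) (j + 1) +
      (j + 2 * n) * (j + 2 * n + 1) * Γ 3 i (j + 2) := by
  have e := hΓ.2 4 i j
  rw [invSymbol_four hΓ, invSymbol_four hΓ] at e
  push_cast at e
  linear_combination e

theorem invSymbol_six (hΓ : Γ ∈ invSymbol (-1) l n K) (i j : ℕ) :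
    6 * Γ 6 i j = -((i + 2 * l) * (i + 2 * l + 1) * (i + 2 * l + 2) * Γ 3 (i + 3) j +
      3 * (i + 2 * l) * (i + 2 * l + 1) * (j + 2 * n) * Γ 3 (i + 2) (j + 1) +
      3 * (i + 2 * l) * (j + 2 * n) * (j + 2 * n + 1) * Γ 3 (i + 1) (j + 2) +
      (j + 2 * n) * (j + 2 * n + 1) * (j + 2 * n + 2) * Γ 3 i (j + 3)) := by
  have e := hΓ.2 5 i j
  have e1 := invSymbol_five hΓ (i + 1) j
  have e2 := invSymbol_five hΓ i (j + 1)
  push_cast at e e1 e2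
  linear_combination 2 * e - (i + 2 * l) * e1 - (j + 2 * n) * e2

theorem invSymbol_seven (hΓ : Γ ∈ invSymbol (-1) l n K) (i j : ℕ) :
    24 * Γ 7 i j =
      (i + 2 * l) * (i + 2 * l + 1) * (i + 2 * l + 2) * (i + 2 * l + 3) * Γ 3 (i + 4) j +
      4 * ((i + 2 * l) * (i + 2 * l + 1) * (i + 2 * l + 2)) * (j + 2 * n) * Γ 3 (i + 3) (j + 1) +
      6 * ((i + 2 * l) * (i + 2 * l + 1)) * ((j + 2 * n) * (j + 2 * n + 1)) * Γ 3 (i + 2) (j + 2) +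
      4 * (i + 2 * l) * ((j + 2 * n) * (j + 2 * n + 1) * (j + 2 * n + 2)) * Γ 3 (i + 1) (j + 3) +
      (j + 2 * n) * (j + 2 * n + 1) * (j + 2 * n + 2) * (j + 2 * n + 3) * Γ 3 i (j + 4) := by
  have e := hΓ.2 6 i j
  have e1 := invSymbol_six hΓ (i + 1) j
  have e2 := invSymbol_six hΓ i (j + 1)
  push_cast at e e1 e2
  linear_combination 6 * e - (i + 2 * l) * e1 - (j + 2 * n) * e2

theorem invSymbol_eight (hΓ : Γ ∈ invSymbol (-1) l n K) (i j : ℕ) {a b : ℝ} (ha : a = i + 2 * l)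
    (hb : b = j + 2 * n) :
    120 * Γ 8 i j = -(a * (a + 1) * (a + 2) * (a + 3) * (a + 4) * Γ 3 (i + 5) j +
      5 * (a * (a + 1) * (a + 2) * (a + 3)) * b * Γ 3 (i + 4) (j + 1) +
      10 * (a * (a + 1) * (a + 2)) * (b * (b + 1)) * Γ 3 (i + 3) (j + 2) +
      10 * (a * (a + 1)) * (b * (b + 1) * (b + 2)) * Γ 3 (i + 2) (j + 3) +
      5 * a * (b * (b + 1) * (b + 2) * (b + 3)) * Γ 3 (i + 1) (j + 4) +
      b * (b + 1) * (b + 2) * (b + 3) * (b + 4) * Γ 3 i (j + 5)) := by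
  have e := hΓ.2 7 i j
  have e1 := invSymbol_seven hΓ (i + 1) j
  have e2 := invSymbol_seven hΓ i (j + 1)
  rw [show ((i + 1 : ℕ) : ℝ) + 2 * l = a + 1 by rw [ha]; push_cast; ring, ← hb] at e1
  rw [show ((j + 1 : ℕ) : ℝ) + 2 * n = b + 1 by rw [hb]; push_cast; ring, ← ha] at e2
  rw [← ha, ← hb] at e
  push_cast at e
  linear_combination 24 * e - a * e1 - b * e2

theorem cocycleCoef_three_four (hΓ : Γ ∈ invSymbol (-1) l n K) (i j : ℕ) :
    cocycleCoef l n Γ 3 4 i j = quarticForm l n i j (Γ 3) := by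
  have e1 := invSymbol_four hΓ (i + 2) j
  have e2 := invSymbol_four hΓ i (j + 2)
  have e3 := invSymbol_six hΓ i j
  rw [cocycleCoef, quarticForm]
  simp only [show i + 3 - 1 = i + 2 by omega, show j + 3 - 1 = j + 2 by omega,
    show i + 4 - 1 = i + 3 by omega, show j + 4 - 1 = j + 3 by omega, Nat.reduceAdd, Nat.reduceSub]
  push_cast at *
  linear_combination -(i + 3 * l) * e1 - (j + 3 * n) * e2 - e3 / 6

theorem cocycleCoef_three_six (hΓ : Γ ∈ invSymbol (-1) l n K) (i j : ℕ) {a b : ℝ}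
    (ha : a = i + 2 * l) (hb : b = j + 2 * n) :
    cocycleCoef l n Γ 3 6 i j = sexticForm l n i j (Γ 3) a b := by
  have e1 := invSymbol_six hΓ (i + 2) j
  have e2 := invSymbol_six hΓ i (j + 2)
  have e3 := invSymbol_eight hΓ i j ha hb
  rw [show ((i + 2 : ℕ) : ℝ) + 2 * l = a + 2 by rw [ha]; push_cast; ring, ← hb] at e1
  rw [show ((j + 2 : ℕ) : ℝ) + 2 * n = b + 2 by rw [hb]; push_cast; ring, ← ha] at e2
  rw [cocycleCoef, sexticForm]
  simp only [show i + 3 - 1 = i + 2 by omega, show j + 3 - 1 = j + 2 by omega,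
    show i + 6 - 1 = i + 5 by omega, show j + 6 - 1 = j + 5 by omega, Nat.reduceAdd, Nat.reduceSub]
  push_cast at *
  linear_combination -(i + 3 * l) / 6 * e1 - (j + 3 * n) / 6 * e2 - e3 / 40

theorem cocycleCoef_symm (a s i j : ℕ) :
    cocycleCoef l n Γ a s i j = -cocycleCoef l n Γ s a i j := by
  rw [cocycleCoef, cocycleCoef, add_comm s a]
  ring

theorem cocycleCoef_self (a i j : ℕ) : cocycleCoef l n Γ a a i j = 0 := by
  have := cocycleCoef_symm (l := l) (n := n) (Γ := Γ) a a i j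
  linarith

/-- The differential of a 1-cochain is again invariant under `sl(2)`. -/
theorem cocycleCoef_rel (hΓ : Γ ∈ invSymbol (-1) l n K) (a s i j : ℕ) :
    ((a : ℝ) - 1) * cocycleCoef l n Γ (a + 2) (s + 1) i j +
      (s - 1) * cocycleCoef l n Γ (a + 1) (s + 2) i j +
      (i + 2 * l) * cocycleCoef l n Γ (a + 1) (s + 1) (i + 1) j +
      (j + 2 * n) * cocycleCoef l n Γ (a + 1) (s + 1) i (j + 1) = 0 := by
  have e1 := hΓ.2 (s + 1) (i + a) j
  have e2 := hΓ.2 (s + 1) i (j + a)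
  have e3 := hΓ.2 (a + 1) (i + s) j
  have e4 := hΓ.2 (a + 1) i (j + s)
  have e5 := hΓ.2 (a + s + 1) i j
  have q1 : ∀ x y : ℕ, x + (y + 2) - 1 = x + y + 1 := fun x y => by omega
  have q2 : ∀ x y : ℕ, x + (y + 1) - 1 = x + y := fun x y => by omega
  simp only [cocycleCoef, q1, q2]
  rw [show a + 2 + s = a + s + 1 + 1 by ring, show a + 1 + s + 1 = a + s + 1 + 1 by ring,
    show a + 1 + s = a + s + 1 by ring]
  simp only [show ∀ x y : ℕ, x + 1 + y = x + y + 1 from fun x y => by ring] at *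
  push_cast at *
  linear_combination -(i + l * (a + 1)) * e1 - (j + n * (a + 1)) * e2 + (i + l * (s + 1)) * e3 +
    (j + n * (s + 1)) * e4 - (s - a) * e5

/-- By homogeneity of the symbol only a + s + i + j = K + 1 can give a condition. -/
theorem cocycleCoef_eq_zero_of_ne (hΓ : Γ ∈ invSymbol (-1) l n K) {a s i j : ℕ} (ha : 3 ≤ a)
    (hs : 3 ≤ s) (h : a + s + i + j ≠ K + 1) : cocycleCoef l n Γ a s i j = 0 := by
  have h0 : ∀ r i j, r + i + j ≠ K → Γ r i j = 0 := hΓ.1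
  rw [cocycleCoef, h0 s (i + a - 1) j (by omega), h0 s i (j + a - 1) (by omega),
    h0 a (i + s - 1) j (by omega), h0 a i (j + s - 1) (by omega), h0 (a + s - 1) i j (by omega)]
  ring

/-- For `k ≤ 7`, the cocycle conditions on `x³, x⁴` and on `x³, x⁶` imply all others. -/
theorem mem_cocycleSymbol_of_forms (hK : K ≤ 8) (hΓ : Γ ∈ invSymbol (-1) l n K)
    (h3 : ∀ r < 3, ∀ i j, Γ r i j = 0) (h4 : ∀ i j, cocycleCoef l n Γ 3 4 i j = 0)
    (h6 : ∀ i j, cocycleCoef l n Γ 3 6 i j = 0) : Γ ∈ cocycleSymbol l n K := by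
  -- Invariance relates the pairs (4, 4), (3, 5) and (3, 4); the first vanishes by skew-symmetry. In
  -- the same way (4, 5) follows next from (3, 6) and (3, 5).
  have h5 : ∀ i j, cocycleCoef l n Γ 3 5 i j = 0 := by
    intro i j
    have e := cocycleCoef_rel hΓ 2 3 i j
    rw [cocycleCoef_self, h4, h4] at e
    push_cast at e
    linarith
  have h45 : ∀ i j, cocycleCoef l n Γ 4 5 i j = 0 := by
    intro i j
    have e := cocycleCoef_rel hΓ 2 4 i j
    simp only [Nat.reduceAdd, h6, h5] at e
    push_cast at e
    linarith
  have hlt : ∀ a s i j, 3 ≤ a → a < s → cocycleCoef l n Γ a s i j = 0 := by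
    intro a s i j ha has
    by_cases h : a + s + i + j = K + 1
    · have ha4 : a ≤ 4 := by omega
      have hs6 : s ≤ 6 := by omega
      interval_cases a <;> interval_cases s
      · exact h4 i j
      · exact h5 i j
      · exact h6 i j
      · exact h45 i j
      · omega
    · exact cocycleCoef_eq_zero_of_ne hΓ ha (by omega) h
  refine ⟨hΓ, h3, fun a s i j ha hs => ?_⟩
  rcases lt_trichotomy a s with h | rfl | h
  · exact hlt _ _ _ _ ha h
  · exact cocycleCoef_self _ _ _
  · rw [cocycleCoef_symm, hlt _ _ _ _ hs h, neg_zero]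

end Equations

/-- The `sl(2)`-equivariant symbol with given coefficients of `X'''`. -/
noncomputable def genSymbol (κ : ℕ) (l n : ℝ) (s : ℕ → ℝ) : ℕ → ℕ → ℕ → ℝ
  | 0, _, _ => 0
  | 1, _, _ => 0
  | 2, _, _ => 0
  | 3, i, j => if i + j = κ then s i else 0
  | r + 4, i, j => -((i + 2 * l) * genSymbol κ l n s (r + 3) (i + 1) j +
      (j + 2 * n) * genSymbol κ l n s (r + 3) i (j + 1)) / (r + 1)

/-- In the relation at r = 2 the coefficient r - 2 of Γ 3 vanishes, so Γ 3 is unconstrained; from r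
= 3 on the relation is the recursive definition, whose denominator is nonzero. -/
theorem genSymbol_mem (κ : ℕ) (l n : ℝ) (s : ℕ → ℝ) :
    genSymbol κ l n s ∈ invSymbol (-1) l n (κ + 3) := by
  constructor
  · have h : ∀ r i j, r + i + j ≠ κ → genSymbol κ l n s (r + 3) i j = 0 := by
      intro r
      induction r with
      | zero => exact fun i j h => if_neg (by omega)
      | succ r ih =>
        intro i j h
        rw [genSymbol, ih _ _ (by omega), ih _ _ (by omega)]
        simp
    intro r i j hr
    match r, hr with
    | 0, _ => rfl
    | 1, _ => rfl
    | 2, _ => rfl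
    | r + 3, hr => exact h r i j (by omega)
  · intro r i j
    match r with
    | 0 => simp [genSymbol]
    | 1 => simp [genSymbol]
    | 2 => simp [genSymbol]
    | r + 3 =>
      rw [genSymbol]
      have : (r : ℝ) + 1 ≠ 0 := by positivity
      push_cast
      field_simp
      ring

/-! ### The space of cocycles cut out by the quartic and sextic forms -/

section CocycleSpace

variable {κ : ℕ} {l n : ℝ}

theorem forms_eq_zero_of_mem {v : Fin (κ + 1) → ℝ} (hv : v ∈ cocycleSpace κ l n) :
    ∃ s : ℕ → ℝ, (∀ i : Fin (κ + 1), v i = s i) ∧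
      (∀ i j, i + j + 3 = κ → quarticForm l n i j (fun i _ => s i) = 0) ∧
      ∀ i j, i + j + 5 = κ → sexticForm l n i j (fun i _ => s i) (i + 2 * l) (j + 2 * n) = 0 := by
  obtain ⟨Γ, hΓ, rfl⟩ := hv
  refine ⟨fun i => Γ 3 i (κ - i), fun i => rfl, fun i j h => ?_, fun i j h => ?_⟩
  · have e := hΓ.2.2 3 4 i j le_rfl (by omega)
    rw [cocycleCoef_three_four hΓ.1] at e
    rw [← e, quarticForm, quarticForm]
    beta_reduce
    rw [show κ - (i + 3) = j by omega,
      show κ - (i + 2) = j + 1 by omega, show κ - (i + 1) = j + 2 by omega,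
      show κ - i = j + 3 by omega]
  · have e := hΓ.2.2 3 6 i j le_rfl (by omega)
    rw [cocycleCoef_three_six hΓ.1 i j rfl rfl] at e
    rw [← e, sexticForm, sexticForm]
    beta_reduce
    rw [show κ - (i + 5) = j by omega,
      show κ - (i + 4) = j + 1 by omega, show κ - (i + 3) = j + 2 by omega,
      show κ - (i + 2) = j + 3 by omega, show κ - (i + 1) = j + 4 by omega,
      show κ - i = j + 5 by omega]

theorem mem_cocycleSpace_of_forms (hκ : κ ≤ 5) (s : ℕ → ℝ)
    (h4 : ∀ i j, i + j + 3 = κ → quarticForm l n i j (fun i _ => s i) = 0)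
    (h6 : ∀ i j, i + j + 5 = κ →
      sexticForm l n i j (fun i _ => s i) (i + 2 * l) (j + 2 * n) = 0) :
    (fun i : Fin (κ + 1) => s i) ∈ cocycleSpace κ l n := by
  have hΓ := genSymbol_mem κ l n s
  have hs : ∀ i j, i + j = κ → genSymbol κ l n s 3 i j = s i := fun i j h => by
    rw [genSymbol, if_pos h]
  refine ⟨_, mem_cocycleSymbol_of_forms (by omega) hΓ ?_ (fun i j => ?_) fun i j => ?_,
    funext fun i => hs _ _ (by omega)⟩
  · intro r hr i j
    interval_cases r <;> rfl
  · by_cases h : i + j + 3 = κ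
    · rw [cocycleCoef_three_four hΓ, ← h4 i j h, quarticForm, quarticForm, hs _ _ (by omega),
        hs _ _ (by omega), hs _ _ (by omega), hs _ _ (by omega)]
    · exact cocycleCoef_eq_zero_of_ne hΓ le_rfl (by omega) (by omega)
  · by_cases h : i + j + 5 = κ
    · rw [cocycleCoef_three_six hΓ i j rfl rfl, ← h6 i j h, sexticForm, sexticForm,
        hs _ _ (by omega), hs _ _ (by omega), hs _ _ (by omega), hs _ _ (by omega),
        hs _ _ (by omega), hs _ _ (by omega)]
    · exact cocycleCoef_eq_zero_of_ne hΓ le_rfl (by omega) (by omega)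

end CocycleSpace

/-! ### Dimensions for small orders -/

/-- The kernels of a matrix and of its transpose. -/
theorem finrank_ker_mulVecLin {r c : ℕ} (M : Matrix (Fin r) (Fin c) ℝ) :
    Module.finrank ℝ (LinearMap.ker M.mulVecLin) + r =
      c + Module.finrank ℝ (LinearMap.ker M.vecMulLinear) := by
  have h1 := M.mulVecLin.finrank_range_add_finrank_ker
  have h2 := M.vecMulLinear.finrank_range_add_finrank_ker
  have h3 : Module.finrank ℝ (LinearMap.range M.mulVecLin) =
      Module.finrank ℝ (LinearMap.range M.vecMulLinear) := by
    rw [← Matrix.mulVecLin_transpose]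
    exact M.rank_transpose.symm
  rw [Module.finrank_fin_fun] at h1 h2
  omega

theorem finrank_eq_one_of_functional {V : Type*} [AddCommGroup V] [Module ℝ V]
    {W : Submodule ℝ V} (f : V →ₗ[ℝ] ℝ) {w : V} (hw : w ∈ W) (hw0 : w ≠ 0)
    (hf : ∀ v ∈ W, f v = 0 → v = 0) : Module.finrank ℝ W = 1 := by
  have hfw : f w ≠ 0 := fun h => hw0 (hf w hw h)
  refine (LinearEquiv.ofBijective (f.comp W.subtype) ⟨?_, ?_⟩).finrank_eq.trans
    (Module.finrank_self ℝ)
  · exact (injective_iff_map_eq_zero _).2 fun v hv => Subtype.ext (hf v.1 v.2 hv)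
  · intro x
    refine ⟨(x / f w) • ⟨w, hw⟩, ?_⟩
    rw [map_smul, smul_eq_mul]
    exact div_mul_cancel₀ x hfw

theorem finrank_eq_zero_of_forall {V : Type*} [AddCommGroup V] [Module ℝ V]
    {W : Submodule ℝ V} (h : ∀ v ∈ W, v = 0) : Module.finrank ℝ W = 0 := by
  rw [(Submodule.eq_bot_iff W).2 h, finrank_bot]

theorem mem_cocycleSpace_iff {κ : ℕ} {l n : ℝ} (hκ : κ ≤ 5) (s : ℕ → ℝ) :
    (fun i : Fin (κ + 1) => s i) ∈ cocycleSpace κ l n ↔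
      (∀ i j, i + j + 3 = κ → quarticForm l n i j (fun i _ => s i) = 0) ∧
      ∀ i j, i + j + 5 = κ → sexticForm l n i j (fun i _ => s i) (i + 2 * l) (j + 2 * n) = 0 := by
  refine ⟨fun h => ?_, fun h => mem_cocycleSpace_of_forms hκ s h.1 h.2⟩
  obtain ⟨s', h1, h2, h3⟩ := forms_eq_zero_of_mem h
  have e : ∀ i ≤ κ, s i = s' i := fun i hi => h1 ⟨i, by omega⟩
  refine ⟨fun i j hij => ?_, fun i j hij => ?_⟩
  · rw [← h2 i j hij, quarticForm, quarticForm, e _ (by omega), e _ (by omega), e _ (by omega),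
      e _ (by omega)]
  · rw [← h3 i j hij, sexticForm, sexticForm, e _ (by omega), e _ (by omega), e _ (by omega),
      e _ (by omega), e _ (by omega), e _ (by omega)]

/-- Extension of a finite sequence by zero. -/
noncomputable def extendFin {N : ℕ} (v : Fin N → ℝ) (i : ℕ) : ℝ := if h : i < N then v ⟨i, h⟩ else 0

theorem extendFin_coe {N : ℕ} (v : Fin N → ℝ) : (fun i : Fin N => extendFin v i) = v := by
  funext i
  simp [extendFin]

/-- A quartic equation needs κ ≥ 3 and a sextic one κ ≥ 5, so every choice of leading coefficients
is a cocycle. -/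
theorem finrank_cocycleSpace_of_le_two {κ : ℕ} (hκ : κ ≤ 2) (l n : ℝ) :
    Module.finrank ℝ (cocycleSpace κ l n) = κ + 1 := by
  have : cocycleSpace κ l n = ⊤ := by
    refine (Submodule.eq_top_iff').2 fun v => ?_
    rw [← extendFin_coe v, mem_cocycleSpace_iff (by omega)]
    exact ⟨fun i j h => by omega, fun i j h => by omega⟩
  rw [this, finrank_top, Module.finrank_fin_fun]

/-! ### The case k = 2 -/

section Two

variable {l n : ℝ}

/-- For κ = 0 the coboundary is -3 (l β₂ + n β₀), and eliminating β₁ from the two invariance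
relations makes it zero at these weights. -/
theorem finrank_coboundarySpace_zero_of_mem (h : (l, n) ∈ k2DimOne) :
    Module.finrank ℝ (coboundarySpace 0 l n) = 0 := by
  refine finrank_eq_zero_of_forall ?_
  rintro _ ⟨β, hβ, rfl⟩
  funext i
  have hi : (i : ℕ) = 0 := by omega
  show -((i + 3 * l) * β (i + 2) + ((0 - i : ℕ) + 3 * n) * β i) = 0
  rw [hi]
  have e0 := hβ.2 0 1 rfl
  have e1 := hβ.2 1 0 rfl
  push_cast at e0 e1
  norm_num at e0 e1 ⊢
  simp only [k2DimOne, Set.mem_ofPred_eq, ne_eq, Prod.mk.injEq, not_and] at h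
  rcases h with ⟨h1, h2⟩ | ⟨rfl, h2⟩ | ⟨rfl, h2⟩
  · have hn : n = -1 - l := by linarith
    subst hn
    have hl : 1 + 2 * l ≠ 0 := fun h => h2 (by linarith) (by linarith)
    have : (1 + 2 * l) * (3 * l * β 2 + 3 * (-1 - l) * β 0) = 0 := by
      linear_combination 3 * l * e1 + 3 * (l + 1) * e0
    linarith [(mul_eq_zero.1 this).resolve_left hl]
  · have h3 : 1 + 2 * n ≠ 0 := fun h => h2 (by linarith)
    have : (1 + 2 * n) * β 0 = 0 := by linarith
    rw [(mul_eq_zero.1 this).resolve_left h3]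
    ring
  · have h3 : 1 + 2 * l ≠ 0 := fun h => h2 (by linarith)
    have : (1 + 2 * l) * β 2 = 0 := by linarith
    rw [(mul_eq_zero.1 this).resolve_left h3]
    ring

theorem finrank_coboundarySpace_zero_of_notMem (h : (l, n) ∉ k2DimOne) :
    Module.finrank ℝ (coboundarySpace 0 l n) = 1 := by
  obtain ⟨b0, b1, b2, e0, e1, hb⟩ : ∃ b0 b1 b2 : ℝ, 2 * l * b1 + (1 + 2 * n) * b0 = 0 ∧
      (1 + 2 * l) * b2 + 2 * n * b1 = 0 ∧ l * b2 + n * b0 ≠ 0 := by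
    simp only [k2DimOne, Set.mem_ofPred_eq, ne_eq, Prod.mk.injEq, not_or, not_and, not_not] at h
    obtain ⟨h1, h2, h3⟩ := h
    by_cases hl : l = 0
    · obtain rfl := h2 hl
      exact ⟨1, 0, 0, by ring, by ring, by norm_num⟩
    by_cases hn : n = 0
    · obtain rfl := h3 hn
      exact ⟨0, 0, 1, by ring, by ring, by norm_num⟩
    by_cases hln : l + n + 1 = 0
    · obtain ⟨rfl, rfl⟩ : l = -1 / 2 ∧ n = -1 / 2 := by
        by_contra h4
        exact h1 hln fun a b => h4 ⟨a, b⟩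
      exact ⟨1, 0, 0, by ring, by ring, by norm_num⟩
    -- The second transvectant; its coboundary is proportional to l n (l + n + 1). Where that
    -- product vanishes outside `k2DimOne`, an operator with a single nonzero coefficient is used
    -- instead.
    refine ⟨2 * l * (1 + 2 * l), -((1 + 2 * n) * (1 + 2 * l)), 2 * n * (1 + 2 * n), by ring, by ring,
      fun h0 => ?_⟩
    have : l * n * (l + n + 1) = 0 := by linear_combination h0 / 4
    exact mul_ne_zero (mul_ne_zero hl hn) hln this
  have hβ : (fun i => if i = 0 then b0 else if i = 1 then b1 else if i = 2 then b2 else 0) ∈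
      invCoef 2 l n := by
    refine mem_invCoef (fun i hi => ?_) fun i hi => ?_
    · rw [if_neg (by omega), if_neg (by omega), if_neg (by omega)]
    · interval_cases i
      · norm_num
        linarith
      · norm_num
        linarith
  refine finrank_eq_one_of_functional (LinearMap.proj 0) ⟨_, hβ, rfl⟩ ?_ ?_
  · intro h0
    have := congrFun h0 0
    have e : -(((0 : ℕ) + 3 * l) * b2 + ((0 : ℕ) + 3 * n) * b0) = 0 := this
    apply hb
    push_cast at e
    linarith
  · intro v _ hv
    funext i
    obtain rfl : i = 0 := Fin.ext (by omega)
    exact hv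

theorem h1Iso_two (lam nu mu : ℝ) (hk : mu - lam - nu = 2) :
    ((lam, nu) ∈ k2DimOne → H1Iso lam nu mu 1) ∧ ((lam, nu) ∉ k2DimOne → H1Iso lam nu mu 0) := by
  have hm : mu = lam + nu + ((0 : ℕ) + 2) := by push_cast; linarith
  refine ⟨fun h => h1Iso_of_finrank hm ?_, fun h => h1Iso_of_finrank hm ?_⟩
  · rw [finrank_coboundarySpace_zero_of_mem h, finrank_cocycleSpace_of_le_two (by norm_num)]
  · rw [finrank_coboundarySpace_zero_of_notMem h, finrank_cocycleSpace_of_le_two (by norm_num)]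

end Two

/-! ### The case k = 3 -/

section Three

variable {l n : ℝ}

/-- At these four weights the invariance relations already imply both x³ relations, so every
coboundary vanishes. -/
theorem finrank_coboundarySpace_one_of_mem (h : (l, n) ∈ k3DimTwo) :
    Module.finrank ℝ (coboundarySpace 1 l n) = 0 := by
  refine finrank_eq_zero_of_forall ?_
  rintro _ ⟨β, hβ, rfl⟩
  have e0 := hβ.2 0 2 rfl
  have e1 := hβ.2 1 1 rfl
  have e2 := hβ.2 2 0 rfl
  push_cast at e0 e1 e2
  norm_num at e0 e1 e2
  have key : 3 * l * β 2 + (1 + 3 * n) * β 0 = 0 ∧ (1 + 3 * l) * β 3 + 3 * n * β 1 = 0 := by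
    simp only [k3DimTwo, Set.mem_insert_iff, Set.mem_singleton_iff, Prod.mk.injEq] at h
    rcases h with ⟨rfl, rfl⟩ | ⟨rfl, rfl⟩ | ⟨rfl, rfl⟩ | ⟨rfl, rfl⟩ <;> constructor <;> linarith
  funext i
  show -((i + 3 * l) * β (i + 2) + ((1 - i : ℕ) + 3 * n) * β i) = 0
  fin_cases i
  · norm_num
    linarith [key.1]
  · norm_num
    linarith [key.2]

/-- The double weights are l = -i₀ / 2, n = (i₁ - k + 1) / 2 with 0 ≤ i₁ ≤ i₀ < k, so there are k (k
+ 1) / 2 of them; the later orders are enumerated in the same way. -/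
theorem isDoubleWeight_three : IsDoubleWeight 3 l n ↔ (l, n) ∈ k3DimZero := by
  simp only [k3DimZero, Set.mem_insert_iff, Set.mem_singleton_iff, Prod.mk.injEq]
  constructor
  · rintro ⟨i, j, h1, h2, h3, h4⟩
    interval_cases i <;> interval_cases j <;> push_cast at h3 h4
    · exact Or.inr (Or.inr (Or.inr (Or.inl ⟨by linarith, by linarith⟩)))
    · exact Or.inl ⟨by linarith, by linarith⟩
    · exact Or.inr (Or.inr (Or.inr (Or.inr (Or.inr ⟨by linarith, by linarith⟩))))
    · exact Or.inr (Or.inr (Or.inl ⟨by linarith, by linarith⟩))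
    · exact Or.inr (Or.inl ⟨by linarith, by linarith⟩)
    · exact Or.inr (Or.inr (Or.inr (Or.inr (Or.inl ⟨by linarith, by linarith⟩))))
  · rintro (⟨rfl, rfl⟩ | ⟨rfl, rfl⟩ | ⟨rfl, rfl⟩ | ⟨rfl, rfl⟩ | ⟨rfl, rfl⟩ | ⟨rfl, rfl⟩)
    · exact ⟨1, 0, by norm_num⟩
    · exact ⟨2, 1, by norm_num⟩
    · exact ⟨2, 0, by norm_num⟩
    · exact ⟨0, 0, by norm_num⟩
    · exact ⟨2, 2, by norm_num⟩
    · exact ⟨1, 1, by norm_num⟩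

theorem h1Iso_three (lam nu mu : ℝ) (hk : mu - lam - nu = 3) :
    ((lam, nu) ∈ k3DimTwo → H1Iso lam nu mu 2) ∧
      ((lam, nu) ∉ k3DimTwo → (lam, nu) ∉ k3DimZero → H1Iso lam nu mu 1) ∧
      ((lam, nu) ∈ k3DimZero → H1Iso lam nu mu 0) := by
  have hm : mu = lam + nu + ((1 : ℕ) + 2) := by push_cast; linarith
  refine ⟨fun h => h1Iso_of_finrank hm ?_, fun h h' => h1Iso_of_finrank hm ?_,
    fun h => h1Iso_of_finrank hm ?_⟩
  · rw [finrank_coboundarySpace_one_of_mem h, finrank_cocycleSpace_of_le_two (by norm_num)]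
  · rw [finrank_coboundarySpace le_rfl fun _ => h, finrank_cocycleSpace_of_le_two (by norm_num),
      finrank_invCoef_one fun hd => h' (isDoubleWeight_three.1 hd)]
  · have h' : (lam, nu) ∉ k3DimTwo := by
      simp only [k3DimZero, k3DimTwo, Set.mem_insert_iff, Set.mem_singleton_iff,
        Prod.mk.injEq] at h ⊢
      rcases h with ⟨rfl, rfl⟩ | ⟨rfl, rfl⟩ | ⟨rfl, rfl⟩ | ⟨rfl, rfl⟩ | ⟨rfl, rfl⟩ | ⟨rfl, rfl⟩ <;>
        norm_num
    rw [finrank_coboundarySpace le_rfl fun _ => h', finrank_cocycleSpace_of_le_two (by norm_num),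
      finrank_invCoef_two (isDoubleWeight_three.2 h)]

end Three

/-! ### The case k = 4 -/

section Four

variable {l n : ℝ}

theorem isDoubleWeight_four : IsDoubleWeight 4 l n ↔ (l, n) ∈ k4DimOne := by
  simp only [k4DimOne, Set.mem_insert_iff, Set.mem_singleton_iff, Prod.mk.injEq]
  constructor
  · rintro ⟨i, j, h1, h2, h3, h4⟩
    have hl : l = -i / 2 := by linarith
    have hn : n = (j - 3) / 2 := by push_cast at h4; linarith
    subst hl hn
    interval_cases i <;> interval_cases j <;> norm_num
  · rintro (⟨rfl, rfl⟩ | ⟨rfl, rfl⟩ | ⟨rfl, rfl⟩ | ⟨rfl, rfl⟩ | ⟨rfl, rfl⟩ | ⟨rfl, rfl⟩ | ⟨rfl, rfl⟩ |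
      ⟨rfl, rfl⟩ | ⟨rfl, rfl⟩ | ⟨rfl, rfl⟩)
    · exact ⟨0, 0, by norm_num⟩
    · exact ⟨3, 3, by norm_num⟩
    · exact ⟨2, 1, by norm_num⟩
    · exact ⟨1, 0, by norm_num⟩
    · exact ⟨3, 2, by norm_num⟩
    · exact ⟨3, 1, by norm_num⟩
    · exact ⟨2, 0, by norm_num⟩
    · exact ⟨3, 0, by norm_num⟩
    · exact ⟨1, 1, by norm_num⟩
    · exact ⟨2, 2, by norm_num⟩

theorem h1Iso_four (lam nu mu : ℝ) (hk : mu - lam - nu = 4) :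
    ((lam, nu) ∉ k4DimOne → H1Iso lam nu mu 2) ∧ ((lam, nu) ∈ k4DimOne → H1Iso lam nu mu 1) := by
  have hm : mu = lam + nu + ((2 : ℕ) + 2) := by push_cast; linarith
  refine ⟨fun h => h1Iso_of_finrank hm ?_, fun h => h1Iso_of_finrank hm ?_⟩ <;>
    rw [finrank_coboundarySpace (by norm_num) (by norm_num), finrank_cocycleSpace_of_le_two le_rfl]
  · rw [finrank_invCoef_one fun hd => h (isDoubleWeight_four.1 hd)]
  · rw [finrank_invCoef_two (isDoubleWeight_four.2 h)]

end Four

theorem mem_ker_vecMulLinear {r c : ℕ} {M : Matrix (Fin r) (Fin c) ℝ} {w : Fin r → ℝ} :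
    w ∈ LinearMap.ker M.vecMulLinear ↔ ∀ j, ∑ i, w i * M i j = 0 :=
  funext_iff

/-! ### The case k = 5 -/

section Five

variable {l n : ℝ}

theorem isDoubleWeight_five : IsDoubleWeight 5 l n ↔
    (l, n) ∈ k5DimOne ∪ {(0, -2), (-2, 0), (-2, -2)} := by
  simp only [k5DimOne, Set.mem_union, Set.mem_insert_iff, Set.mem_singleton_iff, Prod.mk.injEq]
  constructor
  · rintro ⟨i, j, h1, h2, h3, h4⟩
    have hl : l = -i / 2 := by linarith
    have hn : n = (j - 4) / 2 := by push_cast at h4; linarith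
    subst hl hn
    interval_cases i <;> interval_cases j <;> norm_num
  · rintro ((⟨rfl, rfl⟩ | ⟨rfl, rfl⟩ | ⟨rfl, rfl⟩ | ⟨rfl, rfl⟩ | ⟨rfl, rfl⟩ | ⟨rfl, rfl⟩ |
      ⟨rfl, rfl⟩ | ⟨rfl, rfl⟩ | ⟨rfl, rfl⟩ | ⟨rfl, rfl⟩ | ⟨rfl, rfl⟩ | ⟨rfl, rfl⟩) |
      ⟨rfl, rfl⟩ | ⟨rfl, rfl⟩ | ⟨rfl, rfl⟩)
    · exact ⟨1, 1, by norm_num⟩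
    · exact ⟨3, 3, by norm_num⟩
    · exact ⟨1, 0, by norm_num⟩
    · exact ⟨4, 3, by norm_num⟩
    · exact ⟨2, 0, by norm_num⟩
    · exact ⟨4, 2, by norm_num⟩
    · exact ⟨2, 1, by norm_num⟩
    · exact ⟨3, 2, by norm_num⟩
    · exact ⟨2, 2, by norm_num⟩
    · exact ⟨3, 0, by norm_num⟩
    · exact ⟨4, 1, by norm_num⟩
    · exact ⟨3, 1, by norm_num⟩
    · exact ⟨0, 0, by norm_num⟩
    · exact ⟨4, 4, by norm_num⟩
    · exact ⟨4, 0, by norm_num⟩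

/-- The cocycle equation for `k = 5`. -/
noncomputable def cocycleMatrixFive (l n : ℝ) : Matrix (Fin 1) (Fin 4) ℝ :=
  !![4 / 3 * n * (n + 2) * (n + 4), 4 * l * n * (n + 2), 4 * l * n * (l + 2),
    4 / 3 * l * (l + 2) * (l + 4)]

theorem cocycleSpace_three :
    cocycleSpace 3 l n = LinearMap.ker (cocycleMatrixFive l n).mulVecLin := by
  ext v
  have h := mem_cocycleSpace_iff (l := l) (n := n) (κ := 3) (by norm_num) (extendFin v)
  rw [extendFin_coe] at h
  have e0 : extendFin v 0 = v 0 := rfl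
  have e1 : extendFin v 1 = v 1 := rfl
  have e2 : extendFin v 2 = v 2 := rfl
  have e3 : extendFin v 3 = v 3 := rfl
  have key : (cocycleMatrixFive l n).mulVecLin v 0 =
      quarticForm l n 0 0 fun i _ => extendFin v i := by
    simp only [cocycleMatrixFive, quarticForm, Matrix.mulVecLin_apply, Matrix.mulVec, dotProduct,
      Fin.sum_univ_four, e0, e1, e2, e3, Nat.reduceAdd, zero_add, Nat.cast_zero]
    simp
    ring
  rw [h, LinearMap.mem_ker]
  constructor
  · rintro ⟨h4, -⟩
    funext i
    obtain rfl : i = 0 := Subsingleton.elim _ _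
    rw [key]
    exact h4 0 0 rfl
  · intro h0
    refine ⟨fun i j hij => ?_, fun i j hij => by omega⟩
    obtain ⟨rfl, rfl⟩ : i = 0 ∧ j = 0 := by omega
    rw [← key, h0]
    rfl

/-- The outer entries put l and n in {0, -2, -4}, and the middle entries select six of the nine
pairs. -/
theorem cocycleMatrixFive_eq_zero (hM : cocycleMatrixFive l n = 0) :
    (l, n) ∈ k5DimThree ∪ {(0, -2), (-2, 0), (-2, -2)} := by
  have e (j : Fin 4) : cocycleMatrixFive l n 0 j = 0 := by rw [hM]; rfl
  have e0 : 4 / 3 * n * (n + 2) * (n + 4) = 0 := e 0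
  have e1 : 4 * l * n * (n + 2) = 0 := e 1
  have e2 : 4 * l * n * (l + 2) = 0 := e 2
  have e3 : 4 / 3 * l * (l + 2) * (l + 4) = 0 := e 3
  simp only [k5DimThree, Set.mem_union, Set.mem_insert_iff, Set.mem_singleton_iff, Prod.mk.injEq]
  have hl : l = 0 ∨ l = -2 ∨ l = -4 := by
    have h : l * ((l + 2) * (l + 4)) = 0 := by linear_combination 3 / 4 * e3
    simp only [mul_eq_zero, add_eq_zero_iff_eq_neg] at h
    exact h
  have hn : n = 0 ∨ n = -2 ∨ n = -4 := by
    have h : n * ((n + 2) * (n + 4)) = 0 := by linear_combination 3 / 4 * e0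
    simp only [mul_eq_zero, add_eq_zero_iff_eq_neg] at h
    exact h
  rcases hl with rfl | rfl | rfl <;> rcases hn with rfl | rfl | rfl <;> norm_num at *

theorem finrank_cocycleSpace_three_of_ne (hM : cocycleMatrixFive l n ≠ 0) :
    Module.finrank ℝ (cocycleSpace 3 l n) = 3 := by
  have h := finrank_ker_mulVecLin (cocycleMatrixFive l n)
  have h0 : Module.finrank ℝ (LinearMap.ker (cocycleMatrixFive l n).vecMulLinear) = 0 := by
    refine finrank_eq_zero_of_forall fun w hw => ?_
    by_contra hw0
    apply hM
    ext i j
    obtain rfl : i = 0 := Subsingleton.elim _ _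
    have e := mem_ker_vecMulLinear.1 hw j
    rw [Fin.sum_univ_one] at e
    refine (mul_eq_zero.1 e).resolve_left fun h0 => hw0 ?_
    funext i
    rw [Subsingleton.elim i 0]
    exact h0
  refine (congrArg (fun W : Submodule ℝ (Fin 4 → ℝ) => Module.finrank ℝ W)
    cocycleSpace_three).trans ?_
  omega

theorem finrank_cocycleSpace_three_of_eq (hM : cocycleMatrixFive l n = 0) :
    Module.finrank ℝ (cocycleSpace 3 l n) = 4 := by
  rw [cocycleSpace_three, hM, Matrix.mulVecLin_zero, LinearMap.ker_zero, finrank_top,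
    Module.finrank_fin_fun]

theorem h1Iso_five (lam nu mu : ℝ) (hk : mu - lam - nu = 5) :
    ((lam, nu) ∈ k5DimThree → H1Iso lam nu mu 3) ∧
      ((lam, nu) ∉ k5DimThree → (lam, nu) ∉ k5DimOne → H1Iso lam nu mu 2) ∧
      ((lam, nu) ∈ k5DimOne → H1Iso lam nu mu 1) := by
  have hm : mu = lam + nu + ((3 : ℕ) + 2) := by push_cast; linarith
  have hB := finrank_coboundarySpace (κ := 3) (l := lam) (n := nu) (by norm_num) (by norm_num)
  refine ⟨fun h => h1Iso_of_finrank hm ?_, fun h h' => h1Iso_of_finrank hm ?_,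
    fun h => h1Iso_of_finrank hm ?_⟩ <;> rw [hB]
  · rw [finrank_invCoef_one, finrank_cocycleSpace_three_of_eq]
    · simp only [k5DimThree, Set.mem_insert_iff, Set.mem_singleton_iff, Prod.mk.injEq] at h
      rcases h with ⟨rfl, rfl⟩ | ⟨rfl, rfl⟩ | ⟨rfl, rfl⟩ <;> ext i j <;> fin_cases i <;>
        fin_cases j <;> norm_num [cocycleMatrixFive]
    · intro hd
      rw [isDoubleWeight_five] at hd
      simp only [k5DimThree, k5DimOne, Set.mem_union, Set.mem_insert_iff, Set.mem_singleton_iff,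
        Prod.mk.injEq] at h hd
      rcases h with ⟨rfl, rfl⟩ | ⟨rfl, rfl⟩ | ⟨rfl, rfl⟩ <;> norm_num at hd
  -- At these three weights the cocycle equation disappears, but there is also a second invariant
  -- operator, so the dimension of H¹ stays 2.
  · by_cases hd : (lam, nu) ∈ ({(0, -2), (-2, 0), (-2, -2)} : Set (ℝ × ℝ))
    · rw [finrank_invCoef_two (isDoubleWeight_five.2 (Or.inr hd)), finrank_cocycleSpace_three_of_eq]
      simp only [Set.mem_insert_iff, Set.mem_singleton_iff, Prod.mk.injEq] at hd
      rcases hd with ⟨rfl, rfl⟩ | ⟨rfl, rfl⟩ | ⟨rfl, rfl⟩ <;> ext i j <;> fin_cases i <;>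
        fin_cases j <;> norm_num [cocycleMatrixFive]
    · rw [finrank_invCoef_one fun hd' => (isDoubleWeight_five.1 hd').elim h' hd,
        finrank_cocycleSpace_three_of_ne fun hM => (cocycleMatrixFive_eq_zero hM).elim h hd]
  · have hM : cocycleMatrixFive lam nu ≠ 0 := by
      intro hM
      have := cocycleMatrixFive_eq_zero hM
      simp only [k5DimThree, k5DimOne, Set.mem_union, Set.mem_insert_iff, Set.mem_singleton_iff,
        Prod.mk.injEq] at h this
      rcases h with ⟨rfl, rfl⟩ | ⟨rfl, rfl⟩ | ⟨rfl, rfl⟩ | ⟨rfl, rfl⟩ | ⟨rfl, rfl⟩ | ⟨rfl, rfl⟩ |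
        ⟨rfl, rfl⟩ | ⟨rfl, rfl⟩ | ⟨rfl, rfl⟩ | ⟨rfl, rfl⟩ | ⟨rfl, rfl⟩ | ⟨rfl, rfl⟩ <;>
        norm_num at this
    rw [finrank_invCoef_two (isDoubleWeight_five.2 (Or.inl h)), finrank_cocycleSpace_three_of_ne hM]

end Five

/-! ### The case k = 6 -/

section Six

variable {l n : ℝ}

theorem isDoubleWeight_six : IsDoubleWeight 6 l n ↔
    (l, n) ∈ k6DimOne ∪ {(0, -5/2), (-5/2, 0), (-5/2, -5/2)} := by
  simp only [k6DimOne, Set.mem_union, Set.mem_insert_iff, Set.mem_singleton_iff, Prod.mk.injEq]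
  constructor
  · rintro ⟨i, j, h1, h2, h3, h4⟩
    have hl : l = -i / 2 := by linarith
    have hn : n = (j - 5) / 2 := by push_cast at h4; linarith
    subst hl hn
    interval_cases i <;> interval_cases j <;> norm_num
  · rintro ((⟨rfl, rfl⟩ | ⟨rfl, rfl⟩ | ⟨rfl, rfl⟩ | ⟨rfl, rfl⟩ | ⟨rfl, rfl⟩ | ⟨rfl, rfl⟩ |
      ⟨rfl, rfl⟩ | ⟨rfl, rfl⟩ | ⟨rfl, rfl⟩ | ⟨rfl, rfl⟩ | ⟨rfl, rfl⟩ | ⟨rfl, rfl⟩ |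
      ⟨rfl, rfl⟩ | ⟨rfl, rfl⟩ | ⟨rfl, rfl⟩ | ⟨rfl, rfl⟩ | ⟨rfl, rfl⟩ | ⟨rfl, rfl⟩) |
      ⟨rfl, rfl⟩ | ⟨rfl, rfl⟩ | ⟨rfl, rfl⟩)
    · exact ⟨4, 4, by norm_num⟩
    · exact ⟨1, 1, by norm_num⟩
    · exact ⟨5, 4, by norm_num⟩
    · exact ⟨1, 0, by norm_num⟩
    · exact ⟨2, 2, by norm_num⟩
    · exact ⟨3, 3, by norm_num⟩
    · exact ⟨2, 1, by norm_num⟩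
    · exact ⟨4, 3, by norm_num⟩
    · exact ⟨2, 0, by norm_num⟩
    · exact ⟨5, 3, by norm_num⟩
    · exact ⟨3, 2, by norm_num⟩
    · exact ⟨3, 1, by norm_num⟩
    · exact ⟨4, 2, by norm_num⟩
    · exact ⟨3, 0, by norm_num⟩
    · exact ⟨5, 2, by norm_num⟩
    · exact ⟨4, 1, by norm_num⟩
    · exact ⟨4, 0, by norm_num⟩
    · exact ⟨5, 1, by norm_num⟩
    · exact ⟨0, 0, by norm_num⟩
    · exact ⟨5, 5, by norm_num⟩
    · exact ⟨5, 0, by norm_num⟩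

/-- The cocycle equations for `k = 6`. -/
noncomputable def cocycleMatrixSix (l n : ℝ) : Matrix (Fin 2) (Fin 5) ℝ :=
  !![(2 * n + 5) * (2 * n ^ 2 + 10 * n + 3) / 3, 4 * l * (n ^ 2 + 3 * n + 1),
      2 * (1 + 2 * n) * l * (l + 2), 4 / 3 * l * (l + 2) * (l + 4), 0;
    0, 4 / 3 * n * (n + 2) * (n + 4), 2 * (1 + 2 * l) * n * (n + 2), 4 * n * (l ^ 2 + 3 * l + 1),
      (2 * l + 5) * (2 * l ^ 2 + 10 * l + 3) / 3]

theorem cocycleSpace_four :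
    cocycleSpace 4 l n = LinearMap.ker (cocycleMatrixSix l n).mulVecLin := by
  ext v
  have h := mem_cocycleSpace_iff (l := l) (n := n) (κ := 4) (by norm_num) (extendFin v)
  rw [extendFin_coe] at h
  have e0 : extendFin v 0 = v 0 := rfl
  have e1 : extendFin v 1 = v 1 := rfl
  have e2 : extendFin v 2 = v 2 := rfl
  have e3 : extendFin v 3 = v 3 := rfl
  have e4 : extendFin v 4 = v 4 := rfl
  have key0 : (cocycleMatrixSix l n).mulVecLin v 0 =
      quarticForm l n 0 1 fun i _ => extendFin v i := by
    simp only [cocycleMatrixSix, quarticForm, Matrix.mulVecLin_apply, Matrix.mulVec, dotProduct,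
      Fin.sum_univ_five, e0, e1, e2, e3, Nat.reduceAdd, zero_add, Nat.cast_zero]
    simp
    ring
  have key1 : (cocycleMatrixSix l n).mulVecLin v 1 =
      quarticForm l n 1 0 fun i _ => extendFin v i := by
    simp only [cocycleMatrixSix, quarticForm, Matrix.mulVecLin_apply, Matrix.mulVec, dotProduct,
      Fin.sum_univ_five, e1, e2, e3, e4, Nat.reduceAdd, zero_add, Nat.cast_zero]
    simp
    ring
  rw [h, LinearMap.mem_ker]
  constructor
  · rintro ⟨h4, -⟩
    funext i
    fin_cases i
    · exact key0.trans (h4 0 1 rfl)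
    · exact key1.trans (h4 1 0 rfl)
  · intro h0
    refine ⟨fun i j hij => ?_, fun i j hij => by omega⟩
    obtain ⟨rfl, rfl⟩ | ⟨rfl, rfl⟩ : (i = 0 ∧ j = 1) ∨ (i = 1 ∧ j = 0) := by omega
    · rw [← key0, h0]; rfl
    · rw [← key1, h0]; rfl

theorem eq_of_quadratic {x : ℝ} (h : 2 * x ^ 2 + 10 * x + 3 = 0) :
    x = (-5 + √19) / 2 ∨ x = (-5 - √19) / 2 := by
  have h19 : √19 ^ 2 = 19 := Real.sq_sqrt (by norm_num)
  have : (2 * x + 5 - √19) * (2 * x + 5 + √19) = 0 := by linear_combination 2 * h - h19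
  rcases mul_eq_zero.1 this with h | h
  · left; linarith
  · right; linarith

theorem quadratic_pos : 2 * ((-5 + √19) / 2) ^ 2 + 10 * ((-5 + √19) / 2) + 3 = 0 := by
  have h19 : √19 ^ 2 = 19 := Real.sq_sqrt (by norm_num)
  linear_combination h19 / 2

theorem quadratic_neg : 2 * ((-5 - √19) / 2) ^ 2 + 10 * ((-5 - √19) / 2) + 3 = 0 := by
  have h19 : √19 ^ 2 = 19 := Real.sq_sqrt (by norm_num)
  linear_combination h19 / 2

theorem mem_ker_six {w : Fin 2 → ℝ} :
    w ∈ LinearMap.ker (cocycleMatrixSix l n).vecMulLinear ↔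
      w 0 * ((2 * n + 5) * (2 * n ^ 2 + 10 * n + 3)) = 0 ∧
      w 0 * (3 * l * (n ^ 2 + 3 * n + 1)) + w 1 * (n * (n + 2) * (n + 4)) = 0 ∧
      w 0 * ((1 + 2 * n) * l * (l + 2)) + w 1 * ((1 + 2 * l) * n * (n + 2)) = 0 ∧
      w 0 * (l * (l + 2) * (l + 4)) + w 1 * (3 * n * (l ^ 2 + 3 * l + 1)) = 0 ∧
      w 1 * ((2 * l + 5) * (2 * l ^ 2 + 10 * l + 3)) = 0 := by
  rw [mem_ker_vecMulLinear]
  simp only [Fin.sum_univ_two]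
  constructor
  · intro h
    have h0 : w 0 * ((2 * n + 5) * (2 * n ^ 2 + 10 * n + 3) / 3) + w 1 * 0 = 0 := h 0
    have h1 : w 0 * (4 * l * (n ^ 2 + 3 * n + 1)) + w 1 * (4 / 3 * n * (n + 2) * (n + 4)) = 0 := h 1
    have h2 : w 0 * (2 * (1 + 2 * n) * l * (l + 2)) + w 1 * (2 * (1 + 2 * l) * n * (n + 2)) = 0 := h 2
    have h3 : w 0 * (4 / 3 * l * (l + 2) * (l + 4)) + w 1 * (4 * n * (l ^ 2 + 3 * l + 1)) = 0 := h 3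
    have h4 : w 0 * 0 + w 1 * ((2 * l + 5) * (2 * l ^ 2 + 10 * l + 3) / 3) = 0 := h 4
    refine ⟨?_, ?_, ?_, ?_, ?_⟩ <;> linarith
  · rintro ⟨h0, h1, h2, h3, h4⟩ j
    fin_cases j
    · show w 0 * ((2 * n + 5) * (2 * n ^ 2 + 10 * n + 3) / 3) + w 1 * 0 = 0
      linarith
    · show w 0 * (4 * l * (n ^ 2 + 3 * n + 1)) + w 1 * (4 / 3 * n * (n + 2) * (n + 4)) = 0
      linarith
    · show w 0 * (2 * (1 + 2 * n) * l * (l + 2)) + w 1 * (2 * (1 + 2 * l) * n * (n + 2)) = 0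
      linarith
    · show w 0 * (4 / 3 * l * (l + 2) * (l + 4)) + w 1 * (4 * n * (l ^ 2 + 3 * l + 1)) = 0
      linarith
    · show w 0 * 0 + w 1 * ((2 * l + 5) * (2 * l ^ 2 + 10 * l + 3) / 3) = 0
      linarith

/-- If w 1 = 0, the first column makes n a root of (2n + 5)(2n² + 10n + 3), and the second forces l
= 0 because n² + 3n + 1 is nonzero there; w 0 = 0 is symmetric. Otherwise l and n are both roots,
and elimination of w from two middle columns gives `key'`, which leaves (-5/2, -5/2) and the pairs
of distinct roots of the quadratic. -/
theorem exceptional_of_mem_ker_six {w : Fin 2 → ℝ}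
    (hw : w ∈ LinearMap.ker (cocycleMatrixSix l n).vecMulLinear) (hw0 : w ≠ 0) :
    (l, n) ∈ k6DimThree ∪ {(0, -5/2), (-5/2, 0), (-5/2, -5/2)} := by
  obtain ⟨h0, h1, h2, h3, h4⟩ := mem_ker_six.1 hw
  have roots : ∀ x : ℝ, (2 * x + 5) * (2 * x ^ 2 + 10 * x + 3) = 0 →
      x = -5 / 2 ∨ x = (-5 + √19) / 2 ∨ x = (-5 - √19) / 2 := fun x h => by
    rcases mul_eq_zero.1 h with h | h
    · left; linarith
    · exact Or.inr (eq_of_quadratic h)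
  have aux : ∀ x : ℝ, (2 * x + 5) * (2 * x ^ 2 + 10 * x + 3) = 0 → x ^ 2 + 3 * x + 1 ≠ 0 := by
    intro x h h'
    rcases mul_eq_zero.1 h with h | h
    · have : x = -5 / 2 := by linarith
      subst this
      norm_num at h'
    · have : x = -1 / 4 := by linarith
      subst this
      norm_num at h'
  have aux' : ∀ x : ℝ, (2 * x + 5) * (2 * x ^ 2 + 10 * x + 3) = 0 → x ≠ 0 ∧ x + 2 ≠ 0 := by
    refine fun x h => ⟨?_, fun h' => ?_⟩
    · rintro rfl
      norm_num at h
    · obtain rfl : x = -2 := by linarith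
      norm_num at h
  simp only [k6DimThree, Set.mem_union, Set.mem_insert_iff, Set.mem_singleton_iff, Prod.mk.injEq]
  by_cases w1 : w 1 = 0
  · have w0 : w 0 ≠ 0 := fun h => hw0 (funext fun i => by fin_cases i <;> assumption)
    rw [w1] at h1
    have hn := (mul_eq_zero.1 h0).resolve_left w0
    have hl : l = 0 := by
      have e : (w 0 * (n ^ 2 + 3 * n + 1)) * l = 0 := by linarith
      exact (mul_eq_zero.1 e).resolve_left (mul_ne_zero w0 (aux n hn))
    rcases roots n hn with rfl | rfl | rfl <;> simp [hl]
  · have hl := (mul_eq_zero.1 h4).resolve_left w1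
    by_cases w0 : w 0 = 0
    · rw [w0] at h3
      have hn : n = 0 := by
        have e : (w 1 * (l ^ 2 + 3 * l + 1)) * n = 0 := by linarith
        exact (mul_eq_zero.1 e).resolve_left (mul_ne_zero w1 (aux l hl))
      rcases roots l hl with rfl | rfl | rfl <;> simp [hn]
    · have hn := (mul_eq_zero.1 h0).resolve_left w0
      have key : 3 * l * (n ^ 2 + 3 * n + 1) * ((1 + 2 * l) * n * (n + 2)) -
          (1 + 2 * n) * l * (l + 2) * (n * (n + 2) * (n + 4)) = 0 := by
        refine (mul_eq_zero.1 (?_ : w 0 * _ = 0)).resolve_left w0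
        linear_combination (1 + 2 * l) * n * (n + 2) * h1 - n * (n + 2) * (n + 4) * h2
      have key' : 3 * (n ^ 2 + 3 * n + 1) * (1 + 2 * l) - (1 + 2 * n) * (l + 2) * (n + 4) = 0 := by
        refine (mul_eq_zero.1 (?_ : (l * n * (n + 2)) * _ = 0)).resolve_left
          (mul_ne_zero (mul_ne_zero (aux' l hl).1 (aux' n hn).1) (aux' n hn).2)
        linear_combination key
      rcases mul_eq_zero.1 hl with ql | ql <;> rcases mul_eq_zero.1 hn with qn | qn
      · right; right; right
        exact ⟨by linarith, by linarith⟩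
      · exfalso
        obtain rfl : l = -5 / 2 := by linarith
        obtain rfl : n = -13 / 47 := by linear_combination 2 / 47 * key' + 11 / 47 * qn
        norm_num at qn
      · exfalso
        obtain rfl : n = -5 / 2 := by linarith
        obtain rfl : l = -5 / 2 := by linarith
        norm_num at ql
      · have e : (l - n) * (l + n + 5) = 0 := by linear_combination (ql - qn) / 2
        rcases mul_eq_zero.1 e with e | e
        · exfalso
          obtain rfl : l = n := by linarith
          have e1 : (2 * l + 1) * ((2 * l + 5) * (l - 1)) = 0 := by linear_combination key'
          rcases mul_eq_zero.1 e1 with e1 | e1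
          · obtain rfl : l = -1 / 2 := by linarith
            norm_num at ql
          · rcases mul_eq_zero.1 e1 with e1 | e1
            · obtain rfl : l = -5 / 2 := by linarith
              norm_num at ql
            · obtain rfl : l = 1 := by linarith
              norm_num at ql
        · obtain rfl : l = -5 - n := by linarith
          rcases eq_of_quadratic qn with rfl | rfl
          · left; right; right; right; right; right
            exact ⟨by ring, by ring⟩
          · left; right; right; right; right; left
            exact ⟨by ring, by ring⟩

theorem finrank_cocycleSpace_four :
    Module.finrank ℝ (cocycleSpace 4 l n) =
      3 + Module.finrank ℝ (LinearMap.ker (cocycleMatrixSix l n).vecMulLinear) := by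
  have h := finrank_ker_mulVecLin (cocycleMatrixSix l n)
  refine (congrArg (fun W : Submodule ℝ (Fin 5 → ℝ) => Module.finrank ℝ W)
    cocycleSpace_four).trans ?_
  omega

theorem finrank_ker_six_zero
    (h : (l, n) ∉ k6DimThree ∪ {(0, -5/2), (-5/2, 0), (-5/2, -5/2)}) :
    Module.finrank ℝ (LinearMap.ker (cocycleMatrixSix l n).vecMulLinear) = 0 :=
  finrank_eq_zero_of_forall fun _ hw => by_contra fun hw0 => h (exceptional_of_mem_ker_six hw hw0)

theorem finrank_ker_six_one
    (h : (l, n) ∈ k6DimThree ∪ {(0, -5/2), (-5/2, 0), (-5/2, -5/2)}) :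
    Module.finrank ℝ (LinearMap.ker (cocycleMatrixSix l n).vecMulLinear) = 1 := by
  have case_left : ∀ {n : ℝ}, (2 * n + 5) * (2 * n ^ 2 + 10 * n + 3) = 0 →
      Module.finrank ℝ (LinearMap.ker (cocycleMatrixSix 0 n).vecMulLinear) = 1 := by
    intro n hn
    refine finrank_eq_one_of_functional (LinearMap.proj 0) (w := ![1, 0]) (mem_ker_six.2 ?_)
      (fun h => one_ne_zero (congrFun h 0)) fun w hw h0 => ?_
    · simpa using hn
    · have h4 := (mem_ker_six.1 hw).2.2.2.2
      have h1 : w 1 = 0 := by linarith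
      funext i; fin_cases i <;> assumption
  have case_right : ∀ {l : ℝ}, (2 * l + 5) * (2 * l ^ 2 + 10 * l + 3) = 0 →
      Module.finrank ℝ (LinearMap.ker (cocycleMatrixSix l 0).vecMulLinear) = 1 := by
    intro n hn
    refine finrank_eq_one_of_functional (LinearMap.proj 1) (w := ![0, 1]) (mem_ker_six.2 ?_)
      (fun h => one_ne_zero (congrFun h 1)) fun w hw h0 => ?_
    · simpa using hn
    · have h4 := (mem_ker_six.1 hw).1
      have h1 : w 0 = 0 := by linarith
      funext i; fin_cases i <;> assumption
  have case_mid : ∀ {l n : ℝ}, (2 * n + 5) * (2 * n ^ 2 + 10 * n + 3) = 0 →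
      (2 * l + 5) * (2 * l ^ 2 + 10 * l + 3) = 0 →
      (3 * l * (n ^ 2 + 3 * n + 1)) = (n * (n + 2) * (n + 4)) →
      ((1 + 2 * n) * l * (l + 2)) = ((1 + 2 * l) * n * (n + 2)) →
      (l * (l + 2) * (l + 4)) = (3 * n * (l ^ 2 + 3 * l + 1)) →
      (n * (n + 2) * (n + 4)) ≠ 0 →
      Module.finrank ℝ (LinearMap.ker (cocycleMatrixSix l n).vecMulLinear) = 1 := by
    intro l n hn hl h1 h2 h3 hne
    -- The equalities assumed here say that the two rows of the matrix coincide, up to the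
    -- normalisation of columns.
    refine finrank_eq_one_of_functional (LinearMap.proj 0) (w := ![1, -1]) (mem_ker_six.2 ?_)
      (fun h => one_ne_zero (congrFun h 0)) fun w hw h0 => ?_
    · simp only [Matrix.cons_val_zero, Matrix.cons_val_one, hn, hl, h1, h2, h3]
      refine ⟨?_, ?_, ?_, ?_, ?_⟩ <;> ring
    · have h4 := (mem_ker_six.1 hw).2.1
      have h0' : w 0 = 0 := h0
      rw [h0', zero_mul, zero_add] at h4
      have h1 : w 1 = 0 := (mul_eq_zero.1 h4).resolve_right hne
      funext i; fin_cases i <;> assumption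
  -- Sum and product of the two roots of 2x² + 10x + 3; this treats both orderings at once and
  -- avoids the square root.
  have case_conj : ∀ {l n : ℝ}, l + n = -5 → l * n = 3 / 2 →
      Module.finrank ℝ (LinearMap.ker (cocycleMatrixSix l n).vecMulLinear) = 1 := by
    intro l n hs hp
    have hl : l = -5 - n := by linarith
    subst hl
    have q : n ^ 2 = -5 * n - 3 / 2 := by linarith
    have q3 : n ^ 3 = 47 / 2 * n + 15 / 2 := by linear_combination (n - 5) * q
    refine case_mid ?_ ?_ ?_ ?_ ?_ fun h => ?_
    · linear_combination (2 * n + 5) * 2 * q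
    · linear_combination -(2 * n + 5) * 2 * q
    · linear_combination -4 * q3 - 30 * q
    · linear_combination 4 * q3 + 30 * q
    · linear_combination -4 * q3 - 30 * q
    · obtain rfl : n = 1 := by linear_combination 2 / 3 * h - 2 / 3 * q3 - 4 * q
      norm_num at q
  have h19 : √19 ^ 2 = 19 := Real.sq_sqrt (by norm_num)
  simp only [k6DimThree, Set.mem_union, Set.mem_insert_iff, Set.mem_singleton_iff,
    Prod.mk.injEq] at h
  rcases h with (⟨rfl, rfl⟩ | ⟨rfl, rfl⟩ | ⟨rfl, rfl⟩ | ⟨rfl, rfl⟩ | ⟨rfl, rfl⟩ | ⟨rfl, rfl⟩) |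
      ⟨rfl, rfl⟩ | ⟨rfl, rfl⟩ | ⟨rfl, rfl⟩
  · exact case_right (by rw [quadratic_pos, mul_zero])
  · exact case_right (by rw [quadratic_neg, mul_zero])
  · exact case_left (by rw [quadratic_pos, mul_zero])
  · exact case_left (by rw [quadratic_neg, mul_zero])
  · exact case_conj (by ring) (by linear_combination -h19 / 4)
  · exact case_conj (by ring) (by linear_combination -h19 / 4)
  · exact case_left (by norm_num)
  · exact case_right (by norm_num)
  · exact case_mid (by norm_num) (by norm_num) (by norm_num) (by norm_num) (by norm_num)
      (by norm_num)

/-- Twice a double weight is an integer in each component, whereas √19 lies strictly between 4 and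
5. -/
theorem not_isDoubleWeight_of_mem_six (h : (l, n) ∈ k6DimThree) : ¬ IsDoubleWeight 6 l n := by
  have h19 : √19 ^ 2 = 19 := Real.sq_sqrt (by norm_num)
  have lo : 4 < √19 := by nlinarith [Real.sqrt_nonneg 19]
  have hi : √19 < 5 := by nlinarith [Real.sqrt_nonneg 19]
  rintro ⟨i, j, h1, h2, h3, h4⟩
  simp only [k6DimThree, Set.mem_insert_iff, Set.mem_singleton_iff, Prod.mk.injEq] at h
  rcases h with ⟨rfl, rfl⟩ | ⟨rfl, rfl⟩ | ⟨rfl, rfl⟩ | ⟨rfl, rfl⟩ | ⟨rfl, rfl⟩ | ⟨rfl, rfl⟩ <;>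
    interval_cases i <;> push_cast at h3 <;> first
    | (exfalso; linarith)
    | (interval_cases j; push_cast at h4; linarith)

theorem h1Iso_six (lam nu mu : ℝ) (hk : mu - lam - nu = 6) :
    ((lam, nu) ∈ k6DimThree → H1Iso lam nu mu 3) ∧
      ((lam, nu) ∉ k6DimThree → (lam, nu) ∉ k6DimOne → H1Iso lam nu mu 2) ∧
      ((lam, nu) ∈ k6DimOne → H1Iso lam nu mu 1) := by
  have hm : mu = lam + nu + ((4 : ℕ) + 2) := by push_cast; linarith
  have hB := finrank_coboundarySpace (κ := 4) (l := lam) (n := nu) (by norm_num) (by norm_num)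
  refine ⟨fun h => h1Iso_of_finrank hm ?_, fun h h' => h1Iso_of_finrank hm ?_,
    fun h => h1Iso_of_finrank hm ?_⟩ <;> rw [hB, finrank_cocycleSpace_four]
  · rw [finrank_invCoef_one (not_isDoubleWeight_of_mem_six h), finrank_ker_six_one (Or.inl h)]
  · by_cases hd : (lam, nu) ∈ ({(0, -5/2), (-5/2, 0), (-5/2, -5/2)} : Set (ℝ × ℝ))
    · rw [finrank_invCoef_two (isDoubleWeight_six.2 (Or.inr hd)), finrank_ker_six_one (Or.inr hd)]
    · rw [finrank_invCoef_one fun hd' => (isDoubleWeight_six.1 hd').elim h' hd,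
        finrank_ker_six_zero fun hM => hM.elim h hd]
  · have hd := isDoubleWeight_six.2 (Or.inl h)
    rw [finrank_invCoef_two hd, finrank_ker_six_zero]
    rintro (h' | h')
    · exact not_isDoubleWeight_of_mem_six h' hd
    · simp only [k6DimOne, Set.mem_insert_iff, Set.mem_singleton_iff, Prod.mk.injEq] at h h'
      rcases h' with ⟨rfl, rfl⟩ | ⟨rfl, rfl⟩ | ⟨rfl, rfl⟩ <;> norm_num at h

end Six

/-! ### The case k = 7: solving for relations between the cocycle equations -/

section Seven

/-- Two of the six equations for a linear relation between the cocycle equations for `k = 7`. -/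
def HalfRel (n x z f : ℝ) : Prop :=
  (n + 3) * (10 * (2 * n ^ 2 + 12 * n + 7) * x +
      3 * (4 * n ^ 3 + 28 * n ^ 2 + 41 * n + 32) * f) = 0 ∧
    3 * x * (4 * n ^ 2 + 16 * n + 10) + z * ((2 * n + 5) * (2 * n ^ 2 + 10 * n + 3)) +
      3 * f * ((n + 1) * (2 * n + 3) * (2 * n + 7)) = 0

/-- A third equation for a linear relation between the cocycle equations for `k = 7`. -/
def CrossRel (l n x y z f : ℝ) : Prop :=
  12 * x * ((l + 2) * (n + 1)) + 3 * z * ((2 * l + 1) * (2 * n ^ 2 + 6 * n + 2)) +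
    4 * y * ((n + 2) * (n + 4)) + 3 * f * ((n + 1) * (8 * l * n + 16 * l + 8 * n + 10)) = 0

/-- Linear relations between the cocycle equations for `k = 7`. -/
def SevenRel (l n x y z f : ℝ) : Prop :=
  HalfRel n x z f ∧ HalfRel l y z f ∧ CrossRel l n x y z f ∧ CrossRel n l y x z f

theorem SevenRel.swap {l n x y z f : ℝ} (h : SevenRel l n x y z f) : SevenRel n l y x z f :=
  ⟨h.2.1, h.1, h.2.2.2, h.2.2.1⟩

theorem SevenRel.smul {l n x y z f : ℝ} (h : SevenRel l n x y z f) (c : ℝ) :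
    SevenRel l n (c * x) (c * y) (c * z) (c * f) := by
  obtain ⟨⟨h1, h2⟩, ⟨h3, h4⟩, h5, h6⟩ := h
  refine ⟨⟨?_, ?_⟩, ⟨?_, ?_⟩, ?_, ?_⟩
  · linear_combination c * h1
  · linear_combination c * h2
  · linear_combination c * h3
  · linear_combination c * h4
  · unfold CrossRel at *; linear_combination c * h5
  · unfold CrossRel at *; linear_combination c * h6

/-- For fixed n the two equations are linear in x, z, f. Elimination of x gives a product whose
factors separate the branches; the last branch is generic, with x and z proportional to f. -/
theorem HalfRel.cases {n x z f : ℝ} (h : HalfRel n x z f) :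
    (n = -3 ∧ 2 * x = 3 * z + 6 * f) ∨ (2 * n + 5 = 0 ∧ 5 * x = 6 * f) ∨
    (2 * n ^ 2 + 10 * n + 3 = 0 ∧ x = -(n + 9 / 4) * f) ∨
    (2 * n ^ 2 + 12 * n + 7 = 0 ∧ f = 0 ∧ 2 * x = z * (n + 6)) ∨
    (2 * n ^ 2 + 12 * n + 7 ≠ 0 ∧
      5 * (2 * n ^ 2 + 12 * n + 7) * z = -3 * (4 * n ^ 2 + 24 * n + 17) * f ∧
      10 * (2 * n ^ 2 + 12 * n + 7) * x = -3 * (4 * n ^ 3 + 28 * n ^ 2 + 41 * n + 32) * f) := by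
  obtain ⟨h1, h2⟩ := h
  rcases mul_eq_zero.1 h1 with h0 | h0
  · left
    obtain rfl : n = -3 := by linarith
    exact ⟨rfl, by linarith⟩
  right
  have h3 : ((2 * n + 5) * (2 * n ^ 2 + 10 * n + 3)) *
      (5 * (2 * n ^ 2 + 12 * n + 7) * z + 3 * (4 * n ^ 2 + 24 * n + 17) * f) = 0 := by
    linear_combination 5 * (2 * n ^ 2 + 12 * n + 7) * h2 - 3 / 2 * (4 * n ^ 2 + 16 * n + 10) * h0
  rcases mul_eq_zero.1 h3 with h3 | h3
  · rcases mul_eq_zero.1 h3 with h3 | h3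
    · left
      obtain rfl : n = -5 / 2 := by linarith
      exact ⟨h3, by linarith⟩
    · right; left
      refine ⟨h3, ?_⟩
      have h4 : (n + 2) * (x + (n + 9 / 4) * f) = 0 := by grind
      have h5 : n + 2 ≠ 0 := fun h => by
        obtain rfl : n = -2 := by linarith
        norm_num at h3
      linarith [(mul_eq_zero.1 h4).resolve_left h5]
  · right; right
    by_cases hD : 2 * n ^ 2 + 12 * n + 7 = 0
    · left
      rw [hD] at h0 h3
      have hf : f = 0 := by
        have : (4 * n ^ 2 + 24 * n + 17) * f = 0 := by linarith
        refine (mul_eq_zero.1 this).resolve_left fun h => ?_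
        linarith
      subst hf
      exact ⟨hD, rfl, by grind⟩
    · right
      exact ⟨hD, by linarith, by linarith⟩

/-- The cases of `HalfRel.cases` with `z = 1`, `f = 0`. -/
theorem HalfRel.cases_one {n x : ℝ} (h : HalfRel n x 1 0) :
    (n = -3 ∧ 2 * x = n + 6) ∨ (2 * n ^ 2 + 12 * n + 7 = 0 ∧ 2 * x = n + 6) ∨
      (2 * n + 5 = 0 ∧ x = 0) ∨ (2 * n ^ 2 + 10 * n + 3 = 0 ∧ x = 0) := by
  rcases h.cases with ⟨h1, h2⟩ | ⟨h1, h2⟩ | ⟨h1, h2⟩ | ⟨h1, -, h2⟩ | ⟨h1, h2, -⟩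
  · exact Or.inl ⟨h1, by linarith⟩
  · exact Or.inr (Or.inr (Or.inl ⟨h1, by linarith⟩))
  · exact Or.inr (Or.inr (Or.inr ⟨h1, by linarith⟩))
  · exact Or.inr (Or.inl ⟨h1, by linarith⟩)
  · exact absurd (by linarith) h1

/-- A relation is determined by its last coefficient. -/
theorem SevenRel.eq_zero {l n x y z : ℝ} (h : SevenRel l n x y z 0) (hm : l + n + 6 ≠ 0) :
    x = 0 ∧ y = 0 ∧ z = 0 := by
  -- Otherwise normalise z = 1: both n and l then lie in one of four explicit branches, and each of
  -- the sixteen combinations contradicts the cross relations or l + n ≠ -6.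
  have hz : z = 0 := by
    by_contra hz
    have h' := h.smul z⁻¹
    rw [inv_mul_cancel₀ hz, mul_zero] at h'
    obtain ⟨hn, hl, h1, h2⟩ := h'
    generalize z⁻¹ * x = x at *
    generalize z⁻¹ * y = y at *
    simp only [CrossRel] at h1 h2
    rcases hn.cases_one with ⟨hn, hx⟩ | ⟨hn, hx⟩ | ⟨hn, hx⟩ | ⟨hn, hx⟩ <;>
      rcases hl.cases_one with ⟨hl, hy⟩ | ⟨hl, hy⟩ | ⟨hl, hy⟩ | ⟨hl, hy⟩ <;> clear h
    · grind
    · grind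
    · grind
    · grind
    · grind
    · grind
    · grind
    · grind
    · grind
    · grind
    · grind
    · grind
    · grind
    · grind
    · grind
    · grind
  subst hz
  have key : ∀ {n x : ℝ}, HalfRel n x 0 0 → x = 0 := by
    rintro n x ⟨h1, h2⟩
    grind
  exact ⟨key h.1, key h.2.1, rfl⟩

/-- The weights, outside of three lines, for which there is a relation. -/
def sevenWeights : Set (ℝ × ℝ) :=
  {p | (p.1 = p.2 ∧ 2 * p.2 ^ 2 + 10 * p.2 + 3 = 0) ∨
    (2 * p.2 ^ 2 + 10 * p.2 + 3 = 0 ∧ p.1 = -6 - 2 * p.2) ∨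
    (2 * p.1 ^ 2 + 10 * p.1 + 3 = 0 ∧ p.2 = -6 - 2 * p.1)} ∪
  {(-1, -5/2), (-5/2, -1), (-3/2, -3), (-3, -3/2), (-3/2, -3/2), (-2, -2), (-5/2, -5/2)}

/-- After normalising f = 1, the weights n and l each fall into a branch of `HalfRel.cases`, with a
common z. In each combination the cross relations either are contradictory or determine the weights;
exchanging l and n interchanges the branches. -/
theorem SevenRel.mem_sevenWeights {l n x y z f : ℝ} (h : SevenRel l n x y z f)
    (hm : l + n + 6 ≠ 0) (hf : f ≠ 0) : (l, n) ∈ sevenWeights := by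
  have h' := h.smul f⁻¹
  rw [inv_mul_cancel₀ hf] at h'
  obtain ⟨hn, hl, h1, h2⟩ := h'
  generalize f⁻¹ * x = x at *
  generalize f⁻¹ * y = y at *
  generalize f⁻¹ * z = z at *
  simp only [CrossRel] at h1 h2
  simp only [sevenWeights, Set.mem_union, Set.mem_ofPred_eq, Set.mem_insert_iff,
    Set.mem_singleton_iff, Prod.mk.injEq]
  rcases hn.cases with ⟨hn, hx⟩ | ⟨hn, hx⟩ | ⟨hn, hx⟩ | ⟨-, hn, -⟩ | ⟨hn, hx, hx'⟩ <;>
    rcases hl.cases with ⟨hl, hy⟩ | ⟨hl, hy⟩ | ⟨hl, hy⟩ | ⟨-, hl, -⟩ | ⟨hl, hy, hy'⟩ <;> clear h <;>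
      first
      | exact absurd hn one_ne_zero
      | exact absurd hl one_ne_zero
      | skip
  · grind
  · grind
  · grind
  · grind
  · grind
  · grind
  · grind
  · grind
  · grind
  · grind
  · grind
  -- Mixed branch: n is a root of the quadratic and l is generic. Substituting x, y, z in the cross
  -- relations and reducing modulo the quadratic exposes the common factor l + 2 n + 6.
  · have e1 : (l + n + 6) * ((l + 2 * n + 6) * ((18 + 2 * n) * l + 21 + 4 * n)) = 0 := by
      clear h2 hm
      simp only [mul_one] at hx hy hy' h1
      subst hx
      grind
    have e2 : (l + n + 6) * ((l + 2 * n + 6) *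
        ((33 + 8 * n) * l ^ 2 + (90 + 21 * n) * l + 48 + 10 * n)) = 0 := by
      clear h1 hm e1
      simp only [mul_one] at hx hy hy' h2
      subst hx
      grind
    have e1 := (mul_eq_zero.1 e1).resolve_left hm
    have e2 := (mul_eq_zero.1 e2).resolve_left hm
    rcases mul_eq_zero.1 e1 with e3 | e3
    · exact Or.inl (Or.inr (Or.inl ⟨hn, by linarith⟩))
    · rcases mul_eq_zero.1 e2 with e4 | e4
      · exact Or.inl (Or.inr (Or.inl ⟨hn, by linarith⟩))
      · clear hx hy hy' h1 h2 e1 e2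
        grind
  · grind
  · grind
  · grind
  -- Both weights are generic. With D(n) = 2n² + 12n + 7 the formula for z reads D(n) (5z + 6) = -9,
  -- and likewise for l; so D(l) = D(n), whence l = n or l + n = -6.
  · have hz : 5 * z + 6 ≠ 0 := fun h0 => by
      have e : (2 * n ^ 2 + 12 * n + 7) * (5 * z + 6) = -9 := by linarith
      rw [h0, mul_zero] at e
      norm_num at e
    have hD : (5 * z + 6) * (l - n) * (l + n + 6) = 0 := by linear_combination (hy - hx) / 2
    have hln : l = n := by
      have := (mul_eq_zero.1 ((mul_eq_zero.1 hD).resolve_right hm)).resolve_left hz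
      linarith
    subst hln
    have hxy : x = y := by
      refine mul_left_cancel₀ (mul_ne_zero (by norm_num : (10 : ℝ) ≠ 0) hn) ?_
      linear_combination hx' - hy'
    subst hxy
    grind

end Seven

/-! ### The case k = 7: the matrix of equations and its left kernel -/

section Seven

variable {l n : ℝ}

/-- The cocycle equations for `k = 7`. -/
noncomputable def cocycleMatrixSeven (l n : ℝ) : Matrix (Fin 4) (Fin 6) ℝ :=
  !![2 / 3 * (n + 3) * (2 * n ^ 2 + 12 * n + 7), l * (4 * n ^ 2 + 16 * n + 10),
      4 * l * (l + 2) * (n + 1), 4 / 3 * l * (l + 2) * (l + 4), 0, 0;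
    0, (2 * n + 5) * (2 * n ^ 2 + 10 * n + 3) / 3, (2 * l + 1) * (2 * n ^ 2 + 6 * n + 2),
      (2 * n + 1) * (2 * l ^ 2 + 6 * l + 2), (2 * l + 5) * (2 * l ^ 2 + 10 * l + 3) / 3, 0;
    0, 0, 4 / 3 * n * (n + 2) * (n + 4), 4 * n * (n + 2) * (l + 1), n * (4 * l ^ 2 + 16 * l + 10),
      2 / 3 * (l + 3) * (2 * l ^ 2 + 12 * l + 7);
    n * (n + 3) * (4 * n ^ 3 + 28 * n ^ 2 + 41 * n + 32) / 5,
      l * n * (n + 1) * (2 * n + 3) * (2 * n + 7),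
      l * n * (n + 1) * (8 * l * n + 16 * l + 8 * n + 10),
      l * n * (l + 1) * (8 * l * n + 8 * l + 16 * n + 10),
      l * n * (l + 1) * (2 * l + 3) * (2 * l + 7),
      l * (l + 3) * (4 * l ^ 3 + 28 * l ^ 2 + 41 * l + 32) / 5]

theorem cocycleSpace_five :
    cocycleSpace 5 l n = LinearMap.ker (cocycleMatrixSeven l n).mulVecLin := by
  ext v
  have h := mem_cocycleSpace_iff (l := l) (n := n) (κ := 5) (by norm_num) (extendFin v)
  rw [extendFin_coe] at h
  have e0 : extendFin v 0 = v 0 := rfl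
  have e1 : extendFin v 1 = v 1 := rfl
  have e2 : extendFin v 2 = v 2 := rfl
  have e3 : extendFin v 3 = v 3 := rfl
  have e4 : extendFin v 4 = v 4 := rfl
  have e5 : extendFin v 5 = v 5 := rfl
  have key0 : (cocycleMatrixSeven l n).mulVecLin v 0 =
      quarticForm l n 0 2 fun i _ => extendFin v i := by
    simp only [cocycleMatrixSeven, quarticForm, Matrix.mulVecLin_apply, Matrix.mulVec, dotProduct,
      Fin.sum_univ_six, e0, e1, e2, e3, Nat.reduceAdd, zero_add, Nat.cast_zero]
    simp
    ring
  have key1 : (cocycleMatrixSeven l n).mulVecLin v 1 =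
      quarticForm l n 1 1 fun i _ => extendFin v i := by
    simp only [cocycleMatrixSeven, quarticForm, Matrix.mulVecLin_apply, Matrix.mulVec, dotProduct,
      Fin.sum_univ_six, e1, e2, e3, e4, Nat.reduceAdd]
    simp
    ring
  have key2 : (cocycleMatrixSeven l n).mulVecLin v 2 =
      quarticForm l n 2 0 fun i _ => extendFin v i := by
    simp only [cocycleMatrixSeven, quarticForm, Matrix.mulVecLin_apply, Matrix.mulVec, dotProduct,
      Fin.sum_univ_six, e2, e3, e4, e5, Nat.reduceAdd, zero_add, Nat.cast_zero]
    simp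
    ring
  have key3 : (cocycleMatrixSeven l n).mulVecLin v 3 =
      sexticForm l n 0 0 (fun i _ => extendFin v i) (0 + 2 * l) (0 + 2 * n) := by
    simp only [cocycleMatrixSeven, sexticForm, Matrix.mulVecLin_apply, Matrix.mulVec, dotProduct,
      Fin.sum_univ_six, e0, e1, e2, e3, e4, e5, Nat.reduceAdd, zero_add, Nat.cast_zero]
    simp
    ring
  rw [h, LinearMap.mem_ker]
  constructor
  · rintro ⟨h4, h6⟩
    funext i
    fin_cases i
    · exact key0.trans (h4 0 2 rfl)
    · exact key1.trans (h4 1 1 rfl)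
    · exact key2.trans (h4 2 0 rfl)
    · have := h6 0 0 rfl
      rw [Nat.cast_zero] at this
      exact key3.trans this
  · intro h0
    refine ⟨fun i j hij => ?_, fun i j hij => ?_⟩
    · obtain ⟨rfl, rfl⟩ | ⟨rfl, rfl⟩ | ⟨rfl, rfl⟩ :
        (i = 0 ∧ j = 2) ∨ (i = 1 ∧ j = 1) ∨ (i = 2 ∧ j = 0) := by omega
      · rw [← key0, h0]; rfl
      · rw [← key1, h0]; rfl
      · rw [← key2, h0]; rfl
    · obtain ⟨rfl, rfl⟩ : i = 0 ∧ j = 0 := by omega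
      rw [Nat.cast_zero, ← key3, h0]; rfl

theorem finrank_cocycleSpace_five :
    Module.finrank ℝ (cocycleSpace 5 l n) =
      2 + Module.finrank ℝ (LinearMap.ker (cocycleMatrixSeven l n).vecMulLinear) := by
  have h := finrank_ker_mulVecLin (cocycleMatrixSeven l n)
  refine (congrArg (fun W : Submodule ℝ (Fin 6 → ℝ) => Module.finrank ℝ W)
    cocycleSpace_five).trans ?_
  omega

theorem mem_ker_seven {w : Fin 4 → ℝ} :
    w ∈ LinearMap.ker (cocycleMatrixSeven l n).vecMulLinear ↔
      (n + 3) * (10 * (2 * n ^ 2 + 12 * n + 7) * w 0 +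
        3 * n * (4 * n ^ 3 + 28 * n ^ 2 + 41 * n + 32) * w 3) = 0 ∧
      3 * w 0 * (l * (4 * n ^ 2 + 16 * n + 10)) + w 1 * ((2 * n + 5) * (2 * n ^ 2 + 10 * n + 3)) +
        3 * w 3 * (l * n * (n + 1) * (2 * n + 3) * (2 * n + 7)) = 0 ∧
      12 * w 0 * (l * (l + 2) * (n + 1)) + 3 * w 1 * ((2 * l + 1) * (2 * n ^ 2 + 6 * n + 2)) +
        4 * w 2 * (n * (n + 2) * (n + 4)) +
        3 * w 3 * (l * n * (n + 1) * (8 * l * n + 16 * l + 8 * n + 10)) = 0 ∧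
      12 * w 2 * (n * (n + 2) * (l + 1)) + 3 * w 1 * ((2 * n + 1) * (2 * l ^ 2 + 6 * l + 2)) +
        4 * w 0 * (l * (l + 2) * (l + 4)) +
        3 * w 3 * (l * n * (l + 1) * (8 * l * n + 8 * l + 16 * n + 10)) = 0 ∧
      3 * w 2 * (n * (4 * l ^ 2 + 16 * l + 10)) + w 1 * ((2 * l + 5) * (2 * l ^ 2 + 10 * l + 3)) +
        3 * w 3 * (l * n * (l + 1) * (2 * l + 3) * (2 * l + 7)) = 0 ∧
      (l + 3) * (10 * (2 * l ^ 2 + 12 * l + 7) * w 2 +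
        3 * l * (4 * l ^ 3 + 28 * l ^ 2 + 41 * l + 32) * w 3) = 0 := by
  have e0 : ∑ i, w i * cocycleMatrixSeven l n i 0 =
      w 0 * (2 / 3 * (n + 3) * (2 * n ^ 2 + 12 * n + 7)) + w 1 * 0 + w 2 * 0 +
      w 3 * (n * (n + 3) * (4 * n ^ 3 + 28 * n ^ 2 + 41 * n + 32) / 5) := Fin.sum_univ_four _
  have e1 : ∑ i, w i * cocycleMatrixSeven l n i 1 =
      w 0 * (l * (4 * n ^ 2 + 16 * n + 10)) + w 1 * ((2 * n + 5) * (2 * n ^ 2 + 10 * n + 3) / 3) +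
      w 2 * 0 + w 3 * (l * n * (n + 1) * (2 * n + 3) * (2 * n + 7)) := Fin.sum_univ_four _
  have e2 : ∑ i, w i * cocycleMatrixSeven l n i 2 =
      w 0 * (4 * l * (l + 2) * (n + 1)) + w 1 * ((2 * l + 1) * (2 * n ^ 2 + 6 * n + 2)) +
      w 2 * (4 / 3 * n * (n + 2) * (n + 4)) +
      w 3 * (l * n * (n + 1) * (8 * l * n + 16 * l + 8 * n + 10)) := Fin.sum_univ_four _
  have e3 : ∑ i, w i * cocycleMatrixSeven l n i 3 =
      w 0 * (4 / 3 * l * (l + 2) * (l + 4)) + w 1 * ((2 * n + 1) * (2 * l ^ 2 + 6 * l + 2)) +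
      w 2 * (4 * n * (n + 2) * (l + 1)) +
      w 3 * (l * n * (l + 1) * (8 * l * n + 8 * l + 16 * n + 10)) := Fin.sum_univ_four _
  have e4 : ∑ i, w i * cocycleMatrixSeven l n i 4 =
      w 0 * 0 + w 1 * ((2 * l + 5) * (2 * l ^ 2 + 10 * l + 3) / 3) +
      w 2 * (n * (4 * l ^ 2 + 16 * l + 10)) +
      w 3 * (l * n * (l + 1) * (2 * l + 3) * (2 * l + 7)) := Fin.sum_univ_four _
  have e5 : ∑ i, w i * cocycleMatrixSeven l n i 5 =
      w 0 * 0 + w 1 * 0 + w 2 * (2 / 3 * (l + 3) * (2 * l ^ 2 + 12 * l + 7)) +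
      w 3 * (l * (l + 3) * (4 * l ^ 3 + 28 * l ^ 2 + 41 * l + 32) / 5) := Fin.sum_univ_four _
  rw [mem_ker_vecMulLinear]
  constructor
  · intro h
    have h0 := h 0
    have h1 := h 1
    have h2 := h 2
    have h3 := h 3
    have h4 := h 4
    have h5 := h 5
    rw [e0] at h0
    rw [e1] at h1
    rw [e2] at h2
    rw [e3] at h3
    rw [e4] at h4
    rw [e5] at h5
    refine ⟨?_, ?_, ?_, ?_, ?_, ?_⟩ <;> linarith
  · rintro ⟨h0, h1, h2, h3, h4, h5⟩ j
    fin_cases j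
    · exact e0.trans (by linarith)
    · exact e1.trans (by linarith)
    · exact e2.trans (by linarith)
    · exact e3.trans (by linarith)
    · exact e4.trans (by linarith)
    · exact e5.trans (by linarith)

/-- The substitution by n x, l n z, l y makes factors l and n come out of every column equation,
which leaves `SevenRel`; when l and n are nonzero it can be inverted. -/
theorem mem_ker_seven_of_rel {x y z f : ℝ} (h : SevenRel l n x y z f) :
    ![n * x, l * n * z, l * y, f] ∈ LinearMap.ker (cocycleMatrixSeven l n).vecMulLinear := by
  obtain ⟨⟨h1, h2⟩, ⟨h3, h4⟩, h5, h6⟩ := h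
  unfold CrossRel at h5 h6
  rw [mem_ker_seven]
  show (n + 3) * (10 * (2 * n ^ 2 + 12 * n + 7) * (n * x) +
        3 * n * (4 * n ^ 3 + 28 * n ^ 2 + 41 * n + 32) * f) = 0 ∧
      3 * (n * x) * (l * (4 * n ^ 2 + 16 * n + 10)) +
        l * n * z * ((2 * n + 5) * (2 * n ^ 2 + 10 * n + 3)) +
        3 * f * (l * n * (n + 1) * (2 * n + 3) * (2 * n + 7)) = 0 ∧
      12 * (n * x) * (l * (l + 2) * (n + 1)) +
        3 * (l * n * z) * ((2 * l + 1) * (2 * n ^ 2 + 6 * n + 2)) +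
        4 * (l * y) * (n * (n + 2) * (n + 4)) +
        3 * f * (l * n * (n + 1) * (8 * l * n + 16 * l + 8 * n + 10)) = 0 ∧
      12 * (l * y) * (n * (n + 2) * (l + 1)) +
        3 * (l * n * z) * ((2 * n + 1) * (2 * l ^ 2 + 6 * l + 2)) +
        4 * (n * x) * (l * (l + 2) * (l + 4)) +
        3 * f * (l * n * (l + 1) * (8 * l * n + 8 * l + 16 * n + 10)) = 0 ∧
      3 * (l * y) * (n * (4 * l ^ 2 + 16 * l + 10)) +
        l * n * z * ((2 * l + 5) * (2 * l ^ 2 + 10 * l + 3)) +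
        3 * f * (l * n * (l + 1) * (2 * l + 3) * (2 * l + 7)) = 0 ∧
      (l + 3) * (10 * (2 * l ^ 2 + 12 * l + 7) * (l * y) +
        3 * l * (4 * l ^ 3 + 28 * l ^ 2 + 41 * l + 32) * f) = 0
  refine ⟨?_, ?_, ?_, ?_, ?_, ?_⟩
  · linear_combination n * h1
  · linear_combination l * n * h2
  · linear_combination l * n * h5
  · linear_combination l * n * h6
  · linear_combination l * n * h4
  · linear_combination l * h3

theorem exists_rel_of_mem_ker_seven {w : Fin 4 → ℝ} (hl : l ≠ 0) (hn : n ≠ 0)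
    (hw : w ∈ LinearMap.ker (cocycleMatrixSeven l n).vecMulLinear) :
    ∃ x y z f, SevenRel l n x y z f ∧ w = ![n * x, l * n * z, l * y, f] := by
  obtain ⟨h0, h1, h2, h3, h4, h5⟩ := mem_ker_seven.1 hw
  obtain ⟨x, hx⟩ : ∃ x, w 0 = n * x := ⟨w 0 / n, by field_simp⟩
  obtain ⟨y, hy⟩ : ∃ y, w 2 = l * y := ⟨w 2 / l, by field_simp⟩
  obtain ⟨z, hz⟩ : ∃ z, w 1 = l * n * z := ⟨w 1 / (l * n), by field_simp⟩
  rw [hx] at h0 h1 h2 h3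
  rw [hz] at h1 h2 h3 h4
  rw [hy] at h2 h3 h4 h5
  have hln := mul_ne_zero hl hn
  refine ⟨x, y, z, w 3, ⟨⟨?_, ?_⟩, ⟨?_, ?_⟩, ?_, ?_⟩, ?_⟩
  · exact mul_left_cancel₀ hn (by linear_combination h0)
  · exact mul_left_cancel₀ hln (by linear_combination h1)
  · exact mul_left_cancel₀ hl (by linear_combination h5)
  · exact mul_left_cancel₀ hln (by linear_combination h4)
  · unfold CrossRel
    exact mul_left_cancel₀ hln (by linear_combination h2)
  · unfold CrossRel
    exact mul_left_cancel₀ hln (by linear_combination h3)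
  · funext i
    fin_cases i <;> first | assumption | rfl

theorem finrank_ker_seven_zero (hl : l ≠ 0) (hn : n ≠ 0) (hm : l + n + 6 ≠ 0)
    (h : (l, n) ∉ sevenWeights) :
    Module.finrank ℝ (LinearMap.ker (cocycleMatrixSeven l n).vecMulLinear) = 0 := by
  refine finrank_eq_zero_of_forall fun w hw => ?_
  obtain ⟨x, y, z, f, hr, rfl⟩ := exists_rel_of_mem_ker_seven hl hn hw
  by_cases hf : f = 0
  · subst hf
    obtain ⟨rfl, rfl, rfl⟩ := hr.eq_zero hm
    funext i
    fin_cases i <;> simp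
  · exact absurd (hr.mem_sevenWeights hm hf) h

theorem SevenRel.finrank_ker_eq_one {x y z : ℝ} (h : SevenRel l n x y z 1) (hl : l ≠ 0) (hn : n ≠ 0)
    (hm : l + n + 6 ≠ 0) :
    Module.finrank ℝ (LinearMap.ker (cocycleMatrixSeven l n).vecMulLinear) = 1 := by
  refine finrank_eq_one_of_functional (LinearMap.proj 3) (mem_ker_seven_of_rel h)
    (fun h => one_ne_zero (congrFun h 3)) fun w hw h0 => ?_
  obtain ⟨x, y, z, f, hr, rfl⟩ := exists_rel_of_mem_ker_seven hl hn hw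
  obtain rfl : f = 0 := h0
  obtain ⟨rfl, rfl, rfl⟩ := hr.eq_zero hm
  funext i
  fin_cases i <;> simp

/-- A subspace in bijection with `ℝ²` through a linear map. -/
theorem finrank_eq_two_of_map {V : Type*} [AddCommGroup V] [Module ℝ V] {W : Submodule ℝ V}
    (f g : V →ₗ[ℝ] ℝ) (h0 : ∀ v ∈ W, f v = 0 → g v = 0 → v = 0)
    (h : ∀ a b, ∃ v ∈ W, f v = a ∧ g v = b) : Module.finrank ℝ W = 2 := by
  refine (LinearEquiv.ofBijective ((f.prod g).comp W.subtype) ⟨?_, ?_⟩).finrank_eq.trans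
    (by simp)
  · refine (injective_iff_map_eq_zero _).2 fun v hv => Subtype.ext (h0 v.1 v.2 ?_ ?_)
    · exact congrArg Prod.fst hv
    · exact congrArg Prod.snd hv
  · rintro ⟨a, b⟩
    obtain ⟨v, hv, h1, h2⟩ := h a b
    exact ⟨⟨v, hv⟩, Prod.ext h1 h2⟩

theorem mem_ker_seven_left {w : Fin 4 → ℝ} :
    w ∈ LinearMap.ker (cocycleMatrixSeven 0 n).vecMulLinear ↔ w 1 = 0 ∧ w 2 = 0 ∧
      (n + 3) * (10 * (2 * n ^ 2 + 12 * n + 7) * w 0 +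
        3 * n * (4 * n ^ 3 + 28 * n ^ 2 + 41 * n + 32) * w 3) = 0 := by
  rw [mem_ker_seven]
  constructor
  · rintro ⟨h0, h1, h2, h3, h4, h5⟩
    have e2 : w 2 = 0 := by linarith
    rw [e2] at h4
    exact ⟨by linarith, e2, h0⟩
  · rintro ⟨h1, h2, h0⟩
    rw [h1, h2]
    exact ⟨h0, by ring, by ring, by ring, by ring, by ring⟩

theorem mem_ker_seven_right {w : Fin 4 → ℝ} :
    w ∈ LinearMap.ker (cocycleMatrixSeven l 0).vecMulLinear ↔ w 0 = 0 ∧ w 1 = 0 ∧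
      (l + 3) * (10 * (2 * l ^ 2 + 12 * l + 7) * w 2 +
        3 * l * (4 * l ^ 3 + 28 * l ^ 2 + 41 * l + 32) * w 3) = 0 := by
  rw [mem_ker_seven]
  constructor
  · rintro ⟨h0, h1, h2, h3, h4, h5⟩
    have e2 : w 0 = 0 := by linarith
    rw [e2] at h1
    exact ⟨e2, by linarith, h5⟩
  · rintro ⟨h1, h2, h0⟩
    rw [h1, h2]
    exact ⟨by ring, by ring, by ring, by ring, by ring, h0⟩

/-- The two polynomials have no common real root. The sum of squares is the form in which this
serves as the determinant of a system of two equations. -/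
theorem last_row_entries_ne_zero (n : ℝ) : (10 * (2 * n ^ 2 + 12 * n + 7)) ^ 2 +
    (3 * n * (4 * n ^ 3 + 28 * n ^ 2 + 41 * n + 32)) ^ 2 ≠ 0 := by
  intro h
  have h1 : 10 * (2 * n ^ 2 + 12 * n + 7) = 0 := by
    nlinarith [sq_nonneg (10 * (2 * n ^ 2 + 12 * n + 7)),
      sq_nonneg (3 * n * (4 * n ^ 3 + 28 * n ^ 2 + 41 * n + 32))]
  have h2 : 3 * n * (4 * n ^ 3 + 28 * n ^ 2 + 41 * n + 32) = 0 := by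
    nlinarith [sq_nonneg (10 * (2 * n ^ 2 + 12 * n + 7)),
      sq_nonneg (3 * n * (4 * n ^ 3 + 28 * n ^ 2 + 41 * n + 32))]
  clear h
  grind

theorem finrank_ker_seven_left (hn : n ≠ -3) :
    Module.finrank ℝ (LinearMap.ker (cocycleMatrixSeven 0 n).vecMulLinear) = 1 := by
  have hn' : n + 3 ≠ 0 := fun h => hn (by linarith)
  have hne := last_row_entries_ne_zero n
  generalize hβ : 10 * (2 * n ^ 2 + 12 * n + 7) = β at hne
  generalize hα : 3 * n * (4 * n ^ 3 + 28 * n ^ 2 + 41 * n + 32) = α at hne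
  -- On the line β w 0 + α w 3 = 0 the functional is the coordinate along (α, -β); it does not
  -- vanish there even if α or β alone is zero.
  refine finrank_eq_one_of_functional (α • LinearMap.proj 0 - β • LinearMap.proj 3)
    (w := ![α, 0, 0, -β]) (mem_ker_seven_left.2 ?_) (fun h => hne ?_) fun w hw h0 => ?_
  · rw [hα, hβ]
    simp
    right
    ring
  · have h0 : α = 0 := congrFun h 0
    have h3 : -β = 0 := congrFun h 3
    rw [h0, neg_eq_zero.1 h3]
    ring
  · obtain ⟨h1, h2, h3⟩ := mem_ker_seven_left.1 hw
    rw [hα, hβ] at h3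
    have h3 := (mul_eq_zero.1 h3).resolve_left hn'
    replace h0 : α * w 0 - β * w 3 = 0 := h0
    have e0 : w 0 = 0 := (mul_eq_zero.1 (by linear_combination β * h3 + α * h0 :
      (β ^ 2 + α ^ 2) * w 0 = 0)).resolve_left hne
    have e3 : w 3 = 0 := (mul_eq_zero.1 (by linear_combination α * h3 - β * h0 :
      (β ^ 2 + α ^ 2) * w 3 = 0)).resolve_left hne
    funext i
    fin_cases i <;> assumption

theorem finrank_ker_seven_right (hl : l ≠ -3) :
    Module.finrank ℝ (LinearMap.ker (cocycleMatrixSeven l 0).vecMulLinear) = 1 := by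
  have hl' : l + 3 ≠ 0 := fun h => hl (by linarith)
  have hne := last_row_entries_ne_zero l
  generalize hβ : 10 * (2 * l ^ 2 + 12 * l + 7) = β at hne
  generalize hα : 3 * l * (4 * l ^ 3 + 28 * l ^ 2 + 41 * l + 32) = α at hne
  refine finrank_eq_one_of_functional (α • LinearMap.proj 2 - β • LinearMap.proj 3)
    (w := ![0, 0, α, -β]) (mem_ker_seven_right.2 ?_) (fun h => hne ?_) fun w hw h0 => ?_
  · rw [hα, hβ]
    simp
    right
    ring
  · have h0 : α = 0 := congrFun h 2
    have h3 : -β = 0 := congrFun h 3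
    rw [h0, neg_eq_zero.1 h3]
    ring
  · obtain ⟨h1, h2, h3⟩ := mem_ker_seven_right.1 hw
    rw [hα, hβ] at h3
    have h3 := (mul_eq_zero.1 h3).resolve_left hl'
    replace h0 : α * w 2 - β * w 3 = 0 := h0
    have e0 : w 2 = 0 := (mul_eq_zero.1 (by linear_combination β * h3 + α * h0 :
      (β ^ 2 + α ^ 2) * w 2 = 0)).resolve_left hne
    have e3 : w 3 = 0 := (mul_eq_zero.1 (by linear_combination α * h3 - β * h0 :
      (β ^ 2 + α ^ 2) * w 3 = 0)).resolve_left hne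
    funext i
    fin_cases i <;> assumption

/-- At these weights the equations carrying a factor n + 3 or l + 3 that vanishes drop out, which
frees a second parameter. -/
theorem finrank_ker_seven_two
    (h : (l, n) ∈ ({(0, -3), (-3, 0), (-3, -3)} : Set (ℝ × ℝ))) :
    Module.finrank ℝ (LinearMap.ker (cocycleMatrixSeven l n).vecMulLinear) = 2 := by
  simp only [Set.mem_insert_iff, Set.mem_singleton_iff, Prod.mk.injEq] at h
  rcases h with ⟨rfl, rfl⟩ | ⟨rfl, rfl⟩ | ⟨rfl, rfl⟩
  · refine finrank_eq_two_of_map (LinearMap.proj 0) (LinearMap.proj 3) (fun w hw h0 h3 => ?_)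
      fun a b => ⟨![a, 0, 0, b], mem_ker_seven_left.2 ⟨rfl, rfl, by norm_num⟩, rfl, rfl⟩
    obtain ⟨h1, h2, -⟩ := mem_ker_seven_left.1 hw
    funext i
    fin_cases i <;> assumption
  · refine finrank_eq_two_of_map (LinearMap.proj 2) (LinearMap.proj 3) (fun w hw h0 h3 => ?_)
      fun a b => ⟨![0, 0, a, b], mem_ker_seven_right.2 ⟨rfl, rfl, by norm_num⟩, rfl, rfl⟩
    obtain ⟨h1, h2, -⟩ := mem_ker_seven_right.1 hw
    funext i
    fin_cases i <;> assumption
  · refine finrank_eq_two_of_map (LinearMap.proj 1) (LinearMap.proj 3) (fun w hw h0 h3 => ?_)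
      fun a b => ⟨_, mem_ker_seven_of_rel (x := a / 6 + 3 * b) (y := a / 6 + 3 * b) (z := a / 9)
        (f := b) ⟨⟨?_, ?_⟩, ⟨?_, ?_⟩, ?_, ?_⟩, ?_, rfl⟩
    · obtain ⟨x, y, z, f, hr, rfl⟩ := exists_rel_of_mem_ker_seven (by norm_num) (by norm_num) hw
      obtain rfl : f = 0 := h3
      obtain rfl : z = 0 := by
        replace h0 : -3 * -3 * z = 0 := h0
        linarith
      obtain ⟨⟨-, h1⟩, ⟨-, h2⟩, -⟩ := hr
      obtain rfl : x = 0 := by linarith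
      obtain rfl : y = 0 := by linarith
      funext i
      fin_cases i <;> simp
    · ring
    · ring
    · ring
    · ring
    · unfold CrossRel; ring
    · unfold CrossRel; ring
    · show -3 * -3 * (a / 9) = a
      ring

theorem finrank_ker_seven_antidiagonal (hl : l ≠ 0) (hn : n ≠ 0) (hn' : n ≠ -3)
    (hm : l + n + 6 = 0) :
    Module.finrank ℝ (LinearMap.ker (cocycleMatrixSeven l n).vecMulLinear) = 1 := by
  obtain rfl : l = -6 - n := by linarith
  set D := 2 * n ^ 2 + 12 * n + 7 with hD
  have hne : (10 * D) ^ 2 + (6 * (2 * D + 3)) ^ 2 ≠ 0 := by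
    have h1 : 0 < (10 * D) ^ 2 + (6 * (2 * D + 3)) ^ 2 := by nlinarith [sq_nonneg (61 * D + 18)]
    exact h1.ne'
  -- This is the generic solution from `HalfRel.cases` with f = 10 D, cleared of denominators, so it
  -- is valid for D = 0 too. Since D is unchanged under n ↦ -6 - n, the two halves share the same z.
  have hr : SevenRel (-6 - n) n (-3 * (4 * n ^ 3 + 28 * n ^ 2 + 41 * n + 32))
      (-3 * (4 * (-6 - n) ^ 3 + 28 * (-6 - n) ^ 2 + 41 * (-6 - n) + 32)) (-6 * (2 * D + 3))
      (10 * D) := by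
    refine ⟨⟨?_, ?_⟩, ⟨?_, ?_⟩, ?_, ?_⟩ <;> simp only [CrossRel, hD] <;> ring
  refine finrank_eq_one_of_functional
    ((-6 * (2 * D + 3)) • LinearMap.proj 1 + ((-6 - n) * n * (10 * D)) • LinearMap.proj 3)
    (mem_ker_seven_of_rel hr) (fun h => hne ?_) fun w hw h0 => ?_
  · have h1 : (-6 - n) * n * (-6 * (2 * D + 3)) = 0 := congrFun h 1
    have h3 : 10 * D = 0 := congrFun h 3
    have h1 := (mul_eq_zero.1 h1).resolve_left (mul_ne_zero hl hn)
    linear_combination 10 * D * h3 - 6 * (2 * D + 3) * h1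
  · obtain ⟨x, y, z, f, hr, rfl⟩ := exists_rel_of_mem_ker_seven hl hn hw
    replace h0 : -6 * (2 * D + 3) * ((-6 - n) * n * z) + (-6 - n) * n * (10 * D) * f = 0 := h0
    replace h0 : -6 * (2 * D + 3) * z + 10 * D * f = 0 :=
      mul_left_cancel₀ (mul_ne_zero hl hn) (by linear_combination h0)
    -- The generic relation between z and f holds in all branches: where the branch of n gives no
    -- information on z, the branch of l = -6 - n supplies it.
    have h1 : 10 * D * z + 6 * (2 * D + 3) * f = 0 := by
      obtain ⟨h1, h2, -⟩ := hr
      rcases h1.cases with ⟨h, -⟩ | ⟨h, e⟩ | ⟨h, e⟩ | ⟨h, e, -⟩ | ⟨-, h, -⟩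
      · exact absurd h hn'
      · rcases h2.cases with ⟨h', -⟩ | ⟨h', e'⟩ | ⟨h', e'⟩ | ⟨h', e', -⟩ | ⟨-, h', -⟩
        · exact absurd (by linarith) hn'
        · exfalso; linarith
        · exfalso; grind
        · exfalso; grind
        · linear_combination 2 * h'
      · rcases h2.cases with ⟨h', -⟩ | ⟨h', e'⟩ | ⟨h', e'⟩ | ⟨h', e', -⟩ | ⟨-, h', -⟩
        · exact absurd (by linarith) hn'
        · exfalso; grind
        · exfalso; grind
        · exfalso; grind
        · linear_combination 2 * h'
      · rw [e, hD, h]; ring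
      · linear_combination 2 * h
    obtain rfl : z = 0 := (mul_eq_zero.1 (by
      linear_combination 10 * D * h1 - 6 * (2 * D + 3) * h0 :
      ((10 * D) ^ 2 + (6 * (2 * D + 3)) ^ 2) * z = 0)).resolve_left hne
    obtain rfl : f = 0 := (mul_eq_zero.1 (by
      linear_combination 6 * (2 * D + 3) * h1 + 10 * D * h0 :
      ((10 * D) ^ 2 + (6 * (2 * D + 3)) ^ 2) * f = 0)).resolve_left hne
    obtain rfl : x = 0 := by
      obtain ⟨⟨h1, h2⟩, -⟩ := hr
      clear hw h0 hD hne
      grind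
    obtain rfl : y = 0 := by
      obtain ⟨-, ⟨h1, h2⟩, -⟩ := hr
      clear hw h0 hD hne
      grind
    funext i
    fin_cases i <;> simp

end Seven

/-! ### The case k = 7: isolated exceptional weights and the final count -/

section Seven

variable {l n : ℝ}

/-- At a root of the quadratic the half relations force x and y but leave z free; the value of z
comes from the cross relations. -/
theorem finrank_ker_seven_of_quadratic_eq (h : 2 * n ^ 2 + 10 * n + 3 = 0) :
    Module.finrank ℝ (LinearMap.ker (cocycleMatrixSeven n n).vecMulLinear) = 1 := by
  have hr : SevenRel n n (-(n + 9 / 4)) (-(n + 9 / 4)) (1197 / 5 + 257 / 5 * n) 1 := by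
    refine ⟨⟨?_, ?_⟩, ⟨?_, ?_⟩, ?_, ?_⟩ <;> (try unfold CrossRel) <;> grind
  have h0 : n ≠ 0 := by rintro rfl; norm_num at h
  refine hr.finrank_ker_eq_one h0 h0 fun h' => ?_
  obtain rfl : n = -3 := by linarith
  norm_num at h

theorem finrank_ker_seven_of_quadratic (h : 2 * n ^ 2 + 10 * n + 3 = 0) (hl : l = -6 - 2 * n) :
    Module.finrank ℝ (LinearMap.ker (cocycleMatrixSeven l n).vecMulLinear) = 1 ∧
      Module.finrank ℝ (LinearMap.ker (cocycleMatrixSeven n l).vecMulLinear) = 1 := by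
  subst hl
  have hr : SevenRel (-6 - 2 * n) n (-(n + 9 / 4)) (n / 5 - 9 / 5) (-81 / 5 - 16 / 5 * n) 1 := by
    refine ⟨⟨?_, ?_⟩, ⟨?_, ?_⟩, ?_, ?_⟩ <;> (try unfold CrossRel) <;> grind
  have h0 : n ≠ 0 := by rintro rfl; norm_num at h
  have h1 : -6 - 2 * n ≠ 0 := fun h' => by
    obtain rfl : n = -3 := by linarith
    norm_num at h
  exact ⟨hr.finrank_ker_eq_one h1 h0 fun h' => h0 (by linarith),
    hr.swap.finrank_ker_eq_one h0 h1 fun h' => h0 (by linarith)⟩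

/-- These seven weights do not show in the final list: each is also a double weight, so the extra
cocycle is compensated by an extra coboundary. -/
theorem finrank_ker_seven_of_rational (h : (l, n) ∈ ({(-1, -5/2), (-5/2, -1), (-3/2, -3),
      (-3, -3/2), (-3/2, -3/2), (-2, -2), (-5/2, -5/2)} : Set (ℝ × ℝ))) :
    Module.finrank ℝ (LinearMap.ker (cocycleMatrixSeven l n).vecMulLinear) = 1 := by
  have h1 : SevenRel (-1) (-5/2) (6/5) (3/2) (-3/5) 1 := by
    norm_num [SevenRel, HalfRel, CrossRel]
  have h2 : SevenRel (-3/2) (-3) (21/13) (12/13) (-12/13) 1 := by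
    norm_num [SevenRel, HalfRel, CrossRel]
  have h3 : SevenRel (-3/2) (-3/2) (12/13) (12/13) (-12/13) 1 := by
    norm_num [SevenRel, HalfRel, CrossRel]
  have h4 : SevenRel (-2) (-2) 1 1 (-1) 1 := by norm_num [SevenRel, HalfRel, CrossRel]
  have h5 : SevenRel (-5/2) (-5/2) (6/5) (6/5) (-6/5) 1 := by
    norm_num [SevenRel, HalfRel, CrossRel]
  simp only [Set.mem_insert_iff, Set.mem_singleton_iff, Prod.mk.injEq] at h
  rcases h with ⟨rfl, rfl⟩ | ⟨rfl, rfl⟩ | ⟨rfl, rfl⟩ | ⟨rfl, rfl⟩ | ⟨rfl, rfl⟩ | ⟨rfl, rfl⟩ |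
    ⟨rfl, rfl⟩
  · exact h1.finrank_ker_eq_one (by norm_num) (by norm_num) (by norm_num)
  · exact h1.swap.finrank_ker_eq_one (by norm_num) (by norm_num) (by norm_num)
  · exact h2.finrank_ker_eq_one (by norm_num) (by norm_num) (by norm_num)
  · exact h2.swap.finrank_ker_eq_one (by norm_num) (by norm_num) (by norm_num)
  · exact h3.finrank_ker_eq_one (by norm_num) (by norm_num) (by norm_num)
  · exact h4.finrank_ker_eq_one (by norm_num) (by norm_num) (by norm_num)
  · exact h5.finrank_ker_eq_one (by norm_num) (by norm_num) (by norm_num)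

theorem isDoubleWeight_seven : IsDoubleWeight 7 l n ↔
    (l, n) ∈ k7DimZero ∪ {(0, -3), (-3, 0), (-3, -3)} ∪ {(-1, -5/2), (-5/2, -1), (-3/2, -3),
      (-3, -3/2), (-3/2, -3/2), (-2, -2), (-5/2, -5/2)} := by
  simp only [k7DimZero, Set.mem_union, Set.mem_insert_iff, Set.mem_singleton_iff, Prod.mk.injEq]
  constructor
  · rintro ⟨i, j, h1, h2, h3, h4⟩
    have hl : l = -i / 2 := by linarith
    have hn : n = (j - 6) / 2 := by push_cast at h4; linarith
    subst hl hn
    interval_cases i <;> interval_cases j <;> norm_num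
  · intro h
    have key : ∃ i j : ℕ, i ≤ 6 ∧ j ≤ i ∧ l = -i / 2 ∧ n = (j - 6) / 2 := by
      rcases h with ((⟨rfl, rfl⟩ | ⟨rfl, rfl⟩ | ⟨rfl, rfl⟩ | ⟨rfl, rfl⟩ | ⟨rfl, rfl⟩ | ⟨rfl, rfl⟩ |
        ⟨rfl, rfl⟩ | ⟨rfl, rfl⟩ | ⟨rfl, rfl⟩ | ⟨rfl, rfl⟩ | ⟨rfl, rfl⟩ | ⟨rfl, rfl⟩ |
        ⟨rfl, rfl⟩ | ⟨rfl, rfl⟩ | ⟨rfl, rfl⟩ | ⟨rfl, rfl⟩ | ⟨rfl, rfl⟩ | ⟨rfl, rfl⟩) |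
        ⟨rfl, rfl⟩ | ⟨rfl, rfl⟩ | ⟨rfl, rfl⟩) | ⟨rfl, rfl⟩ | ⟨rfl, rfl⟩ | ⟨rfl, rfl⟩ | ⟨rfl, rfl⟩ |
        ⟨rfl, rfl⟩ | ⟨rfl, rfl⟩ | ⟨rfl, rfl⟩
      · exact ⟨5, 5, by norm_num⟩
      · exact ⟨1, 1, by norm_num⟩
      · exact ⟨1, 0, by norm_num⟩
      · exact ⟨6, 5, by norm_num⟩
      · exact ⟨2, 2, by norm_num⟩
      · exact ⟨4, 4, by norm_num⟩
      · exact ⟨2, 0, by norm_num⟩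
      · exact ⟨6, 4, by norm_num⟩
      · exact ⟨3, 2, by norm_num⟩
      · exact ⟨4, 3, by norm_num⟩
      · exact ⟨3, 1, by norm_num⟩
      · exact ⟨5, 3, by norm_num⟩
      · exact ⟨4, 0, by norm_num⟩
      · exact ⟨6, 2, by norm_num⟩
      · exact ⟨4, 1, by norm_num⟩
      · exact ⟨5, 2, by norm_num⟩
      · exact ⟨6, 1, by norm_num⟩
      · exact ⟨5, 0, by norm_num⟩
      · exact ⟨0, 0, by norm_num⟩
      · exact ⟨6, 6, by norm_num⟩
      · exact ⟨6, 0, by norm_num⟩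
      · exact ⟨2, 1, by norm_num⟩
      · exact ⟨5, 4, by norm_num⟩
      · exact ⟨3, 0, by norm_num⟩
      · exact ⟨6, 3, by norm_num⟩
      · exact ⟨3, 3, by norm_num⟩
      · exact ⟨4, 2, by norm_num⟩
      · exact ⟨5, 1, by norm_num⟩
    obtain ⟨i, j, h1, h2, h3, h4⟩ := key
    exact ⟨i, j, by omega, by omega, by linarith, by push_cast; linarith⟩

theorem mem_sevenWeights_cases (h : (l, n) ∈ sevenWeights) : (l, n) ∈ k7DimTwo ∨
    (l, n) ∈ ({(-1, -5/2), (-5/2, -1), (-3/2, -3), (-3, -3/2), (-3/2, -3/2), (-2, -2),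
      (-5/2, -5/2)} : Set (ℝ × ℝ)) := by
  rcases h with h | h
  · left
    right
    simp only [Set.mem_insert_iff, Set.mem_singleton_iff, Prod.mk.injEq]
    rcases h with ⟨h1, h2⟩ | ⟨h2, h1⟩ | ⟨h2, h1⟩ <;> dsimp only at h1 h2 <;>
      rcases eq_of_quadratic h2 with rfl | rfl <;> subst h1
    · right; left; exact ⟨rfl, rfl⟩
    · left; exact ⟨rfl, rfl⟩
    · right; right; right; right; left; exact ⟨by ring, rfl⟩
    · right; right; left; exact ⟨by ring, rfl⟩
    · right; right; right; right; right; exact ⟨rfl, by ring⟩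
    · right; right; right; left; exact ⟨rfl, by ring⟩
  · exact Or.inr h

theorem finrank_ker_seven_one (h : (l, n) ∈ k7DimTwo)
    (h' : (l, n) ∉ ({(0, -3), (-3, 0), (-3, -3)} : Set (ℝ × ℝ))) :
    Module.finrank ℝ (LinearMap.ker (cocycleMatrixSeven l n).vecMulLinear) = 1 := by
  simp only [Set.mem_insert_iff, Set.mem_singleton_iff, Prod.mk.injEq, not_or, not_and] at h'
  obtain ⟨h1, h2, h3⟩ := h'
  rcases h with h | h
  · by_cases hl : l = 0
    · subst hl
      exact finrank_ker_seven_left (h1 rfl)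
    by_cases hn : n = 0
    · subst hn
      exact finrank_ker_seven_right fun h => h2 h rfl
    · have hm : n = -6 - l := (h.resolve_left hl).resolve_left hn
      refine finrank_ker_seven_antidiagonal hl hn (fun h => h3 ?_ h) ?_ <;> linarith
  · simp only [Set.mem_insert_iff, Set.mem_singleton_iff, Prod.mk.injEq] at h
    rcases h with ⟨rfl, rfl⟩ | ⟨rfl, rfl⟩ | ⟨rfl, rfl⟩ | ⟨rfl, rfl⟩ | ⟨rfl, rfl⟩ | ⟨rfl, rfl⟩
    · exact finrank_ker_seven_of_quadratic_eq quadratic_neg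
    · exact finrank_ker_seven_of_quadratic_eq quadratic_pos
    · exact (finrank_ker_seven_of_quadratic quadratic_neg (by ring)).1
    · exact (finrank_ker_seven_of_quadratic quadratic_neg (by ring)).2
    · exact (finrank_ker_seven_of_quadratic quadratic_pos (by ring)).1
    · exact (finrank_ker_seven_of_quadratic quadratic_pos (by ring)).2

/-- On the three lines the constraints 0 ≤ i₁ ≤ i₀ ≤ 6 allow only the three excluded points, and at
the remaining weights √19 would have to be an integer. -/
theorem not_isDoubleWeight_of_mem_seven (h : (l, n) ∈ k7DimTwo)
    (h' : (l, n) ∉ ({(0, -3), (-3, 0), (-3, -3)} : Set (ℝ × ℝ))) : ¬ IsDoubleWeight 7 l n := by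
  rintro ⟨i, j, h1, h2, h3, h4⟩
  push_cast at h4
  simp only [Set.mem_insert_iff, Set.mem_singleton_iff, Prod.mk.injEq, not_or, not_and] at h'
  obtain ⟨k1, k2, k3⟩ := h'
  rcases h with h | h
  · rcases h with h | h | h <;> dsimp only at h
    · have : (i : ℝ) = 0 := by linarith
      have hi : i = 0 := by exact_mod_cast this
      obtain rfl : j = 0 := by omega
      exact k1 h (by push_cast at h4; linarith)
    · have : (j : ℝ) = 6 := by linarith
      have hj : j = 6 := by exact_mod_cast this
      obtain rfl : i = 6 := by omega
      exact k2 (by push_cast at h3; linarith) h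
    · have : (i : ℝ) = j + 6 := by linarith
      have hi : i = j + 6 := by exact_mod_cast this
      obtain rfl : j = 0 := by omega
      obtain rfl : i = 6 := by omega
      exact k3 (by push_cast at h3; linarith) (by push_cast at h4; linarith)
  · have h19 : √19 ^ 2 = 19 := Real.sq_sqrt (by norm_num)
    have lo : 4 < √19 := by nlinarith [Real.sqrt_nonneg 19]
    have hi : √19 < 5 := by nlinarith [Real.sqrt_nonneg 19]
    simp only [Set.mem_insert_iff, Set.mem_singleton_iff, Prod.mk.injEq] at h
    have key : ∀ a b : ℕ, √19 ≠ a - b := by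
      intro a b hab
      have e : 4 < (a : ℤ) - b := by exact_mod_cast hab ▸ lo
      have e' : (a : ℤ) - b < 5 := by exact_mod_cast hab ▸ hi
      omega
    rcases h with ⟨rfl, rfl⟩ | ⟨rfl, rfl⟩ | ⟨rfl, rfl⟩ | ⟨rfl, rfl⟩ | ⟨rfl, rfl⟩ | ⟨rfl, rfl⟩
    · exact key i 5 (by push_cast; linarith)
    · exact key 5 i (by push_cast; linarith)
    · exact key 1 j (by push_cast; linarith)
    · exact key i 5 (by push_cast; linarith)
    · exact key j 1 (by push_cast; linarith)
    · exact key 5 i (by push_cast; linarith)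

theorem h1Iso_seven (lam nu mu : ℝ) (hk : mu - lam - nu = 7) :
    ((lam, nu) ∈ k7DimTwo → H1Iso lam nu mu 2) ∧
      ((lam, nu) ∉ k7DimTwo → (lam, nu) ∉ k7DimZero → H1Iso lam nu mu 1) ∧
      ((lam, nu) ∈ k7DimZero → H1Iso lam nu mu 0) := by
  have hm : mu = lam + nu + ((5 : ℕ) + 2) := by push_cast; linarith
  have hB := finrank_coboundarySpace (κ := 5) (l := lam) (n := nu) (by norm_num) (by norm_num)
  have ker_zero (h : (lam, nu) ∉ k7DimTwo) (h' : (lam, nu) ∉ ({(-1, -5/2), (-5/2, -1), (-3/2, -3),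
      (-3, -3/2), (-3/2, -3/2), (-2, -2), (-5/2, -5/2)} : Set (ℝ × ℝ))) :
      Module.finrank ℝ (LinearMap.ker (cocycleMatrixSeven lam nu).vecMulLinear) = 0 :=
    finrank_ker_seven_zero (fun h0 => h (Or.inl (Or.inl h0)))
      (fun h0 => h (Or.inl (Or.inr (Or.inl h0))))
      (fun h0 => h (Or.inl (Or.inr (Or.inr (by dsimp only; linarith)))))
      fun hw => (mem_sevenWeights_cases hw).elim h h'
  refine ⟨fun h => h1Iso_of_finrank hm ?_, fun h h' => h1Iso_of_finrank hm ?_,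
    fun h => h1Iso_of_finrank hm ?_⟩ <;> rw [hB, finrank_cocycleSpace_five]
  · by_cases hd : (lam, nu) ∈ ({(0, -3), (-3, 0), (-3, -3)} : Set (ℝ × ℝ))
    · rw [finrank_invCoef_two (isDoubleWeight_seven.2 (Or.inl (Or.inr hd))),
        finrank_ker_seven_two hd]
    · rw [finrank_invCoef_one (not_isDoubleWeight_of_mem_seven h hd), finrank_ker_seven_one h hd]
  · have hd : (lam, nu) ∉ ({(0, -3), (-3, 0), (-3, -3)} : Set (ℝ × ℝ)) := by
      simp only [Set.mem_insert_iff, Set.mem_singleton_iff, Prod.mk.injEq]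
      rintro (⟨rfl, rfl⟩ | ⟨rfl, rfl⟩ | ⟨rfl, rfl⟩) <;> exact h (Or.inl (by norm_num))
    by_cases hr : (lam, nu) ∈ ({(-1, -5/2), (-5/2, -1), (-3/2, -3), (-3, -3/2), (-3/2, -3/2),
      (-2, -2), (-5/2, -5/2)} : Set (ℝ × ℝ))
    · rw [finrank_invCoef_two (isDoubleWeight_seven.2 (Or.inr hr)),
        finrank_ker_seven_of_rational hr]
    · rw [finrank_invCoef_one fun hd' => (isDoubleWeight_seven.1 hd').elim (fun h0 => h0.elim h' hd)
        hr, ker_zero h hr]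
  · have hd : IsDoubleWeight 7 lam nu := isDoubleWeight_seven.2 (Or.inl (Or.inl h))
    rw [finrank_invCoef_two hd, ker_zero]
    · intro h2
      refine not_isDoubleWeight_of_mem_seven h2 ?_ hd
      simp only [k7DimZero, Set.mem_insert_iff, Set.mem_singleton_iff, Prod.mk.injEq] at h ⊢
      clear hB ker_zero hd h2
      rintro (⟨rfl, rfl⟩ | ⟨rfl, rfl⟩ | ⟨rfl, rfl⟩) <;> norm_num at h
    · simp only [k7DimZero, Set.mem_insert_iff, Set.mem_singleton_iff, Prod.mk.injEq] at h ⊢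
      clear hB ker_zero hd
      rintro (⟨rfl, rfl⟩ | ⟨rfl, rfl⟩ | ⟨rfl, rfl⟩ | ⟨rfl, rfl⟩ | ⟨rfl, rfl⟩ | ⟨rfl, rfl⟩ |
        ⟨rfl, rfl⟩) <;> norm_num at h

end Seven

/-! ### Vanishing for generic weights -/

section Generic

/-- Polynomial functions of two real variables. -/
def IsPolyFun (f : ℝ → ℝ → ℝ) : Prop :=
  ∃ P : MvPolynomial (Fin 2) ℝ, ∀ l n, MvPolynomial.eval ![l, n] P = f l n

namespace IsPolyFun

theorem const (c : ℝ) : IsPolyFun fun _ _ => c := ⟨MvPolynomial.C c, fun _ _ => by simp⟩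

theorem fst : IsPolyFun fun l _ => l := ⟨MvPolynomial.X 0, fun _ _ => by simp⟩

theorem snd : IsPolyFun fun _ n => n := ⟨MvPolynomial.X 1, fun _ _ => by simp⟩

variable {f g : ℝ → ℝ → ℝ}

theorem add (hf : IsPolyFun f) (hg : IsPolyFun g) : IsPolyFun fun l n => f l n + g l n := by
  obtain ⟨P, hP⟩ := hf
  obtain ⟨Q, hQ⟩ := hg
  exact ⟨P + Q, fun l n => by rw [map_add, hP, hQ]⟩

theorem mul (hf : IsPolyFun f) (hg : IsPolyFun g) : IsPolyFun fun l n => f l n * g l n := by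
  obtain ⟨P, hP⟩ := hf
  obtain ⟨Q, hQ⟩ := hg
  exact ⟨P * Q, fun l n => by rw [map_mul, hP, hQ]⟩

end IsPolyFun

/-- A polynomial family of linear systems that is injective at one point is generically
injective. -/
theorem exists_polynomial_injective {m N : Type*} [Fintype m] [Fintype N] [DecidableEq N]
    (T : m → ℝ → ℝ → (N → ℝ) →ₗ[ℝ] ℝ) (hT : ∀ r v, IsPolyFun fun l n => T r l n v) (l₀ n₀ : ℝ)
    (h₀ : ∀ v, (∀ r, T r l₀ n₀ v = 0) → v = 0) :
    ∃ P : MvPolynomial (Fin 2) ℝ, P ≠ 0 ∧ ∀ l n, MvPolynomial.eval ![l, n] P ≠ 0 →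
      ∀ v, (∀ r, T r l n v = 0) → v = 0 := by
  classical
  -- With L a left inverse at the base point, the determinant of L composed with the system is a
  -- polynomial in the weights, equal to 1 at the base point; where it is nonzero the system is
  -- injective.
  obtain ⟨L, hL⟩ := (LinearMap.pi fun r => T r l₀ n₀).exists_leftInverse_of_injective
    (LinearMap.ker_eq_bot'.2 fun v hv => h₀ v fun r => congrFun hv r)
  choose A hA using fun (r : m) (k : N) => hT r (Pi.single k 1)
  let R : Matrix N N (MvPolynomial (Fin 2) ℝ) :=
    Matrix.of fun i k => ∑ r, MvPolynomial.C (L (Pi.single r 1) i) * A r k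
  have hR (l n : ℝ) : (MvPolynomial.eval ![l, n]).mapMatrix R =
      LinearMap.toMatrix' (L ∘ₗ LinearMap.pi fun r => T r l n) := by
    ext i k
    rw [LinearMap.toMatrix'_apply, LinearMap.comp_apply,
      show (LinearMap.pi fun r => T r l n) (Pi.single k 1) =
        ∑ r, T r l n (Pi.single k 1) • (Pi.single r 1 : m → ℝ) by
        funext r; simp [Finset.sum_apply, Pi.single_apply], map_sum, Finset.sum_apply]
    simp [R, hA, mul_comm]
  refine ⟨R.det, fun h => ?_, fun l n h v hv => ?_⟩
  · have e := RingHom.map_det (MvPolynomial.eval ![l₀, n₀]) R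
    rw [h, hR, hL, LinearMap.toMatrix'_id, Matrix.det_one, map_zero] at e
    exact zero_ne_one e
  · rw [RingHom.map_det, hR] at h
    refine Matrix.eq_zero_of_mulVec_eq_zero h ?_
    rw [LinearMap.toMatrix'_mulVec, LinearMap.comp_apply,
      show (LinearMap.pi fun r => T r l n) v = 0 from funext hv, map_zero]

theorem extendFin_add {N : ℕ} (v w : Fin N → ℝ) (i : ℕ) :
    extendFin (v + w) i = extendFin v i + extendFin w i := by
  unfold extendFin
  split_ifs <;> simp

theorem extendFin_smul {N : ℕ} (c : ℝ) (v : Fin N → ℝ) (i : ℕ) :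
    extendFin (c • v) i = c * extendFin v i := by
  unfold extendFin
  split_ifs <;> simp

/-- The quartic form as a linear functional. -/
noncomputable def quarticFunctional {N : ℕ} (i j : ℕ) (l n : ℝ) : (Fin N → ℝ) →ₗ[ℝ] ℝ where
  toFun v := quarticForm l n i j fun a _ => extendFin v a
  map_add' v w := by simp only [quarticForm, extendFin_add]; ring
  map_smul' c v := by simp only [quarticForm, extendFin_smul, RingHom.id_apply, smul_eq_mul]; ring

/-- The sextic form as a linear functional. -/
noncomputable def sexticFunctional {N : ℕ} (i j : ℕ) (l n : ℝ) : (Fin N → ℝ) →ₗ[ℝ] ℝ where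
  toFun v := sexticForm l n i j (fun a _ => extendFin v a) (i + 2 * l) (j + 2 * n)
  map_add' v w := by simp only [sexticForm, extendFin_add]; ring
  map_smul' c v := by simp only [sexticForm, extendFin_smul, RingHom.id_apply, smul_eq_mul]; ring

theorem isPolyFun_quarticFunctional {N : ℕ} (i j : ℕ) (v : Fin N → ℝ) :
    IsPolyFun fun l n => quarticFunctional i j l n v := by
  show IsPolyFun fun l n => quarticForm l n i j fun a _ => extendFin v a
  unfold quarticForm
  repeat' first
    | exact .const _
    | exact .fst
    | exact .snd
    | apply IsPolyFun.add
    | apply IsPolyFun.mul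

theorem isPolyFun_sexticFunctional {N : ℕ} (i j : ℕ) (v : Fin N → ℝ) :
    IsPolyFun fun l n => sexticFunctional i j l n v := by
  show IsPolyFun fun l n => sexticForm l n i j (fun a _ => extendFin v a) (i + 2 * l) (j + 2 * n)
  unfold sexticForm
  repeat' first
    | exact .const _
    | exact .fst
    | exact .snd
    | apply IsPolyFun.add
    | apply IsPolyFun.mul

/-- The forms determine the sequence at the weights `(1/2, -κ/2)`. -/
theorem eq_zero_of_forms {κ : ℕ} (hκ : 6 ≤ κ) {s : ℕ → ℝ} (h0 : s 0 = 0)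
    (h4 : ∀ i j, i + j + 3 = κ → quarticForm (1 / 2) (-κ / 2) i j (fun i _ => s i) = 0)
    (h6 : ∀ i j, i + j + 5 = κ →
      sexticForm (1 / 2) (-κ / 2) i j (fun i _ => s i) (i + 2 * (1 / 2)) (j + 2 * (-κ / 2)) = 0) :
    ∀ i ≤ κ, s i = 0 := by
  obtain ⟨t, rfl⟩ := Nat.exists_eq_add_of_le' hκ
  -- The first four quartic equations express s 3, ..., s 6 through s 1 and s 2; two sextic
  -- equations then form a triangular system for s 1, s 2 with diagonal entries positive for t = κ -
  -- 6 ≥ 0.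
  have h12 : s 1 = 0 ∧ s 2 = 0 := by
    have h1 := h4 1 (t + 2) (by omega)
    have h2 := h4 2 (t + 1) (by omega)
    have h3 := h4 3 t (by omega)
    have f0 := h6 0 (t + 1) (by omega)
    have f1 := h6 1 t (by omega)
    have h0' := h4 0 (t + 3) (by omega)
    have ht : (0 : ℝ) ≤ t := t.cast_nonneg
    simp only [quarticForm, sexticForm, Nat.reduceAdd, zero_add, h0, mul_zero, add_zero] at *
    push_cast at *
    generalize (t : ℝ) = t at *
    replace h0 := h0'
    have e3 : s 3 = (1 / 15 * t + 2 / 5) * s 1 + s 2 := by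
      linear_combination 2 / 15 * h0
    have e4 : s 4 = (22 / 255 * t + 44 / 85) * s 1 + (1 / 17 * t + 24 / 17) * s 2 := by
      linear_combination 1 / 17 * h1 - (-22 / 17) * e3
    have e5 : s 5 = (1 / 315 * t ^ 2 + 2192 / 16065 * t + 3772 / 5355) * s 1 +
        (43 / 357 * t + 94 / 51) * s 2 := by
      linear_combination 2 / 63 * h2 - (-1 / 21 * t + 4 / 21) * e3 - (-95 / 63) * e4
    have e6 : s 6 = (341 / 46410 * t ^ 2 + 27227 / 139230 * t + 21089 / 23205) * s 1 +
        (1 / 442 * t ^ 2 + 324 / 1547 * t + 1041 / 442) * s 2 := by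
      linear_combination 1 / 52 * h3 - (1 / 52 * t + 1 / 13) * e3 - (-1 / 26 * t + 6 / 13) * e4 -
        (-87 / 52) * e5
    have a : (1 / 30 * t ^ 2 + 41 / 90 * t + 23 / 15) * s 1 = 0 := by
      linear_combination f0 - (-1 / 2 * t + 67) * e3 - (-60) * e4 - 21 * e5
    have b : (-6 / 1105 * t ^ 2 - 706 / 9945 * t - 764 / 3315) * s 1 +
        (10 / 221 * t ^ 2 + 142 / 221 * t + 504 / 221) * s 2 = 0 := by
      linear_combination f1 - (6 * t - 122) * e3 - (-2 * t + 294) * e4 - (-240) * e5 - 72 * e6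
    have s1 : s 1 = 0 := by
      have h : 0 < 1 / 30 * t ^ 2 + 41 / 90 * t + 23 / 15 := by positivity
      exact (mul_eq_zero.1 (by linear_combination a :
        (1 / 30 * t ^ 2 + 41 / 90 * t + 23 / 15) * s 1 = 0)).resolve_left h.ne'
    refine ⟨s1, ?_⟩
    have h : 0 < 10 / 221 * t ^ 2 + 142 / 221 * t + 504 / 221 := by positivity
    rw [s1] at b
    exact (mul_eq_zero.1 (by linear_combination b :
      (10 / 221 * t ^ 2 + 142 / 221 * t + 504 / 221) * s 2 = 0)).resolve_left h.ne'
  intro i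
  induction i using Nat.strong_induction_on with
  | _ i ih =>
    intro hi
    match i, ih, hi with
    | 0, _, _ => exact h0
    | 1, _, _ => exact h12.1
    | 2, _, _ => exact h12.2
    | i + 3, ih, hi =>
      have h := h4 i (t + 3 - i) (by omega)
      simp only [quarticForm] at h
      rw [ih (i + 2) (by omega) (by omega), ih (i + 1) (by omega) (by omega),
        ih i (by omega) (by omega)] at h
      simp only [mul_zero, add_zero] at h
      refine (mul_eq_zero.1 h).resolve_left ?_
      -- With l = 1/2 the coefficient of s (i + 3) in the quartic form is positive, so three
      -- consecutive zeros propagate.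
      positivity

/-- For `k ≥ 8`, the cohomology vanishes for generic weights. -/
theorem exists_polynomial_h1Iso_zero {κ : ℕ} (hκ : 6 ≤ κ) :
    ∃ P : MvPolynomial (Fin 2) ℝ, P ≠ 0 ∧ ∀ l n m : ℝ, m = l + n + (κ + 2) →
      MvPolynomial.eval ![l, n] P ≠ 0 → H1Iso l n m 0 := by
  -- The coordinate s 0 is added because coboundaries always leave a nonzero solution; injectivity
  -- of the enlarged system means dim Z ≤ 1.
  let T : Fin (κ - 2) ⊕ Fin (κ - 4) ⊕ Unit → ℝ → ℝ → (Fin (κ + 1) → ℝ) →ₗ[ℝ] ℝ :=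
    Sum.elim (fun i => quarticFunctional i (κ - 3 - i))
      (Sum.elim (fun i => sexticFunctional i (κ - 5 - i)) fun _ _ _ => LinearMap.proj 0)
  obtain ⟨P, hP, h⟩ := exists_polynomial_injective T
    (by
      rintro (i | i | i) v
      · exact isPolyFun_quarticFunctional _ _ v
      · exact isPolyFun_sexticFunctional _ _ v
      · exact .const _) (1 / 2) (-κ / 2) (by
      intro v hv
      rw [← extendFin_coe v]
      funext i
      refine eq_zero_of_forms hκ (hv (Sum.inr (Sum.inr ()))) (fun i j hij => ?_)
        (fun i j hij => ?_) i (by omega)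
      · have e := hv (Sum.inl ⟨i, by omega⟩)
        obtain rfl : j = κ - 3 - i := by omega
        exact e
      · have e := hv (Sum.inr (Sum.inl ⟨i, by omega⟩))
        obtain rfl : j = κ - 5 - i := by omega
        exact e)
  refine ⟨P, hP, fun l n m hm hPl => h1Iso_of_finrank hm ?_⟩
  have h1 : Module.finrank ℝ (cocycleSpace κ l n) ≤ 1 := by
    have hi : Function.Injective
        ((LinearMap.proj 0 : (Fin (κ + 1) → ℝ) →ₗ[ℝ] ℝ).comp (cocycleSpace κ l n).subtype) := by
      refine (injective_iff_map_eq_zero _).2 fun v hv => Subtype.ext (h l n hPl _ ?_)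
      obtain ⟨s, hs, h4, h6⟩ := forms_eq_zero_of_mem v.2
      have e : ∀ i ≤ κ, extendFin v.1 i = s i := fun i hi => by
        rw [extendFin, dif_pos (by omega), hs]
      rintro (⟨i, hi⟩ | ⟨i, hi⟩ | i)
      · refine Eq.trans ?_ (h4 i (κ - 3 - i) (by omega))
        show quarticForm l n i (κ - 3 - i) (fun a _ => extendFin v.1 a) = _
        rw [quarticForm, quarticForm, e _ (by omega), e _ (by omega), e _ (by omega),
          e _ (by omega)]
      · refine Eq.trans ?_ (h6 i (κ - 5 - i) (by omega))
        show sexticForm l n i (κ - 5 - i) (fun a _ => extendFin v.1 a) _ _ = _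
        rw [sexticForm, sexticForm, e _ (by omega), e _ (by omega), e _ (by omega),
          e _ (by omega), e _ (by omega), e _ (by omega)]
      · exact hv
    exact (LinearMap.finrank_le_finrank_of_injective hi).trans (Module.finrank_self ℝ).le
  have h2 : coboundarySpace κ l n ≤ cocycleSpace κ l n := by
    rw [← map_coboundary hm, ← range_cocycleLead hm]
    exact LinearMap.map_le_range
  have h3 := Submodule.finrank_mono h2
  have h4 : 1 ≤ Module.finrank ℝ (coboundarySpace κ l n) := by
    rw [finrank_coboundarySpace (by omega) (by omega)]
    by_cases hd : IsDoubleWeight (κ + 2) l n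
    · rw [finrank_invCoef_two hd]; norm_num
    · rw [finrank_invCoef_one hd]
  omega

/-- If k is not an integer ≥ 2, vanishing holds for all weights and the constant polynomial 1
serves; otherwise k ≥ 8 and the determinant argument applies. -/
theorem h1Iso_generic (k : ℝ) (hk : k ∉ ({2, 3, 4, 5, 6, 7} : Set ℝ)) :
    ∃ P : MvPolynomial (Fin 2) ℝ, P ≠ 0 ∧
      ∀ lam nu mu : ℝ, mu - lam - nu = k → MvPolynomial.eval ![lam, nu] P ≠ 0 →
        H1Iso lam nu mu 0 := by
  by_cases h : ∃ κ : ℕ, k = κ + 2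
  · obtain ⟨κ, rfl⟩ := h
    have hκ : 6 ≤ κ := by
      by_contra! hlt
      apply hk
      interval_cases κ <;> norm_num
    obtain ⟨P, hP, h⟩ := exists_polynomial_h1Iso_zero hκ
    exact ⟨P, hP, fun l n m hm => h l n m (by linarith)⟩
  · exact ⟨1, one_ne_zero, fun l n m hm _ => h1Iso_zero_of_forall_ne fun κ hκ =>
      h ⟨κ, by linarith⟩⟩

end Generic
theorem theorem5p1 :
    (∀ lam nu mu : ℝ, mu - lam - nu = 2 →
      ((lam, nu) ∈ k2DimOne → H1Iso lam nu mu 1) ∧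
      ((lam, nu) ∉ k2DimOne → H1Iso lam nu mu 0)) ∧
    (∀ lam nu mu : ℝ, mu - lam - nu = 3 →
      ((lam, nu) ∈ k3DimTwo → H1Iso lam nu mu 2) ∧
      ((lam, nu) ∉ k3DimTwo → (lam, nu) ∉ k3DimZero → H1Iso lam nu mu 1) ∧
      ((lam, nu) ∈ k3DimZero → H1Iso lam nu mu 0)) ∧
    (∀ lam nu mu : ℝ, mu - lam - nu = 4 →
      ((lam, nu) ∉ k4DimOne → H1Iso lam nu mu 2) ∧
      ((lam, nu) ∈ k4DimOne → H1Iso lam nu mu 1)) ∧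
    (∀ lam nu mu : ℝ, mu - lam - nu = 5 →
      ((lam, nu) ∈ k5DimThree → H1Iso lam nu mu 3) ∧
      ((lam, nu) ∉ k5DimThree → (lam, nu) ∉ k5DimOne → H1Iso lam nu mu 2) ∧
      ((lam, nu) ∈ k5DimOne → H1Iso lam nu mu 1)) ∧
    (∀ lam nu mu : ℝ, mu - lam - nu = 6 →
      ((lam, nu) ∈ k6DimThree → H1Iso lam nu mu 3) ∧
      ((lam, nu) ∉ k6DimThree → (lam, nu) ∉ k6DimOne → H1Iso lam nu mu 2) ∧
      ((lam, nu) ∈ k6DimOne → H1Iso lam nu mu 1)) ∧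
    (∀ lam nu mu : ℝ, mu - lam - nu = 7 →
      ((lam, nu) ∈ k7DimTwo → H1Iso lam nu mu 2) ∧
      ((lam, nu) ∉ k7DimTwo → (lam, nu) ∉ k7DimZero → H1Iso lam nu mu 1) ∧
      ((lam, nu) ∈ k7DimZero → H1Iso lam nu mu 0)) ∧
    (∀ k : ℝ, k ∉ ({2, 3, 4, 5, 6, 7} : Set ℝ) →
      ∃ P : MvPolynomial (Fin 2) ℝ, P ≠ 0 ∧
        ∀ lam nu mu : ℝ, mu - lam - nu = k → MvPolynomial.eval ![lam, nu] P ≠ 0 →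
          H1Iso lam nu mu 0) := by
  exact ⟨h1Iso_two, h1Iso_three, h1Iso_four, h1Iso_five, h1Iso_six, h1Iso_seven, h1Iso_generic⟩
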